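/- **Setting.** Let $K\ge 1$ and let $N^X_1,\dots,N^X_K$, $N^Y_1,\dots,N^Y_K\ge 1$ be integers. Consider a pure (all amplitudes positive) multipeakon solution $$u(x,t)=\sum_{k=1}^K\sum_{i=1}^{N^X_k} m_{k,i}(t)e^{-|x-x_{k,i}(t)|},\qquad v(x,t)=\sum_{k=1}^K\sum_{i=1}^{N^Y_k} n_{k,i}(t)e^{-|x-y_{k,i}(t)|}$$ of the Geng--Xue equation $m_t+(m_xu+3mu_x)v=0$, $n_t+(n_xv+3nv_x)u=0$, $m=u-u_{xx}$, $n=v-v_{xx}$, with $K+K$ groups; that is, for all $t\in\mathbf R$, $m_{k,i}>0$, $n_{k,i}>0$, $$x_{1,1}<\dots<x_{1,N^X_1}<y_{1,1}<\dots<y_{1,N^Y_1}<\dots<x_{K,1}<\dots<x_{K,N^X_K}<y_{K,1}<\dots<y_{K,N^Y_K},$$ $$\dot x_{k,i}=u(x_{k,i})v(x_{k,i}),\qquad \dot m_{k,i}=m_{k,i}\bigl(u(x_{k,i})v_x(x_{k,i})-2u_x(x_{k,i})v(x_{k,i})\bigr),$$ $$\dot y_{k,i}=u(y_{k,i})v(y_{k,i}),\qquad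 \dot n_{k,i}=n_{k,i}\bigl(u_x(y_{k,i})v(y_{k,i})-2u(y_{k,i})v_x(y_{k,i})\bigr),$$ where $u_x$, $v_x$ at a peak mean the average of the one-sided derivatives. **Parameters.** Let $0<\lambda_1<\dots<\lambda_K$, $0<\mu_1<\dots<\mu_{K-1}$, $a_1(0),\dots,a_K(0)>0$, $b_1(0),\dots,b_{K-1}(0)>0$, $C,D>0$, and, for each group with $N\ge2$ members, $\tau_1,\dots,\tau_{N-1}>0$ and $0<\sigma_1<\dots<\sigma_{N-1}$ (written $\tau^X_{j,i},\sigma^X_{j,i}$, resp. $\tau^Y_{j,i},\sigma^Y_{j,i}$, when the group has to be indicated), and put $\sigma_0=0$, $T_i=\sum_{a=1}^i\tau_a$, $S_i=\sum_{b=1}^{i-1}\tau_{b+1}\sigma_b$, $R_i=\sigma_iT_i-S_i$ (so $R_0=0$). Write $\lambda_I=\prod_{i\in I}\lambda_i$, $\mu_J=\prod_{j\in J}\mu_j$, $L=\lambda_{[1,K]}$, $M=\mu_{[1,K-1]}$ (empty products are $1$; $[p,q]$ is an integer interval, empty if $q<p$). The parameters are assumed to satisfy: the last $\sigma$ of a non-singleton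 group is smaller than the first $\tau$ of the next group to the right, if that is also a non-singleton; $\sigma^X_{K,N^X_K-1}<D$ if $N^Y_K=1$ and $N^X_K\ge2$; $M<C\tau^Y_{1,1}$ if $N^X_1=1$ and $N^Y_1\ge2$; $\tau^X_{1,1}M<C\sigma^X_{1,1}\tau^X_{1,2}$ if $N^X_1\ge3$; and $1<CD$ if $K=N^X_1=N^Y_1=1$. Let $$\Psi_{IJ}=\frac{\prod_{p<q\in I}(\lambda_p-\lambda_q)^2\prod_{p<q\in J}(\mu_p-\mu_q)^2}{\prod_{p\in I,q\in J}(\lambda_p+\mu_q)},\qquad a_i=a_i(0)e^{t/\lambda_i},\quad b_j=b_j(0)e^{t/\mu_j},$$ $$J^{rs}_{ij}(t)=\sum_{I\subseteq[1,K],|I|=i}\ \sum_{J\subseteq[1,K-1],|J|=j}\Psi_{IJ}\prod_{p\in I}\lambda_p^ra_p\prod_{q\in J}\mu_q^sb_q\quad(0\le i\le K,\ 0\le j\le K-1),$$ and $J^{rs}_{ij}=0$ for other $i,j$. Let $X_{k,i}=\frac12e^{2x_{k,i}}$, $Q_{k,i}=2m_{k,i}e^{-x_{k,i}}$, $Y_{k,i}=\frac12e^{2y_{k,i}}$,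 $P_{k,i}=2n_{k,i}e^{-y_{k,i}}$ and $j'=K+1-j$. The solution *has these parameters* if at time $t=0$ the following holds, where $\tau,\sigma,T,S,R,N$ refer to the group in question. * $X$-singletons: $X_{j'}=\dfrac{J^{00}_{jj}}{J^{11}_{j-1,j-1}}$, $Q_{j'}=\dfrac{J^{11}_{j-1,j-1}J^{01}_{j,j-1}}{J^{10}_{jj}J^{10}_{j-1,j-1}}$ for $1\le j\le K-1$; $X_1=\dfrac{J^{00}_{K,K-1}}{J^{11}_{K-1,K-2}+CJ^{10}_{K-1,K-1}}$, $Q_1=\dfrac ML\Bigl(\dfrac{J^{11}_{K-1,K-2}}{J^{10}_{K-1,K-1}}+C\Bigr)$. * $X$-groups with $N\ge2$, $1\le j\le K-1$: with $E_i=J^{11}_{j,j-1}+T_iJ^{11}_{j-1,j-1}+S_iJ^{11}_{j-1,j-2}$, $F_i=J^{10}_{jj}+\sigma_iJ^{10}_{j,j-1}+R_iJ^{10}_{j-1,j-1}$, $G=J^{11}_{j-1,j-1}+\sigma_{N-1}J^{11}_{j-1,j-2}$, $X_{j',i}=\dfrac{J^{00}_{j+1,j}+T_iJ^{00}_{jj}+S_iJ^{00}_{j,j-1}}{E_i}$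 and $Q_{j',i}=\dfrac{(\sigma_i-\sigma_{i-1})J^{01}_{j,j-1}E_i}{F_iF_{i-1}}$ for $1\le i\le N-1$; $X_{j',N}=\dfrac{J^{00}_{jj}+\sigma_{N-1}J^{00}_{j,j-1}}{G}$, $Q_{j',N}=\dfrac{J^{01}_{j,j-1}G}{J^{10}_{j-1,j-1}F_{N-1}}$. * Leftmost $X$-group with $N\ge2$: with $E_i=J^{11}_{K,K-1}+T_iJ^{11}_{K-1,K-1}+S_iJ^{11}_{K-1,K-2}$, $F_i=\sigma_iJ^{10}_{K,K-1}+R_iJ^{10}_{K-1,K-1}$, $G=J^{11}_{K-1,K-1}+\sigma_{N-1}J^{11}_{K-1,K-2}$, $U=J^{11}_{K-1,K-2}+\frac1{\sigma_1}J^{11}_{K-1,K-1}$, $V=J^{10}_{K-1,K-1}+\frac1{\tau_1}J^{10}_{K,K-1}$, $X_{1,1}=\dfrac{J^{00}_{K,K-1}}{U+CV}$, $Q_{1,1}=\dfrac ML\Bigl(\dfrac UV+C\Bigr)$; $X_{1,i}=\dfrac{S_iJ^{00}_{K,K-1}}{E_i}$, $Q_{1,i}=\dfrac{(\sigma_i-\sigma_{i-1})J^{01}_{K,K-1}E_i}{F_iF_{i-1}}$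 for $2\le i\le N-1$; $X_{1,N}=\dfrac{\sigma_{N-1}J^{00}_{K,K-1}}{G}$, $Q_{1,N}=\dfrac{J^{01}_{K,K-1}G}{J^{10}_{K-1,K-1}F_{N-1}}$. * $Y$-singletons: $Y_{j'}=\dfrac{J^{00}_{j,j-1}}{J^{11}_{j-1,j-2}}$, $P_{j'}=\dfrac{J^{10}_{j-1,j-1}J^{11}_{j-1,j-2}}{J^{01}_{j,j-1}J^{01}_{j-1,j-2}}$ for $2\le j\le K$; $Y_K=J^{00}_{11}+DJ^{00}_{10}$, $P_K=1/J^{00}_{10}$. * $Y$-groups with $N\ge2$, $2\le j\le K$: with $E_i=J^{11}_{j-1,j-1}+T_iJ^{11}_{j-1,j-2}+S_iJ^{11}_{j-2,j-2}$, $F_i=J^{01}_{j,j-1}+\sigma_iJ^{01}_{j-1,j-1}+R_iJ^{01}_{j-1,j-2}$, $G=J^{11}_{j-1,j-2}+\sigma_{N-1}J^{11}_{j-2,j-2}$, $Y_{j',i}=\dfrac{J^{00}_{jj}+T_iJ^{00}_{j,j-1}+S_iJ^{00}_{j-1,j-1}}{E_i}$ and $P_{j',i}=\dfrac{(\sigma_i-\sigma_{i-1})J^{10}_{j-1,j-1}E_i}{F_iF_{i-1}}$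 for $1\le i\le N-1$; $Y_{j',N}=\dfrac{J^{00}_{j,j-1}+\sigma_{N-1}J^{00}_{j-1,j-1}}{G}$, $P_{j',N}=\dfrac{J^{10}_{j-1,j-1}G}{J^{01}_{j-1,j-2}F_{N-1}}$. * Rightmost $Y$-group with $N\ge2$: $Y_{K,i}=J^{00}_{11}+T_iJ^{00}_{10}+S_i$, $P_{K,i}=\dfrac{\sigma_i-\sigma_{i-1}}{(J^{01}_{10}+\sigma_i)(J^{01}_{10}+\sigma_{i-1})}$ for $1\le i\le N-1$; $Y_{K,N}=J^{00}_{11}+(T_{N-1}+D)J^{00}_{10}+S_{N-1}+D\sigma_{N-1}$, $P_{K,N}=\dfrac1{J^{01}_{10}+\sigma_{N-1}}$. **Theorem.** For a solution with these parameters, the positions of the peakons in the non-singleton groups satisfy the following, where $a_i,b_j$ now denote $a_i(0),b_j(0)$, where $N$ is the number of members of the group in question, and where $z\sim[c;d]$ means $z(t)=\frac t2c+\frac12\ln d+o(1)$. As $t\to+\infty$: * $X$-groups except the leftmost ($1\le j\le K-1$): $x_{j',i}\sim\Bigl[\frac1{\lambda_{j+1}}+\frac1{\mu_j};\frac{2a_{j+1}b_j\Psi_{[1,j+1][1,j]}}{\lambda_{[1,j]}\mu_{[1,j-1]}\Psi_{[1,j][1,j-1]}}\Bigr]$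 for $1\le i\le N-1$, and $x_{j',N}\sim\Bigl[\frac1{\lambda_j}+\frac1{\mu_j};\frac{2a_jb_j\Psi_{[1,j][1,j]}}{\lambda_{[1,j-1]}\mu_{[1,j-1]}\Psi_{[1,j-1][1,j-1]}}\Bigr]$. * Leftmost $X$-group: $x_{1,1}\sim\bigl[0;\frac{2\tau_1}{CL}\bigr]$; $x_{1,i}\sim\bigl[0;\frac{2S_i}{LM}\bigr]$ for $2\le i\le N-1$; $x_{1,N}\sim\Bigl[\frac1{\lambda_K};\frac{2\sigma_{N-1}a_K\Psi_{[1,K][1,K-1]}}{\lambda_{[1,K-1]}M\Psi_{[1,K-1][1,K-1]}}\Bigr]$. * $Y$-groups except the leftmost and rightmost ($2\le j\le K-1$): $y_{j',i}\sim\Bigl[\frac1{\lambda_j}+\frac1{\mu_j};\frac{2a_jb_j\Psi_{[1,j][1,j]}}{\lambda_{[1,j-1]}\mu_{[1,j-1]}\Psi_{[1,j-1][1,j-1]}}\Bigr]$ for $1\le i\le N-1$, and $y_{j',N}\sim\Bigl[\frac1{\lambda_j}+\frac1{\mu_{j-1}};\frac{2a_jb_{j-1}\Psi_{[1,j][1,j-1]}}{\lambda_{[1,j-1]}\mu_{[1,j-2]}\Psi_{[1,j-1][1,j-2]}}\Bigr]$.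 * Leftmost $Y$-group, $K\ge2$: $y_{1,i}\sim\Bigl[\frac1{\lambda_K};\frac{2T_ia_K\Psi_{[1,K][1,K-1]}}{\lambda_{[1,K-1]}M\Psi_{[1,K-1][1,K-1]}}\Bigr]$ for $1\le i\le N-1$, and $y_{1,N}\sim\Bigl[\frac1{\lambda_K}+\frac1{\mu_{K-1}};\frac{2a_Kb_{K-1}\Psi_{[1,K][1,K-1]}}{\lambda_{[1,K-1]}\mu_{[1,K-2]}\Psi_{[1,K-1][1,K-2]}}\Bigr]$. * Rightmost $Y$-group, $K\ge2$: $y_{K,i}\sim\bigl[\frac1{\lambda_1}+\frac1{\mu_1};2a_1b_1\Psi_{\{1\}\{1\}}\bigr]$ for $1\le i\le N$. * Only $Y$-group, $K=1$: $y_{1,i}\sim\bigl[\frac1{\lambda_1};2T_ia_1\bigr]$ for $1\le i\le N-1$, $y_{1,N}\sim\bigl[\frac1{\lambda_1};2(T_{N-1}+D)a_1\bigr]$; and $y_{1,1}(t)=\frac t{2\lambda_1}+\frac12\ln(2\tau_1a_1)$ exactly, for all $t$. As $t\to-\infty$: * $X$-groups except the leftmost and rightmost ($2\le j\le K-1$):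 $x_{j,1}\sim\Bigl[\frac1{\lambda_j}+\frac1{\mu_{j-1}};\frac{2a_jb_{j-1}\Psi_{[j,K][j-1,K-1]}}{\lambda_{[j+1,K]}\mu_{[j,K-1]}\Psi_{[j+1,K][j,K-1]}}\Bigr]$, and $x_{j,i}\sim\Bigl[\frac1{\lambda_j}+\frac1{\mu_j};\frac{2a_jb_j\Psi_{[j,K][j,K-1]}}{\lambda_{[j+1,K]}\mu_{[j+1,K-1]}\Psi_{[j+1,K][j+1,K-1]}}\Bigr]$ for $2\le i\le N$. * Leftmost $X$-group, $K\ge2$: $x_{1,i}\sim\Bigl[\frac1{\lambda_1}+\frac1{\mu_1};\frac{2a_1b_1\Psi_{[1,K][1,K-1]}}{\lambda_{[2,K]}\mu_{[2,K-1]}\Psi_{[2,K][2,K-1]}}\Bigr]$ for $1\le i\le N$. * Rightmost $X$-group, $K\ge2$: $x_{K,1}\sim\bigl[\frac1{\lambda_K}+\frac1{\mu_{K-1}};2a_Kb_{K-1}\Psi_{\{K\}\{K-1\}}\bigr]$; $x_{K,i}\sim\bigl[\frac1{\lambda_K};\frac{2S_ia_K}{T_i}\bigr]$ for $2\le i\le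 N-1$; $x_{K,N}\sim\bigl[\frac1{\lambda_K};2\sigma_{N-1}a_K\bigr]$. * Only $X$-group, $K=1$: $x_{1,1}\sim\bigl[\frac1{\lambda_1};\frac{2\sigma_1a_1}{1+C\sigma_1}\bigr]$; $x_{1,i}\sim\bigl[\frac1{\lambda_1};\frac{2S_ia_1}{T_i}\bigr]$ for $2\le i\le N-1$; and $x_{1,N}(t)=\frac t{2\lambda_1}+\frac12\ln(2\sigma_{N-1}a_1)$ exactly, for all $t$. * $Y$-groups except the rightmost ($1\le j\le K-1$): $y_{j,1}\sim\Bigl[\frac1{\lambda_j}+\frac1{\mu_j};\frac{2a_jb_j\Psi_{[j,K][j,K-1]}}{\lambda_{[j+1,K]}\mu_{[j+1,K-1]}\Psi_{[j+1,K][j+1,K-1]}}\Bigr]$, and $y_{j,i}\sim\Bigl[\frac1{\lambda_{j+1}}+\frac1{\mu_j};\frac{2a_{j+1}b_j\Psi_{[j+1,K][j,K-1]}}{\lambda_{[j+2,K]}\mu_{[j+1,K-1]}\Psi_{[j+2,K][j+1,K-1]}}\Bigr]$ for $2\le i\le N$. * Rightmost $Y$-group: $y_{K,1}\sim\bigl[\frac1{\lambda_K};2\tau_1a_K\bigr]$;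 $y_{K,i}\sim[0;2S_i]$ for $2\le i\le N-1$; $y_{K,N}\sim[0;2(S_{N-1}+D\sigma_{N-1})]$. -/

import Mathlib

open scoped Topology

noncomputable section

namespace GengXue

/-! ### Multipeakons with `K + K` groups

Groups are numbered `1, …, K` from left to right, and the peakons of a group `1, …, N` from left
to right.  A family indexed by groups and members is a function `ℕ → ℕ → _`, first argument the
group and second argument the member; only indices in the stated ranges ever matter. -/

/-- The wave `∑ₖ ∑ᵢ wₖᵢ exp(-|z - pₖᵢ|)` at the point `z` and time `t`, for peakons with
positions `p` and amplitudes `w`, arranged in `K` groups, the `k`th one having `N k` members. -/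
def wave (K : ℕ) (N : ℕ → ℕ) (p w : ℕ → ℕ → ℝ → ℝ) (t z : ℝ) : ℝ :=
  ∑ k ∈ Finset.Icc 1 K, ∑ i ∈ Finset.Icc 1 (N k), w k i t * Real.exp (-|z - p k i t|)

/-- The spatial derivative of `wave` at `z`; at a peak this is the average of the left and right
derivatives, since `Real.sign 0 = 0`. -/
def waveDeriv (K : ℕ) (N : ℕ → ℕ) (p w : ℕ → ℕ → ℝ → ℝ) (t z : ℝ) : ℝ :=
  ∑ k ∈ Finset.Icc 1 K, ∑ i ∈ Finset.Icc 1 (N k),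
    -(w k i t * Real.sign (z - p k i t) * Real.exp (-|z - p k i t|))

/-- `(x, m)` and `(y, n)` are the positions and amplitudes of a pure, non-overlapping multipeakon
solution of the Geng--Xue equation with `K + K` groups, the first one being an `X`-group:
the `k`th `X`-group has `NX k` members and the `k`th `Y`-group has `NY k` members. -/
structure IsPeakonSolution (K : ℕ) (NX NY : ℕ → ℕ) (x m y n : ℕ → ℕ → ℝ → ℝ) : Prop where
  m_pos : ∀ k i t, 1 ≤ k → k ≤ K → 1 ≤ i → i ≤ NX k → 0 < m k i t
  n_pos : ∀ k i t, 1 ≤ k → k ≤ K → 1 ≤ i → i ≤ NY k → 0 < n k i t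
  x_lt_x : ∀ k i t, 1 ≤ k → k ≤ K → 1 ≤ i → i + 1 ≤ NX k → x k i t < x k (i + 1) t
  y_lt_y : ∀ k i t, 1 ≤ k → k ≤ K → 1 ≤ i → i + 1 ≤ NY k → y k i t < y k (i + 1) t
  x_lt_y : ∀ k t, 1 ≤ k → k ≤ K → x k (NX k) t < y k 1 t
  y_lt_x : ∀ k t, 1 ≤ k → k + 1 ≤ K → y k (NY k) t < x (k + 1) 1 t
  x_ode : ∀ k i t, 1 ≤ k → k ≤ K → 1 ≤ i → i ≤ NX k →
    HasDerivAt (x k i) (wave K NX x m t (x k i t) * wave K NY y n t (x k i t)) t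
  y_ode : ∀ k i t, 1 ≤ k → k ≤ K → 1 ≤ i → i ≤ NY k →
    HasDerivAt (y k i) (wave K NX x m t (y k i t) * wave K NY y n t (y k i t)) t
  m_ode : ∀ k i t, 1 ≤ k → k ≤ K → 1 ≤ i → i ≤ NX k →
    HasDerivAt (m k i)
      (m k i t * (wave K NX x m t (x k i t) * waveDeriv K NY y n t (x k i t)
        - 2 * waveDeriv K NX x m t (x k i t) * wave K NY y n t (x k i t))) t
  n_ode : ∀ k i t, 1 ≤ k → k ≤ K → 1 ≤ i → i ≤ NY k →
    HasDerivAt (n k i)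
      (n k i t * (waveDeriv K NX x m t (y k i t) * wave K NY y n t (y k i t)
        - 2 * wave K NX x m t (y k i t) * waveDeriv K NY y n t (y k i t))) t

/-! ### The parameters -/

/-- The shape of a configuration (`K` and the group sizes `NX`, `NY`), together with the spectral
parameters (eigenvalues `lam 1, …, lam K` and `mu 1, …, mu (K-1)`, residues `a0`, `b0` at time
zero, and `C`, `D`) and the internal parameters of the groups. -/
structure Params where
  K : ℕ
  NX : ℕ → ℕ
  NY : ℕ → ℕ
  lam : ℕ → ℝ
  mu : ℕ → ℝ
  a0 : ℕ → ℝ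
  b0 : ℕ → ℝ
  C : ℝ
  D : ℝ
  tauX : ℕ → ℕ → ℝ
  sigX : ℕ → ℕ → ℝ
  tauY : ℕ → ℕ → ℝ
  sigY : ℕ → ℕ → ℝ

/-- `σᵢ` with the convention `σ₀ = 0`. -/
def sigma (sig : ℕ → ℝ) (i : ℕ) : ℝ := if i = 0 then 0 else sig i

/-- `Tᵢ = τ₁ + ⋯ + τᵢ`. -/
def sumT (tau : ℕ → ℝ) (i : ℕ) : ℝ := ∑ a ∈ Finset.Icc 1 i, tau a

/-- `Sᵢ = τ₂ σ₁ + ⋯ + τᵢ σᵢ₋₁`. -/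
def sumS (tau sig : ℕ → ℝ) (i : ℕ) : ℝ := ∑ b ∈ Finset.Icc 1 (i - 1), tau (b + 1) * sig b

/-- `Rᵢ = σᵢ Tᵢ - Sᵢ`, which gives `R₀ = 0`. -/
def sumR (tau sig : ℕ → ℝ) (i : ℕ) : ℝ := sigma sig i * sumT tau i - sumS tau sig i

namespace Params

variable (P : Params)

/-- `∏ λᵢ` over `p ≤ i ≤ q`. -/
def prodLam (p q : ℕ) : ℝ := ∏ i ∈ Finset.Icc p q, P.lam i

/-- `∏ μⱼ` over `p ≤ j ≤ q`. -/
def prodMu (p q : ℕ) : ℝ := ∏ j ∈ Finset.Icc p q, P.mu j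

/-- `L`, the product of all `λᵢ`. -/
def L : ℝ := P.prodLam 1 P.K

/-- `M`, the product of all `μⱼ`. -/
def M : ℝ := P.prodMu 1 (P.K - 1)

/-- The constraints on the parameters. -/
structure Admissible : Prop where
  K_pos : 1 ≤ P.K
  NX_pos : ∀ j, 1 ≤ j → j ≤ P.K → 1 ≤ P.NX j
  NY_pos : ∀ j, 1 ≤ j → j ≤ P.K → 1 ≤ P.NY j
  lam_pos : ∀ i, 1 ≤ i → i ≤ P.K → 0 < P.lam i
  lam_lt : ∀ i, 1 ≤ i → i + 1 ≤ P.K → P.lam i < P.lam (i + 1)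
  mu_pos : ∀ j, 1 ≤ j → j ≤ P.K - 1 → 0 < P.mu j
  mu_lt : ∀ j, 1 ≤ j → j + 1 ≤ P.K - 1 → P.mu j < P.mu (j + 1)
  a0_pos : ∀ i, 1 ≤ i → i ≤ P.K → 0 < P.a0 i
  b0_pos : ∀ j, 1 ≤ j → j ≤ P.K - 1 → 0 < P.b0 j
  C_pos : 0 < P.C
  D_pos : 0 < P.D
  tauX_pos : ∀ j i, 1 ≤ j → j ≤ P.K → 1 ≤ i → i ≤ P.NX j - 1 → 0 < P.tauX j i
  tauY_pos : ∀ j i, 1 ≤ j → j ≤ P.K → 1 ≤ i → i ≤ P.NY j - 1 → 0 < P.tauY j i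
  sigX_pos : ∀ j i, 1 ≤ j → j ≤ P.K → 1 ≤ i → i ≤ P.NX j - 1 → 0 < P.sigX j i
  sigY_pos : ∀ j i, 1 ≤ j → j ≤ P.K → 1 ≤ i → i ≤ P.NY j - 1 → 0 < P.sigY j i
  sigX_lt : ∀ j i, 1 ≤ j → j ≤ P.K → 1 ≤ i → i + 1 ≤ P.NX j - 1 →
    P.sigX j i < P.sigX j (i + 1)
  sigY_lt : ∀ j i, 1 ≤ j → j ≤ P.K → 1 ≤ i → i + 1 ≤ P.NY j - 1 →
    P.sigY j i < P.sigY j (i + 1)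
  sigX_lt_tauY : ∀ j, 1 ≤ j → j ≤ P.K → 2 ≤ P.NX j → 2 ≤ P.NY j →
    P.sigX j (P.NX j - 1) < P.tauY j 1
  sigY_lt_tauX : ∀ j, 1 ≤ j → j + 1 ≤ P.K → 2 ≤ P.NY j → 2 ≤ P.NX (j + 1) →
    P.sigY j (P.NY j - 1) < P.tauX (j + 1) 1
  sigX_lt_D : P.NY P.K = 1 → 2 ≤ P.NX P.K → P.sigX P.K (P.NX P.K - 1) < P.D
  C_of_singleton : P.NX 1 = 1 → 2 ≤ P.NY 1 → P.M < P.C * P.tauY 1 1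
  C_of_three_le : 3 ≤ P.NX 1 → P.tauX 1 1 * P.M < P.C * P.sigX 1 1 * P.tauX 1 2
  one_lt_CD : P.K = 1 → P.NX 1 = 1 → P.NY 1 = 1 → 1 < P.C * P.D

/-! ### The sums `J` -/

/-- `aᵢ(t) = aᵢ(0) exp(t / λᵢ)`. -/
def a (t : ℝ) (i : ℕ) : ℝ := P.a0 i * Real.exp (t / P.lam i)

/-- `bⱼ(t) = bⱼ(0) exp(t / μⱼ)`. -/
def b (t : ℝ) (j : ℕ) : ℝ := P.b0 j * Real.exp (t / P.mu j)

/-- `Ψ_{IJ}`, that is, the product of `(λ_p - λ_q)²` over pairs `p < q` in `I` and of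
`(μ_p - μ_q)²` over pairs `p < q` in `J`, divided by the product of `λ_p + μ_q` over
`p ∈ I`, `q ∈ J`. -/
def Psi (I J : Finset ℕ) : ℝ :=
  (∏ p ∈ I, ∏ q ∈ I with p < q, (P.lam p - P.lam q) ^ 2)
    * (∏ p ∈ J, ∏ q ∈ J with p < q, (P.mu p - P.mu q) ^ 2)
    / ∏ p ∈ I, ∏ q ∈ J, (P.lam p + P.mu q)

/-- `Ψ_{IJ}` for the integer intervals `I = [p, q]` and `J = [r, s]`
(an interval `[p, q]` with `q < p` is empty). -/
def psi (p q r s : ℕ) : ℝ := P.Psi (Finset.Icc p q) (Finset.Icc r s)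

/-- `J_{ij}^{rs}` at time `t`, with `A = K` and `B = K - 1`. -/
def J (t : ℝ) (r s : ℕ) (i j : ℤ) : ℝ :=
  if 0 ≤ i ∧ i ≤ (P.K : ℤ) ∧ 0 ≤ j ∧ j ≤ (P.K : ℤ) - 1 then
    ∑ I ∈ (Finset.Icc 1 P.K).powersetCard i.toNat,
      ∑ J ∈ (Finset.Icc 1 (P.K - 1)).powersetCard j.toNat,
        P.Psi I J * (∏ p ∈ I, P.lam p ^ r * P.a t p) * (∏ q ∈ J, P.mu q ^ s * P.b t q)
  else 0

/-! ### The peakon variables in terms of the parameters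

In the formulas below, `l` is the number of the group from the left and `j = K + 1 - l` its
number from the right; `X = exp(2x)/2`, `Y = exp(2y)/2`, `Q = 2 m exp(-x)`, `P = 2 n exp(-y)`. -/

/-- `X_{l,i}` at time `t`. -/
def X (t : ℝ) (l i : ℕ) : ℝ :=
  let K : ℤ := P.K
  let j : ℤ := K + 1 - l
  let N := P.NX l
  let tau := P.tauX l
  let sig := P.sigX l
  let T := sumT tau
  let S := sumS tau sig
  if N = 1 then
    if l = 1 then
      P.J t 0 0 K (K - 1) / (P.J t 1 1 (K - 1) (K - 2) + P.C * P.J t 1 0 (K - 1) (K - 1))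
    else P.J t 0 0 j j / P.J t 1 1 (j - 1) (j - 1)
  else if l = 1 then
    if i = 1 then
      P.J t 0 0 K (K - 1)
        / (P.J t 1 1 (K - 1) (K - 2) + 1 / sig 1 * P.J t 1 1 (K - 1) (K - 1)
          + P.C * (P.J t 1 0 (K - 1) (K - 1) + 1 / tau 1 * P.J t 1 0 K (K - 1)))
    else if i < N then
      S i * P.J t 0 0 K (K - 1)
        / (P.J t 1 1 K (K - 1) + T i * P.J t 1 1 (K - 1) (K - 1)
          + S i * P.J t 1 1 (K - 1) (K - 2))
    else
      sig (N - 1) * P.J t 0 0 K (K - 1)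
        / (P.J t 1 1 (K - 1) (K - 1) + sig (N - 1) * P.J t 1 1 (K - 1) (K - 2))
  else
    if i < N then
      (P.J t 0 0 (j + 1) j + T i * P.J t 0 0 j j + S i * P.J t 0 0 j (j - 1))
        / (P.J t 1 1 j (j - 1) + T i * P.J t 1 1 (j - 1) (j - 1)
          + S i * P.J t 1 1 (j - 1) (j - 2))
    else
      (P.J t 0 0 j j + sig (N - 1) * P.J t 0 0 j (j - 1))
        / (P.J t 1 1 (j - 1) (j - 1) + sig (N - 1) * P.J t 1 1 (j - 1) (j - 2))

/-- `Q_{l,i}` at time `t`. -/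
def Q (t : ℝ) (l i : ℕ) : ℝ :=
  let K : ℤ := P.K
  let j : ℤ := K + 1 - l
  let N := P.NX l
  let tau := P.tauX l
  let sig := P.sigX l
  let T := sumT tau
  let S := sumS tau sig
  let R := sumR tau sig
  if N = 1 then
    if l = 1 then
      P.M / P.L * (P.J t 1 1 (K - 1) (K - 2) / P.J t 1 0 (K - 1) (K - 1) + P.C)
    else
      P.J t 1 1 (j - 1) (j - 1) * P.J t 0 1 j (j - 1)
        / (P.J t 1 0 j j * P.J t 1 0 (j - 1) (j - 1))
  else if l = 1 then
    if i = 1 then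
      P.M / P.L *
        ((P.J t 1 1 (K - 1) (K - 2) + 1 / sig 1 * P.J t 1 1 (K - 1) (K - 1))
          / (P.J t 1 0 (K - 1) (K - 1) + 1 / tau 1 * P.J t 1 0 K (K - 1)) + P.C)
    else if i < N then
      (sigma sig i - sigma sig (i - 1)) * P.J t 0 1 K (K - 1)
        * (P.J t 1 1 K (K - 1) + T i * P.J t 1 1 (K - 1) (K - 1)
          + S i * P.J t 1 1 (K - 1) (K - 2))
        * (sigma sig i * P.J t 1 0 K (K - 1) + R i * P.J t 1 0 (K - 1) (K - 1))⁻¹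
        * (sigma sig (i - 1) * P.J t 1 0 K (K - 1)
          + R (i - 1) * P.J t 1 0 (K - 1) (K - 1))⁻¹
    else
      P.J t 0 1 K (K - 1)
        * (P.J t 1 1 (K - 1) (K - 1) + sig (N - 1) * P.J t 1 1 (K - 1) (K - 2))
        / (P.J t 1 0 (K - 1) (K - 1)
          * (sig (N - 1) * P.J t 1 0 K (K - 1) + R (N - 1) * P.J t 1 0 (K - 1) (K - 1)))
  else
    if i < N then
      (sigma sig i - sigma sig (i - 1)) * P.J t 0 1 j (j - 1)
        * (P.J t 1 1 j (j - 1) + T i * P.J t 1 1 (j - 1) (j - 1)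
          + S i * P.J t 1 1 (j - 1) (j - 2))
        * (P.J t 1 0 j j + sigma sig i * P.J t 1 0 j (j - 1)
          + R i * P.J t 1 0 (j - 1) (j - 1))⁻¹
        * (P.J t 1 0 j j + sigma sig (i - 1) * P.J t 1 0 j (j - 1)
          + R (i - 1) * P.J t 1 0 (j - 1) (j - 1))⁻¹
    else
      P.J t 0 1 j (j - 1)
        * (P.J t 1 1 (j - 1) (j - 1) + sig (N - 1) * P.J t 1 1 (j - 1) (j - 2))
        / (P.J t 1 0 (j - 1) (j - 1)
          * (P.J t 1 0 j j + sig (N - 1) * P.J t 1 0 j (j - 1)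
            + R (N - 1) * P.J t 1 0 (j - 1) (j - 1)))

/-- `Y_{l,i}` at time `t`. -/
def Y (t : ℝ) (l i : ℕ) : ℝ :=
  let j : ℤ := (P.K : ℤ) + 1 - l
  let N := P.NY l
  let tau := P.tauY l
  let sig := P.sigY l
  let T := sumT tau
  let S := sumS tau sig
  if N = 1 then
    if l = P.K then P.J t 0 0 1 1 + P.D * P.J t 0 0 1 0
    else P.J t 0 0 j (j - 1) / P.J t 1 1 (j - 1) (j - 2)
  else if l = P.K then
    if i < N then P.J t 0 0 1 1 + T i * P.J t 0 0 1 0 + S i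
    else
      P.J t 0 0 1 1 + (T (N - 1) + P.D) * P.J t 0 0 1 0 + (S (N - 1) + P.D * sig (N - 1))
  else
    if i < N then
      (P.J t 0 0 j j + T i * P.J t 0 0 j (j - 1) + S i * P.J t 0 0 (j - 1) (j - 1))
        / (P.J t 1 1 (j - 1) (j - 1) + T i * P.J t 1 1 (j - 1) (j - 2)
          + S i * P.J t 1 1 (j - 2) (j - 2))
    else
      (P.J t 0 0 j (j - 1) + sig (N - 1) * P.J t 0 0 (j - 1) (j - 1))
        / (P.J t 1 1 (j - 1) (j - 2) + sig (N - 1) * P.J t 1 1 (j - 2) (j - 2))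

/-- `P_{l,i}` at time `t` (named `PP` here, since `P` denotes the parameters). -/
def PP (t : ℝ) (l i : ℕ) : ℝ :=
  let j : ℤ := (P.K : ℤ) + 1 - l
  let N := P.NY l
  let tau := P.tauY l
  let sig := P.sigY l
  let T := sumT tau
  let S := sumS tau sig
  let R := sumR tau sig
  if N = 1 then
    if l = P.K then 1 / P.J t 0 0 1 0
    else
      P.J t 1 0 (j - 1) (j - 1) * P.J t 1 1 (j - 1) (j - 2)
        / (P.J t 0 1 j (j - 1) * P.J t 0 1 (j - 1) (j - 2))
  else if l = P.K then
    if i < N then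
      (sigma sig i - sigma sig (i - 1))
        / ((P.J t 0 1 1 0 + sigma sig i) * (P.J t 0 1 1 0 + sigma sig (i - 1)))
    else 1 / (P.J t 0 1 1 0 + sig (N - 1))
  else
    if i < N then
      (sigma sig i - sigma sig (i - 1)) * P.J t 1 0 (j - 1) (j - 1)
        * (P.J t 1 1 (j - 1) (j - 1) + T i * P.J t 1 1 (j - 1) (j - 2)
          + S i * P.J t 1 1 (j - 2) (j - 2))
        * (P.J t 0 1 j (j - 1) + sigma sig i * P.J t 0 1 (j - 1) (j - 1)
          + R i * P.J t 0 1 (j - 1) (j - 2))⁻¹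
        * (P.J t 0 1 j (j - 1) + sigma sig (i - 1) * P.J t 0 1 (j - 1) (j - 1)
          + R (i - 1) * P.J t 0 1 (j - 1) (j - 2))⁻¹
    else
      P.J t 1 0 (j - 1) (j - 1)
        * (P.J t 1 1 (j - 1) (j - 2) + sig (N - 1) * P.J t 1 1 (j - 2) (j - 2))
        / (P.J t 0 1 (j - 1) (j - 2)
          * (P.J t 0 1 j (j - 1) + sig (N - 1) * P.J t 0 1 (j - 1) (j - 1)
            + R (N - 1) * P.J t 0 1 (j - 1) (j - 2)))

/-- The peakon variables at time zero are the ones with parameters `P`.  Nothing is demanded at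
other times. -/
structure HasInitialData (x m y n : ℕ → ℕ → ℝ → ℝ) : Prop where
  x_init : ∀ l i, 1 ≤ l → l ≤ P.K → 1 ≤ i → i ≤ P.NX l →
    1 / 2 * Real.exp (2 * x l i 0) = P.X 0 l i
  m_init : ∀ l i, 1 ≤ l → l ≤ P.K → 1 ≤ i → i ≤ P.NX l →
    2 * m l i 0 * Real.exp (-x l i 0) = P.Q 0 l i
  y_init : ∀ l i, 1 ≤ l → l ≤ P.K → 1 ≤ i → i ≤ P.NY l →
    1 / 2 * Real.exp (2 * y l i 0) = P.Y 0 l i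
  n_init : ∀ l i, 1 ≤ l → l ≤ P.K → 1 ≤ i → i ≤ P.NY l →
    2 * n l i 0 * Real.exp (-y l i 0) = P.PP 0 l i

/-- `Tᵢ` for the `j`th `X`-group. -/
def TX (j i : ℕ) : ℝ := sumT (P.tauX j) i

/-- `Sᵢ` for the `j`th `X`-group. -/
def SX (j i : ℕ) : ℝ := sumS (P.tauX j) (P.sigX j) i

/-- `Tᵢ` for the `j`th `Y`-group. -/
def TY (j i : ℕ) : ℝ := sumT (P.tauY j) i

/-- `Sᵢ` for the `j`th `Y`-group. -/
def SY (j i : ℕ) : ℝ := sumS (P.tauY j) (P.sigY j) i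

end Params

/-- `f(t) = (t/2) c + (1/2) ln d + o(1)` along the filter `l`. -/
def ApproachesLine (l : Filter ℝ) (f : ℝ → ℝ) (c d : ℝ) : Prop :=
  Filter.Tendsto (fun t => f t - (t / 2 * c + 1 / 2 * Real.log d)) l (𝓝 0)

end GengXue

end

/-! The formulas for X, Q, Y, P are imposed at time zero only. The proof shows that they propagate
to all times (`Params.Admissible.explicit`); after that each position is governed by a quotient of
finite sums of exponentials, and its asymptotics are read off from the largest terms of numerator
and denominator.

Propagation. In the variables Q, QX, P, PY the peakon equations are polynomial: at a point z the
wave u is e^{-z} times the sum of QX over the peakons to its left plus e^z/2 times the sum of Q over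
those to its right, and likewise for v. A polynomial vector field on a finite-dimensional space has
at most one solution through a given state (`IsPolynomialSolution.unique`), so it suffices that the
explicit formulas solve the system (`Params.Admissible.isPolynomialSolution`).

To see this, attach to each place next to a member of a group a triple s of time-independent
coefficients; between members it is (1, σ_i, R_i). The partial sums of QX to the left and of Q to
the right of the place are quotients `numL`/`den` and `numR`/`den`, where each of these three is the
combination, with coefficients s, of three sums J; within a group only s varies. Differences between
neighbouring places are computed by Wronskian identities (`numL_wronskian`, `numR_wronskian`), the
minors of consecutive triples producing T_i and S_i. Time derivatives are computed in
`hasDerivAt_sums`: each partial sum evolves as the equations demand, up to a term that is the same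
at all places of the group and cancels in differences.

All of these are quadratic relations between sums J with a single source (`sum_special_residues`,
`jSum_bilinear`, `jSum_hirota`). A product of two sums J runs over quadruples (I, J, I', J'). Moving
a point from I' to I, or from J' to J, changes the product of the two Ψ by just the factor that
turns the residue of one rational function at that point into the residue of another. Summed over
all quadruples these residues drop out, and by the residue theorem only those at auxiliary poles and
at infinity remain; they are again products of sums J. A double pole at 0 yields derivatives,
because the weights evolve by w' = w/x.

Asymptotics. Since 1/λ_i and 1/μ_j decrease with the index, J_{ij} is dominated by the initial
segments I = [1,i], J = [1,j] as t → +∞ and by final segments as t → -∞. A quotient whose dominant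
index sets differ by one λ_p and one μ_q grows with exponent 1/λ_p + 1/μ_q. The internal parameters
survive only if numerator and denominator are led by different internal coefficients; this happens
at the ends of the configuration, where some of the sums J vanish because their indices are out of
range. -/

noncomputable section

/-! ### Residue sums of rational functions with simple poles. -/

namespace GengXue

open Finset Polynomial

/-- The sum of the residues of `q(z) ∏ (zⱼ - z) / (∏ (z - c) ∏ (zⱼ - z))` vanishes. -/
theorem sum_residues {ι : Type*} [DecidableEq ι] (s A : Finset ι) (z : ι → ℝ)
    (hz : Set.InjOn z s) (T : Finset ℝ) (hT : ∀ c ∈ T, ∀ i ∈ s, z i ≠ c) (q : ℝ[X])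
    (hq : q.Monic) (hdeg : A.card + q.natDegree + 1 ≤ s.card + T.card) :
    ∑ i ∈ s, q.eval (z i) / (∏ c ∈ T, (z i - c))
        * ((∏ j ∈ A, (z j - z i)) / ∏ j ∈ s.erase i, (z j - z i))
      = ∑ c ∈ T, q.eval c / (∏ d ∈ T.erase c, (c - d))
          * ((∏ j ∈ A, (z j - c)) / ∏ j ∈ s, (z j - c))
        + if A.card + q.natDegree + 1 = s.card + T.card then (-1) ^ (A.card + s.card + 1)
          else 0 := by
  classical
  set p : ℝ[X] := q * ∏ j ∈ A, (X - C (z j)) with hp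
  have hmon : (∏ j ∈ A, (X - C (z j))).Monic := monic_prod_of_monic _ _ fun j _ => monic_X_sub_C _
  have hpm : p.Monic := hq.mul hmon
  have hpd : p.natDegree = A.card + q.natDegree := by
    rw [hp, hq.natDegree_mul hmon, natDegree_prod_of_monic _ _ fun j _ => monic_X_sub_C _]
    simp [add_comm]
  set S : Finset (ι ⊕ ℝ) := s.disjSum T with hS
  set v : ι ⊕ ℝ → ℝ := Sum.elim z id with hv
  have hinj : Set.InjOn v S := by
    rintro (a | a) ha (b | b) hb hab <;> simp [hS, hv] at ha hb hab ⊢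
    · exact hz ha hb hab
    · exact hT b hb a ha hab
    · exact hT a ha b hb hab.symm
    · exact hab
  have hcard : S.card = s.card + T.card := by simp [hS]
  have hdlt : p.degree < S.card := by
    rw [degree_eq_natDegree hpm.ne_zero, hpd, hcard]
    exact_mod_cast hdeg
  -- Lagrange interpolation at all poles: the coefficient of p of degree |S| - 1 is the sum of the
  -- residues of p / ∏ (X - v) at its finite poles. It is 1 or 0 according to whether p, which is
  -- monic, has that degree.
  have key := Lagrange.coeff_eq_sum hinj hdlt
  have hco : p.coeff (S.card - 1)
      = if A.card + q.natDegree + 1 = s.card + T.card then 1 else 0 := by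
    split_ifs with h
    · have : S.card - 1 = p.natDegree := by omega
      rw [this]; exact hpm
    · apply coeff_eq_zero_of_natDegree_lt; omega
  have hev : ∀ x : ℝ, p.eval x = (-1) ^ A.card * (q.eval x * ∏ j ∈ A, (z j - x)) := by
    intro x
    rw [hp, eval_mul, eval_prod, ← prod_const, mul_left_comm, ← prod_mul_distrib]
    congr 1
    apply prod_congr rfl; intros; simp
  rw [hco, hS, sum_disjSum] at key
  have e1 : ∀ i ∈ s, p.eval (v (Sum.inl i)) / ∏ j ∈ S.erase (Sum.inl i), (v (Sum.inl i) - v j)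
      = (-1) ^ (A.card + s.card + 1) * (q.eval (z i) / (∏ c ∈ T, (z i - c))
        * ((∏ j ∈ A, (z j - z i)) / ∏ j ∈ s.erase i, (z j - z i))) := by
    intro i hi
    have h1 : S.erase (Sum.inl i) = (s.erase i).disjSum T := by
      ext (a | a) <;> simp [hS]
    have h2 : ∏ j ∈ s.erase i, (z i - z j) = (-1) ^ (s.card - 1) * ∏ j ∈ s.erase i, (z j - z i) := by
      rw [← card_erase_of_mem hi, ← prod_const, ← prod_mul_distrib]
      apply prod_congr rfl; intros; ring
    rw [h1, prod_disjSum, hev]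
    simp only [hv, Sum.elim_inl, Sum.elim_inr, id]
    rw [h2]
    obtain ⟨k, hk⟩ : ∃ k, s.card = k + 1 := ⟨s.card - 1, by have := card_pos.2 ⟨i, hi⟩; omega⟩
    rw [hk]
    have : ((-1 : ℝ) ^ (A.card + (k + 1) + 1)) = (-1) ^ A.card * (-1) ^ k := by ring
    rw [this]
    have h3 : ((-1 : ℝ) ^ k)⁻¹ = (-1) ^ k := by
      rw [← inv_pow]; norm_num
    simp only [div_eq_mul_inv, mul_inv, Nat.add_sub_cancel, h3]
    ring
  have e2 : ∀ c ∈ T, p.eval (v (Sum.inr c)) / ∏ j ∈ S.erase (Sum.inr c), (v (Sum.inr c) - v j)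
      = - ((-1) ^ (A.card + s.card + 1) * (q.eval c / (∏ d ∈ T.erase c, (c - d))
          * ((∏ j ∈ A, (z j - c)) / ∏ j ∈ s, (z j - c)))) := by
    intro c hc
    have h1 : S.erase (Sum.inr c) = s.disjSum (T.erase c) := by
      ext (a | a) <;> simp [hS]
    have h2 : ∏ j ∈ s, (c - z j) = (-1) ^ s.card * ∏ j ∈ s, (z j - c) := by
      rw [← prod_const, ← prod_mul_distrib]
      apply prod_congr rfl; intros; ring
    rw [h1, prod_disjSum, hev]
    simp only [hv, Sum.elim_inl, Sum.elim_inr, id]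
    rw [h2]
    have h3 : ((-1 : ℝ) ^ s.card)⁻¹ = (-1) ^ s.card := by
      rw [← inv_pow]; norm_num
    simp only [div_eq_mul_inv, mul_inv, h3]
    ring
  rw [sum_congr rfl e1, sum_congr rfl e2, ← mul_sum, sum_neg_distrib, ← mul_sum] at key
  have hs : ((-1 : ℝ) ^ (A.card + s.card + 1)) * (-1) ^ (A.card + s.card + 1) = 1 := by
    rw [← pow_add]; exact Even.neg_one_pow ⟨_, rfl⟩
  have := congrArg (fun r => (-1) ^ (A.card + s.card + 1) * r) key
  simp only [mul_add, mul_neg, ← mul_assoc, hs, one_mul] at this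
  rw [mul_ite, mul_one, mul_zero] at this
  rw [this]; ring

/-- The case of `sum_residues` with two kinds of points, `xᵢ` and `-yⱼ`. -/
theorem sum_residues_two (x y : ℕ → ℝ) (A B C D : Finset ℕ) (hx : Set.InjOn x B)
    (hy : Set.InjOn y D) (hxy : ∀ p ∈ B, ∀ q ∈ D, x p + y q ≠ 0) (T : Finset ℝ)
    (hTx : ∀ c ∈ T, ∀ i ∈ B, x i ≠ c) (hTy : ∀ c ∈ T, ∀ i ∈ D, -y i ≠ c) (q : ℝ[X])
    (hq : q.Monic) (hdeg : A.card + C.card + q.natDegree + 1 ≤ B.card + D.card + T.card) :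
    ∑ p ∈ B, q.eval (x p) / (∏ c ∈ T, (x p - c))
        * ((∏ i ∈ A, (x i - x p)) * (∏ j ∈ C, (y j + x p))
          / ((∏ i ∈ B.erase p, (x i - x p)) * ∏ j ∈ D, (y j + x p)))
      - ∑ p ∈ D, q.eval (-y p) / (∏ c ∈ T, (-y p - c))
        * ((∏ i ∈ A, (x i + y p)) * (∏ j ∈ C, (y j - y p))
          / ((∏ i ∈ B, (x i + y p)) * ∏ j ∈ D.erase p, (y j - y p)))
      = ∑ c ∈ T, q.eval c / (∏ d ∈ T.erase c, (c - d))
          * ((∏ i ∈ A, (x i - c)) * (∏ j ∈ C, (y j + c))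
            / ((∏ i ∈ B, (x i - c)) * ∏ j ∈ D, (y j + c)))
        + if A.card + C.card + q.natDegree + 1 = B.card + D.card + T.card
          then (-1) ^ (A.card + B.card + 1) else 0 := by
  classical
  -- The points -yⱼ turn the factors zⱼ - c into -(yⱼ + c), so that the denominators x + y of Ψ
  -- appear as differences of interpolation points.
  set z : ℕ ⊕ ℕ → ℝ := Sum.elim x (fun j => -y j) with hz
  have hinj : Set.InjOn z (B.disjSum D) := by
    rintro (a | a) ha (b | b) hb hab <;> simp [hz] at ha hb hab ⊢
    · exact hx ha hb hab
    · exact hxy a ha b hb (by linarith)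
    · exact hxy b hb a ha (by linarith)
    · exact hy ha hb hab
  have key := sum_residues (B.disjSum D) (A.disjSum C) z hinj T (by
    rintro c hc (i | i) hi <;> simp [hz] at hi ⊢
    · exact hTx c hc i hi
    · exact hTy c hc i hi) q hq (by simp only [card_disjSum]; omega)
  have hneg : ∀ (E : Finset ℕ) (u : ℝ), ∏ j ∈ E, (-y j - u) = (-1) ^ E.card * ∏ j ∈ E, (y j + u) := by
    intro E u
    rw [← prod_const, ← prod_mul_distrib]
    apply prod_congr rfl; intros; ring
  have hinv : ∀ k : ℕ, ((-1 : ℝ) ^ k)⁻¹ = (-1) ^ k := fun k => by rw [← inv_pow]; norm_num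
  have hsq : ∀ k : ℕ, (-1 : ℝ) ^ k * (-1) ^ k = 1 := fun k => by
    rw [← pow_add]; exact Even.neg_one_pow ⟨_, rfl⟩
  rw [sum_disjSum] at key
  simp only [card_disjSum] at key
  have e1 : ∀ p ∈ B, q.eval (z (Sum.inl p)) / (∏ c ∈ T, (z (Sum.inl p) - c))
        * ((∏ j ∈ A.disjSum C, (z j - z (Sum.inl p)))
          / ∏ j ∈ (B.disjSum D).erase (Sum.inl p), (z j - z (Sum.inl p)))
      = (-1) ^ (C.card + D.card) * (q.eval (x p) / (∏ c ∈ T, (x p - c))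
        * ((∏ i ∈ A, (x i - x p)) * (∏ j ∈ C, (y j + x p))
          / ((∏ i ∈ B.erase p, (x i - x p)) * ∏ j ∈ D, (y j + x p)))) := by
    intro p hp
    have h1 : (B.disjSum D).erase (Sum.inl p) = (B.erase p).disjSum D := by
      ext (a | a) <;> simp
    rw [h1]
    simp only [prod_disjSum, hz, Sum.elim_inl, Sum.elim_inr, hneg]
    simp only [div_eq_mul_inv, mul_inv, hinv, pow_add]
    ring
  have e2 : ∀ p ∈ D, q.eval (z (Sum.inr p)) / (∏ c ∈ T, (z (Sum.inr p) - c))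
        * ((∏ j ∈ A.disjSum C, (z j - z (Sum.inr p)))
          / ∏ j ∈ (B.disjSum D).erase (Sum.inr p), (z j - z (Sum.inr p)))
      = - ((-1) ^ (C.card + D.card) * (q.eval (-y p) / (∏ c ∈ T, (-y p - c))
        * ((∏ i ∈ A, (x i + y p)) * (∏ j ∈ C, (y j - y p))
          / ((∏ i ∈ B, (x i + y p)) * ∏ j ∈ D.erase p, (y j - y p))))) := by
    intro p hp
    have h1 : (B.disjSum D).erase (Sum.inr p) = B.disjSum (D.erase p) := by
      ext (a | a) <;> simp
    rw [h1]
    simp only [prod_disjSum, hz, Sum.elim_inl, Sum.elim_inr, hneg]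
    obtain ⟨k, hk⟩ : ∃ k, D.card = k + 1 := ⟨D.card - 1, by have := card_pos.2 ⟨p, hp⟩; omega⟩
    rw [card_erase_of_mem hp, hk]
    simp only [div_eq_mul_inv, mul_inv, hinv, pow_add, Nat.add_sub_cancel, sub_neg_eq_add,
      ← sub_eq_add_neg]
    ring
  have e3 : ∀ c ∈ T, q.eval c / (∏ d ∈ T.erase c, (c - d))
          * ((∏ j ∈ A.disjSum C, (z j - c)) / ∏ j ∈ B.disjSum D, (z j - c))
      = (-1) ^ (C.card + D.card) * (q.eval c / (∏ d ∈ T.erase c, (c - d))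
          * ((∏ i ∈ A, (x i - c)) * (∏ j ∈ C, (y j + c))
            / ((∏ i ∈ B, (x i - c)) * ∏ j ∈ D, (y j + c)))) := by
    intro c hc
    simp only [prod_disjSum, hz, Sum.elim_inl, Sum.elim_inr, hneg]
    simp only [div_eq_mul_inv, mul_inv, hinv, pow_add]
    ring
  rw [sum_congr rfl e1, sum_congr rfl e2, sum_congr rfl e3, ← mul_sum, sum_neg_distrib, ← mul_sum,
    ← mul_sum] at key
  have hs := hsq (C.card + D.card)
  have := congrArg (fun r => (-1) ^ (C.card + D.card) * r) key
  simp only [mul_add, mul_neg, ← mul_assoc, hs, one_mul] at this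
  rw [sub_eq_add_neg, this]
  congr 1
  rw [mul_ite, mul_zero]
  congr 1
  have : (-1 : ℝ) ^ (A.card + C.card + (B.card + D.card) + 1)
    = (-1) ^ (C.card + D.card) * (-1) ^ (A.card + B.card + 1) := by ring
  rw [this, ← mul_assoc, hs, one_mul]

end GengXue

end

/-! ### Sums over pairs of subsets, and the exchange of a point between two factors. -/

noncomputable section

namespace GengXue

open Finset

theorem prod_pairs_insert (f : ℕ → ℕ → ℝ) (hf : ∀ i j, f i j = f j i) (I : Finset ℕ) (a : ℕ)
    (ha : a ∉ I) :
    ∏ p ∈ insert a I, ∏ q ∈ insert a I with p < q, f p q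
      = (∏ p ∈ I, ∏ q ∈ I with p < q, f p q) * ∏ i ∈ I, f i a := by
  have h1 : ∏ q ∈ insert a I with a < q, f a q = ∏ i ∈ I, if a < i then f i a else 1 := by
    rw [filter_insert, if_neg (lt_irrefl a), prod_filter]
    exact prod_congr rfl fun i _ => by rw [hf a i]
  have h2 : ∀ p ∈ I, ∏ q ∈ insert a I with p < q, f p q
      = (∏ q ∈ I with p < q, f p q) * if p < a then f p a else 1 := by
    intro p _
    rw [filter_insert]
    split_ifs with h
    · rw [prod_insert (by simp [ha]), mul_comm]
    · rw [mul_one]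
  rw [prod_insert ha, h1, prod_congr rfl h2, prod_mul_distrib, mul_left_comm, ← prod_mul_distrib]
  congr 1
  apply prod_congr rfl
  intro i hi
  have : i ≠ a := fun h => ha (h ▸ hi)
  rcases lt_or_gt_of_ne this with h | h
  · simp [h, not_lt.2 h.le]
  · simp [h, not_lt.2 h.le]

/-- `Ψ_{IJ}` for arbitrary points `xᵢ`, `yⱼ`. -/
def psiSet (x y : ℕ → ℝ) (I J : Finset ℕ) : ℝ :=
  (∏ p ∈ I, ∏ q ∈ I with p < q, (x p - x q) ^ 2)
    * (∏ p ∈ J, ∏ q ∈ J with p < q, (y p - y q) ^ 2)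
    / ∏ p ∈ I, ∏ q ∈ J, (x p + y q)

theorem psiSet_swap (x y : ℕ → ℝ) (I J : Finset ℕ) : psiSet x y I J = psiSet y x J I := by
  unfold psiSet
  rw [prod_comm, mul_comm]
  simp only [add_comm]

/-- The square of ∏ (xᵢ - x_a) is what makes the exchange argument work: one factor cancels the
denominator of a residue at x_a, the other supplies the numerator of a residue of a different
function at the same point. -/
theorem psiSet_insert_left (x y : ℕ → ℝ) (I J : Finset ℕ) (a : ℕ) (ha : a ∉ I) :
    psiSet x y (insert a I) J
      = psiSet x y I J * ((∏ i ∈ I, (x i - x a)) ^ 2 / ∏ j ∈ J, (y j + x a)) := by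
  unfold psiSet
  rw [prod_pairs_insert _ (fun i j => by ring) I a ha, prod_insert ha, prod_pow]
  simp only [add_comm (x a)]
  rw [div_mul_div_comm]
  congr 1 <;> ring

theorem psiSet_insert_right (x y : ℕ → ℝ) (I J : Finset ℕ) (a : ℕ) (ha : a ∉ J) :
    psiSet x y I (insert a J)
      = psiSet x y I J * ((∏ j ∈ J, (y j - y a)) ^ 2 / ∏ i ∈ I, (x i + y a)) := by
  rw [psiSet_swap, psiSet_insert_left _ _ _ _ _ ha, psiSet_swap y x J I]

/-- The subsets of `I₀` with `n` elements, for an integer `n`. -/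
def cardSub (I₀ : Finset ℕ) (n : ℤ) : Finset (Finset ℕ) :=
  I₀.powerset.filter fun I => (I.card : ℤ) = n

theorem mem_cardSub {I₀ I : Finset ℕ} {n : ℤ} : I ∈ cardSub I₀ n ↔ I ⊆ I₀ ∧ (I.card : ℤ) = n := by
  simp [cardSub]

/-- The summand of the sums `J`. -/
def jTerm (x y w v : ℕ → ℝ) (I J : Finset ℕ) : ℝ :=
  psiSet x y I J * (∏ i ∈ I, w i) * ∏ j ∈ J, v j

/-- The sums `J` for arbitrary points and weights. -/
def jSum (x y : ℕ → ℝ) (I₀ J₀ : Finset ℕ) (w v : ℕ → ℝ) (n m : ℤ) : ℝ :=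
  ∑ I ∈ cardSub I₀ n, ∑ J ∈ cardSub J₀ m, jTerm x y w v I J

theorem jSum_swap (x y : ℕ → ℝ) (I₀ J₀ : Finset ℕ) (w v : ℕ → ℝ) (n m : ℤ) :
    jSum x y I₀ J₀ w v n m = jSum y x J₀ I₀ v w m n := by
  unfold jSum
  rw [sum_comm]
  refine sum_congr rfl fun J _ => sum_congr rfl fun I _ => ?_
  rw [jTerm, jTerm, psiSet_swap]; ring

theorem jSum_congr (x y : ℕ → ℝ) {I₀ J₀ : Finset ℕ} {w w' v v' : ℕ → ℝ} (n m : ℤ)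
    (hw : ∀ i ∈ I₀, w i = w' i) (hv : ∀ j ∈ J₀, v j = v' j) :
    jSum x y I₀ J₀ w v n m = jSum x y I₀ J₀ w' v' n m := by
  unfold jSum
  refine sum_congr rfl fun I hI => sum_congr rfl fun J hJ => ?_
  rw [mem_cardSub] at hI hJ
  rw [jTerm, jTerm, prod_congr rfl fun i hi => hw i (hI.1 hi),
    prod_congr rfl fun j hj => hv j (hJ.1 hj)]

/-- Pairs (K, p) with p ∈ K correspond to pairs (K \ {p}, p). Having p outermost and running over
all of `I₀` lets two such sums be compared point by point. -/
theorem sum_cardSub_mem (I₀ : Finset ℕ) (n : ℤ) (f : Finset ℕ → ℕ → ℝ) :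
    ∑ K ∈ cardSub I₀ n, ∑ p ∈ K, f K p
      = ∑ p ∈ I₀, ∑ K ∈ cardSub I₀ (n - 1), if p ∈ K then 0 else f (insert p K) p := by
  have h1 : ∑ K ∈ cardSub I₀ n, ∑ p ∈ K, f K p
      = ∑ K ∈ cardSub I₀ n, ∑ p ∈ I₀, if p ∈ K then f K p else 0 := by
    refine sum_congr rfl fun K hK => ?_
    rw [sum_ite_mem, inter_eq_right.2 (mem_cardSub.1 hK).1]
  rw [h1, sum_comm]
  refine sum_congr rfl fun p hp => ?_
  rw [← sum_filter]
  have h2 : (∑ K ∈ cardSub I₀ (n - 1), if p ∈ K then 0 else f (insert p K) p)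
      = ∑ K ∈ (cardSub I₀ (n - 1)).filter (p ∉ ·), f (insert p K) p := by
    rw [sum_filter]; exact sum_congr rfl fun K _ => by split_ifs <;> rfl
  rw [h2]
  refine sum_bij' (fun K _ => K.erase p) (fun K _ => insert p K) ?_ ?_ ?_ ?_ ?_
  · intro K hK
    simp only [mem_filter, mem_cardSub] at hK ⊢
    refine ⟨⟨(erase_subset _ _).trans hK.1.1, ?_⟩, by simp⟩
    have := card_erase_add_one hK.2
    omega
  · intro K hK
    simp only [mem_filter, mem_cardSub] at hK ⊢
    refine ⟨⟨insert_subset hp hK.1.1, ?_⟩, by simp⟩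
    rw [card_insert_of_notMem hK.2]; push_cast; omega
  · intro K hK
    exact insert_erase (mem_filter.1 hK).2
  · intro K hK
    exact erase_insert (mem_filter.1 hK).2
  · intro K hK
    rw [insert_erase (mem_filter.1 hK).2]

/-- Moving one point from the second set to the first one. -/
theorem sum_move (I₀ : Finset ℕ) (n n' : ℤ) (f g : Finset ℕ → Finset ℕ → ℕ → ℝ)
    (hf : ∀ I K p, p ∈ I → f I K p = 0) (hg : ∀ I K p, p ∈ K → g I K p = 0)
    (h : ∀ I K p, p ∈ I₀ → I ⊆ I₀ → K ⊆ I₀ → p ∉ I → p ∉ K →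
      f I (insert p K) p = g (insert p I) K p) :
    ∑ I ∈ cardSub I₀ n, ∑ K ∈ cardSub I₀ n', ∑ p ∈ K, f I K p
      = ∑ I ∈ cardSub I₀ (n + 1), ∑ K ∈ cardSub I₀ (n' - 1), ∑ p ∈ I, g I K p := by
  have h1 : ∀ I, ∑ K ∈ cardSub I₀ n', ∑ p ∈ K, f I K p
      = ∑ p ∈ I₀, ∑ K ∈ cardSub I₀ (n' - 1), if p ∈ K then 0 else f I (insert p K) p :=
    fun I => sum_cardSub_mem I₀ n' fun K p => f I K p
  have h2 : ∑ I ∈ cardSub I₀ (n + 1), ∑ K ∈ cardSub I₀ (n' - 1), ∑ p ∈ I, g I K p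
      = ∑ I ∈ cardSub I₀ (n + 1), ∑ p ∈ I, ∑ K ∈ cardSub I₀ (n' - 1), g I K p :=
    sum_congr rfl fun I _ => sum_comm
  rw [h2, sum_cardSub_mem I₀ (n + 1) fun I p => ∑ K ∈ cardSub I₀ (n' - 1), g I K p,
    add_sub_cancel_right, sum_congr rfl fun I _ => h1 I, sum_comm]
  refine sum_congr rfl fun p hp => sum_congr rfl fun I hI => ?_
  split_ifs with hpI
  · refine sum_eq_zero fun K _ => ?_
    split_ifs
    · rfl
    · exact hf _ _ _ hpI
  · refine sum_congr rfl fun K hK => ?_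
    split_ifs with hpK
    · exact (hg _ _ _ hpK).symm
    · exact h I K p hp (mem_cardSub.1 hI).1 (mem_cardSub.1 hK).1 hpI hpK

theorem sum_four_comm {α : Type*} (A B C D : Finset α) (F : α → α → α → α → ℝ) :
    ∑ a ∈ A, ∑ b ∈ B, ∑ c ∈ C, ∑ d ∈ D, F a b c d
      = ∑ c ∈ C, ∑ d ∈ D, ∑ a ∈ A, ∑ b ∈ B, F a b c d := by
  have h1 : ∀ a, ∑ b ∈ B, ∑ c ∈ C, ∑ d ∈ D, F a b c d = ∑ c ∈ C, ∑ d ∈ D, ∑ b ∈ B, F a b c d := by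
    intro a
    rw [sum_comm]
    exact sum_congr rfl fun c _ => sum_comm
  rw [sum_congr rfl fun a _ => h1 a, sum_comm]
  exact sum_congr rfl fun c _ => sum_comm

/-- The sets J, J' are outermost, so that points can be moved between I and I' while J and J' stay
fixed; the opposite order, needed for moves between J and J', is reached with `sum_four_comm`. -/
theorem jSum_mul_jSum (x y : ℕ → ℝ) (I₀ J₀ : Finset ℕ) (w₁ v₁ w₂ v₂ : ℕ → ℝ) (n m n' m' : ℤ) :
    jSum x y I₀ J₀ w₁ v₁ n m * jSum x y I₀ J₀ w₂ v₂ n' m'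
      = ∑ J ∈ cardSub J₀ m, ∑ J' ∈ cardSub J₀ m', ∑ I ∈ cardSub I₀ n, ∑ I' ∈ cardSub I₀ n',
          jTerm x y w₁ v₁ I J * jTerm x y w₂ v₂ I' J' := by
  unfold jSum
  rw [sum_comm, sum_comm (s := cardSub I₀ n'), sum_mul_sum]
  refine sum_congr rfl fun J _ => sum_congr rfl fun J' _ => ?_
  rw [sum_mul_sum]

theorem prod_shift_zero (x : ℕ → ℝ) (I : Finset ℕ) (p : ℕ) (hp : p ∈ I) :
    ∏ i ∈ I, (x i - x p) = 0 := prod_eq_zero hp (sub_self _)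

theorem prod_sub_ne_zero (x : ℕ → ℝ) (I₀ I : Finset ℕ) (hx : Set.InjOn x I₀) (hI : I ⊆ I₀) (p : ℕ)
    (hp : p ∈ I₀) (hpI : p ∉ I) : ∏ i ∈ I, (x i - x p) ≠ 0 :=
  prod_ne_zero_iff.2 fun _ hi h => hpI (hx (hI hi) hp (sub_eq_zero.1 h) ▸ hi)

/-- The exchange identity behind all bilinear relations between the sums `J`: the residues at
`xₚ` and `-y_q` cancel between three families of rational functions. -/
theorem sum_special_residues (x y : ℕ → ℝ) (I₀ J₀ : Finset ℕ) (hx : Set.InjOn x I₀)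
    (hy : Set.InjOn y J₀) (hxy : ∀ p ∈ I₀, ∀ q ∈ J₀, y q + x p ≠ 0)
    (w₁ v₁ w₂ v₂ : ℕ → ℝ) (n m n' m' : ℤ) (r₁ r₂ r₃ : ℝ → ℝ)
    (h12 : ∀ p ∈ I₀, r₁ (x p) * w₂ p = r₂ (x p) * w₁ p)
    (h23 : ∀ p ∈ J₀, r₂ (-y p) * v₂ p = r₃ (-y p) * v₁ p)
    (s₁ s₃ : Finset ℕ → Finset ℕ → ℝ) (s₂ : Finset ℕ → Finset ℕ → Finset ℕ → Finset ℕ → ℝ)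
    (h1 : ∀ I ∈ cardSub I₀ n, ∀ I' ∈ cardSub I₀ n', ∑ p ∈ I', r₁ (x p)
      * ((∏ i ∈ I, (x i - x p)) / ∏ i ∈ I'.erase p, (x i - x p)) = s₁ I I')
    (h2 : ∀ I ∈ cardSub I₀ (n + 1), ∀ I' ∈ cardSub I₀ (n' - 1), ∀ J ∈ cardSub J₀ m,
      ∀ J' ∈ cardSub J₀ m',
      ∑ p ∈ I, r₂ (x p) * ((∏ i ∈ I', (x i - x p)) * (∏ j ∈ J, (y j + x p))
          / ((∏ i ∈ I.erase p, (x i - x p)) * ∏ j ∈ J', (y j + x p)))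
      - ∑ p ∈ J', r₂ (-y p) * ((∏ i ∈ I', (x i + y p)) * (∏ j ∈ J, (y j - y p))
          / ((∏ i ∈ I, (x i + y p)) * ∏ j ∈ J'.erase p, (y j - y p))) = s₂ I I' J J')
    (h3 : ∀ J ∈ cardSub J₀ (m + 1), ∀ J' ∈ cardSub J₀ (m' - 1), - ∑ p ∈ J, r₃ (-y p)
      * ((∏ j ∈ J', (y j - y p)) / ∏ j ∈ J.erase p, (y j - y p)) = s₃ J J') :
    ∑ J ∈ cardSub J₀ m, ∑ J' ∈ cardSub J₀ m', ∑ I ∈ cardSub I₀ n, ∑ I' ∈ cardSub I₀ n',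
        jTerm x y w₁ v₁ I J * jTerm x y w₂ v₂ I' J' * s₁ I I'
      = (∑ J ∈ cardSub J₀ m, ∑ J' ∈ cardSub J₀ m', ∑ I ∈ cardSub I₀ (n + 1),
          ∑ I' ∈ cardSub I₀ (n' - 1),
          jTerm x y w₁ v₁ I J * jTerm x y w₂ v₂ I' J' * s₂ I I' J J')
        - ∑ J ∈ cardSub J₀ (m + 1), ∑ J' ∈ cardSub J₀ (m' - 1), ∑ I ∈ cardSub I₀ (n + 1),
          ∑ I' ∈ cardSub I₀ (n' - 1),
          jTerm x y w₁ v₁ I J * jTerm x y w₂ v₂ I' J' * s₃ J J' := by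
  -- `g` and `k` are the contributions of the poles x_p and -y_p of the middle function. The pole
  -- sum of the first function equals that of `g`, the pole sum of the third equals that of `k`, and
  -- `s₂` is the difference of the two.
  set g : Finset ℕ → Finset ℕ → Finset ℕ → Finset ℕ → ℕ → ℝ := fun J J' I I' p =>
    jTerm x y w₁ v₁ I J * jTerm x y w₂ v₂ I' J' *
      (r₂ (x p) * ((∏ i ∈ I', (x i - x p)) * (∏ j ∈ J, (y j + x p))
          / ((∏ i ∈ I.erase p, (x i - x p)) * ∏ j ∈ J', (y j + x p)))) with hg
  set k : Finset ℕ → Finset ℕ → Finset ℕ → Finset ℕ → ℕ → ℝ := fun J J' I I' p =>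
    jTerm x y w₁ v₁ I J * jTerm x y w₂ v₂ I' J' *
      (r₂ (-y p) * ((∏ i ∈ I', (x i + y p)) * (∏ j ∈ J, (y j - y p))
          / ((∏ i ∈ I, (x i + y p)) * ∏ j ∈ J'.erase p, (y j - y p)))) with hk
  have e1 : ∀ J ∈ cardSub J₀ m, ∀ J' ∈ cardSub J₀ m', ∑ I ∈ cardSub I₀ n, ∑ I' ∈ cardSub I₀ n',
        jTerm x y w₁ v₁ I J * jTerm x y w₂ v₂ I' J' * s₁ I I'
      = ∑ I ∈ cardSub I₀ (n + 1), ∑ I' ∈ cardSub I₀ (n' - 1), ∑ p ∈ I, g J J' I I' p := by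
    intro J hJ J' hJ'
    rw [mem_cardSub] at hJ hJ'
    -- A point p is moved from I' to I. The hypotheses of `sum_move` hold since a residue term
    -- vanishes as soon as its numerator contains the factor x_p - x_p.
    rw [← sum_move I₀ n n' (fun I I' p => jTerm x y w₁ v₁ I J * jTerm x y w₂ v₂ I' J' *
      (r₁ (x p) * ((∏ i ∈ I, (x i - x p)) / ∏ i ∈ I'.erase p, (x i - x p))))]
    · refine sum_congr rfl fun I hI => sum_congr rfl fun I' hI' => ?_
      rw [← h1 I hI I' hI', mul_sum]
    · intro I K p hp
      rw [prod_shift_zero x I p hp]; simp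
    · intro I K p hp
      simp only [hg]
      rw [prod_shift_zero x K p hp]; simp
    · intro I K p hp hI hK hpI hpK
      have a1 := prod_sub_ne_zero x I₀ I hx hI p hp hpI
      have a2 := prod_sub_ne_zero x I₀ K hx hK p hp hpK
      have a3 : ∏ j ∈ J, (y j + x p) ≠ 0 := prod_ne_zero_iff.2 fun j hj => hxy p hp j (hJ.1 hj)
      have a4 : ∏ j ∈ J', (y j + x p) ≠ 0 := prod_ne_zero_iff.2 fun j hj => hxy p hp j (hJ'.1 hj)
      simp only [hg, jTerm, erase_insert hpI, erase_insert hpK, prod_insert hpI, prod_insert hpK,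
        psiSet_insert_left _ _ _ _ _ hpI, psiSet_insert_left _ _ _ _ _ hpK]
      have := h12 p hp
      -- After cancelling, both sides are the same product of terms times ∏_I (xᵢ - x_p) ∏_{I'} (xᵢ
      -- - x_p) / ∏_{J'} (yⱼ + x_p), and the remaining scalars r₁ w₂ and r₂ w₁ agree by `h12`.
      field_simp
      linear_combination (psiSet x y I J * (∏ i ∈ I, w₁ i) * (∏ j ∈ J, v₁ j) * psiSet x y K J'
        * (∏ i ∈ K, w₂ i) * (∏ j ∈ J', v₂ j)) * this
  have e3 : ∀ I ∈ cardSub I₀ (n + 1), ∀ I' ∈ cardSub I₀ (n' - 1),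
      ∑ J ∈ cardSub J₀ m, ∑ J' ∈ cardSub J₀ m', ∑ p ∈ J', k J J' I I' p
      = - ∑ J ∈ cardSub J₀ (m + 1), ∑ J' ∈ cardSub J₀ (m' - 1),
        jTerm x y w₁ v₁ I J * jTerm x y w₂ v₂ I' J' * s₃ J J' := by
    intro I hI I' hI'
    rw [mem_cardSub] at hI hI'
    rw [sum_move J₀ m m' (fun J J' p => k J J' I I' p) (fun J J' p =>
      jTerm x y w₁ v₁ I J * jTerm x y w₂ v₂ I' J' *
      (r₃ (-y p) * ((∏ j ∈ J', (y j - y p)) / ∏ j ∈ J.erase p, (y j - y p))))]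
    · rw [← sum_neg_distrib]
      refine sum_congr rfl fun J hJ => ?_
      rw [← sum_neg_distrib]
      refine sum_congr rfl fun J' hJ' => ?_
      rw [← h3 J hJ J' hJ', mul_neg, neg_neg, mul_sum]
    · intro J K p hp
      simp only [hk]
      rw [prod_shift_zero y J p hp]; simp
    · intro J K p hp
      rw [prod_shift_zero y K p hp]; simp
    · intro J K p hp hJ hK hpJ hpK
      have a1 := prod_sub_ne_zero y J₀ J hy hJ p hp hpJ
      have a2 := prod_sub_ne_zero y J₀ K hy hK p hp hpK
      have a3 : ∏ i ∈ I, (x i + y p) ≠ 0 := prod_ne_zero_iff.2 fun i hi => by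
        rw [add_comm]; exact hxy i (hI.1 hi) p hp
      have a4 : ∏ i ∈ I', (x i + y p) ≠ 0 := prod_ne_zero_iff.2 fun i hi => by
        rw [add_comm]; exact hxy i (hI'.1 hi) p hp
      simp only [hk, jTerm, erase_insert hpJ, erase_insert hpK, prod_insert hpJ, prod_insert hpK,
        psiSet_insert_right _ _ _ _ _ hpJ, psiSet_insert_right _ _ _ _ _ hpK]
      have := h23 p hp
      field_simp
      linear_combination (psiSet x y I J * (∏ i ∈ I, w₁ i) * (∏ j ∈ J, v₁ j) * psiSet x y I' K
        * (∏ i ∈ I', w₂ i) * (∏ j ∈ K, v₂ j)) * this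
  have e2 : (∑ J ∈ cardSub J₀ m, ∑ J' ∈ cardSub J₀ m', ∑ I ∈ cardSub I₀ (n + 1),
          ∑ I' ∈ cardSub I₀ (n' - 1),
          jTerm x y w₁ v₁ I J * jTerm x y w₂ v₂ I' J' * s₂ I I' J J')
      = (∑ J ∈ cardSub J₀ m, ∑ J' ∈ cardSub J₀ m', ∑ I ∈ cardSub I₀ (n + 1),
          ∑ I' ∈ cardSub I₀ (n' - 1), ∑ p ∈ I, g J J' I I' p)
        - ∑ J ∈ cardSub J₀ m, ∑ J' ∈ cardSub J₀ m', ∑ I ∈ cardSub I₀ (n + 1),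
          ∑ I' ∈ cardSub I₀ (n' - 1), ∑ p ∈ J', k J J' I I' p := by
    simp only [← sum_sub_distrib]
    refine sum_congr rfl fun J hJ => sum_congr rfl fun J' hJ' => sum_congr rfl fun I hI =>
      sum_congr rfl fun I' hI' => ?_
    rw [← h2 I hI I' hI' J hJ J' hJ', mul_sub, mul_sum, mul_sum]
  rw [e2, sum_congr rfl fun J hJ => sum_congr rfl fun J' hJ' => e1 J hJ J' hJ', sum_four_comm
    (cardSub J₀ m) (cardSub J₀ m') _ _ (fun J J' I I' => ∑ p ∈ J', k J J' I I' p),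
    sum_congr rfl fun I hI => sum_congr rfl fun I' hI' => e3 I hI I' hI',
    sum_four_comm (cardSub J₀ (m + 1))]
  simp only [sum_neg_distrib]
  ring

end GengXue

end

/-! ### The general bilinear relation between sums J. -/

noncomputable section

namespace GengXue

open Finset Polynomial

/-- Factors that are products over the elements of the sets can be absorbed into the weights. In
this way the residue at an auxiliary pole c becomes a product of two sums J with weights multiplied
or divided by x - c and y + c. -/
theorem jSum_mul_jSum_shift (x y : ℕ → ℝ) (I₀ J₀ : Finset ℕ) (w₁ v₁ w₂ v₂ a b c d : ℕ → ℝ)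
    (n m n' m' : ℤ) :
    ∑ J ∈ cardSub J₀ m, ∑ J' ∈ cardSub J₀ m', ∑ I ∈ cardSub I₀ n, ∑ I' ∈ cardSub I₀ n',
        jTerm x y w₁ v₁ I J * jTerm x y w₂ v₂ I' J'
          * ((∏ i ∈ I, a i) * (∏ j ∈ J, b j) * (∏ i ∈ I', c i) * ∏ j ∈ J', d j)
      = jSum x y I₀ J₀ (fun i => w₁ i * a i) (fun j => v₁ j * b j) n m
        * jSum x y I₀ J₀ (fun i => w₂ i * c i) (fun j => v₂ j * d j) n' m' := by
  rw [jSum_mul_jSum]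
  refine sum_congr rfl fun J _ => sum_congr rfl fun J' _ => sum_congr rfl fun I _ =>
    sum_congr rfl fun I' _ => ?_
  simp only [jTerm, prod_mul_distrib]
  ring

theorem sum_four_mul (A B C D : Finset (Finset ℕ)) (T : Finset ℝ) (κ : ℝ → ℝ) (ε : ℝ)
    (t : Finset ℕ → Finset ℕ → Finset ℕ → Finset ℕ → ℝ)
    (e : ℝ → Finset ℕ → Finset ℕ → Finset ℕ → Finset ℕ → ℝ) :
    ∑ J ∈ A, ∑ J' ∈ B, ∑ I ∈ C, ∑ I' ∈ D, t J J' I I' * (∑ c ∈ T, κ c * e c J J' I I' + ε)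
      = ∑ c ∈ T, κ c * (∑ J ∈ A, ∑ J' ∈ B, ∑ I ∈ C, ∑ I' ∈ D, t J J' I I' * e c J J' I I')
        + ε * ∑ J ∈ A, ∑ J' ∈ B, ∑ I ∈ C, ∑ I' ∈ D, t J J' I I' := by
  simp only [mul_add, mul_sum, sum_add_distrib]
  congr 1
  · rw [sum_comm (s := T) (t := A)]
    refine sum_congr rfl fun J _ => ?_
    rw [sum_comm (s := T) (t := B)]
    refine sum_congr rfl fun J' _ => ?_
    rw [sum_comm (s := T) (t := C)]
    refine sum_congr rfl fun I _ => ?_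
    rw [sum_comm (s := T) (t := D)]
    refine sum_congr rfl fun I' _ => sum_congr rfl fun c _ => ?_
    ring
  · refine sum_congr rfl fun J _ => sum_congr rfl fun J' _ => sum_congr rfl fun I _ =>
      sum_congr rfl fun I' _ => mul_comm _ _

/-- The general bilinear relation between sums `J`; the `Tₖ` are the finite poles. -/
theorem jSum_bilinear (x y : ℕ → ℝ) (I₀ J₀ : Finset ℕ) (hx : Set.InjOn x I₀)
    (hy : Set.InjOn y J₀) (hx0 : ∀ p ∈ I₀, 0 < x p) (hy0 : ∀ p ∈ J₀, 0 < y p)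
    (w₁ v₁ w₂ v₂ : ℕ → ℝ) (n m n' m' : ℤ) (T₁ T₂ T₃ : Finset ℝ) (q₁ q₂ q₃ : ℝ[X])
    (hq₁ : q₁.Monic) (hq₂ : q₂.Monic) (hq₃ : q₃.Monic)
    (hT₁ : ∀ c ∈ T₁, ∀ p ∈ I₀, x p ≠ c) (hT₂ : ∀ c ∈ T₂, ∀ p ∈ I₀, x p ≠ c)
    (hT₂' : ∀ c ∈ T₂, ∀ p ∈ J₀, -y p ≠ c) (hT₃ : ∀ c ∈ T₃, ∀ p ∈ J₀, -y p ≠ c) (κ : ℝ)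
    (h12 : ∀ p ∈ I₀, q₁.eval (x p) / (∏ c ∈ T₁, (x p - c)) * w₂ p
      = q₂.eval (x p) / (∏ c ∈ T₂, (x p - c)) * w₁ p)
    (h23 : ∀ p ∈ J₀, q₂.eval (-y p) / (∏ c ∈ T₂, (-y p - c)) * v₂ p
      = κ * (q₃.eval (-y p) / (∏ c ∈ T₃, (-y p - c))) * v₁ p)
    (d1 : n + q₁.natDegree + 1 ≤ n' + T₁.card)
    (d2 : n' + m + q₂.natDegree ≤ n + 1 + m' + T₂.card)
    (d3 : m' + q₃.natDegree ≤ m + 1 + T₃.card) :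
    ∑ c ∈ T₁, q₁.eval c / (∏ d ∈ T₁.erase c, (c - d))
        * (jSum x y I₀ J₀ (fun i => w₁ i * (x i - c)) v₁ n m
          * jSum x y I₀ J₀ (fun i => w₂ i / (x i - c)) v₂ n' m')
      + (if n + q₁.natDegree + 1 = n' + T₁.card then (-1 : ℝ) ^ (n + n' + 1) else 0)
        * (jSum x y I₀ J₀ w₁ v₁ n m * jSum x y I₀ J₀ w₂ v₂ n' m')
      = ∑ c ∈ T₂, q₂.eval c / (∏ d ∈ T₂.erase c, (c - d))
        * (jSum x y I₀ J₀ (fun i => w₁ i / (x i - c)) (fun j => v₁ j * (y j + c)) (n + 1) m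
          * jSum x y I₀ J₀ (fun i => w₂ i * (x i - c)) (fun j => v₂ j / (y j + c)) (n' - 1) m')
      + (if n' + m + q₂.natDegree = n + 1 + m' + T₂.card then (-1 : ℝ) ^ (n + n' + 1) else 0)
        * (jSum x y I₀ J₀ w₁ v₁ (n + 1) m * jSum x y I₀ J₀ w₂ v₂ (n' - 1) m')
      - κ * (∑ c ∈ T₃, q₃.eval c / (∏ d ∈ T₃.erase c, (c - d))
        * (jSum x y I₀ J₀ w₁ (fun j => v₁ j / (y j + c)) (n + 1) (m + 1)
          * jSum x y I₀ J₀ w₂ (fun j => v₂ j * (y j + c)) (n' - 1) (m' - 1))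
      + (if m' + q₃.natDegree = m + 1 + T₃.card then -1 else 0)
        * (jSum x y I₀ J₀ w₁ v₁ (n + 1) (m + 1) * jSum x y I₀ J₀ w₂ v₂ (n' - 1) (m' - 1))) := by
  have hxy : ∀ p ∈ I₀, ∀ q ∈ J₀, y q + x p ≠ 0 := fun p hp q hq =>
    (add_pos (hy0 q hq) (hx0 p hp)).ne'
  -- The three functions are qₖ / ∏_{c ∈ Tₖ} (z - c); `κ` carries the scalar that cannot be put into
  -- the monic q₃. The sums s₁, s₂, s₃ collect what the residue theorem leaves: residues at the
  -- finite poles Tₖ, and one at infinity exactly when the degree bound is an equality.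
  have key := sum_special_residues x y I₀ J₀ hx hy hxy w₁ v₁ w₂ v₂ n m n' m'
    (fun z => q₁.eval z / ∏ c ∈ T₁, (z - c)) (fun z => q₂.eval z / ∏ c ∈ T₂, (z - c))
    (fun z => κ * (q₃.eval z / ∏ c ∈ T₃, (z - c))) h12 h23
    (fun I I' => ∑ c ∈ T₁, q₁.eval c / (∏ d ∈ T₁.erase c, (c - d))
          * ((∏ i ∈ I, (x i - c)) / (∏ i ∈ I', (x i - c)))
        + (if n + q₁.natDegree + 1 = n' + T₁.card then (-1 : ℝ) ^ (n + n' + 1) else 0))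
    (fun J J' => κ * (∑ c ∈ T₃, q₃.eval c / (∏ d ∈ T₃.erase c, (c - d))
          * ((∏ j ∈ J', (y j + c)) / (∏ j ∈ J, (y j + c)))
        + (if m' + q₃.natDegree = m + 1 + T₃.card then -1 else 0)))
    (fun I I' J J' => ∑ c ∈ T₂, q₂.eval c / (∏ d ∈ T₂.erase c, (c - d))
          * ((∏ i ∈ I', (x i - c)) * (∏ j ∈ J, (y j + c))
            / ((∏ i ∈ I, (x i - c)) * ∏ j ∈ J', (y j + c)))
        + (if n' + m + q₂.natDegree = n + 1 + m' + T₂.card then (-1 : ℝ) ^ (n + n' + 1) else 0))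
    ?_ ?_ ?_
  · have a1 := jSum_mul_jSum_shift x y I₀ J₀ w₁ v₁ w₂ v₂
    have s1 := sum_four_mul (cardSub J₀ m) (cardSub J₀ m') (cardSub I₀ n) (cardSub I₀ n') T₁
      (fun c => q₁.eval c / (∏ d ∈ T₁.erase c, (c - d)))
      (if n + q₁.natDegree + 1 = n' + T₁.card then (-1 : ℝ) ^ (n + n' + 1) else 0)
      (fun J J' I I' => jTerm x y w₁ v₁ I J * jTerm x y w₂ v₂ I' J')
      (fun c J J' I I' => (∏ i ∈ I, (x i - c)) / (∏ i ∈ I', (x i - c)))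
    have s2 := sum_four_mul (cardSub J₀ m) (cardSub J₀ m') (cardSub I₀ (n + 1))
      (cardSub I₀ (n' - 1)) T₂ (fun c => q₂.eval c / (∏ d ∈ T₂.erase c, (c - d)))
      (if n' + m + q₂.natDegree = n + 1 + m' + T₂.card then (-1 : ℝ) ^ (n + n' + 1) else 0)
      (fun J J' I I' => jTerm x y w₁ v₁ I J * jTerm x y w₂ v₂ I' J')
      (fun c J J' I I' => ((∏ i ∈ I', (x i - c)) * (∏ j ∈ J, (y j + c))
            / ((∏ i ∈ I, (x i - c)) * ∏ j ∈ J', (y j + c))))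
    have s3 := sum_four_mul (cardSub J₀ (m + 1)) (cardSub J₀ (m' - 1)) (cardSub I₀ (n + 1))
      (cardSub I₀ (n' - 1)) T₃ (fun c => q₃.eval c / (∏ d ∈ T₃.erase c, (c - d)))
      (if m' + q₃.natDegree = m + 1 + T₃.card then -1 else 0)
      (fun J J' I I' => jTerm x y w₁ v₁ I J * jTerm x y w₂ v₂ I' J')
      (fun c J J' I I' => ((∏ j ∈ J', (y j + c)) / (∏ j ∈ J, (y j + c))))
    simp only [← jSum_mul_jSum] at s1 s2 s3
    have s3' : (∑ J ∈ cardSub J₀ (m + 1), ∑ J' ∈ cardSub J₀ (m' - 1), ∑ I ∈ cardSub I₀ (n + 1),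
          ∑ I' ∈ cardSub I₀ (n' - 1),
          jTerm x y w₁ v₁ I J * jTerm x y w₂ v₂ I' J' *
            (κ * (∑ c ∈ T₃, q₃.eval c / (∏ d ∈ T₃.erase c, (c - d))
          * ((∏ j ∈ J', (y j + c)) / (∏ j ∈ J, (y j + c)))
        + (if m' + q₃.natDegree = m + 1 + T₃.card then -1 else 0))))
        = κ * (∑ J ∈ cardSub J₀ (m + 1), ∑ J' ∈ cardSub J₀ (m' - 1), ∑ I ∈ cardSub I₀ (n + 1),
          ∑ I' ∈ cardSub I₀ (n' - 1),
          jTerm x y w₁ v₁ I J * jTerm x y w₂ v₂ I' J' *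
            (∑ c ∈ T₃, q₃.eval c / (∏ d ∈ T₃.erase c, (c - d))
          * ((∏ j ∈ J', (y j + c)) / (∏ j ∈ J, (y j + c)))
        + (if m' + q₃.natDegree = m + 1 + T₃.card then -1 else 0))) := by
      rw [mul_sum]
      refine sum_congr rfl fun J _ => ?_
      rw [mul_sum]
      refine sum_congr rfl fun J' _ => ?_
      rw [mul_sum]
      refine sum_congr rfl fun I _ => ?_
      rw [mul_sum]
      exact sum_congr rfl fun I' _ => by ring
    rw [s1, s2, s3', s3] at key
    -- Only c remains as a parameter of the residue, so the fourfold sum factors.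
    have t1 : ∀ c, (∑ J ∈ cardSub J₀ m, ∑ J' ∈ cardSub J₀ m', ∑ I ∈ cardSub I₀ n,
        ∑ I' ∈ cardSub I₀ n', jTerm x y w₁ v₁ I J * jTerm x y w₂ v₂ I' J'
          * ((∏ i ∈ I, (x i - c)) / (∏ i ∈ I', (x i - c))))
        = jSum x y I₀ J₀ (fun i => w₁ i * (x i - c)) v₁ n m
          * jSum x y I₀ J₀ (fun i => w₂ i / (x i - c)) v₂ n' m' := by
      intro c
      have := a1 (fun i => x i - c) (fun _ => 1) (fun i => (x i - c)⁻¹) (fun _ => 1) n m n' m'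
      simpa only [prod_const_one, mul_one, prod_inv_distrib, ← div_eq_mul_inv] using this
    have t2 : ∀ c, (∑ J ∈ cardSub J₀ m, ∑ J' ∈ cardSub J₀ m', ∑ I ∈ cardSub I₀ (n + 1),
        ∑ I' ∈ cardSub I₀ (n' - 1), jTerm x y w₁ v₁ I J * jTerm x y w₂ v₂ I' J'
          * ((∏ i ∈ I', (x i - c)) * (∏ j ∈ J, (y j + c))
            / ((∏ i ∈ I, (x i - c)) * ∏ j ∈ J', (y j + c))))
        = jSum x y I₀ J₀ (fun i => w₁ i / (x i - c)) (fun j => v₁ j * (y j + c)) (n + 1) m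
          * jSum x y I₀ J₀ (fun i => w₂ i * (x i - c)) (fun j => v₂ j / (y j + c)) (n' - 1) m' := by
      intro c
      have := a1 (fun i => (x i - c)⁻¹) (fun j => y j + c) (fun i => x i - c)
        (fun j => (y j + c)⁻¹) (n + 1) m (n' - 1) m'
      simp only [prod_inv_distrib, ← div_eq_mul_inv] at this
      rw [← this]
      refine sum_congr rfl fun J _ => sum_congr rfl fun J' _ => sum_congr rfl fun I _ =>
        sum_congr rfl fun I' _ => ?_
      rw [div_eq_mul_inv, div_eq_mul_inv, mul_inv]
      ring
    have t3 : ∀ c, (∑ J ∈ cardSub J₀ (m + 1), ∑ J' ∈ cardSub J₀ (m' - 1),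
        ∑ I ∈ cardSub I₀ (n + 1), ∑ I' ∈ cardSub I₀ (n' - 1),
        jTerm x y w₁ v₁ I J * jTerm x y w₂ v₂ I' J'
          * ((∏ j ∈ J', (y j + c)) / (∏ j ∈ J, (y j + c))))
        = jSum x y I₀ J₀ w₁ (fun j => v₁ j / (y j + c)) (n + 1) (m + 1)
          * jSum x y I₀ J₀ w₂ (fun j => v₂ j * (y j + c)) (n' - 1) (m' - 1) := by
      intro c
      have := a1 (fun _ => 1) (fun j => (y j + c)⁻¹) (fun _ => 1) (fun j => y j + c)
        (n + 1) (m + 1) (n' - 1) (m' - 1)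
      simp only [prod_const_one, mul_one, prod_inv_distrib, ← div_eq_mul_inv] at this
      rw [← this]
      refine sum_congr rfl fun J _ => sum_congr rfl fun J' _ => sum_congr rfl fun I _ =>
        sum_congr rfl fun I' _ => ?_
      ring
    simp only [t1, t2, t3] at key
    exact key
  · intro I hI I' hI'
    rw [mem_cardSub] at hI hI'
    have := sum_residues_two x y I I' ∅ ∅ (hx.mono hI'.1) (hy.mono (by simp)) (by simp) T₁
      (fun c hc i hi => hT₁ c hc i (hI'.1 hi)) (by simp) q₁ hq₁ (by
        simp only [card_empty]; omega)
    simp only [prod_empty, mul_one, sum_empty, sub_zero, card_empty, add_zero] at this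
    rw [this]
    congr 1
    have h : (I.card + q₁.natDegree + 1 = I'.card + T₁.card)
      ↔ (n + q₁.natDegree + 1 = n' + T₁.card) := by omega
    have h' : n + n' + 1 = ((I.card + I'.card + 1 : ℕ) : ℤ) := by push_cast; omega
    simp only [h, h', zpow_natCast]
  · intro I hI I' hI' J hJ J' hJ'
    rw [mem_cardSub] at hI hI' hJ hJ'
    have := sum_residues_two x y I' I J J' (hx.mono hI.1) (hy.mono hJ'.1)
      (fun p hp q hq => by rw [add_comm]; exact hxy p (hI.1 hp) q (hJ'.1 hq)) T₂
      (fun c hc i hi => hT₂ c hc i (hI.1 hi)) (fun c hc i hi => hT₂' c hc i (hJ'.1 hi)) q₂ hq₂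
      (by omega)
    rw [this]
    have h : (I'.card + J.card + q₂.natDegree + 1 = I.card + J'.card + T₂.card)
      ↔ (n' + m + q₂.natDegree = n + 1 + m' + T₂.card) := by omega
    have h' : n + n' + 1 = ((I'.card + I.card + 1 : ℕ) : ℤ) := by push_cast; omega
    simp only [h, h', zpow_natCast]
  · intro J hJ J' hJ'
    rw [mem_cardSub] at hJ hJ'
    have := sum_residues_two x y ∅ ∅ J' J (hx.mono (by simp)) (hy.mono hJ.1) (by simp) T₃
      (by simp) (fun c hc i hi => hT₃ c hc i (hJ.1 hi)) q₃ hq₃ (by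
        simp only [card_empty]; omega)
    simp only [prod_empty, one_mul, sum_empty, zero_sub, card_empty, zero_add] at this
    simp only [mul_assoc κ, ← mul_sum, ← mul_neg]
    rw [this]
    congr 2
    have h : (J'.card + q₃.natDegree + 1 = J.card + T₃.card)
      ↔ (m' + q₃.natDegree = m + 1 + T₃.card) := by omega
    simp only [h]
    norm_num

end GengXue

end

/-! ### Wronskian identities for the sums inside a group. -/

noncomputable section

namespace GengXue

open Finset Polynomial

/-- Two finite families of points. -/
structure PointData where
  x : ℕ → ℝ
  y : ℕ → ℝ
  I : Finset ℕ
  J : Finset ℕ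

namespace PointData

/-- The families consist of distinct positive numbers. -/
structure Valid (D : PointData) : Prop where
  injx : Set.InjOn D.x D.I
  injy : Set.InjOn D.y D.J
  posx : ∀ p ∈ D.I, 0 < D.x p
  posy : ∀ p ∈ D.J, 0 < D.y p

/-- Exchange of the two families. -/
def swap (D : PointData) : PointData := ⟨D.y, D.x, D.J, D.I⟩

theorem Valid.swap {D : PointData} (h : D.Valid) : D.swap.Valid :=
  ⟨h.injy, h.injx, h.posy, h.posx⟩

/-- The sums `J` with weights `f(x) w` and `g(y) v`. -/
def jW (D : PointData) (w v : ℕ → ℝ) (f g : ℝ → ℝ) (n m : ℤ) : ℝ :=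
  jSum D.x D.y D.I D.J (fun i => f (D.x i) * w i) (fun j => g (D.y j) * v j) n m

theorem jW_swap (D : PointData) (w v : ℕ → ℝ) (f g : ℝ → ℝ) (n m : ℤ) :
    D.swap.jW v w g f m n = D.jW w v f g n m :=
  (jSum_swap _ _ _ _ _ _ _ _).symm

theorem jSum_eq_jW (D : PointData) {w v w' v' : ℕ → ℝ} (f g : ℝ → ℝ) (n m : ℤ)
    (hw : ∀ i ∈ D.I, w' i = f (D.x i) * w i) (hv : ∀ j ∈ D.J, v' j = g (D.y j) * v j) :
    jSum D.x D.y D.I D.J w' v' n m = D.jW w v f g n m :=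
  jSum_congr _ _ _ _ hw hv

/-- The bilinear relation behind the telescoping of the sums of the `Q X`. -/
theorem jW_bilinear_inv (D : PointData) (h : D.Valid) (w v : ℕ → ℝ) (n m n' m' : ℤ)
    (d1 : n < n') (d2 : n' + m ≤ n + m' + 2) (d3 : m' ≤ m + 1) :
    D.jW w v id 1 n m * D.jW w v Inv.inv id n' m'
      = D.jW w v Inv.inv id (n + 1) m * D.jW w v id 1 (n' - 1) m'
        + (if n' + m = n + m' + 2 then (-1 : ℝ) ^ (n + n' + 1) else 0)
          * (D.jW w v 1 1 (n + 1) m * D.jW w v 1 id (n' - 1) m')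
        - (if m' = m + 1 then 1 else 0)
          * (D.jW w v 1 1 (n + 1) (m + 1) * D.jW w v 1 id (n' - 1) (m' - 1)) := by
  have hx0 : ∀ p ∈ D.I, D.x p ≠ 0 := fun p hp => (h.posx p hp).ne'
  have hy0 : ∀ p ∈ D.J, D.y p ≠ 0 := fun p hp => (h.posy p hp).ne'
  -- The choice is r₁ = r₂ = 1/z and r₃ = -1: the first two have their auxiliary pole at 0, the
  -- third has none. The extra weight y in the second factor compensates 1/(-y) = κ/y with κ = -1.
  have key := jSum_bilinear D.x D.y D.I D.J h.injx h.injy h.posx h.posy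
    w v w (fun j => D.y j * v j) n m n' m' {0} {0} ∅ 1 1 1
    monic_one monic_one monic_one (by simpa using hx0) (by simpa using hx0)
    (by simpa using hy0) (by simp) (-1) (by simp)
    (by intro p hp; have := hy0 p hp; simp; field_simp) (by simp; omega)
    (by simp; omega) (by simp; omega)
  -- The strict inequality `d1` removes the residue at infinity of the first function.
  rw [if_neg (by simp; omega)] at key
  simp only [card_singleton, card_empty, natDegree_one, Nat.cast_zero, Nat.cast_one, add_zero,
    sum_singleton, sum_empty, eval_one, erase_singleton, prod_empty, div_one, sub_zero, one_mul,
    zero_mul, zero_add] at key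
  rw [jSum_eq_jW D (w := w) (v := v) id 1 n m (w' := fun i => w i * D.x i) (v' := v)
      (by intros; simp; ring) (by simp),
    jSum_eq_jW D (w := w) (v := v) Inv.inv id n' m' (w' := fun i => w i / D.x i)
      (v' := fun j => D.y j * v j) (by intros; field_simp) (by simp),
    jSum_eq_jW D (w := w) (v := v) Inv.inv id (n + 1) m (w' := fun i => w i / D.x i)
      (v' := fun j => v j * D.y j) (by intros; field_simp) (by intros; simp; ring),
    jSum_eq_jW D (w := w) (v := v) id 1 (n' - 1) m' (w' := fun i => w i * D.x i)
      (v' := fun j => D.y j * v j / D.y j) (by intros; simp; ring)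
      (by intro j hj; have := hy0 j hj; simp; field_simp),
    jSum_eq_jW D (w := w) (v := v) 1 1 (n + 1) m (w' := w) (v' := v) (by simp) (by simp),
    jSum_eq_jW D (w := w) (v := v) 1 1 (n + 1) (m + 1) (w' := w) (v' := v) (by simp) (by simp),
    jSum_eq_jW D (w := w) (v := v) 1 id (n' - 1) m' (w' := w) (v' := fun j => D.y j * v j)
      (by simp) (by simp),
    jSum_eq_jW D (w := w) (v := v) 1 id (n' - 1) (m' - 1) (w' := w) (v' := fun j => D.y j * v j)
      (by simp) (by simp), show n + 1 + m' + 1 = n + m' + 2 by ring] at key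
  rw [key]
  split_ifs <;> ring

/-- The bilinear relation behind the telescoping of the sums of the `Q`. -/
theorem jW_bilinear_sq (D : PointData) (h : D.Valid) (w v : ℕ → ℝ) (n m n' m' : ℤ)
    (d1 : n + 1 ≤ n') (d2 : n' + m ≤ n + m' + 2) (d3 : m' < m + 2) :
    (if n + 1 = n' then (-1 : ℝ) ^ (n + n' + 1) else 0)
        * (D.jW w v id id n m * D.jW w v 1 id n' m')
      = D.jW w v 1 (fun z => z ^ 2) (n + 1) m * D.jW w v id 1 (n' - 1) m'
        + (if n' + m = n + m' + 2 then (-1 : ℝ) ^ (n + n' + 1) else 0)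
          * (D.jW w v id id (n + 1) m * D.jW w v 1 id (n' - 1) m')
        - D.jW w v id 1 (n + 1) (m + 1) * D.jW w v 1 (fun z => z ^ 2) (n' - 1) (m' - 1) := by
  have hx0 : ∀ p ∈ D.I, D.x p ≠ 0 := fun p hp => (h.posx p hp).ne'
  have hy0 : ∀ p ∈ D.J, D.y p ≠ 0 := fun p hp => (h.posy p hp).ne'
  -- Here r₁ = 1 and r₂ = r₃ = 1/z; the weights x w in the first factor against w in the second
  -- balance 1 against 1/x. The third function has no residue at infinity by `d3`.
  have key := jSum_bilinear D.x D.y D.I D.J h.injx h.injy h.posx h.posy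
    (fun i => D.x i * w i) (fun j => D.y j * v j) w (fun j => D.y j * v j) n m n' m' ∅ {0} {0}
    1 1 1 monic_one monic_one monic_one (by simp) (by simpa using hx0)
    (by simpa using hy0) (by simpa using hy0) 1
    (by intro p hp; have := hx0 p hp; simp; field_simp)
    (by intro p hp; have := hy0 p hp; simp) (by simp; omega)
    (by simp; omega) (by simp; omega)
  rw [if_neg (c := m' + _ = _) (by simp; omega)] at key
  simp only [card_singleton, card_empty, natDegree_one, Nat.cast_zero, Nat.cast_one, add_zero,
    sum_singleton, sum_empty, eval_one, erase_singleton, prod_empty, div_one, sub_zero, one_mul,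
    zero_mul, zero_add] at key
  rw [jSum_eq_jW D (w := w) (v := v) id id n m (w' := fun i => D.x i * w i)
      (v' := fun j => D.y j * v j) (by simp) (by simp),
    jSum_eq_jW D (w := w) (v := v) 1 id n' m' (w' := w)
      (v' := fun j => D.y j * v j) (by simp) (by simp),
    jSum_eq_jW D (w := w) (v := v) 1 (fun z => z ^ 2) (n + 1) m (w' := fun i => D.x i * w i / D.x i)
      (v' := fun j => D.y j * v j * D.y j) (by intro j hj; have := hx0 j hj; simp; field_simp)
      (by intros; ring),
    jSum_eq_jW D (w := w) (v := v) id 1 (n' - 1) m' (w' := fun i => w i * D.x i)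
      (v' := fun j => D.y j * v j / D.y j) (by intros; simp; ring)
      (by intro j hj; have := hy0 j hj; simp; field_simp),
    jSum_eq_jW D (w := w) (v := v) id id (n + 1) m (w' := fun i => D.x i * w i)
      (v' := fun j => D.y j * v j) (by simp) (by simp),
    jSum_eq_jW D (w := w) (v := v) 1 id (n' - 1) m' (w' := w) (v' := fun j => D.y j * v j)
      (by simp) (by simp),
    jSum_eq_jW D (w := w) (v := v) id 1 (n + 1) (m + 1) (w' := fun i => D.x i * w i)
      (v' := fun j => D.y j * v j / D.y j) (by simp)
      (by intro j hj; have := hy0 j hj; simp; field_simp),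
    jSum_eq_jW D (w := w) (v := v) 1 (fun z => z ^ 2) (n' - 1) (m' - 1) (w' := w)
      (v' := fun j => D.y j * v j * D.y j) (by simp) (by intros; ring),
    show n + 1 + m' + 1 = n + m' + 2 by ring] at key
  rw [key]

section Telescoping

/-- The numbers one, two, three refer to the three denominators of a group, the sums with weights (x
w, v) and indices (n, m), (n, m-1), (n-1, m-1), each with its companion numerator. All three
Wronskians contain the factor `jW 1 id n (m-1)`; this is why differences of the partial sums factor.
In each case at most one residue at infinity survives, and the index inequalities decide which. -/
theorem wronskian_one_three (D : PointData) (h : D.Valid) (w v : ℕ → ℝ) (n m : ℤ) :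
    D.jW w v Inv.inv id n (m - 1) * D.jW w v id 1 n m
        - D.jW w v Inv.inv id (n + 1) m * D.jW w v id 1 (n - 1) (m - 1)
      = D.jW w v 1 id n (m - 1) * D.jW w v 1 1 n m := by
  have key := D.jW_bilinear_inv h w v (n - 1) (m - 1) (n + 1) m (by omega) (by omega) (by omega)
  rw [if_neg (by omega), if_pos (by omega)] at key
  simp only [sub_add_cancel, add_sub_cancel_right] at key
  linarith

theorem wronskian_one_two (D : PointData) (h : D.Valid) (w v : ℕ → ℝ) (n m : ℤ) :
    D.jW w v Inv.inv id (n + 1) (m - 1) * D.jW w v id 1 n m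
        - D.jW w v Inv.inv id (n + 1) m * D.jW w v id 1 n (m - 1)
      = D.jW w v 1 id n (m - 1) * D.jW w v 1 1 (n + 1) m := by
  have key := D.jW_bilinear_inv h w v n m (n + 1) (m - 1) (by omega) (by omega) (by omega)
  rw [if_pos (by omega), if_neg (by omega), Even.neg_one_zpow ⟨n + 1, by ring⟩] at key
  simp only [add_sub_cancel_right] at key
  linarith

theorem wronskian_two_three (D : PointData) (h : D.Valid) (w v : ℕ → ℝ) (n m : ℤ) :
    D.jW w v Inv.inv id n (m - 1) * D.jW w v id 1 n (m - 1)
        - D.jW w v Inv.inv id (n + 1) (m - 1) * D.jW w v id 1 (n - 1) (m - 1)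
      = D.jW w v 1 id n (m - 1) * D.jW w v 1 1 n (m - 1) := by
  have key := D.jW_bilinear_inv h w v (n - 1) (m - 1) (n + 1) (m - 1) (by omega) (by omega)
    (by omega)
  rw [if_pos (by omega), if_neg (by omega), Odd.neg_one_zpow ⟨n, by ring⟩] at key
  simp only [sub_add_cancel, add_sub_cancel_right] at key
  linarith

/-- The same three denominators, paired now with the numerators of the sums of Q on the right. The
common factor is again `jW 1 id n (m-1)`. -/
theorem wronskian_sq_one_three (D : PointData) (h : D.Valid) (w v : ℕ → ℝ) (n m : ℤ) :
    D.jW w v 1 (fun z => z ^ 2) n (m - 1) * D.jW w v id 1 (n - 1) (m - 1)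
        - D.jW w v 1 (fun z => z ^ 2) (n - 1) (m - 2) * D.jW w v id 1 n m
      = D.jW w v 1 id n (m - 1) * D.jW w v id id (n - 1) (m - 1) := by
  have key := D.jW_bilinear_sq h w v (n - 1) (m - 1) n (m - 1) (by omega) (by omega) (by omega)
  rw [if_pos (by omega), if_neg (by omega), Even.neg_one_zpow ⟨n, by ring⟩,
    show m - 1 - 1 = m - 2 by ring] at key
  simp only [sub_add_cancel] at key
  linarith

theorem wronskian_sq_one_two (D : PointData) (h : D.Valid) (w v : ℕ → ℝ) (n m : ℤ) :
    D.jW w v 1 (fun z => z ^ 2) n (m - 1) * D.jW w v id 1 n (m - 1)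
        - D.jW w v 1 (fun z => z ^ 2) n (m - 2) * D.jW w v id 1 n m
      = D.jW w v 1 id n (m - 1) * D.jW w v id id n (m - 1) := by
  have key := D.jW_bilinear_sq h w v (n - 1) (m - 1) (n + 1) (m - 1) (by omega) (by omega)
    (by omega)
  rw [if_neg (by omega), if_pos (by omega), Odd.neg_one_zpow ⟨n, by ring⟩,
    show m - 1 - 1 = m - 2 by ring] at key
  simp only [sub_add_cancel, add_sub_cancel_right] at key
  linarith

theorem wronskian_sq_two_three (D : PointData) (h : D.Valid) (w v : ℕ → ℝ) (n m : ℤ) :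
    D.jW w v 1 (fun z => z ^ 2) n (m - 2) * D.jW w v id 1 (n - 1) (m - 1)
        - D.jW w v 1 (fun z => z ^ 2) (n - 1) (m - 2) * D.jW w v id 1 n (m - 1)
      = D.jW w v 1 id n (m - 1) * D.jW w v id id (n - 1) (m - 2) := by
  have key := D.jW_bilinear_sq h w v (n - 1) (m - 2) n (m - 1) (by omega) (by omega) (by omega)
  rw [if_pos (by omega), if_neg (by omega), Even.neg_one_zpow ⟨n, by ring⟩,
    show m - 1 - 1 = m - 2 by ring, show m - 2 + 1 = m - 1 by ring] at key
  simp only [sub_add_cancel] at key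
  linarith

end Telescoping

end PointData

end GengXue

end

/-! ### The bilinear relation with a double pole, which produces derivatives. -/

noncomputable section

namespace GengXue

open Finset Polynomial

theorem continuous_jSum (x y : ℕ → ℝ) (I J : Finset ℕ) (w v : ℝ → ℕ → ℝ) (n m : ℤ)
    (hw : ∀ i, Continuous fun c => w c i) (hv : ∀ j, Continuous fun c => v c j) :
    Continuous fun c => jSum x y I J (w c) (v c) n m := by
  unfold jSum jTerm
  fun_prop

/-- The sum `J` with the summands multiplied by `∑ αᵢ + ∑ βⱼ`. -/
def jDer (x y : ℕ → ℝ) (I₀ J₀ : Finset ℕ) (w v α β : ℕ → ℝ) (n m : ℤ) : ℝ :=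
  ∑ I ∈ cardSub I₀ n, ∑ J ∈ cardSub J₀ m, jTerm x y w v I J * (∑ i ∈ I, α i + ∑ j ∈ J, β j)

theorem hasDerivAt_prod_one_add (I : Finset ℕ) (α : ℕ → ℝ) :
    HasDerivAt (fun c : ℝ => ∏ i ∈ I, (1 + c * α i)) (∑ i ∈ I, α i) 0 := by
  have := HasDerivAt.fun_finsetProd (u := I) (f := fun i (c : ℝ) => 1 + c * α i) (f' := α)
    (x := (0 : ℝ)) fun i _ => by simpa using ((hasDerivAt_id (0 : ℝ)).mul_const (α i)).const_add 1
  simpa using this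

/-- Perturbing the weights by factors 1 + cα and 1 + cβ multiplies each summand by a product whose
derivative at c = 0 is ∑ α + ∑ β. With α = 1/x and β = 1/y this is also the time derivative of the
summand. -/
theorem hasDerivAt_jSum_one_add (x y : ℕ → ℝ) (I₀ J₀ : Finset ℕ) (w v α β : ℕ → ℝ) (n m : ℤ) :
    HasDerivAt (fun c : ℝ => jSum x y I₀ J₀ (fun i => w i * (1 + c * α i))
      (fun j => v j * (1 + c * β j)) n m) (jDer x y I₀ J₀ w v α β n m) 0 := by
  unfold jSum jDer
  refine HasDerivAt.fun_sum fun I _ => HasDerivAt.fun_sum fun J _ => ?_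
  have h1 := ((hasDerivAt_prod_one_add I α).mul (hasDerivAt_prod_one_add J β)).const_mul
    (jTerm x y w v I J)
  have e : (fun c : ℝ => jTerm x y (fun i => w i * (1 + c * α i)) (fun j => v j * (1 + c * β j)) I J)
      = fun c => jTerm x y w v I J
        * ((∏ i ∈ I, (1 + c * α i)) * ∏ j ∈ J, (1 + c * β j)) := by
    funext c
    simp only [jTerm, prod_mul_distrib]
    ring
  rw [e]
  exact h1.congr_deriv (by simp)

theorem jDer_add (x y : ℕ → ℝ) (I₀ J₀ : Finset ℕ) (w v α β : ℕ → ℝ) (n m : ℤ) :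
    jDer x y I₀ J₀ w v α β n m
      = jDer x y I₀ J₀ w v α 0 n m + jDer x y I₀ J₀ w v 0 β n m := by
  unfold jDer
  simp only [← sum_add_distrib]
  refine sum_congr rfl fun I _ => sum_congr rfl fun J _ => ?_
  simp; ring

theorem jDer_neg (x y : ℕ → ℝ) (I₀ J₀ : Finset ℕ) (w v α : ℕ → ℝ) (n m : ℤ) :
    jDer x y I₀ J₀ w v (fun i => -α i) 0 n m = -jDer x y I₀ J₀ w v α 0 n m := by
  unfold jDer
  simp

/-- The bilinear relation with a double pole at zero. -/
theorem jSum_hirota (x y : ℕ → ℝ) (I₀ J₀ : Finset ℕ) (hx : Set.InjOn x I₀)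
    (hy : Set.InjOn y J₀) (hx0 : ∀ p ∈ I₀, 0 < x p) (hy0 : ∀ p ∈ J₀, 0 < y p)
    (w₁ v₁ w₂ v₂ : ℕ → ℝ) (n m n' m' : ℤ) (T₁ T₃ : Finset ℝ) (q₁ q₃ : ℝ[X])
    (hq₁ : q₁.Monic) (hq₃ : q₃.Monic)
    (hT₁ : ∀ c ∈ T₁, ∀ p ∈ I₀, x p ≠ c) (hT₃ : ∀ c ∈ T₃, ∀ p ∈ J₀, -y p ≠ c) (κ : ℝ)
    (h12 : ∀ p ∈ I₀, q₁.eval (x p) / (∏ c ∈ T₁, (x p - c)) * w₂ p = 1 / x p ^ 2 * w₁ p)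
    (h23 : ∀ p ∈ J₀, 1 / y p ^ 2 * v₂ p
      = κ * (q₃.eval (-y p) / (∏ c ∈ T₃, (-y p - c))) * v₁ p)
    (d1 : n + q₁.natDegree + 1 ≤ n' + T₁.card)
    (d2 : n' + m ≤ n + m' + 3)
    (d3 : m' + q₃.natDegree ≤ m + 1 + T₃.card) :
    ∑ c ∈ T₁, q₁.eval c / (∏ d ∈ T₁.erase c, (c - d))
        * (jSum x y I₀ J₀ (fun i => w₁ i * (x i - c)) v₁ n m
          * jSum x y I₀ J₀ (fun i => w₂ i / (x i - c)) v₂ n' m')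
      + (if n + q₁.natDegree + 1 = n' + T₁.card then (-1 : ℝ) ^ (n + n' + 1) else 0)
        * (jSum x y I₀ J₀ w₁ v₁ n m * jSum x y I₀ J₀ w₂ v₂ n' m')
      = jDer x y I₀ J₀ (fun i => w₁ i / x i) (fun j => v₁ j * y j) (fun i => (x i)⁻¹)
            (fun j => (y j)⁻¹) (n + 1) m
          * jSum x y I₀ J₀ (fun i => w₂ i * x i) (fun j => v₂ j / y j) (n' - 1) m'
        - jSum x y I₀ J₀ (fun i => w₁ i / x i) (fun j => v₁ j * y j) (n + 1) m
          * jDer x y I₀ J₀ (fun i => w₂ i * x i) (fun j => v₂ j / y j) (fun i => (x i)⁻¹)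
            (fun j => (y j)⁻¹) (n' - 1) m'
      + (if n' + m = n + m' + 3 then (-1 : ℝ) ^ (n + n' + 1) else 0)
        * (jSum x y I₀ J₀ w₁ v₁ (n + 1) m * jSum x y I₀ J₀ w₂ v₂ (n' - 1) m')
      - κ * (∑ c ∈ T₃, q₃.eval c / (∏ d ∈ T₃.erase c, (c - d))
        * (jSum x y I₀ J₀ w₁ (fun j => v₁ j / (y j + c)) (n + 1) (m + 1)
          * jSum x y I₀ J₀ w₂ (fun j => v₂ j * (y j + c)) (n' - 1) (m' - 1))
      + (if m' + q₃.natDegree = m + 1 + T₃.card then -1 else 0)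
        * (jSum x y I₀ J₀ w₁ v₁ (n + 1) (m + 1) * jSum x y I₀ J₀ w₂ v₂ (n' - 1) (m' - 1))) := by
  -- The double pole 1/z² is replaced by the pair of simple poles 1/(z(z - c)). The weights are
  -- perturbed so that the compatibility conditions hold exactly for each c: (1 - c/x)/(x(x - c)) =
  -- 1/x² and (1 + c/y)/(y(y + c)) = 1/y².
  set W : ℝ → ℕ → ℝ := fun c i => w₁ i * (1 + c * -(x i)⁻¹) with hW
  set V : ℝ → ℕ → ℝ := fun c j => v₂ j * (1 + c * (y j)⁻¹) with hV
  have hW0 : W 0 = w₁ := by funext i; simp [hW]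
  have hV0 : V 0 = v₂ := by funext i; simp [hV]
  have hWc : ∀ i, Continuous fun c => W c i := fun i => by fun_prop
  have hVc : ∀ i, Continuous fun c => V c i := fun i => by fun_prop
  set R₁ : ℝ → ℝ := fun z => ∑ c ∈ T₁, q₁.eval c / (∏ d ∈ T₁.erase c, (c - d))
        * (jSum x y I₀ J₀ (fun i => W z i * (x i - c)) v₁ n m
          * jSum x y I₀ J₀ (fun i => w₂ i / (x i - c)) (V z) n' m')
      + (if n + q₁.natDegree + 1 = n' + T₁.card then (-1 : ℝ) ^ (n + n' + 1) else 0)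
        * (jSum x y I₀ J₀ (W z) v₁ n m * jSum x y I₀ J₀ w₂ (V z) n' m') with hR₁
  set R₂ : ℝ → ℝ := fun z => (if n' + m = n + m' + 3 then (-1 : ℝ) ^ (n + n' + 1) else 0)
        * (jSum x y I₀ J₀ (W z) v₁ (n + 1) m * jSum x y I₀ J₀ w₂ (V z) (n' - 1) m') with hR₂
  set R₃ : ℝ → ℝ := fun z => κ * (∑ c ∈ T₃, q₃.eval c / (∏ d ∈ T₃.erase c, (c - d))
        * (jSum x y I₀ J₀ (W z) (fun j => v₁ j / (y j + c)) (n + 1) (m + 1)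
          * jSum x y I₀ J₀ w₂ (fun j => V z j * (y j + c)) (n' - 1) (m' - 1))
      + (if m' + q₃.natDegree = m + 1 + T₃.card then -1 else 0)
        * (jSum x y I₀ J₀ (W z) v₁ (n + 1) (m + 1)
          * jSum x y I₀ J₀ w₂ (V z) (n' - 1) (m' - 1))) with hR₃
  have cont : ∀ (w v : ℝ → ℕ → ℝ) (a b : ℤ), (∀ i, Continuous fun c => w c i) →
      (∀ j, Continuous fun c => v c j) → Continuous fun c => jSum x y I₀ J₀ (w c) (v c) a b :=
    fun w v a b => continuous_jSum x y I₀ J₀ w v a b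
  have c1 : Continuous R₁ := by
    refine Continuous.add (continuous_finsetSum _ fun c _ => continuous_const.mul
      (Continuous.mul ?_ ?_)) (continuous_const.mul (Continuous.mul ?_ ?_))
    · exact cont (fun z i => W z i * (x i - c)) (fun _ => v₁) n m
        (fun i => (hWc i).mul continuous_const) fun _ => continuous_const
    · exact cont (fun _ i => w₂ i / (x i - c)) V n' m' (fun _ => continuous_const) hVc
    · exact cont W (fun _ => v₁) n m hWc fun _ => continuous_const
    · exact cont (fun _ => w₂) V n' m' (fun _ => continuous_const) hVc
  have c2 : Continuous R₂ := by
    refine continuous_const.mul (Continuous.mul ?_ ?_)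
    · exact cont W (fun _ => v₁) _ _ hWc fun _ => continuous_const
    · exact cont (fun _ => w₂) V _ _ (fun _ => continuous_const) hVc
  have c3 : Continuous R₃ := by
    refine continuous_const.mul (Continuous.add (continuous_finsetSum _ fun c _ =>
      continuous_const.mul (Continuous.mul ?_ ?_)) (continuous_const.mul (Continuous.mul ?_ ?_)))
    · exact cont W (fun _ j => v₁ j / (y j + c)) _ _ hWc fun _ => continuous_const
    · exact cont (fun _ => w₂) (fun z j => V z j * (y j + c)) _ _ (fun _ => continuous_const)
        fun j => (hVc j).mul continuous_const
    · exact cont W (fun _ => v₁) _ _ hWc fun _ => continuous_const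
    · exact cont (fun _ => w₂) V _ _ (fun _ => continuous_const) hVc
  set f : (ℕ → ℝ) → (ℕ → ℝ) → ℝ → ℝ := fun α β c => jSum x y I₀ J₀
    (fun i => w₁ i / x i * (1 + c * α i)) (fun j => v₁ j * y j * (1 + c * β j)) (n + 1) m with hf
  set g : (ℕ → ℝ) → (ℕ → ℝ) → ℝ → ℝ := fun α β c => jSum x y I₀ J₀
    (fun i => w₂ i * x i * (1 + c * α i)) (fun j => v₂ j / y j * (1 + c * β j)) (n' - 1) m' with hg
  -- The residues at 0 and at c carry the opposite coefficients -1/c and 1/c, so together they form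
  -- the difference quotient Φ(c)/c with Φ(0) = 0.
  set Φ : ℝ → ℝ := fun c => f 0 (fun j => (y j)⁻¹) c * g (fun i => -(x i)⁻¹) 0 c
    - f (fun i => -(x i)⁻¹) 0 c * g 0 (fun j => (y j)⁻¹) c with hΦ
  have hf0 : ∀ α β, f α β 0 = jSum x y I₀ J₀ (fun i => w₁ i / x i) (fun j => v₁ j * y j)
      (n + 1) m := fun α β => by simp [hf]
  have hg0 : ∀ α β, g α β 0 = jSum x y I₀ J₀ (fun i => w₂ i * x i) (fun j => v₂ j / y j)
      (n' - 1) m' := fun α β => by simp [hg]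
  -- The perturbation in x enters one product of Φ through `g` and the other through `f`, with a
  -- minus sign; the perturbation in y enters them the other way round. In the derivative the two
  -- combine into full derivatives of each factor.
  have hder : HasDerivAt Φ (jDer x y I₀ J₀ (fun i => w₁ i / x i) (fun j => v₁ j * y j)
            (fun i => (x i)⁻¹) (fun j => (y j)⁻¹) (n + 1) m
          * jSum x y I₀ J₀ (fun i => w₂ i * x i) (fun j => v₂ j / y j) (n' - 1) m'
        - jSum x y I₀ J₀ (fun i => w₁ i / x i) (fun j => v₁ j * y j) (n + 1) m
          * jDer x y I₀ J₀ (fun i => w₂ i * x i) (fun j => v₂ j / y j) (fun i => (x i)⁻¹)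
            (fun j => (y j)⁻¹) (n' - 1) m') 0 := by
    have df := fun α β => hasDerivAt_jSum_one_add x y I₀ J₀ (fun i => w₁ i / x i)
      (fun j => v₁ j * y j) α β (n + 1) m
    have dg := fun α β => hasDerivAt_jSum_one_add x y I₀ J₀ (fun i => w₂ i * x i)
      (fun j => v₂ j / y j) α β (n' - 1) m'
    have := ((df 0 fun j => (y j)⁻¹).mul (dg (fun i => -(x i)⁻¹) 0)).sub
      ((df (fun i => -(x i)⁻¹) 0).mul (dg 0 fun j => (y j)⁻¹))
    refine this.congr_deriv ?_
    have e1 := hf0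
    have e2 := hg0
    simp only [hf, hg] at e1 e2
    rw [e1, e2, e1, e2, jDer_neg, jDer_neg, jDer_add x y I₀ J₀ _ _ (fun i => (x i)⁻¹) (fun j => (y j)⁻¹) (n + 1) m,
      jDer_add x y I₀ J₀ _ _ (fun i => (x i)⁻¹) (fun j => (y j)⁻¹) (n' - 1) m']
    ring
  have hΦ0 : Φ 0 = 0 := by simp only [hΦ, hf0, hg0]; ring
  have main : ∀ᶠ c in 𝓝[>] (0 : ℝ), R₁ c = c⁻¹ * Φ c + R₂ c - R₃ c := by
    -- For small c the new pole avoids all xₚ; it avoids all -yₚ since c is positive. This is why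
    -- the limit is taken from the right.
    have hne : ∀ᶠ c in 𝓝[>] (0 : ℝ), ∀ p ∈ I₀, x p ≠ c := by
      refine (Filter.eventually_all_finset I₀).2 fun p hp => ?_
      have : ∀ᶠ c in 𝓝 (0 : ℝ), c < x p := gt_mem_nhds (hx0 p hp)
      exact (this.filter_mono nhdsWithin_le_nhds).mono fun c hc => hc.ne'
    filter_upwards [hne, self_mem_nhdsWithin] with c hc hc0
    have hc0' : (0 : ℝ) < c := hc0
    have hT2 : ∀ d ∈ ({0, c} : Finset ℝ), ∀ p ∈ I₀, x p ≠ d := by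
      intro d hd p hp
      rcases mem_insert.1 hd with rfl | hd
      · exact (hx0 p hp).ne'
      · rw [mem_singleton.1 hd]; exact hc p hp
    have hT2' : ∀ d ∈ ({0, c} : Finset ℝ), ∀ p ∈ J₀, -y p ≠ d := by
      intro d hd p hp h
      have := hy0 p hp
      rcases mem_insert.1 hd with h' | hd
      · linarith
      · rw [mem_singleton.1 hd] at h; linarith
    have h0c : (0 : ℝ) ∉ ({c} : Finset ℝ) := by simpa using hc0'.ne
    have key := jSum_bilinear x y I₀ J₀ hx hy hx0 hy0 (W c) v₁ w₂ (V c) n m n' m' T₁ {0, c} T₃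
      q₁ 1 q₃ hq₁ monic_one hq₃ hT₁ hT2 hT2' hT₃ κ
      (by
        intro p hp
        have a1 := (hx0 p hp).ne'
        have a2 := sub_ne_zero.2 (hc p hp)
        rw [h12 p hp, prod_pair hc0'.ne]
        simp only [hW, eval_one, sub_zero]
        field_simp
        ring)
      (by
        intro p hp
        have a1 := hy0 p hp
        have a2 : -y p - c ≠ 0 := by linarith
        rw [← h23 p hp, prod_pair hc0'.ne]
        simp only [hV, eval_one, sub_zero]
        field_simp
        ring)
      d1 (by simp [card_pair hc0'.ne]; omega) d3
    rw [sum_pair hc0'.ne, erase_insert h0c, Finset.pair_comm, erase_insert (by simpa using hc0'.ne'),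
      prod_singleton, prod_singleton, Finset.pair_comm c 0, card_pair hc0'.ne] at key
    have e1 : jSum x y I₀ J₀ (fun i => W c i / (x i - 0)) (fun j => v₁ j * (y j + 0)) (n + 1) m
        = f (fun i => -(x i)⁻¹) 0 c :=
      jSum_congr _ _ _ _ (fun i _ => by simp [hW]; ring) (fun j _ => by simp)
    have e2 : jSum x y I₀ J₀ (fun i => w₂ i * (x i - 0)) (fun j => V c j / (y j + 0)) (n' - 1) m'
        = g 0 (fun j => (y j)⁻¹) c :=
      jSum_congr _ _ _ _ (fun i _ => by simp) (fun j _ => by simp [hV]; ring)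
    have e3 : jSum x y I₀ J₀ (fun i => W c i / (x i - c)) (fun j => v₁ j * (y j + c)) (n + 1) m
        = f 0 (fun j => (y j)⁻¹) c :=
      jSum_congr _ _ _ _
        (fun i hi => by
          have a1 := (hx0 i hi).ne'
          have a2 := sub_ne_zero.2 (hc i hi)
          simp [hW]; field_simp; ring)
        (fun j hj => by have a1 := (hy0 j hj).ne'; field_simp)
    have e4 : jSum x y I₀ J₀ (fun i => w₂ i * (x i - c)) (fun j => V c j / (y j + c)) (n' - 1) m'
        = g (fun i => -(x i)⁻¹) 0 c :=
      jSum_congr _ _ _ _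
        (fun i hi => by have a1 := (hx0 i hi).ne'; field_simp; ring)
        (fun j hj => by
          have a1 := (hy0 j hj)
          have a2 : y j + c ≠ 0 := by linarith
          simp [hV]; field_simp)
    rw [e1, e2, e3, e4] at key
    have e5 : (n' + m + ((1 : ℝ[X]).natDegree : ℤ) = n + 1 + m' + ((2 : ℕ) : ℤ))
        ↔ (n' + m = n + m' + 3) := by simp; omega
    simp only [e5] at key
    simp only [hR₁, hR₂, hR₃, hΦ]
    rw [key, eval_one, eval_one]
    simp
    ring
  have lim1 : Filter.Tendsto R₁ (𝓝[>] 0) (𝓝 (R₁ 0)) := (c1.tendsto 0).mono_left nhdsWithin_le_nhds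
  have slope := hder.tendsto_slope_zero_right
  simp only [zero_add, hΦ0, sub_zero, smul_eq_mul] at slope
  have lim2 := (slope.add ((c2.tendsto 0).mono_left nhdsWithin_le_nhds)).sub
    ((c3.tendsto 0).mono_left nhdsWithin_le_nhds)
  have fin := tendsto_nhds_unique (lim1.congr' main) lim2
  simp only [hR₁, hR₂, hR₃, hW0, hV0] at fin
  exact fin

end GengXue

end

/-! ### Time evolution of the partial sums at the places of a group. -/

noncomputable section

namespace GengXue

open Finset Polynomial

theorem jDer_congr (x y : ℕ → ℝ) {I₀ J₀ : Finset ℕ} {w w' v v' : ℕ → ℝ} (α β : ℕ → ℝ) (n m : ℤ)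
    (hw : ∀ i ∈ I₀, w i = w' i) (hv : ∀ j ∈ J₀, v j = v' j) :
    jDer x y I₀ J₀ w v α β n m = jDer x y I₀ J₀ w' v' α β n m := by
  unfold jDer
  refine sum_congr rfl fun I hI => sum_congr rfl fun J hJ => ?_
  rw [mem_cardSub] at hI hJ
  rw [jTerm, jTerm, prod_congr rfl fun i hi => hw i (hI.1 hi),
    prod_congr rfl fun j hj => hv j (hJ.1 hj)]

namespace PointData

/-- The time derivative of `jW` if the weights evolve by `w' = w / x`, `v' = v / y`. -/
def jD (D : PointData) (w v : ℕ → ℝ) (f g : ℝ → ℝ) (n m : ℤ) : ℝ :=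
  jDer D.x D.y D.I D.J (fun i => f (D.x i) * w i) (fun j => g (D.y j) * v j)
    (fun i => (D.x i)⁻¹) (fun j => (D.y j)⁻¹) n m

theorem jDer_eq_jD (D : PointData) {w v w' v' : ℕ → ℝ} (f g : ℝ → ℝ) (n m : ℤ)
    (hw : ∀ i ∈ D.I, w' i = f (D.x i) * w i) (hv : ∀ j ∈ D.J, v' j = g (D.y j) * v j) :
    jDer D.x D.y D.I D.J w' v' (fun i => (D.x i)⁻¹) (fun j => (D.y j)⁻¹) n m
      = D.jD w v f g n m :=
  jDer_congr _ _ _ _ _ _ hw hv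

/-- Each summand is a constant times e^{ct} with c = ∑ 1/x + ∑ 1/y over its index sets, and this c
is the factor inserted by `jD`. -/
theorem hasDerivAt_jW (D : PointData) (w₀ v₀ : ℕ → ℝ) (f g : ℝ → ℝ) (n m : ℤ) (t : ℝ) :
    HasDerivAt (fun t => D.jW (fun i => w₀ i * Real.exp (t / D.x i))
      (fun j => v₀ j * Real.exp (t / D.y j)) f g n m)
      (D.jD (fun i => w₀ i * Real.exp (t / D.x i)) (fun j => v₀ j * Real.exp (t / D.y j)) f g n m)
      t := by
  unfold jW jSum jD jDer
  refine HasDerivAt.fun_sum fun I _ => HasDerivAt.fun_sum fun J _ => ?_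
  set c := ∑ i ∈ I, (D.x i)⁻¹ + ∑ j ∈ J, (D.y j)⁻¹ with hc
  have e : ∀ t, jTerm D.x D.y (fun i => f (D.x i) * (w₀ i * Real.exp (t / D.x i)))
      (fun j => g (D.y j) * (v₀ j * Real.exp (t / D.y j))) I J
      = jTerm D.x D.y (fun i => f (D.x i) * w₀ i) (fun j => g (D.y j) * v₀ j) I J
        * Real.exp (t * c) := by
    intro t
    simp only [jTerm, prod_mul_distrib, hc, mul_add, mul_sum, Real.exp_add, Real.exp_sum,
      div_eq_mul_inv]
    ring
  simp only [e]
  have h1 : HasDerivAt (fun t : ℝ => Real.exp (t * c)) (Real.exp (t * c) * (1 * c)) t :=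
    ((hasDerivAt_id t).mul_const c).exp
  refine (h1.const_mul _).congr_deriv ?_
  ring

/-- The evolution of the denominators of a group. -/
theorem jD_denominator (D : PointData) (h : D.Valid) (w v : ℕ → ℝ) (n m a b : ℤ)
    (d1 : n < a + 2) (d2 : a + m < n + b + 2) (d3 : b ≤ m) :
    D.jD w v id 1 a b * D.jW w v 1 id n (m - 1) - D.jW w v id 1 a b * D.jD w v 1 id n (m - 1)
      = D.jW w v 1 (fun z => z ^ 2) a (b - 1) * D.jW w v id Inv.inv n m
        - D.jW w v Inv.inv id (a + 1) b * D.jW w v (fun z => z ^ 2) 1 (n - 1) (m - 1) := by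
  have hx0 : ∀ p ∈ D.I, D.x p ≠ 0 := fun p hp => (h.posx p hp).ne'
  have hy0 : ∀ p ∈ D.J, D.y p ≠ 0 := fun p hp => (h.posy p hp).ne'
  -- Here r₁ = 1/z, r₂ = 1/z², r₃ = -1/z. All three inequalities are strict enough that nothing
  -- comes from infinity; the right-hand side consists of the residues at 0 of the first and third
  -- functions.
  have key := jSum_hirota D.x D.y D.I D.J h.injx h.injy h.posx h.posy
    (fun i => D.x i * w i) v w (fun j => D.y j * v j) (n - 1) (m - 1) (a + 1) b {0} {0} 1 1
    monic_one monic_one (by simpa using hx0) (by simpa using hy0) (-1)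
    (by intro p hp; have := hx0 p hp; simp; field_simp)
    (by intro p hp; have := hy0 p hp; simp; field_simp) (by simp; omega) (by omega)
    (by simp; omega)
  rw [if_neg (by simp; omega), if_neg (by omega), if_neg (by simp; omega)] at key
  simp only [sub_add_cancel, add_sub_cancel_right, sum_singleton, eval_one, erase_singleton,
    prod_empty, div_one, sub_zero, one_mul, zero_mul, add_zero] at key
  rw [jSum_eq_jW D (w := w) (v := v) (fun z => z ^ 2) 1 (n - 1) (m - 1)
      (w' := fun i => D.x i * w i * D.x i) (v' := v) (by intros; ring) (by simp),
    jSum_eq_jW D (w := w) (v := v) Inv.inv id (a + 1) b (w' := fun i => w i / D.x i)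
      (v' := fun j => D.y j * v j) (by intros; field_simp) (by simp),
    jDer_eq_jD D (w := w) (v := v) 1 id n (m - 1) (w' := fun i => D.x i * w i / D.x i)
      (v' := fun j => v j * D.y j) (by intro i hi; have := hx0 i hi; simp; field_simp)
      (by intros; simp; ring),
    jSum_eq_jW D (w := w) (v := v) 1 id n (m - 1) (w' := fun i => D.x i * w i / D.x i)
      (v' := fun j => v j * D.y j) (by intro i hi; have := hx0 i hi; simp; field_simp)
      (by intros; simp; ring),
    jSum_eq_jW D (w := w) (v := v) id 1 a b (w' := fun i => w i * D.x i)
      (v' := fun j => D.y j * v j / D.y j) (by intros; simp; ring)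
      (by intro j hj; have := hy0 j hj; simp; field_simp),
    jDer_eq_jD D (w := w) (v := v) id 1 a b (w' := fun i => w i * D.x i)
      (v' := fun j => D.y j * v j / D.y j) (by intros; simp; ring)
      (by intro j hj; have := hy0 j hj; simp; field_simp),
    jSum_eq_jW D (w := w) (v := v) id Inv.inv n m (w' := fun i => D.x i * w i)
      (v' := fun j => v j / D.y j) (by simp) (by intros; field_simp),
    jSum_eq_jW D (w := w) (v := v) 1 (fun z => z ^ 2) a (b - 1) (w' := w)
      (v' := fun j => D.y j * v j * D.y j) (by simp) (by intros; ring)] at key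
  linarith

/-- With r₁ = z, r₂ = 1/z² and r₃ = 1 the only finite auxiliary pole is the double pole at 0.
Everything except the two derivatives is therefore a residue at infinity, present only in a case of
equality of the index bounds. -/
theorem jD_numerator_left (D : PointData) (h : D.Valid) (w v : ℕ → ℝ) (n m a b : ℤ)
    (d1 : n ≤ a + 1) (d2 : a + m ≤ n + b + 1) (d3 : b ≤ m) :
    (if n = a + 1 then (-1 : ℝ) ^ (n + a) else 0)
        * (D.jW w v id 1 (n - 1) (m - 1)
          * D.jW w v (fun z => (z ^ 2)⁻¹) (fun z => z ^ 2) (a + 2) b)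
      = D.jD w v 1 id n (m - 1) * D.jW w v Inv.inv id (a + 1) b
        - D.jW w v 1 id n (m - 1) * D.jD w v Inv.inv id (a + 1) b
        + (if a + m = n + b + 1 then (-1 : ℝ) ^ (n + a) else 0)
          * (D.jW w v id 1 n (m - 1)
            * D.jW w v (fun z => (z ^ 2)⁻¹) (fun z => z ^ 2) (a + 1) b)
        + (if b = m then 1 else 0)
          * (D.jW w v id 1 n m
            * D.jW w v (fun z => (z ^ 2)⁻¹) (fun z => z ^ 2) (a + 1) (b - 1)) := by
  have hx0 : ∀ p ∈ D.I, D.x p ≠ 0 := fun p hp => (h.posx p hp).ne'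
  have hy0 : ∀ p ∈ D.J, D.y p ≠ 0 := fun p hp => (h.posy p hp).ne'
  have key := jSum_hirota D.x D.y D.I D.J h.injx h.injy h.posx h.posy
    (fun i => D.x i * w i) v (fun i => w i / D.x i ^ 2) (fun j => D.y j ^ 2 * v j) (n - 1) (m - 1)
    (a + 2) b ∅ ∅ X 1 monic_X monic_one (by simp) (by simp) 1
    (by intro p hp; have := hx0 p hp; simp; field_simp)
    (by intro p hp; have := hy0 p hp; simp; field_simp) (by simp; omega) (by omega)
    (by simp; omega)
  have c1 : (n - 1 + ((X : ℝ[X]).natDegree : ℤ) + 1 = a + 2 + ((∅ : Finset ℝ).card : ℤ))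
      ↔ n = a + 1 := by simp; omega
  have c2 : (a + 2 + (m - 1) = n - 1 + b + 3) ↔ a + m = n + b + 1 := by omega
  have c3 : (b + ((1 : ℝ[X]).natDegree : ℤ) = m + ((∅ : Finset ℝ).card : ℤ))
      ↔ b = m := by simp
  simp only [c1, c2, c3, sub_add_cancel, sum_empty, zero_add, one_mul,
    show n - 1 + (a + 2) + 1 = n + a + 2 by ring, show a + 2 - 1 = a + 1 by ring,
    zpow_add₀ (show (-1 : ℝ) ≠ 0 by norm_num) (n + a) 2,
    Even.neg_one_zpow (α := ℝ) even_two, mul_one] at key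
  rw [jSum_eq_jW D (w := w) (v := v) id 1 (n - 1) (m - 1) (w' := fun i => D.x i * w i) (v' := v)
      (by simp) (by simp),
    jSum_eq_jW D (w := w) (v := v) id 1 n (m - 1) (w' := fun i => D.x i * w i) (v' := v)
      (by simp) (by simp),
    jSum_eq_jW D (w := w) (v := v) id 1 n m (w' := fun i => D.x i * w i) (v' := v)
      (by simp) (by simp),
    jSum_eq_jW D (w := w) (v := v) (fun z => (z ^ 2)⁻¹) (fun z => z ^ 2) (a + 2) b
      (w' := fun i => w i / D.x i ^ 2) (v' := fun j => D.y j ^ 2 * v j)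
      (by intros; field_simp) (by intros; ring),
    jSum_eq_jW D (w := w) (v := v) (fun z => (z ^ 2)⁻¹) (fun z => z ^ 2) (a + 1) b
      (w' := fun i => w i / D.x i ^ 2) (v' := fun j => D.y j ^ 2 * v j)
      (by intros; field_simp) (by intros; ring),
    jSum_eq_jW D (w := w) (v := v) (fun z => (z ^ 2)⁻¹) (fun z => z ^ 2) (a + 1) (b - 1)
      (w' := fun i => w i / D.x i ^ 2) (v' := fun j => D.y j ^ 2 * v j)
      (by intros; field_simp) (by intros; ring),
    jDer_eq_jD D (w := w) (v := v) 1 id n (m - 1) (w' := fun i => D.x i * w i / D.x i)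
      (v' := fun j => v j * D.y j) (by intro i hi; have := hx0 i hi; simp; field_simp)
      (by intros; simp; ring),
    jSum_eq_jW D (w := w) (v := v) 1 id n (m - 1) (w' := fun i => D.x i * w i / D.x i)
      (v' := fun j => v j * D.y j) (by intro i hi; have := hx0 i hi; simp; field_simp)
      (by intros; simp; ring),
    jDer_eq_jD D (w := w) (v := v) Inv.inv id (a + 1) b (w' := fun i => w i / D.x i ^ 2 * D.x i)
      (v' := fun j => D.y j ^ 2 * v j / D.y j)
      (by intro i hi; have := hx0 i hi; field_simp)
      (by intro j hj; have := hy0 j hj; simp; field_simp),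
    jSum_eq_jW D (w := w) (v := v) Inv.inv id (a + 1) b (w' := fun i => w i / D.x i ^ 2 * D.x i)
      (v' := fun j => D.y j ^ 2 * v j / D.y j)
      (by intro i hi; have := hx0 i hi; field_simp)
      (by intro j hj; have := hy0 j hj; simp; field_simp)] at key
  rw [key]
  split_ifs <;> ring

/-- The companion choice is r₁ = 1, r₂ = 1/z², r₃ = -z, again without finite poles other than the
double one. -/
theorem jD_numerator_right (D : PointData) (h : D.Valid) (w v : ℕ → ℝ) (n m a b : ℤ)
    (d1 : n ≤ a + 1) (d2 : a + m ≤ n + b + 1) (d3 : b ≤ m) :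
    (if n = a + 1 then (-1 : ℝ) ^ (n + a + 1) else 0)
        * (D.jW w v id 1 (n - 1) (m - 1)
          * D.jW w v Inv.inv (fun z => z ^ 3) (a + 1) (b - 1))
      = D.jD w v 1 id n (m - 1) * D.jW w v 1 (fun z => z ^ 2) a (b - 1)
        - D.jW w v 1 id n (m - 1) * D.jD w v 1 (fun z => z ^ 2) a (b - 1)
        + (if a + m = n + b + 1 then (-1 : ℝ) ^ (n + a + 1) else 0)
          * (D.jW w v id 1 n (m - 1)
            * D.jW w v Inv.inv (fun z => z ^ 3) a (b - 1))
        - (if b = m then 1 else 0)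
          * (D.jW w v id 1 n m
            * D.jW w v Inv.inv (fun z => z ^ 3) a (b - 2)) := by
  have hx0 : ∀ p ∈ D.I, D.x p ≠ 0 := fun p hp => (h.posx p hp).ne'
  have hy0 : ∀ p ∈ D.J, D.y p ≠ 0 := fun p hp => (h.posy p hp).ne'
  have key := jSum_hirota D.x D.y D.I D.J h.injx h.injy h.posx h.posy
    (fun i => D.x i * w i) v (fun i => w i / D.x i) (fun j => D.y j ^ 3 * v j) (n - 1) (m - 1)
    (a + 1) (b - 1) ∅ ∅ 1 X monic_one monic_X (by simp) (by simp) (-1)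
    (by intro p hp; have := hx0 p hp; simp; field_simp)
    (by intro p hp; have := hy0 p hp; simp; field_simp) (by simp; omega) (by omega)
    (by simp; omega)
  have c1 : (n - 1 + ((1 : ℝ[X]).natDegree : ℤ) + 1 = a + 1 + ((∅ : Finset ℝ).card : ℤ))
      ↔ n = a + 1 := by simp
  have c2 : (a + 1 + (m - 1) = n - 1 + (b - 1) + 3) ↔ a + m = n + b + 1 := by omega
  have c3 : (b - 1 + ((X : ℝ[X]).natDegree : ℤ) = m + ((∅ : Finset ℝ).card : ℤ))
      ↔ b = m := by simp
  simp only [c1, c2, c3, sub_add_cancel, sum_empty, zero_add,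
    show n - 1 + (a + 1) + 1 = n + a + 1 by ring, add_sub_cancel_right,
    show b - 1 - 1 = b - 2 by ring] at key
  rw [jSum_eq_jW D (w := w) (v := v) id 1 (n - 1) (m - 1) (w' := fun i => D.x i * w i) (v' := v)
      (by simp) (by simp),
    jSum_eq_jW D (w := w) (v := v) id 1 n (m - 1) (w' := fun i => D.x i * w i) (v' := v)
      (by simp) (by simp),
    jSum_eq_jW D (w := w) (v := v) id 1 n m (w' := fun i => D.x i * w i) (v' := v)
      (by simp) (by simp),
    jSum_eq_jW D (w := w) (v := v) Inv.inv (fun z => z ^ 3) (a + 1) (b - 1)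
      (w' := fun i => w i / D.x i) (v' := fun j => D.y j ^ 3 * v j)
      (by intros; field_simp) (by intros; ring),
    jSum_eq_jW D (w := w) (v := v) Inv.inv (fun z => z ^ 3) a (b - 1)
      (w' := fun i => w i / D.x i) (v' := fun j => D.y j ^ 3 * v j)
      (by intros; field_simp) (by intros; ring),
    jSum_eq_jW D (w := w) (v := v) Inv.inv (fun z => z ^ 3) a (b - 2)
      (w' := fun i => w i / D.x i) (v' := fun j => D.y j ^ 3 * v j)
      (by intros; field_simp) (by intros; ring),
    jDer_eq_jD D (w := w) (v := v) 1 id n (m - 1) (w' := fun i => D.x i * w i / D.x i)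
      (v' := fun j => v j * D.y j) (by intro i hi; have := hx0 i hi; simp; field_simp)
      (by intros; simp; ring),
    jSum_eq_jW D (w := w) (v := v) 1 id n (m - 1) (w' := fun i => D.x i * w i / D.x i)
      (v' := fun j => v j * D.y j) (by intro i hi; have := hx0 i hi; simp; field_simp)
      (by intros; simp; ring),
    jDer_eq_jD D (w := w) (v := v) 1 (fun z => z ^ 2) a (b - 1)
      (w' := fun i => w i / D.x i * D.x i)
      (v' := fun j => D.y j ^ 3 * v j / D.y j)
      (by intro i hi; have := hx0 i hi; simp; field_simp)
      (by intro j hj; have := hy0 j hj; field_simp),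
    jSum_eq_jW D (w := w) (v := v) 1 (fun z => z ^ 2) a (b - 1)
      (w' := fun i => w i / D.x i * D.x i)
      (v' := fun j => D.y j ^ 3 * v j / D.y j)
      (by intro i hi; have := hx0 i hi; simp; field_simp)
      (by intro j hj; have := hy0 j hj; field_simp)] at key
  rw [key]
  split_ifs <;> ring

/-- The charges of the three denominators of a group. -/
def GroupCharge (n m a b : ℤ) : Prop :=
  (a = n ∧ b = m) ∨ (a = n ∧ b = m - 1) ∨ (a = n - 1 ∧ b = m - 1)

/-- For each of the three admissible pairs (a, b) exactly one of the three residues at infinity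
survives, and each time the result has the same factor, with indices depending on n and m only.
Because of this the identity extends to linear combinations with arbitrary coefficients. -/
theorem jD_group_left (D : PointData) (h : D.Valid) (w v : ℕ → ℝ) (n m a b : ℤ)
    (hab : GroupCharge n m a b) :
    D.jD w v Inv.inv id (a + 1) b * D.jW w v 1 id n (m - 1)
        - D.jW w v Inv.inv id (a + 1) b * D.jD w v 1 id n (m - 1)
      = D.jW w v (fun z => (z ^ 2)⁻¹) (fun z => z ^ 2) (n + 1) (m - 1) * D.jW w v id 1 a b := by
  have key := D.jD_numerator_left h w v n m a b (by unfold GroupCharge at hab; omega)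
    (by unfold GroupCharge at hab; omega) (by unfold GroupCharge at hab; omega)
  rcases hab with ⟨rfl, rfl⟩ | ⟨rfl, rfl⟩ | ⟨rfl, rfl⟩
  · rw [if_neg (by omega), if_neg (by omega), if_pos rfl] at key
    linarith
  · rw [if_neg (by omega), if_pos (by omega), if_neg (by omega), Even.neg_one_zpow ⟨a, by ring⟩]
      at key
    linarith
  · rw [if_pos (by omega), if_neg (by omega), if_neg (by omega),
      Odd.neg_one_zpow ⟨n - 1, by ring⟩, show n - 1 + 2 = n + 1 by ring] at key
    linarith

theorem jD_group_right (D : PointData) (h : D.Valid) (w v : ℕ → ℝ) (n m a b : ℤ)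
    (hab : GroupCharge n m a b) :
    D.jD w v 1 (fun z => z ^ 2) a (b - 1) * D.jW w v 1 id n (m - 1)
        - D.jW w v 1 (fun z => z ^ 2) a (b - 1) * D.jD w v 1 id n (m - 1)
      = -D.jW w v Inv.inv (fun z => z ^ 3) n (m - 2) * D.jW w v id 1 a b := by
  have key := D.jD_numerator_right h w v n m a b (by unfold GroupCharge at hab; omega)
    (by unfold GroupCharge at hab; omega) (by unfold GroupCharge at hab; omega)
  rcases hab with ⟨rfl, rfl⟩ | ⟨rfl, rfl⟩ | ⟨rfl, rfl⟩
  · rw [if_neg (by omega), if_neg (by omega), if_pos rfl] at key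
    linarith
  · rw [if_neg (by omega), if_pos (by omega), if_neg (by omega), Odd.neg_one_zpow ⟨a, by ring⟩,
      show m - 1 - 1 = m - 2 by ring] at key
    rw [show m - 1 - 1 = m - 2 by ring]
    linarith
  · rw [if_pos (by omega), if_neg (by omega), if_neg (by omega),
      Even.neg_one_zpow ⟨n, by ring⟩, sub_add_cancel,
      show m - 1 - 1 = m - 2 by ring] at key
    rw [show m - 1 - 1 = m - 2 by ring]
    linarith

/-- The right-hand side contains just the numerators `numR` and `numL` belonging to (a, b), times
factors independent of (a, b). So the evolution of a denominator is expressed by the partial sums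
themselves. -/
theorem jD_group_den (D : PointData) (h : D.Valid) (w v : ℕ → ℝ) (n m a b : ℤ)
    (hab : GroupCharge n m a b) :
    D.jD w v id 1 a b * D.jW w v 1 id n (m - 1) - D.jW w v id 1 a b * D.jD w v 1 id n (m - 1)
      = D.jW w v 1 (fun z => z ^ 2) a (b - 1) * D.jW w v id Inv.inv n m
        - D.jW w v Inv.inv id (a + 1) b * D.jW w v (fun z => z ^ 2) 1 (n - 1) (m - 1) := by
  unfold GroupCharge at hab
  exact D.jD_denominator h w v n m a b (by omega) (by omega) (by omega)

/-- A combination of three quantities with coefficients `s`. -/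
def comb (s : ℝ × ℝ × ℝ) (f : ℤ → ℤ → ℝ) (n m : ℤ) : ℝ :=
  s.1 * f n m + s.2.1 * f n (m - 1) + s.2.2 * f (n - 1) (m - 1)

/-- The common denominator of the sums at a place described by `s` inside a group. -/
def den (D : PointData) (w v : ℕ → ℝ) (s : ℝ × ℝ × ℝ) (n m : ℤ) : ℝ :=
  comb s (fun a b => D.jW w v id 1 a b) n m

/-- The numerator of the sum of the `Q X` on the left. -/
def numL (D : PointData) (w v : ℕ → ℝ) (s : ℝ × ℝ × ℝ) (n m : ℤ) : ℝ :=
  comb s (fun a b => D.jW w v Inv.inv id (a + 1) b) n m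

/-- The numerator of the sum of the `Q` on the right. -/
def numR (D : PointData) (w v : ℕ → ℝ) (s : ℝ × ℝ × ℝ) (n m : ℤ) : ℝ :=
  comb s (fun a b => D.jW w v 1 (fun z => z ^ 2) a (b - 1)) n m

theorem hasDerivAt_comb (s : ℝ × ℝ × ℝ) (f : ℝ → ℤ → ℤ → ℝ) (f' : ℤ → ℤ → ℝ) (t : ℝ)
    (h : ∀ a b, HasDerivAt (fun t => f t a b) (f' a b) t) (n m : ℤ) :
    HasDerivAt (fun t => comb s (f t) n m) (comb s f' n m) t :=
  (((h n m).const_mul _).add ((h n (m - 1)).const_mul _)).add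
    ((h (n - 1) (m - 1)).const_mul _)

/-- Evolution of the two sums at a place inside a group; the quantities `δ` and `ε` do not depend
on the place. -/
theorem hasDerivAt_sums (D : PointData) (h : D.Valid) (w₀ v₀ : ℕ → ℝ) (n m : ℤ) (t : ℝ)
    (w v : ℝ → ℕ → ℝ) (hw : w = fun t i => w₀ i * Real.exp (t / D.x i))
    (hv : v = fun t j => v₀ j * Real.exp (t / D.y j))
    (hG : D.jW (w t) (v t) 1 id n (m - 1) ≠ 0) :
    ∃ δ ε : ℝ, ∀ s : ℝ × ℝ × ℝ, D.den (w t) (v t) s n m ≠ 0 →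
      HasDerivAt (fun t => D.numL (w t) (v t) s n m / D.den (w t) (v t) s n m)
        (δ + (D.numL (w t) (v t) s n m / D.den (w t) (v t) s n m
              * (D.jW (w t) (v t) (fun z => z ^ 2) 1 (n - 1) (m - 1)
                / D.jW (w t) (v t) 1 id n (m - 1))
            - D.numR (w t) (v t) s n m / D.den (w t) (v t) s n m
              * (D.jW (w t) (v t) id Inv.inv n m / D.jW (w t) (v t) 1 id n (m - 1)))
          * (D.numL (w t) (v t) s n m / D.den (w t) (v t) s n m)) t ∧
      HasDerivAt (fun t => D.numR (w t) (v t) s n m / D.den (w t) (v t) s n m)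
        (ε + (D.numL (w t) (v t) s n m / D.den (w t) (v t) s n m
              * (D.jW (w t) (v t) (fun z => z ^ 2) 1 (n - 1) (m - 1)
                / D.jW (w t) (v t) 1 id n (m - 1))
            - D.numR (w t) (v t) s n m / D.den (w t) (v t) s n m
              * (D.jW (w t) (v t) id Inv.inv n m / D.jW (w t) (v t) 1 id n (m - 1)))
          * (D.numR (w t) (v t) s n m / D.den (w t) (v t) s n m)) t := by
  have der : ∀ f g n m, HasDerivAt (fun t => D.jW (w t) (v t) f g n m)
      (D.jD (w t) (v t) f g n m) t := by
    intro f g n m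
    rw [hw, hv]
    exact D.hasDerivAt_jW w₀ v₀ f g n m t
  have c1 : GroupCharge n m n m := Or.inl ⟨rfl, rfl⟩
  have c2 : GroupCharge n m n (m - 1) := Or.inr (Or.inl ⟨rfl, rfl⟩)
  have c3 : GroupCharge n m (n - 1) (m - 1) := Or.inr (Or.inr ⟨rfl, rfl⟩)
  set G := D.jW (w t) (v t) 1 id n (m - 1) with hGdef
  -- The inhomogeneous terms δ and ε are the common factors found in `jD_group_left` and
  -- `jD_group_right`, divided by `G`; they do not involve s.
  refine ⟨D.jW (w t) (v t) (fun z => (z ^ 2)⁻¹) (fun z => z ^ 2) (n + 1) (m - 1) / G,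
    -D.jW (w t) (v t) Inv.inv (fun z => z ^ 3) n (m - 2) / G, fun s hs => ?_⟩
  have dF : HasDerivAt (fun t => D.den (w t) (v t) s n m)
      (comb s (fun a b => D.jD (w t) (v t) id 1 a b) n m) t :=
    hasDerivAt_comb s (fun t a b => D.jW (w t) (v t) id 1 a b) _ t
      (fun a b => der id 1 a b) n m
  have dL : HasDerivAt (fun t => D.numL (w t) (v t) s n m)
      (comb s (fun a b => D.jD (w t) (v t) Inv.inv id (a + 1) b) n m) t :=
    hasDerivAt_comb s (fun t a b => D.jW (w t) (v t) Inv.inv id (a + 1) b) _ t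
      (fun a b => der Inv.inv id (a + 1) b) n m
  have dR : HasDerivAt (fun t => D.numR (w t) (v t) s n m)
      (comb s (fun a b => D.jD (w t) (v t) 1 (fun z => z ^ 2) a (b - 1)) n m) t :=
    hasDerivAt_comb s (fun t a b => D.jW (w t) (v t) 1 (fun z => z ^ 2) a (b - 1)) _ t
      (fun a b => der 1 (fun z => z ^ 2) a (b - 1)) n m
  -- Everything is measured relative to `G`. Writing L, R, F for the two numerators and the
  -- denominator, L'G - LG' and R'G - RG' are multiples of F, and F'G - FG' is a combination of R
  -- and L. The quotient rule then gives Riccati equations for L/F and R/F.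
  have eF : comb s (fun a b => D.jD (w t) (v t) id 1 a b) n m * G
      = D.den (w t) (v t) s n m * D.jD (w t) (v t) 1 id n (m - 1)
        + D.numR (w t) (v t) s n m * D.jW (w t) (v t) id Inv.inv n m
        - D.numL (w t) (v t) s n m * D.jW (w t) (v t) (fun z => z ^ 2) 1 (n - 1) (m - 1) := by
    have e1 := D.jD_group_den h (w t) (v t) n m n m c1
    have e2 := D.jD_group_den h (w t) (v t) n m n (m - 1) c2
    have e3 := D.jD_group_den h (w t) (v t) n m (n - 1) (m - 1) c3
    rw [← hGdef] at e1 e2 e3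
    simp only [comb, den, numL, numR]
    linear_combination s.1 * e1 + s.2.1 * e2 + s.2.2 * e3
  have eL : comb s (fun a b => D.jD (w t) (v t) Inv.inv id (a + 1) b) n m * G
      = D.numL (w t) (v t) s n m * D.jD (w t) (v t) 1 id n (m - 1)
        + D.jW (w t) (v t) (fun z => (z ^ 2)⁻¹) (fun z => z ^ 2) (n + 1) (m - 1)
          * D.den (w t) (v t) s n m := by
    have e1 := D.jD_group_left h (w t) (v t) n m n m c1
    have e2 := D.jD_group_left h (w t) (v t) n m n (m - 1) c2
    have e3 := D.jD_group_left h (w t) (v t) n m (n - 1) (m - 1) c3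
    rw [← hGdef] at e1 e2 e3
    simp only [comb, den, numL]
    linear_combination s.1 * e1 + s.2.1 * e2 + s.2.2 * e3
  have eR : comb s (fun a b => D.jD (w t) (v t) 1 (fun z => z ^ 2) a (b - 1)) n m * G
      = D.numR (w t) (v t) s n m * D.jD (w t) (v t) 1 id n (m - 1)
        - D.jW (w t) (v t) Inv.inv (fun z => z ^ 3) n (m - 2)
          * D.den (w t) (v t) s n m := by
    have e1 := D.jD_group_right h (w t) (v t) n m n m c1
    have e2 := D.jD_group_right h (w t) (v t) n m n (m - 1) c2
    have e3 := D.jD_group_right h (w t) (v t) n m (n - 1) (m - 1) c3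
    rw [← hGdef] at e1 e2 e3
    simp only [comb, den, numR]
    linear_combination s.1 * e1 + s.2.1 * e2 + s.2.2 * e3
  refine ⟨(dL.div dF hs).congr_deriv ?_, (dR.div dF hs).congr_deriv ?_⟩
  · rw [eq_div_of_mul_eq hG eF, eq_div_of_mul_eq hG eL]
    field_simp
    ring
  · rw [eq_div_of_mul_eq hG eF, eq_div_of_mul_eq hG eR]
    field_simp
    ring

/-- Difference of the left sums at two places inside a group. -/
theorem numL_wronskian (D : PointData) (h : D.Valid) (w v : ℕ → ℝ) (n m : ℤ)
    (s s' : ℝ × ℝ × ℝ) :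
    D.numL w v s n m * D.den w v s' n m - D.numL w v s' n m * D.den w v s n m
      = D.jW w v 1 id n (m - 1)
        * ((s'.1 * s.2.1 - s'.2.1 * s.1) * D.jW w v 1 1 (n + 1) m
          + (s'.1 * s.2.2 - s'.2.2 * s.1) * D.jW w v 1 1 n m
          + (s'.2.1 * s.2.2 - s'.2.2 * s.2.1) * D.jW w v 1 1 n (m - 1)) := by
  simp only [numL, den, comb, sub_add_cancel]
  linear_combination (s'.1 * s.2.1 - s'.2.1 * s.1) * D.wronskian_one_two h w v n m
    + (s'.1 * s.2.2 - s'.2.2 * s.1) * D.wronskian_one_three h w v n m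
    + (s'.2.1 * s.2.2 - s'.2.2 * s.2.1) * D.wronskian_two_three h w v n m

/-- Difference of the right sums at two places inside a group. -/
theorem numR_wronskian (D : PointData) (h : D.Valid) (w v : ℕ → ℝ) (n m : ℤ)
    (s s' : ℝ × ℝ × ℝ) :
    D.numR w v s' n m * D.den w v s n m - D.numR w v s n m * D.den w v s' n m
      = D.jW w v 1 id n (m - 1)
        * ((s'.1 * s.2.1 - s'.2.1 * s.1) * D.jW w v id id n (m - 1)
          + (s'.1 * s.2.2 - s'.2.2 * s.1) * D.jW w v id id (n - 1) (m - 1)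
          + (s'.2.1 * s.2.2 - s'.2.2 * s.2.1) * D.jW w v id id (n - 1) (m - 2)) := by
  simp only [numR, den, comb, show m - 1 - 1 = m - 2 by ring]
  linear_combination (s'.1 * s.2.1 - s'.2.1 * s.1) * D.wronskian_sq_one_two h w v n m
    + (s'.1 * s.2.2 - s'.2.2 * s.1) * D.wronskian_sq_one_three h w v n m
    + (s'.2.1 * s.2.2 - s'.2.2 * s.2.1) * D.wronskian_sq_two_three h w v n m

end PointData

end GengXue

end

/-! ### The multipeakon equations in polynomial form. -/

noncomputable section

namespace GengXue

open Finset

/-- The sum over all members up to member `i` of group `k`. -/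
def sumLeft (N : ℕ → ℕ) (f : ℕ → ℕ → ℝ) (k i : ℕ) : ℝ :=
  ∑ l ∈ Ico 1 k, ∑ r ∈ Icc 1 (N l), f l r + ∑ r ∈ Icc 1 i, f k r

/-- The sum over all members after member `i` of group `k`. -/
def sumRight (K : ℕ) (N : ℕ → ℕ) (f : ℕ → ℕ → ℝ) (k i : ℕ) : ℝ :=
  ∑ l ∈ Ioc k K, ∑ r ∈ Icc 1 (N l), f l r + ∑ r ∈ Ioc i (N k), f k r

theorem sumLeft_add_sumRight (K : ℕ) (N : ℕ → ℕ) (f : ℕ → ℕ → ℝ) (k i : ℕ) (hk : 1 ≤ k)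
    (hkK : k ≤ K) (hi : i ≤ N k) :
    sumLeft N f k i + sumRight K N f k i = ∑ l ∈ Icc 1 K, ∑ r ∈ Icc 1 (N l), f l r := by
  have h1 : ∑ l ∈ Icc 1 K, ∑ r ∈ Icc 1 (N l), f l r
      = ∑ l ∈ Ico 1 k, ∑ r ∈ Icc 1 (N l), f l r
        + (∑ r ∈ Icc 1 (N k), f k r + ∑ l ∈ Ioc k K, ∑ r ∈ Icc 1 (N l), f l r) := by
    have e : Icc 1 K = Ico 1 k ∪ insert k (Ioc k K) := by
      ext l; simp only [mem_Icc, mem_union, mem_Ico, mem_insert, mem_Ioc]; omega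
    rw [e, sum_union, sum_insert (by simp)]
    rw [disjoint_left]
    intro l hl hl'
    simp only [mem_Ico, mem_insert, mem_Ioc] at hl hl'
    omega
  have h2 : ∑ r ∈ Icc 1 (N k), f k r = ∑ r ∈ Icc 1 i, f k r + ∑ r ∈ Ioc i (N k), f k r := by
    have e : Icc 1 (N k) = Icc 1 i ∪ Ioc i (N k) := by
      ext l; simp only [mem_Icc, mem_union, mem_Ioc]; omega
    rw [e, sum_union]
    rw [disjoint_left]
    intro l hl hl'
    simp only [mem_Icc, mem_Ioc] at hl hl'
    omega
  rw [h1, h2, sumLeft, sumRight]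
  ring

theorem sumLeft_step (N : ℕ → ℕ) (f : ℕ → ℕ → ℝ) (k i : ℕ) (hi : 1 ≤ i) :
    sumLeft N f k i = sumLeft N f k (i - 1) + f k i := by
  obtain ⟨j, rfl⟩ : ∃ j, i = j + 1 := ⟨i - 1, by omega⟩
  rw [sumLeft, sumLeft, sum_Icc_succ_top (by omega), Nat.add_sub_cancel]
  ring

theorem sumRight_step (K : ℕ) (N : ℕ → ℕ) (f : ℕ → ℕ → ℝ) (k i : ℕ) (hi : 1 ≤ i) (hiN : i ≤ N k) :
    sumRight K N f k (i - 1) = sumRight K N f k i + f k i := by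
  have e : Ioc (i - 1) (N k) = insert i (Ioc i (N k)) := by
    ext l; simp only [mem_insert, mem_Ioc]; omega
  rw [sumRight, sumRight, e, sum_insert (by simp)]
  ring

theorem sumLeft_congr {N : ℕ → ℕ} {f g : ℕ → ℕ → ℝ} {k i : ℕ}
    (h : ∀ l r, 1 ≤ l → 1 ≤ r → (l < k ∧ r ≤ N l ∨ l = k ∧ r ≤ i) → f l r = g l r) (hk : 1 ≤ k) :
    sumLeft N f k i = sumLeft N g k i := by
  unfold sumLeft
  congr 1
  · refine sum_congr rfl fun l hl => sum_congr rfl fun r hr => ?_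
    rw [mem_Ico] at hl
    rw [mem_Icc] at hr
    exact h l r hl.1 hr.1 (Or.inl ⟨hl.2, hr.2⟩)
  · refine sum_congr rfl fun r hr => ?_
    rw [mem_Icc] at hr
    exact h k r hk hr.1 (Or.inr ⟨rfl, hr.2⟩)

theorem sumRight_congr {K : ℕ} {N : ℕ → ℕ} {f g : ℕ → ℕ → ℝ} {k i : ℕ}
    (h : ∀ l r, l ≤ K → 1 ≤ r → r ≤ N l → (k < l ∨ l = k ∧ i < r) → f l r = g l r) (hk : k ≤ K) :
    sumRight K N f k i = sumRight K N g k i := by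
  unfold sumRight
  congr 1
  · refine sum_congr rfl fun l hl => sum_congr rfl fun r hr => ?_
    rw [mem_Ioc] at hl
    rw [mem_Icc] at hr
    exact h l r hl.2 hr.1 hr.2 (Or.inl hl.1)
  · refine sum_congr rfl fun r hr => ?_
    rw [mem_Ioc] at hr
    exact h k r hk (by omega) hr.2 (Or.inr ⟨rfl, hr.1⟩)

theorem sumLeft_mul (N : ℕ → ℕ) (f : ℕ → ℕ → ℝ) (k i : ℕ) (c : ℝ) :
    sumLeft N (fun l r => c * f l r) k i = c * sumLeft N f k i := by
  simp only [sumLeft, mul_add, mul_sum]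

theorem sumRight_mul (K : ℕ) (N : ℕ → ℕ) (f : ℕ → ℕ → ℝ) (k i : ℕ) (c : ℝ) :
    sumRight K N (fun l r => c * f l r) k i = c * sumRight K N f k i := by
  simp only [sumRight, mul_add, mul_sum]

/-- The rate of change attached to a place, as seen from the sums on both sides. -/
def placeRate (K : ℕ) (N : ℕ → ℕ) (q v : ℕ → ℕ → ℝ) (C D : ℝ) (k i : ℕ) : ℝ :=
  sumLeft N v k i * D - sumRight K N q k i * C

/-- The right-hand side of the equation for `QX`. -/
def momentRate (K : ℕ) (N : ℕ → ℕ) (q v : ℕ → ℕ → ℝ) (C D : ℝ) (k i : ℕ) : ℝ :=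
  placeRate K N q v C D k i * sumLeft N v k i
    - placeRate K N q v C D k (i - 1) * sumLeft N v k (i - 1)

/-- The right-hand side of the equation for `Q`. -/
def massRate (K : ℕ) (N : ℕ → ℕ) (q v : ℕ → ℕ → ℝ) (C D : ℝ) (k i : ℕ) : ℝ :=
  placeRate K N q v C D k (i - 1) * sumRight K N q k (i - 1)
    - placeRate K N q v C D k i * sumRight K N q k i

/-- The polynomial form of the multipeakon equations: `q`, `p` are the quantities `Q`, `P`, and
`v`, `z` are the products `QX`, `PY`. -/
structure IsPolynomialSolution (K : ℕ) (NX NY : ℕ → ℕ) (q v p z : ℕ → ℕ → ℝ → ℝ) : Prop where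
  q_ode : ∀ k i t, 1 ≤ k → k ≤ K → 1 ≤ i → i ≤ NX k → HasDerivAt (q k i)
    (massRate K NX (fun k i => q k i t) (fun k i => v k i t)
      (sumLeft NY (fun k i => z k i t) k 0) (sumRight K NY (fun k i => p k i t) k 0) k i) t
  v_ode : ∀ k i t, 1 ≤ k → k ≤ K → 1 ≤ i → i ≤ NX k → HasDerivAt (v k i)
    (momentRate K NX (fun k i => q k i t) (fun k i => v k i t)
      (sumLeft NY (fun k i => z k i t) k 0) (sumRight K NY (fun k i => p k i t) k 0) k i) t
  p_ode : ∀ k i t, 1 ≤ k → k ≤ K → 1 ≤ i → i ≤ NY k → HasDerivAt (p k i)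
    (massRate K NY (fun k i => p k i t) (fun k i => z k i t)
      (sumLeft NX (fun k i => v k i t) k (NX k))
      (sumRight K NX (fun k i => q k i t) k (NX k)) k i) t
  z_ode : ∀ k i t, 1 ≤ k → k ≤ K → 1 ≤ i → i ≤ NY k → HasDerivAt (z k i)
    (momentRate K NY (fun k i => p k i t) (fun k i => z k i t)
      (sumLeft NX (fun k i => v k i t) k (NX k))
      (sumRight K NX (fun k i => q k i t) k (NX k)) k i) t

section Waves

/-- The wave at a point which separates the members up to `(k, i)` from the others. -/
theorem wave_eq (K : ℕ) (N : ℕ → ℕ) (p w : ℕ → ℕ → ℝ → ℝ) (t ζ : ℝ) (k i : ℕ) (hk : 1 ≤ k)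
    (hkK : k ≤ K) (hi : i ≤ N k)
    (hl : ∀ l r, 1 ≤ l → 1 ≤ r → (l < k ∧ r ≤ N l ∨ l = k ∧ r ≤ i) → p l r t ≤ ζ)
    (hr : ∀ l r, l ≤ K → 1 ≤ r → r ≤ N l → (k < l ∨ l = k ∧ i < r) → ζ ≤ p l r t) :
    wave K N p w t ζ = Real.exp (-ζ) * sumLeft N (fun l r => w l r t * Real.exp (p l r t)) k i
      + Real.exp ζ / 2 * sumRight K N (fun l r => 2 * w l r t * Real.exp (-p l r t)) k i := by
  rw [wave, ← sumLeft_add_sumRight K N _ k i hk hkK hi, ← sumLeft_mul, ← sumRight_mul]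
  congr 1
  · refine sumLeft_congr (fun l r h1 h2 h3 => ?_) hk
    have := hl l r h1 h2 h3
    rw [abs_of_nonneg (by linarith), neg_sub, sub_eq_add_neg, Real.exp_add]
    ring
  · refine sumRight_congr (fun l r h1 h2 h3 h4 => ?_) hkK
    have := hr l r h1 h2 h3 h4
    rw [abs_of_nonpos (by linarith), neg_neg, sub_eq_add_neg, Real.exp_add]
    ring

/-- The derivative of the wave at a point strictly separating the members. -/
theorem waveDeriv_eq (K : ℕ) (N : ℕ → ℕ) (p w : ℕ → ℕ → ℝ → ℝ) (t ζ : ℝ) (k i : ℕ) (hk : 1 ≤ k)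
    (hkK : k ≤ K) (hi : i ≤ N k)
    (hl : ∀ l r, 1 ≤ l → 1 ≤ r → (l < k ∧ r ≤ N l ∨ l = k ∧ r ≤ i) → p l r t < ζ)
    (hr : ∀ l r, l ≤ K → 1 ≤ r → r ≤ N l → (k < l ∨ l = k ∧ i < r) → ζ < p l r t) :
    waveDeriv K N p w t ζ
      = -(Real.exp (-ζ) * sumLeft N (fun l r => w l r t * Real.exp (p l r t)) k i)
      + Real.exp ζ / 2 * sumRight K N (fun l r => 2 * w l r t * Real.exp (-p l r t)) k i := by
  rw [waveDeriv, ← sumLeft_add_sumRight K N _ k i hk hkK hi, ← neg_mul, ← sumLeft_mul,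
    ← sumRight_mul]
  congr 1
  · refine sumLeft_congr (fun l r h1 h2 h3 => ?_) hk
    have := hl l r h1 h2 h3
    rw [abs_of_pos (by linarith), Real.sign_of_pos (by linarith), neg_sub, sub_eq_add_neg,
      Real.exp_add]
    ring
  · refine sumRight_congr (fun l r h1 h2 h3 h4 => ?_) hkK
    have := hr l r h1 h2 h3 h4
    rw [abs_of_neg (by linarith), Real.sign_of_neg (by linarith), neg_neg, sub_eq_add_neg,
      Real.exp_add]
    ring

/-- The derivative of the wave at one of its own peaks. -/
theorem waveDeriv_peak (K : ℕ) (N : ℕ → ℕ) (p w : ℕ → ℕ → ℝ → ℝ) (t : ℝ) (k i : ℕ) (hk : 1 ≤ k)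
    (hkK : k ≤ K) (hi1 : 1 ≤ i) (hi : i ≤ N k)
    (hl : ∀ l r, 1 ≤ l → 1 ≤ r → (l < k ∧ r ≤ N l ∨ l = k ∧ r ≤ i - 1) → p l r t < p k i t)
    (hr : ∀ l r, l ≤ K → 1 ≤ r → r ≤ N l → (k < l ∨ l = k ∧ i < r) → p k i t < p l r t) :
    waveDeriv K N p w t (p k i t)
      = -(Real.exp (-p k i t)
          * sumLeft N (fun l r => w l r t * Real.exp (p l r t)) k (i - 1))
      + Real.exp (p k i t) / 2
        * sumRight K N (fun l r => 2 * w l r t * Real.exp (-p l r t)) k i := by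
  rw [waveDeriv, ← sumLeft_add_sumRight K N _ k i hk hkK hi, ← neg_mul, sumLeft_step _ _ _ _ hi1,
    ← sumLeft_mul, ← sumRight_mul]
  simp only [sub_self, Real.sign_zero, mul_zero, zero_mul, neg_zero, add_zero]
  congr 1
  · refine sumLeft_congr (fun l r h1 h2 h3 => ?_) hk
    have := hl l r h1 h2 h3
    rw [abs_of_pos (by linarith), Real.sign_of_pos (by linarith), neg_sub, sub_eq_add_neg,
      Real.exp_add]
    ring
  · refine sumRight_congr (fun l r h1 h2 h3 h4 => ?_) hkK
    have := hr l r h1 h2 h3 h4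
    rw [abs_of_neg (by linarith), Real.sign_of_neg (by linarith), neg_neg, sub_eq_add_neg,
      Real.exp_add]
    ring

end Waves

section Peaks

/-- The equations for one peak in polynomial form. -/
theorem hasDerivAt_peak (K : ℕ) (N : ℕ → ℕ) (q v : ℕ → ℕ → ℝ) (C D u ud w wd : ℝ) (k i : ℕ)
    (hi1 : 1 ≤ i) (hi : i ≤ N k) (x m : ℝ → ℝ) (t : ℝ)
    (hx : HasDerivAt x (u * w) t)
    (hm : HasDerivAt m (m t * (u * wd - 2 * ud * w)) t)
    (hq : q k i = 2 * m t * Real.exp (-x t)) (hv : v k i = m t * Real.exp (x t))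
    (hu : u = Real.exp (-x t) * sumLeft N v k i + Real.exp (x t) / 2 * sumRight K N q k i)
    (hud : ud = -(Real.exp (-x t) * sumLeft N v k (i - 1))
      + Real.exp (x t) / 2 * sumRight K N q k i)
    (hw : w = Real.exp (-x t) * C + Real.exp (x t) / 2 * D)
    (hwd : wd = -(Real.exp (-x t) * C) + Real.exp (x t) / 2 * D) :
    HasDerivAt (fun t => 2 * m t * Real.exp (-x t)) (massRate K N q v C D k i) t ∧
    HasDerivAt (fun t => m t * Real.exp (x t)) (momentRate K N q v C D k i) t := by
  have e : Real.exp (-x t) * Real.exp (x t) = 1 := by rw [← Real.exp_add]; simp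
  have sL := sumLeft_step N v k i hi1
  have sR := sumRight_step K N q k i hi1 hi
  rw [hv] at sL
  rw [hq] at sR
  constructor
  · refine ((hm.const_mul 2).mul hx.neg.exp).congr_deriv ?_
    -- All waves are expressed by the sums A strictly to the left and B strictly to the right of the
    -- peak, its own contribution being split off. The two sides then differ by a multiple of e^{-x}
    -- e^{x} - 1.
    unfold massRate placeRate
    rw [hw, hwd, hud, hu, sR, sL]
    set A := sumLeft N v k (i - 1)
    set B := sumRight K N q k i
    set E := Real.exp (x t)
    set F := Real.exp (-x t)
    set M := m t
    linear_combination (2 * M * A * F * D - 4 * M * F * B * C - M * E * B * D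
      - 4 * M ^ 2 * F ^ 2 * C) * e
  · refine (hm.mul hx.exp).congr_deriv ?_
    unfold momentRate placeRate
    rw [hw, hwd, hud, hu, sR, sL]
    set A := sumLeft N v k (i - 1)
    set B := sumRight K N q k i
    set E := Real.exp (x t)
    set F := Real.exp (-x t)
    set M := m t
    linear_combination (2 * M * A * E * D + 2 * M * F * A * C - M * E * B * C
      + M ^ 2 * E ^ 2 * D) * e

end Peaks

section Ordering

/-- Strict monotonicity within a family whose members alternate in groups. -/
theorem lt_within (N : ℕ → ℕ) (p : ℕ → ℕ → ℝ) (k : ℕ)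
    (h : ∀ i, 1 ≤ i → i + 1 ≤ N k → p k i < p k (i + 1)) (i j : ℕ) (hi : 1 ≤ i) (hij : i < j)
    (hj : j ≤ N k) : p k i < p k j := by
  induction j, hij using Nat.le_induction with
  | base => exact h i hi hj
  | succ j hij ih => exact (ih (by omega)).trans (h j (by omega) hj)

theorem le_within (N : ℕ → ℕ) (p : ℕ → ℕ → ℝ) (k : ℕ)
    (h : ∀ i, 1 ≤ i → i + 1 ≤ N k → p k i < p k (i + 1)) (i j : ℕ) (hi : 1 ≤ i) (hij : i ≤ j)
    (hj : j ≤ N k) : p k i ≤ p k j := by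
  rcases hij.eq_or_lt with rfl | hij
  · exact le_rfl
  · exact (lt_within N p k h i j hi hij hj).le

/-- Only neighbouring peakons are ordered by assumption. The full order is needed to decide the sign
in each absolute value |z - p| of the waves. -/
theorem IsPeakonSolution.x_lt_y_of_le {K : ℕ} {NX NY : ℕ → ℕ}
    {x m y n : ℕ → ℕ → ℝ → ℝ} (h : IsPeakonSolution K NX NY x m y n)
    (hNX : ∀ k, 1 ≤ k → k ≤ K → 1 ≤ NX k) (hNY : ∀ k, 1 ≤ k → k ≤ K → 1 ≤ NY k) (t : ℝ)
    (k l : ℕ) (hk : 1 ≤ k) (hkl : k ≤ l) (hl : l ≤ K) (i j : ℕ) (hi : 1 ≤ i) (hiN : i ≤ NX k)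
    (hj : 1 ≤ j) (hjN : j ≤ NY l) : x k i t < y l j t := by
  have hx := fun l (h1 : 1 ≤ l) (h2 : l ≤ K) => le_within NX (fun k i => x k i t) l
    fun i h3 h4 => h.x_lt_x l i t h1 h2 h3 h4
  have hy := fun l (h1 : 1 ≤ l) (h2 : l ≤ K) => le_within NY (fun k i => y k i t) l
    fun i h3 h4 => h.y_lt_y l i t h1 h2 h3 h4
  have key : ∀ l, k ≤ l → l ≤ K → x k i t < y l 1 t := by
    intro l hkl
    induction l, hkl using Nat.le_induction with
    | base =>
      intro hl
      exact (hx k hk hl i (NX k) hi hiN le_rfl).trans_lt (h.x_lt_y k t hk hl)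
    | succ l hkl ih =>
      intro hl
      have h1 := hy l (by omega) (by omega) 1 (NY l) le_rfl (hNY l (by omega) (by omega)) le_rfl
      have h2 := h.y_lt_x l t (by omega) hl
      have h3 := hx (l + 1) (by omega) hl 1 (NX (l + 1)) le_rfl (hNX _ (by omega) hl) le_rfl
      have h4 := h.x_lt_y (l + 1) t (by omega) hl
      exact ((((ih (by omega)).trans_le h1).trans h2).trans_le h3).trans h4
  exact (key l hkl hl).trans_le (hy l (by omega) hl 1 j le_rfl hj hjN)

theorem IsPeakonSolution.y_lt_x_of_lt {K : ℕ} {NX NY : ℕ → ℕ}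
    {x m y n : ℕ → ℕ → ℝ → ℝ} (h : IsPeakonSolution K NX NY x m y n)
    (hNX : ∀ k, 1 ≤ k → k ≤ K → 1 ≤ NX k) (hNY : ∀ k, 1 ≤ k → k ≤ K → 1 ≤ NY k) (t : ℝ)
    (k l : ℕ) (hk : 1 ≤ k) (hkl : k < l) (hl : l ≤ K) (i j : ℕ) (hi : 1 ≤ i) (hiN : i ≤ NY k)
    (hj : 1 ≤ j) (hjN : j ≤ NX l) : y k i t < x l j t := by
  have h1 := le_within NX (fun k i => x k i t) l
    (fun i h3 h4 => h.x_lt_x l i t (by omega) hl h3 h4) 1 j le_rfl hj hjN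
  have h2 := le_within NY (fun k i => y k i t) k
    (fun i h3 h4 => h.y_lt_y k i t (by omega) (by omega) h3 h4) i (NY k) hi hiN le_rfl
  have h3 := h.y_lt_x (l - 1) t (by omega) (by omega)
  rw [Nat.sub_add_cancel (by omega)] at h3
  rcases (show k ≤ l - 1 by omega).eq_or_lt with rfl | hlt
  · exact (h2.trans_lt h3).trans_le h1
  · have h4 := h.x_lt_y_of_le hNX hNY t (k + 1) (l - 1) (by omega) (by omega) (by omega) 1 (NY (l - 1))
      le_rfl (hNX _ (by omega) (by omega)) (hNY _ (by omega) (by omega)) le_rfl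
    have h5 := h.y_lt_x k t hk (by omega)
    exact (((h2.trans_lt h5).trans h4).trans h3).trans_le h1

theorem IsPeakonSolution.x_lt_x_lex {K : ℕ} {NX NY : ℕ → ℕ}
    {x m y n : ℕ → ℕ → ℝ → ℝ} (h : IsPeakonSolution K NX NY x m y n)
    (hNX : ∀ k, 1 ≤ k → k ≤ K → 1 ≤ NX k) (hNY : ∀ k, 1 ≤ k → k ≤ K → 1 ≤ NY k) (t : ℝ)
    (k l : ℕ) (hk : 1 ≤ k) (hl : l ≤ K) (i j : ℕ) (hi : 1 ≤ i) (hiN : i ≤ NX k)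
    (hj : 1 ≤ j) (hjN : j ≤ NX l) (hlt : k < l ∨ k = l ∧ i < j) : x k i t < x l j t := by
  rcases hlt with hlt | ⟨rfl, hlt⟩
  · exact (h.x_lt_y_of_le hNX hNY t k k hk le_rfl (by omega) i 1 hi hiN le_rfl
      (hNY k hk (by omega))).trans (h.y_lt_x_of_lt hNX hNY t k l hk hlt hl 1 j le_rfl
      (hNY k hk (by omega)) hj hjN)
  · exact lt_within NX (fun k i => x k i t) k (fun i h3 h4 => h.x_lt_x k i t hk hl h3 h4) i j hi
      hlt hjN

theorem IsPeakonSolution.y_lt_y_lex {K : ℕ} {NX NY : ℕ → ℕ}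
    {x m y n : ℕ → ℕ → ℝ → ℝ} (h : IsPeakonSolution K NX NY x m y n)
    (hNX : ∀ k, 1 ≤ k → k ≤ K → 1 ≤ NX k) (hNY : ∀ k, 1 ≤ k → k ≤ K → 1 ≤ NY k) (t : ℝ)
    (k l : ℕ) (hk : 1 ≤ k) (hl : l ≤ K) (i j : ℕ) (hi : 1 ≤ i) (hiN : i ≤ NY k)
    (hj : 1 ≤ j) (hjN : j ≤ NY l) (hlt : k < l ∨ k = l ∧ i < j) : y k i t < y l j t := by
  rcases hlt with hlt | ⟨rfl, hlt⟩
  · exact (h.y_lt_x_of_lt hNX hNY t k l hk hlt hl i 1 hi hiN le_rfl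
      (hNX l (by omega) hl)).trans (h.x_lt_y_of_le hNX hNY t l l (by omega) le_rfl hl 1 j le_rfl
      (hNX l (by omega) hl) hj hjN)
  · exact lt_within NY (fun k i => y k i t) k (fun i h3 h4 => h.y_lt_y k i t hk hl h3 h4) i j hi
      hlt hjN

/-- A multipeakon solution in polynomial form. -/
theorem IsPeakonSolution.isPolynomialSolution {K : ℕ} {NX NY : ℕ → ℕ}
    {x m y n : ℕ → ℕ → ℝ → ℝ} (h : IsPeakonSolution K NX NY x m y n)
    (hNX : ∀ k, 1 ≤ k → k ≤ K → 1 ≤ NX k) (hNY : ∀ k, 1 ≤ k → k ≤ K → 1 ≤ NY k) :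
    IsPolynomialSolution K NX NY (fun k i t => 2 * m k i t * Real.exp (-x k i t))
      (fun k i t => m k i t * Real.exp (x k i t))
      (fun k i t => 2 * n k i t * Real.exp (-y k i t))
      (fun k i t => n k i t * Real.exp (y k i t)) := by
  have xx := fun t => h.x_lt_x_lex hNX hNY t
  have yy := fun t => h.y_lt_y_lex hNX hNY t
  have xy := fun t => h.x_lt_y_of_le hNX hNY t
  have yx := fun t => h.y_lt_x_of_lt hNX hNY t
  have hX : ∀ k i t, 1 ≤ k → k ≤ K → 1 ≤ i → i ≤ NX k → _ := fun k i t hk hkK hi1 hi =>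
    hasDerivAt_peak K NX (fun k i => 2 * m k i t * Real.exp (-x k i t))
      (fun k i => m k i t * Real.exp (x k i t))
      (sumLeft NY (fun k i => n k i t * Real.exp (y k i t)) k 0)
      (sumRight K NY (fun k i => 2 * n k i t * Real.exp (-y k i t)) k 0) _ _ _ _ k i hi1 hi
      (x k i) (m k i) t (h.x_ode k i t hk hkK hi1 hi) (h.m_ode k i t hk hkK hi1 hi) rfl rfl
      (wave_eq K NX x m t _ k i hk hkK hi
        (fun l r h1 h2 h3 => by
          rcases h3 with h3 | ⟨rfl, h3⟩
          · exact (xx t l k h1 hkK r i h2 h3.2 hi1 hi (Or.inl h3.1)).le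
          · rcases h3.eq_or_lt with rfl | h3
            · exact le_rfl
            · exact (xx t l l h1 hkK r i h2 (by omega) hi1 hi (Or.inr ⟨rfl, h3⟩)).le)
        (fun l r h1 h2 h3 h4 => (xx t k l hk h1 i r hi1 hi h2 h3 (by omega)).le))
      (waveDeriv_peak K NX x m t k i hk hkK hi1 hi
        (fun l r h1 h2 h3 => by
          rcases h3 with h3 | ⟨rfl, h3⟩
          · exact xx t l k h1 hkK r i h2 h3.2 hi1 hi (Or.inl h3.1)
          · exact xx t l l h1 hkK r i h2 (by omega) hi1 hi (Or.inr ⟨rfl, by omega⟩))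
        (fun l r h1 h2 h3 h4 => xx t k l hk h1 i r hi1 hi h2 h3 (by omega)))
      (wave_eq K NY y n t _ k 0 hk hkK (by omega)
        (fun l r h1 h2 h3 => by
          rcases h3 with h3 | ⟨rfl, h3⟩
          · exact (yx t l k h1 h3.1 hkK r i h2 h3.2 hi1 hi).le
          · omega)
        (fun l r h1 h2 h3 h4 => (xy t k l hk (by omega) h1 i r hi1 hi h2 h3).le))
      (waveDeriv_eq K NY y n t _ k 0 hk hkK (by omega)
        (fun l r h1 h2 h3 => by
          rcases h3 with h3 | ⟨rfl, h3⟩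
          · exact yx t l k h1 h3.1 hkK r i h2 h3.2 hi1 hi
          · omega)
        (fun l r h1 h2 h3 h4 => xy t k l hk (by omega) h1 i r hi1 hi h2 h3))
  have hY : ∀ k i t, 1 ≤ k → k ≤ K → 1 ≤ i → i ≤ NY k → _ := fun k i t hk hkK hi1 hi =>
    hasDerivAt_peak K NY (fun k i => 2 * n k i t * Real.exp (-y k i t))
      (fun k i => n k i t * Real.exp (y k i t))
      (sumLeft NX (fun k i => m k i t * Real.exp (x k i t)) k (NX k))
      (sumRight K NX (fun k i => 2 * m k i t * Real.exp (-x k i t)) k (NX k)) _ _ _ _ k i hi1 hi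
      (y k i) (n k i) t
      -- `hasDerivAt_peak` takes the peak's own wave first, so for a Y-peakon the two waves change
      -- roles.
      ((h.y_ode k i t hk hkK hi1 hi).congr_deriv (mul_comm _ _))
      ((h.n_ode k i t hk hkK hi1 hi).congr_deriv
        (g' := n k i t * (wave K NY y n t (y k i t) * waveDeriv K NX x m t (y k i t)
          - 2 * waveDeriv K NY y n t (y k i t) * wave K NX x m t (y k i t))) (by ring)) rfl rfl
      (wave_eq K NY y n t _ k i hk hkK hi
        (fun l r h1 h2 h3 => by
          rcases h3 with h3 | ⟨rfl, h3⟩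
          · exact (yy t l k h1 hkK r i h2 h3.2 hi1 hi (Or.inl h3.1)).le
          · rcases h3.eq_or_lt with rfl | h3
            · exact le_rfl
            · exact (yy t l l h1 hkK r i h2 (by omega) hi1 hi (Or.inr ⟨rfl, h3⟩)).le)
        (fun l r h1 h2 h3 h4 => (yy t k l hk h1 i r hi1 hi h2 h3 (by omega)).le))
      (waveDeriv_peak K NY y n t k i hk hkK hi1 hi
        (fun l r h1 h2 h3 => by
          rcases h3 with h3 | ⟨rfl, h3⟩
          · exact yy t l k h1 hkK r i h2 h3.2 hi1 hi (Or.inl h3.1)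
          · exact yy t l l h1 hkK r i h2 (by omega) hi1 hi (Or.inr ⟨rfl, by omega⟩))
        (fun l r h1 h2 h3 h4 => yy t k l hk h1 i r hi1 hi h2 h3 (by omega)))
      (wave_eq K NX x m t _ k (NX k) hk hkK le_rfl
        (fun l r h1 h2 h3 => by
          rcases h3 with h3 | ⟨rfl, h3⟩
          · exact (xy t l k h1 h3.1.le hkK r i h2 h3.2 hi1 hi).le
          · exact (xy t l l h1 le_rfl hkK r i h2 h3 hi1 hi).le)
        (fun l r h1 h2 h3 h4 => (yx t k l hk (by rcases h4 with h4 | ⟨rfl, h4⟩ <;> omega) h1 i r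
          hi1 hi h2 h3).le))
      (waveDeriv_eq K NX x m t _ k (NX k) hk hkK le_rfl
        (fun l r h1 h2 h3 => by
          rcases h3 with h3 | ⟨rfl, h3⟩
          · exact xy t l k h1 h3.1.le hkK r i h2 h3.2 hi1 hi
          · exact xy t l l h1 le_rfl hkK r i h2 h3 hi1 hi)
        (fun l r h1 h2 h3 h4 => yx t k l hk (by rcases h4 with h4 | ⟨rfl, h4⟩ <;> omega) h1 i r
          hi1 hi h2 h3))
  exact ⟨fun k i t h1 h2 h3 h4 => (hX k i t h1 h2 h3 h4).1,
    fun k i t h1 h2 h3 h4 => (hX k i t h1 h2 h3 h4).2,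
    fun k i t h1 h2 h3 h4 => (hY k i t h1 h2 h3 h4).1,
    fun k i t h1 h2 h3 h4 => (hY k i t h1 h2 h3 h4).2⟩

end Ordering

end GengXue

end

/-! ### Uniqueness for the polynomial system. -/

noncomputable section

namespace GengXue

open Finset

/-- Global uniqueness for an autonomous equation with continuously differentiable right-hand
side. -/
theorem eq_of_hasDerivAt_of_contDiff {E : Type*} [NormedAddCommGroup E] [NormedSpace ℝ E]
    {F : E → E} (hF : ContDiff ℝ 1 F) {f g : ℝ → E} (hf : ∀ t, HasDerivAt f (F (f t)) t)
    (hg : ∀ t, HasDerivAt g (F (g t)) t) {t₀ : ℝ} (h : f t₀ = g t₀) : f = g := by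
  have cf : Continuous f := continuous_iff_continuousAt.2 fun t => (hf t).continuousAt
  have cg : Continuous g := continuous_iff_continuousAt.2 fun t => (hg t).continuousAt
  have hopen : IsOpen {t | f t = g t} := by
    rw [isOpen_iff_mem_nhds]
    intro t ht
    -- A neighbourhood of the common value on which the field is Lipschitz contains both curves for
    -- nearby times, so local uniqueness shows that the coincidence set is open. It is also closed,
    -- and the line is connected.
    obtain ⟨C, s, hs, hL⟩ := hF.locallyLipschitz (f t)
    exact ODE_solution_unique_of_eventually (v := fun _ => F) (s := fun _ => s) (K := C)
      (Filter.Eventually.of_forall fun _ => hL)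
      ((cf.continuousAt.eventually hs).mono fun u hu => ⟨hf u, hu⟩)
      ((cg.continuousAt.eventually (by rw [← ht]; exact hs)).mono fun u hu => ⟨hg u, hu⟩) ht
  have huniv := IsClopen.eq_univ ⟨isClosed_eq cf cg, hopen⟩ ⟨t₀, h⟩
  funext t
  exact huniv.ge (Set.mem_univ t)

theorem contDiff_sumLeft {E : Type*} [NormedAddCommGroup E] [NormedSpace ℝ E] (N : ℕ → ℕ)
    (f : E → ℕ → ℕ → ℝ) (hf : ∀ k i, ContDiff ℝ 1 fun z => f z k i) (k i : ℕ) :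
    ContDiff ℝ 1 fun z => sumLeft N (f z) k i :=
  (ContDiff.sum fun l _ => ContDiff.sum fun r _ => hf l r).add (ContDiff.sum fun r _ => hf k r)

theorem contDiff_sumRight {E : Type*} [NormedAddCommGroup E] [NormedSpace ℝ E] (K : ℕ)
    (N : ℕ → ℕ) (f : E → ℕ → ℕ → ℝ) (hf : ∀ k i, ContDiff ℝ 1 fun z => f z k i) (k i : ℕ) :
    ContDiff ℝ 1 fun z => sumRight K N (f z) k i :=
  (ContDiff.sum fun l _ => ContDiff.sum fun r _ => hf l r).add (ContDiff.sum fun r _ => hf k r)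

theorem contDiff_placeRate {E : Type*} [NormedAddCommGroup E] [NormedSpace ℝ E] (K : ℕ)
    (N : ℕ → ℕ) (q v : E → ℕ → ℕ → ℝ) (C D : E → ℝ) (hq : ∀ k i, ContDiff ℝ 1 fun z => q z k i)
    (hv : ∀ k i, ContDiff ℝ 1 fun z => v z k i) (hC : ContDiff ℝ 1 C) (hD : ContDiff ℝ 1 D)
    (k i : ℕ) : ContDiff ℝ 1 fun z => placeRate K N (q z) (v z) (C z) (D z) k i :=
  ((contDiff_sumLeft N v hv k i).mul hD).sub ((contDiff_sumRight K N q hq k i).mul hC)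

theorem contDiff_momentRate {E : Type*} [NormedAddCommGroup E] [NormedSpace ℝ E] (K : ℕ)
    (N : ℕ → ℕ) (q v : E → ℕ → ℕ → ℝ) (C D : E → ℝ) (hq : ∀ k i, ContDiff ℝ 1 fun z => q z k i)
    (hv : ∀ k i, ContDiff ℝ 1 fun z => v z k i) (hC : ContDiff ℝ 1 C) (hD : ContDiff ℝ 1 D)
    (k i : ℕ) : ContDiff ℝ 1 fun z => momentRate K N (q z) (v z) (C z) (D z) k i :=
  ((contDiff_placeRate K N q v C D hq hv hC hD k i).mul (contDiff_sumLeft N v hv k i)).sub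
    ((contDiff_placeRate K N q v C D hq hv hC hD k (i - 1)).mul
      (contDiff_sumLeft N v hv k (i - 1)))

theorem contDiff_massRate {E : Type*} [NormedAddCommGroup E] [NormedSpace ℝ E] (K : ℕ)
    (N : ℕ → ℕ) (q v : E → ℕ → ℕ → ℝ) (C D : E → ℝ) (hq : ∀ k i, ContDiff ℝ 1 fun z => q z k i)
    (hv : ∀ k i, ContDiff ℝ 1 fun z => v z k i) (hC : ContDiff ℝ 1 C) (hD : ContDiff ℝ 1 D)
    (k i : ℕ) : ContDiff ℝ 1 fun z => massRate K N (q z) (v z) (C z) (D z) k i :=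
  ((contDiff_placeRate K N q v C D hq hv hC hD k (i - 1)).mul
      (contDiff_sumRight K N q hq k (i - 1))).sub
    ((contDiff_placeRate K N q v C D hq hv hC hD k i).mul (contDiff_sumRight K N q hq k i))

theorem placeRate_congr {K : ℕ} {N : ℕ → ℕ} {q v q' v' : ℕ → ℕ → ℝ} {C D C' D' : ℝ} {k i : ℕ}
    (hq : ∀ l r, 1 ≤ l → l ≤ K → 1 ≤ r → r ≤ N l → q l r = q' l r)
    (hv : ∀ l r, 1 ≤ l → l ≤ K → 1 ≤ r → r ≤ N l → v l r = v' l r) (hC : C = C') (hD : D = D')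
    (hk : 1 ≤ k) (hkK : k ≤ K) (hi : i ≤ N k) :
    placeRate K N q v C D k i = placeRate K N q' v' C' D' k i ∧
    sumLeft N v k i = sumLeft N v' k i ∧ sumRight K N q k i = sumRight K N q' k i := by
  have h1 : sumLeft N v k i = sumLeft N v' k i := sumLeft_congr (fun l r h1 h2 h3 => by
    rcases h3 with h3 | ⟨rfl, h3⟩
    · exact hv l r h1 (by omega) h2 h3.2
    · exact hv l r h1 hkK h2 (by omega)) hk
  have h2 : sumRight K N q k i = sumRight K N q' k i := sumRight_congr (fun l r h1 h2 h3 h4 =>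
    hq l r (by omega) h1 h2 h3) hkK
  exact ⟨by rw [placeRate, placeRate, h1, h2, hC, hD], h1, h2⟩

/-- A family on a box, extended by zero. -/
def extendBox {A B : ℕ} (w : Fin A → Fin B → ℝ) (k i : ℕ) : ℝ :=
  if h : k < A ∧ i < B then w ⟨k, h.1⟩ ⟨i, h.2⟩ else 0

/-- The members of a family in groups, as a family on a box. -/
def restrictBox (A B : ℕ) (N : ℕ → ℕ) (f : ℕ → ℕ → ℝ) (k : Fin A) (i : Fin B) : ℝ :=
  if 1 ≤ (k : ℕ) ∧ 1 ≤ (i : ℕ) ∧ (i : ℕ) ≤ N k then f k i else 0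

/-- The families are indexed by all natural numbers, while uniqueness is applied in a normed space.
A box large enough for all groups is used, with zeros at the irrelevant indices, where the vector
field vanishes too. -/
theorem extendBox_restrictBox {A B : ℕ} {N : ℕ → ℕ} (f : ℕ → ℕ → ℝ) {k i : ℕ} (hk : 1 ≤ k)
    (hkA : k < A) (hi : 1 ≤ i) (hiN : i ≤ N k) (hB : N k < B) :
    extendBox (restrictBox A B N f) k i = f k i := by
  have : k < A ∧ i < B := ⟨hkA, by omega⟩
  simp [extendBox, restrictBox, this, hk, hi, hiN]

theorem contDiff_extendBox {E : Type*} [NormedAddCommGroup E] [NormedSpace ℝ E] {A B : ℕ}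
    (w : E → Fin A → Fin B → ℝ) (hw : ContDiff ℝ 1 w) (k i : ℕ) :
    ContDiff ℝ 1 fun z => extendBox (w z) k i := by
  unfold extendBox
  split_ifs with h
  · exact contDiff_pi.1 (contDiff_pi.1 hw ⟨k, h.1⟩) ⟨i, h.2⟩
  · exact contDiff_const

theorem contDiff_restrictBox {E : Type*} [NormedAddCommGroup E] [NormedSpace ℝ E] (A B : ℕ)
    (N : ℕ → ℕ) (f : E → ℕ → ℕ → ℝ) (hf : ∀ k i, ContDiff ℝ 1 fun z => f z k i) :
    ContDiff ℝ 1 fun z => restrictBox A B N (f z) := by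
  refine contDiff_pi.2 fun k => contDiff_pi.2 fun i => ?_
  unfold restrictBox
  split_ifs
  · exact hf k i
  · exact contDiff_const

theorem hasDerivAt_restrictBox (A B : ℕ) (N : ℕ → ℕ) (f : ℝ → ℕ → ℕ → ℝ) (f' g : ℕ → ℕ → ℝ)
    (t : ℝ)
    (hf : ∀ k i, 1 ≤ k → k < A → 1 ≤ i → i ≤ N k → HasDerivAt (fun t => f t k i) (f' k i) t)
    (hg : ∀ k i, 1 ≤ k → k < A → 1 ≤ i → i ≤ N k → f' k i = g k i) :
    HasDerivAt (fun t => restrictBox A B N (f t)) (restrictBox A B N g) t := by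
  refine hasDerivAt_pi.2 fun k => hasDerivAt_pi.2 fun i => ?_
  unfold restrictBox
  split_ifs with h
  · rw [← hg k i h.1 k.2 h.2.1 h.2.2]
    exact hf k i h.1 k.2 h.2.1 h.2.2
  · exact hasDerivAt_const _ _

/-- The state space of the polynomial equations. -/
abbrev BoxState (A B : ℕ) : Type :=
  ((Fin A → Fin B → ℝ) × (Fin A → Fin B → ℝ)) × ((Fin A → Fin B → ℝ) × (Fin A → Fin B → ℝ))

/-- The vector field of the polynomial equations. -/
def polyField (K B : ℕ) (NX NY : ℕ → ℕ) (w : BoxState (K + 1) B) : BoxState (K + 1) B :=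
  ((restrictBox _ _ NX fun k i => massRate K NX (extendBox w.1.1) (extendBox w.1.2)
      (sumLeft NY (extendBox w.2.2) k 0) (sumRight K NY (extendBox w.2.1) k 0) k i,
    restrictBox _ _ NX fun k i => momentRate K NX (extendBox w.1.1) (extendBox w.1.2)
      (sumLeft NY (extendBox w.2.2) k 0) (sumRight K NY (extendBox w.2.1) k 0) k i),
   (restrictBox _ _ NY fun k i => massRate K NY (extendBox w.2.1) (extendBox w.2.2)
      (sumLeft NX (extendBox w.1.2) k (NX k)) (sumRight K NX (extendBox w.1.1) k (NX k)) k i,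
    restrictBox _ _ NY fun k i => momentRate K NY (extendBox w.2.1) (extendBox w.2.2)
      (sumLeft NX (extendBox w.1.2) k (NX k)) (sumRight K NX (extendBox w.1.1) k (NX k)) k i))

theorem contDiff_polyField (K B : ℕ) (NX NY : ℕ → ℕ) : ContDiff ℝ 1 (polyField K B NX NY) := by
  have e1 := contDiff_extendBox (fun w : BoxState (K + 1) B => w.1.1) (by fun_prop)
  have e2 := contDiff_extendBox (fun w : BoxState (K + 1) B => w.1.2) (by fun_prop)
  have e3 := contDiff_extendBox (fun w : BoxState (K + 1) B => w.2.1) (by fun_prop)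
  have e4 := contDiff_extendBox (fun w : BoxState (K + 1) B => w.2.2) (by fun_prop)
  refine ((contDiff_restrictBox _ _ _ _ fun k i => ?_).prodMk
    (contDiff_restrictBox _ _ _ _ fun k i => ?_)).prodMk
    ((contDiff_restrictBox _ _ _ _ fun k i => ?_).prodMk
    (contDiff_restrictBox _ _ _ _ fun k i => ?_))
  · exact contDiff_massRate _ _ _ _ _ _ e1 e2 (contDiff_sumLeft _ _ e4 _ _)
      (contDiff_sumRight _ _ _ e3 _ _) k i
  · exact contDiff_momentRate _ _ _ _ _ _ e1 e2 (contDiff_sumLeft _ _ e4 _ _)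
      (contDiff_sumRight _ _ _ e3 _ _) k i
  · exact contDiff_massRate _ _ _ _ _ _ e3 e4 (contDiff_sumLeft _ _ e2 _ _)
      (contDiff_sumRight _ _ _ e1 _ _) k i
  · exact contDiff_momentRate _ _ _ _ _ _ e3 e4 (contDiff_sumLeft _ _ e2 _ _)
      (contDiff_sumRight _ _ _ e1 _ _) k i

/-- The state of a solution. -/
def boxState (K B : ℕ) (NX NY : ℕ → ℕ) (q v p z : ℕ → ℕ → ℝ → ℝ) (t : ℝ) : BoxState (K + 1) B :=
  ((restrictBox _ _ NX fun k i => q k i t, restrictBox _ _ NX fun k i => v k i t),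
   (restrictBox _ _ NY fun k i => p k i t, restrictBox _ _ NY fun k i => z k i t))

theorem IsPolynomialSolution.hasDerivAt_boxState {K B : ℕ} {NX NY : ℕ → ℕ}
    {q v p z : ℕ → ℕ → ℝ → ℝ} (h : IsPolynomialSolution K NX NY q v p z)
    (hB : ∀ k ≤ K, NX k < B ∧ NY k < B) (t : ℝ) :
    HasDerivAt (boxState K B NX NY q v p z)
      (polyField K B NX NY (boxState K B NX NY q v p z t)) t := by
  set w := boxState K B NX NY q v p z t with hw
  have eX : ∀ f : ℕ → ℕ → ℝ, ∀ l r, 1 ≤ l → l ≤ K → 1 ≤ r → r ≤ NX l →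
      f l r = extendBox (restrictBox (K + 1) B NX f) l r := fun f l r h1 h2 h3 h4 =>
    (extendBox_restrictBox f h1 (by omega) h3 h4 (hB l h2).1).symm
  have eY : ∀ f : ℕ → ℕ → ℝ, ∀ l r, 1 ≤ l → l ≤ K → 1 ≤ r → r ≤ NY l →
      f l r = extendBox (restrictBox (K + 1) B NY f) l r := fun f l r h1 h2 h3 h4 =>
    (extendBox_restrictBox f h1 (by omega) h3 h4 (hB l h2).2).symm
  have q' := eX fun k i => q k i t
  have v' := eX fun k i => v k i t
  have p' := eY fun k i => p k i t
  have z' := eY fun k i => z k i t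
  -- The inner uses with C = D = 0 serve only to compare the sums over the other family, which then
  -- appear as C and D of the outer one.
  have cX : ∀ k i, 1 ≤ k → k ≤ K → i ≤ NX k → _ := fun k i hk hkK hi =>
    placeRate_congr q' v' (placeRate_congr (C := 0) (D := 0) p' z' rfl rfl hk hkK (Nat.zero_le _)).2.1
      (placeRate_congr (C := 0) (D := 0) p' z' rfl rfl hk hkK (Nat.zero_le _)).2.2 hk hkK hi
  have cY : ∀ k i, 1 ≤ k → k ≤ K → i ≤ NY k → _ := fun k i hk hkK hi =>
    placeRate_congr p' z' (placeRate_congr (C := 0) (D := 0) q' v' rfl rfl hk hkK le_rfl).2.1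
      (placeRate_congr (C := 0) (D := 0) q' v' rfl rfl hk hkK le_rfl).2.2 hk hkK hi
  refine ((hasDerivAt_restrictBox _ _ _ (fun t k i => q k i t) _ _ t
    (fun k i h1 h2 h3 h4 => h.q_ode k i t h1 (by omega) h3 h4) ?_).prodMk
    (hasDerivAt_restrictBox _ _ _ (fun t k i => v k i t) _ _ t
    (fun k i h1 h2 h3 h4 => h.v_ode k i t h1 (by omega) h3 h4) ?_)).prodMk
    ((hasDerivAt_restrictBox _ _ _ (fun t k i => p k i t) _ _ t
    (fun k i h1 h2 h3 h4 => h.p_ode k i t h1 (by omega) h3 h4) ?_).prodMk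
    (hasDerivAt_restrictBox _ _ _ (fun t k i => z k i t) _ _ t
    (fun k i h1 h2 h3 h4 => h.z_ode k i t h1 (by omega) h3 h4) ?_))
  · intro k i h1 h2 h3 h4
    obtain ⟨a1, a2, a3⟩ := cX k i h1 (by omega) h4
    obtain ⟨b1, b2, b3⟩ := cX k (i - 1) h1 (by omega) (by omega)
    rw [massRate, a1, b1, a3, b3]
    rfl
  · intro k i h1 h2 h3 h4
    obtain ⟨a1, a2, a3⟩ := cX k i h1 (by omega) h4
    obtain ⟨b1, b2, b3⟩ := cX k (i - 1) h1 (by omega) (by omega)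
    rw [momentRate, a1, b1, a2, b2]
    rfl
  · intro k i h1 h2 h3 h4
    obtain ⟨a1, a2, a3⟩ := cY k i h1 (by omega) h4
    obtain ⟨b1, b2, b3⟩ := cY k (i - 1) h1 (by omega) (by omega)
    rw [massRate, a1, b1, a3, b3]
    rfl
  · intro k i h1 h2 h3 h4
    obtain ⟨a1, a2, a3⟩ := cY k i h1 (by omega) h4
    obtain ⟨b1, b2, b3⟩ := cY k (i - 1) h1 (by omega) (by omega)
    rw [momentRate, a1, b1, a2, b2]
    rfl

/-- Polynomial solutions are determined by their values at one time. -/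
theorem IsPolynomialSolution.unique {K : ℕ} {NX NY : ℕ → ℕ} {q v p z q' v' p' z' : ℕ → ℕ → ℝ → ℝ}
    (h : IsPolynomialSolution K NX NY q v p z) (h' : IsPolynomialSolution K NX NY q' v' p' z')
    {t₀ : ℝ}
    (hX : ∀ k i, 1 ≤ k → k ≤ K → 1 ≤ i → i ≤ NX k → q k i t₀ = q' k i t₀ ∧ v k i t₀ = v' k i t₀)
    (hY : ∀ k i, 1 ≤ k → k ≤ K → 1 ≤ i → i ≤ NY k → p k i t₀ = p' k i t₀ ∧ z k i t₀ = z' k i t₀)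
    (t : ℝ) :
    (∀ k i, 1 ≤ k → k ≤ K → 1 ≤ i → i ≤ NX k → q k i t = q' k i t ∧ v k i t = v' k i t) ∧
    (∀ k i, 1 ≤ k → k ≤ K → 1 ≤ i → i ≤ NY k → p k i t = p' k i t ∧ z k i t = z' k i t) := by
  obtain ⟨B, hB⟩ : ∃ B, ∀ k ≤ K, NX k < B ∧ NY k < B := by
    -- The total number of peakons plus one exceeds every group size.
    refine ⟨∑ l ∈ range (K + 1), (NX l + NY l) + 1, fun k hk => ?_⟩
    have := single_le_sum (f := fun l => NX l + NY l) (fun _ _ => Nat.zero_le _)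
      (mem_range.2 (show k < K + 1 by omega))
    omega
  have cong : ∀ (N : ℕ → ℕ) (f g : ℕ → ℕ → ℝ),
      (∀ k i, 1 ≤ k → k ≤ K → 1 ≤ i → i ≤ N k → f k i = g k i) →
      restrictBox (K + 1) B N f = restrictBox (K + 1) B N g := by
    intro N f g hfg
    funext k i
    unfold restrictBox
    split_ifs with hc
    · exact hfg k i hc.1 (by omega) hc.2.1 hc.2.2
    · rfl
  have h0 : boxState K B NX NY q v p z t₀ = boxState K B NX NY q' v' p' z' t₀ := by
    unfold boxState
    rw [cong NX _ _ fun k i h1 h2 h3 h4 => (hX k i h1 h2 h3 h4).1,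
      cong NX _ _ fun k i h1 h2 h3 h4 => (hX k i h1 h2 h3 h4).2,
      cong NY _ _ fun k i h1 h2 h3 h4 => (hY k i h1 h2 h3 h4).1,
      cong NY _ _ fun k i h1 h2 h3 h4 => (hY k i h1 h2 h3 h4).2]
  have main := congrFun (eq_of_hasDerivAt_of_contDiff (contDiff_polyField K B NX NY)
    (h.hasDerivAt_boxState hB) (h'.hasDerivAt_boxState hB) h0) t
  unfold boxState at main
  simp only [Prod.mk.injEq] at main
  have back : ∀ (N : ℕ → ℕ) (f g : ℕ → ℕ → ℝ),
      restrictBox (K + 1) B N f = restrictBox (K + 1) B N g → (∀ k ≤ K, N k < B) →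
      ∀ k i, 1 ≤ k → k ≤ K → 1 ≤ i → i ≤ N k → f k i = g k i := by
    intro N f g hfg hN k i h1 h2 h3 h4
    rw [← extendBox_restrictBox f h1 (Nat.lt_succ_of_le h2) h3 h4 (hN k h2), hfg,
      extendBox_restrictBox g h1 (Nat.lt_succ_of_le h2) h3 h4 (hN k h2)]
  have bX : ∀ k ≤ K, NX k < B := fun k hk => (hB k hk).1
  have bY : ∀ k ≤ K, NY k < B := fun k hk => (hB k hk).2
  exact ⟨fun k i h1 h2 h3 h4 => ⟨back NX _ _ main.1.1 bX k i h1 h2 h3 h4,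
      back NX _ _ main.1.2 bX k i h1 h2 h3 h4⟩,
    fun k i h1 h2 h3 h4 => ⟨back NY _ _ main.2.1 bY k i h1 h2 h3 h4,
      back NY _ _ main.2.2 bY k i h1 h2 h3 h4⟩⟩

end GengXue

end

/-! ### The sums J of the parameters: translation, positivity, boundary cases. -/

noncomputable section

namespace GengXue

open Finset

namespace Params

/-- The eigenvalues as point data. -/
def data (P : Params) : PointData := ⟨P.lam, P.mu, Icc 1 P.K, Icc 1 (P.K - 1)⟩

theorem lt_of_step_lt {f : ℕ → ℝ} {n : ℕ} (h : ∀ i, 1 ≤ i → i + 1 ≤ n → f i < f (i + 1)) {i j : ℕ}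
    (hi : 1 ≤ i) (hij : i < j) (hj : j ≤ n) : f i < f j :=
  lt_within (fun _ => n) (fun _ => f) 0 h i j hi hij hj

theorem injOn_of_step_lt {f : ℕ → ℝ} {n : ℕ} (h : ∀ i, 1 ≤ i → i + 1 ≤ n → f i < f (i + 1)) :
    Set.InjOn f (Icc 1 n) := by
  intro i hi j hj hij
  simp only [coe_Icc, Set.mem_Icc] at hi hj
  rcases lt_trichotomy i j with hlt | rfl | hlt
  · exact absurd hij (lt_of_step_lt h hi.1 hlt hj.2).ne
  · rfl
  · exact absurd hij (lt_of_step_lt h hj.1 hlt hi.2).ne'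

theorem Admissible.data_valid {P : Params} (hP : P.Admissible) : P.data.Valid where
  injx := injOn_of_step_lt hP.lam_lt
  injy := injOn_of_step_lt hP.mu_lt
  posx := fun i hi => hP.lam_pos i (mem_Icc.1 hi).1 (mem_Icc.1 hi).2
  posy := fun i hi => hP.mu_pos i (mem_Icc.1 hi).1 (mem_Icc.1 hi).2

/-- The convention that J vanishes outside the index range is automatic for `jW`, since no subsets
of such cardinality exist. -/
theorem J_eq_jW (P : Params) (hK : 1 ≤ P.K) (t : ℝ) (r s : ℕ) (i j : ℤ) :
    P.J t r s i j = P.data.jW (P.a t) (P.b t) (fun z => z ^ r) (fun z => z ^ s) i j := by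
  have hcard : ∀ (S : Finset ℕ) (n : ℤ), 0 ≤ n → S.powersetCard n.toNat = cardSub S n := by
    intro S n hn
    ext I
    rw [mem_powersetCard, mem_cardSub]
    refine and_congr_right fun _ => ?_
    omega
  have hempty : ∀ (S : Finset ℕ) (n : ℤ), (n < 0 ∨ (S.card : ℤ) < n) → cardSub S n = ∅ := by
    intro S n hn
    ext I
    rw [mem_cardSub]
    simp only [notMem_empty, iff_false, not_and]
    intro hI
    have := card_le_card hI
    omega
  unfold J PointData.jW jSum
  split_ifs with h
  · rw [hcard _ _ h.1, hcard _ _ h.2.2.1]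
    rfl
  · by_cases h1 : 0 ≤ i ∧ i ≤ P.K
    · rw [sum_eq_zero]
      intro I _
      rw [show cardSub P.data.J j = ∅ from hempty _ _ (by simp [data]; omega), sum_empty]
    · rw [show cardSub P.data.I i = ∅ from hempty _ _ (by simp [data]; omega), sum_empty]

theorem jW_one_one (P : Params) (hK : 1 ≤ P.K) (t : ℝ) (i j : ℤ) :
    P.data.jW (P.a t) (P.b t) 1 1 i j = P.J t 0 0 i j := by
  rw [P.J_eq_jW hK]
  congr 1

theorem jW_id_one (P : Params) (hK : 1 ≤ P.K) (t : ℝ) (i j : ℤ) :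
    P.data.jW (P.a t) (P.b t) id 1 i j = P.J t 1 0 i j := by
  rw [P.J_eq_jW hK]
  simp only [pow_one, pow_zero]
  rfl

theorem jW_one_id (P : Params) (hK : 1 ≤ P.K) (t : ℝ) (i j : ℤ) :
    P.data.jW (P.a t) (P.b t) 1 id i j = P.J t 0 1 i j := by
  rw [P.J_eq_jW hK]
  simp only [pow_one, pow_zero]
  rfl

theorem jW_id_id (P : Params) (hK : 1 ≤ P.K) (t : ℝ) (i j : ℤ) :
    P.data.jW (P.a t) (P.b t) id id i j = P.J t 1 1 i j := by
  rw [P.J_eq_jW hK]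
  simp only [pow_one]
  rfl

theorem jW_eq_zero (P : Params) (w v : ℕ → ℝ) (f g : ℝ → ℝ) (i j : ℤ)
    (h : i < 0 ∨ (P.K : ℤ) < i ∨ j < 0) : P.data.jW w v f g i j = 0 := by
  unfold PointData.jW jSum
  refine sum_eq_zero fun I hI => sum_eq_zero fun J hJ => ?_
  rw [mem_cardSub] at hI hJ
  have := card_le_card hI.1
  simp [data] at this
  omega

theorem Admissible.a_pos {P : Params} (hP : P.Admissible) (t : ℝ) (i : ℕ) (h1 : 1 ≤ i)
    (h2 : i ≤ P.K) : 0 < P.a t i := mul_pos (hP.a0_pos i h1 h2) (Real.exp_pos _)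

theorem Admissible.b_pos {P : Params} (hP : P.Admissible) (t : ℝ) (i : ℕ) (h1 : 1 ≤ i)
    (h2 : i ≤ P.K - 1) : 0 < P.b t i := mul_pos (hP.b0_pos i h1 h2) (Real.exp_pos _)

theorem Admissible.Psi_pos {P : Params} (hP : P.Admissible) {I J : Finset ℕ} (hI : I ⊆ Icc 1 P.K)
    (hJ : J ⊆ Icc 1 (P.K - 1)) : 0 < P.Psi I J := by
  have hV := hP.data_valid
  unfold Psi
  refine div_pos (mul_pos ?_ ?_) ?_
  · refine prod_pos fun p hp => prod_pos fun q hq => ?_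
    rw [mem_filter] at hq
    refine pow_pos_of_ne (sub_ne_zero.2 fun h => ?_)
    exact hq.2.ne (hV.injx (hI hp) (hI hq.1) h)
  · refine prod_pos fun p hp => prod_pos fun q hq => ?_
    rw [mem_filter] at hq
    refine pow_pos_of_ne (sub_ne_zero.2 fun h => ?_)
    exact hq.2.ne (hV.injy (hJ hp) (hJ hq.1) h)
  · exact prod_pos fun p hp => prod_pos fun q hq => add_pos (hV.posx p (hI hp)) (hV.posy q (hJ hq))
where
  pow_pos_of_ne {z : ℝ} (h : z ≠ 0) : 0 < z ^ 2 := by positivity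

/-- The summand of `J`. -/
def term (P : Params) (t : ℝ) (r s : ℕ) (I J : Finset ℕ) : ℝ :=
  P.Psi I J * (∏ p ∈ I, P.lam p ^ r * P.a t p) * (∏ q ∈ J, P.mu q ^ s * P.b t q)

theorem Admissible.term_pos {P : Params} (hP : P.Admissible) (t : ℝ) (r s : ℕ) {I J : Finset ℕ}
    (hI : I ⊆ Icc 1 P.K) (hJ : J ⊆ Icc 1 (P.K - 1)) : 0 < P.term t r s I J := by
  refine mul_pos (mul_pos (hP.Psi_pos hI hJ) (prod_pos fun p hp => ?_)) (prod_pos fun p hp => ?_)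
  · have := mem_Icc.1 (hI hp)
    exact mul_pos (pow_pos (hP.lam_pos p this.1 this.2) r) (hP.a_pos t p this.1 this.2)
  · have := mem_Icc.1 (hJ hp)
    exact mul_pos (pow_pos (hP.mu_pos p this.1 this.2) s) (hP.b_pos t p this.1 this.2)

theorem Admissible.J_pos {P : Params} (hP : P.Admissible) (t : ℝ) (r s : ℕ) {i j : ℤ} (hi : 0 ≤ i)
    (hiK : i ≤ P.K) (hj : 0 ≤ j) (hjK : j ≤ (P.K : ℤ) - 1) : 0 < P.J t r s i j := by
  rw [J, if_pos ⟨hi, hiK, hj, hjK⟩]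
  refine sum_pos (fun I hI => sum_pos (fun J hJ => ?_) ?_) ?_
  · rw [mem_powersetCard] at hI hJ
    exact hP.term_pos t r s hI.1 hJ.1
  · rw [powersetCard_nonempty, Nat.card_Icc]; omega
  · rw [powersetCard_nonempty, Nat.card_Icc]; omega

theorem Admissible.J_nonneg {P : Params} (hP : P.Admissible) (t : ℝ) (r s : ℕ) (i j : ℤ) :
    0 ≤ P.J t r s i j := by
  by_cases h : 0 ≤ i ∧ i ≤ (P.K : ℤ) ∧ 0 ≤ j ∧ j ≤ (P.K : ℤ) - 1
  · exact (hP.J_pos t r s h.1 h.2.1 h.2.2.1 h.2.2.2).le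
  · rw [J, if_neg h]

theorem J_eq_zero (P : Params) (t : ℝ) (r s : ℕ) {i j : ℤ}
    (h : ¬(0 ≤ i ∧ i ≤ (P.K : ℤ) ∧ 0 ≤ j ∧ j ≤ (P.K : ℤ) - 1)) : P.J t r s i j = 0 := if_neg h

theorem J_zero_zero (P : Params) (hK : 1 ≤ P.K) (t : ℝ) (r s : ℕ) : P.J t r s 0 0 = 1 := by
  rw [J, if_pos (by omega)]
  simp [Psi]

/-- If all the first points are used, the exponent of the `λᵢ` only gives a factor. -/
theorem J_succ_left (P : Params) (t : ℝ) (r s : ℕ) (j : ℤ) :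
    P.J t (r + 1) s P.K j = P.L * P.J t r s P.K j := by
  unfold J
  split_ifs
  · have e : powersetCard (P.K : ℤ).toNat (Icc 1 P.K) = {Icc 1 P.K} := by
      have := powersetCard_self (Icc 1 P.K)
      rwa [Nat.card_Icc, Nat.add_sub_cancel] at this
    simp only [e, sum_singleton, mul_sum, pow_succ, prod_mul_distrib, L, prodLam]
    refine sum_congr rfl fun J _ => ?_
    ring
  · simp

theorem J_succ_right (P : Params) (t : ℝ) (r s : ℕ) (i : ℤ) :
    P.J t r (s + 1) i (P.K - 1) = P.M * P.J t r s i (P.K - 1) := by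
  unfold J
  split_ifs with h
  · rw [show ((P.K : ℤ) - 1).toNat = (Icc 1 (P.K - 1)).card by simp, powersetCard_self]
    simp only [sum_singleton, mul_sum, pow_succ, prod_mul_distrib, M, prodMu]
    refine sum_congr rfl fun J _ => ?_
    ring
  · simp

theorem Admissible.L_pos {P : Params} (hP : P.Admissible) : 0 < P.L :=
  prod_pos fun i hi => hP.lam_pos i (mem_Icc.1 hi).1 (mem_Icc.1 hi).2

theorem Admissible.M_pos {P : Params} (hP : P.Admissible) : 0 < P.M :=
  prod_pos fun i hi => hP.mu_pos i (mem_Icc.1 hi).1 (mem_Icc.1 hi).2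

end Params

end GengXue

end

/-! ### Internal parameters and the places of a configuration. -/

noncomputable section

namespace GengXue

open Finset

section Internal

theorem sumT_step (tau : ℕ → ℝ) (i : ℕ) : sumT tau (i + 1) = sumT tau i + tau (i + 1) :=
  sum_Icc_succ_top (by omega) _

theorem sumS_step (tau sig : ℕ → ℝ) (i : ℕ) :
    sumS tau sig (i + 1) = sumS tau sig i + tau (i + 1) * sigma sig i := by
  rcases i with _ | i
  · simp [sumS, sigma]
  · simp only [sumS, Nat.add_sub_cancel, sigma]
    rw [sum_Icc_succ_top (by omega)]
    simp

/-- Together with `sumR_cross` this computes the 2 × 2 minors of consecutive triples (1, σ_i, R_i)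
and (1, σ_{i+1}, R_{i+1}): they are σ_{i+1} - σ_i times 1, T_{i+1}, S_{i+1}. Hence T and S appear in
X and Y, but σ and R in the denominators of Q and P. -/
theorem sumR_step (tau sig : ℕ → ℝ) (i : ℕ) :
    sumR tau sig (i + 1) - sumR tau sig i
      = (sigma sig (i + 1) - sigma sig i) * sumT tau (i + 1) := by
  simp only [sumR, sumT_step, sumS_step]
  ring

theorem sumR_cross (tau sig : ℕ → ℝ) (i : ℕ) :
    sigma sig i * sumR tau sig (i + 1) - sumR tau sig i * sigma sig (i + 1)
      = (sigma sig (i + 1) - sigma sig i) * sumS tau sig (i + 1) := by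
  simp only [sumR, sumT_step, sumS_step]
  ring

theorem sumR_zero (tau sig : ℕ → ℝ) : sumR tau sig 0 = 0 := by simp [sumR, sumS, sigma]

/-- The conditions on the internal parameters of one group with `N` members. -/
structure InternalPos (N : ℕ) (tau sig : ℕ → ℝ) : Prop where
  tau_pos : ∀ i, 1 ≤ i → i ≤ N - 1 → 0 < tau i
  sig_pos : ∀ i, 1 ≤ i → i ≤ N - 1 → 0 < sig i
  sig_lt : ∀ i, 1 ≤ i → i + 1 ≤ N - 1 → sig i < sig (i + 1)

variable {N : ℕ} {tau sig : ℕ → ℝ}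

theorem InternalPos.sigma_pos (h : InternalPos N tau sig) {i : ℕ} (h1 : 1 ≤ i) (h2 : i ≤ N - 1) :
    0 < sigma sig i := by
  rw [sigma, if_neg (by omega)]; exact h.sig_pos i h1 h2

theorem InternalPos.sigma_nonneg (h : InternalPos N tau sig) {i : ℕ} (h2 : i ≤ N - 1) :
    0 ≤ sigma sig i := by
  rcases Nat.eq_zero_or_pos i with rfl | h1
  · simp [sigma]
  · exact (h.sigma_pos h1 h2).le

theorem InternalPos.sigma_lt (h : InternalPos N tau sig) {i : ℕ} (h2 : i + 1 ≤ N - 1) :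
    sigma sig i < sigma sig (i + 1) := by
  rcases Nat.eq_zero_or_pos i with rfl | h1
  · simpa [sigma] using h.sig_pos 1 le_rfl h2
  · rw [sigma, sigma, if_neg (by omega), if_neg (by omega)]
    exact h.sig_lt i h1 h2

theorem InternalPos.sumT_nonneg (h : InternalPos N tau sig) {i : ℕ} (h2 : i ≤ N - 1) :
    0 ≤ sumT tau i :=
  sum_nonneg fun a ha => by
    rw [mem_Icc] at ha
    exact (h.tau_pos a ha.1 (by omega)).le

theorem InternalPos.sumT_pos (h : InternalPos N tau sig) {i : ℕ} (h1 : 1 ≤ i) (h2 : i ≤ N - 1) :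
    0 < sumT tau i := by
  obtain ⟨j, rfl⟩ : ∃ j, i = j + 1 := ⟨i - 1, by omega⟩
  rw [sumT_step]
  have := h.sumT_nonneg (show j ≤ N - 1 by omega)
  have := h.tau_pos (j + 1) (by omega) h2
  linarith

theorem InternalPos.sumS_nonneg (h : InternalPos N tau sig) {i : ℕ} (h2 : i ≤ N - 1) :
    0 ≤ sumS tau sig i :=
  sum_nonneg fun a ha => by
    rw [mem_Icc] at ha
    exact (mul_pos (h.tau_pos (a + 1) (by omega) (by omega))
      (h.sig_pos a ha.1 (by omega))).le

theorem InternalPos.sumS_pos (h : InternalPos N tau sig) {i : ℕ} (h1 : 2 ≤ i) (h2 : i ≤ N - 1) :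
    0 < sumS tau sig i := by
  obtain ⟨j, rfl⟩ : ∃ j, i = j + 1 := ⟨i - 1, by omega⟩
  rw [sumS_step]
  have := h.sumS_nonneg (show j ≤ N - 1 by omega)
  have := mul_pos (h.tau_pos (j + 1) (by omega) h2)
    (h.sigma_pos (show 1 ≤ j by omega) (show j ≤ N - 1 by omega))
  linarith

theorem InternalPos.sumR_nonneg (h : InternalPos N tau sig) {i : ℕ} (h2 : i ≤ N - 1) :
    0 ≤ sumR tau sig i := by
  induction i with
  | zero => rw [sumR_zero]
  | succ i ih =>
    have := sumR_step tau sig i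
    have := mul_nonneg (sub_nonneg.2 (h.sigma_lt h2).le) (h.sumT_nonneg h2)
    have := ih (by omega)
    linarith

end Internal

namespace Params

theorem Admissible.internalX {P : Params} (hP : P.Admissible) {l : ℕ} (h1 : 1 ≤ l)
    (h2 : l ≤ P.K) : InternalPos (P.NX l) (P.tauX l) (P.sigX l) :=
  ⟨fun i => hP.tauX_pos l i h1 h2, fun i => hP.sigX_pos l i h1 h2,
    fun i => hP.sigX_lt l i h1 h2⟩

theorem Admissible.internalY {P : Params} (hP : P.Admissible) {l : ℕ} (h1 : 1 ≤ l)
    (h2 : l ≤ P.K) : InternalPos (P.NY l) (P.tauY l) (P.sigY l) :=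
  ⟨fun i => hP.tauY_pos l i h1 h2, fun i => hP.sigY_pos l i h1 h2,
    fun i => hP.sigY_lt l i h1 h2⟩

/-- The number from the right of the group with number `l` from the left. -/
def grp (P : Params) (l : ℕ) : ℤ := (P.K : ℤ) + 1 - l

/-- The place after the `i`th member of the `l`th `X`-group. -/
def stX (P : Params) (l i : ℕ) : ℝ × ℝ × ℝ :=
  if i = P.NX l then (0, 0, 1)
  -- At the far left the generic triple (1, 0, 0) would give the denominator J_{KK} = 0. The second
  -- entry is taken to be 1 instead, and the first, invisible in the denominator, is fitted to the
  -- sum of Q; this is where C enters.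
  else if l = 1 ∧ i = 0 then (P.C / P.M + if P.NX 1 = 1 then 0 else 1 / P.sigX 1 1, 1, 0)
  else (1, sigma (P.sigX l) i, sumR (P.tauX l) (P.sigX l) i)

/-- The place after the `i`th member of the `l`th `Y`-group. -/
def stY (P : Params) (l i : ℕ) : ℝ × ℝ × ℝ :=
  -- At the far right (0, 0, 1) would give the denominator J_{0,-1} = 0. With (0, 1, ·) it is J_{00}
  -- = 1, and the third entry, fitted to the sum of PY, brings in D.
  if i = P.NY l then (if l = P.K then (0, 1, P.D + sumT (P.tauY l) (P.NY l - 1)) else (0, 0, 1))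
  else (1, sigma (P.sigY l) i, sumR (P.tauY l) (P.sigY l) i)

/-- The denominator at a place next to or between members of an `X`-group. -/
def denX (P : Params) (t : ℝ) (j : ℤ) (s : ℝ × ℝ × ℝ) : ℝ :=
  s.1 * P.J t 1 0 j j + s.2.1 * P.J t 1 0 j (j - 1) + s.2.2 * P.J t 1 0 (j - 1) (j - 1)

/-- The denominator at a place next to or between members of a `Y`-group. -/
def denY (P : Params) (t : ℝ) (j : ℤ) (s : ℝ × ℝ × ℝ) : ℝ :=
  s.1 * P.J t 0 1 j (j - 1) + s.2.1 * P.J t 0 1 (j - 1) (j - 1)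
    + s.2.2 * P.J t 0 1 (j - 1) (j - 2)

/-- The sum of the `Q X` to the left of a place at an `X`-group. -/
def leftX (P : Params) (t : ℝ) (j : ℤ) (s : ℝ × ℝ × ℝ) : ℝ :=
  P.data.numL (P.a t) (P.b t) s j j / P.data.den (P.a t) (P.b t) s j j

/-- The sum of the `Q` to the right of a place at an `X`-group. -/
def rightX (P : Params) (t : ℝ) (j : ℤ) (s : ℝ × ℝ × ℝ) : ℝ :=
  P.data.numR (P.a t) (P.b t) s j j / P.data.den (P.a t) (P.b t) s j j

/-- The sum of the `P Y` to the left of a place at a `Y`-group. -/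
def leftY (P : Params) (t : ℝ) (j : ℤ) (s : ℝ × ℝ × ℝ) : ℝ :=
  P.data.swap.numL (P.b t) (P.a t) s (j - 1) j / P.data.swap.den (P.b t) (P.a t) s (j - 1) j

/-- The sum of the `P` to the right of a place at a `Y`-group. -/
def rightY (P : Params) (t : ℝ) (j : ℤ) (s : ℝ × ℝ × ℝ) : ℝ :=
  P.data.swap.numR (P.b t) (P.a t) s (j - 1) j / P.data.swap.den (P.b t) (P.a t) s (j - 1) j

theorem den_data (P : Params) (hK : 1 ≤ P.K) (t : ℝ) (j : ℤ) (s : ℝ × ℝ × ℝ) :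
    P.data.den (P.a t) (P.b t) s j j = P.denX t j s := by
  simp only [PointData.den, PointData.comb, P.jW_id_one hK, denX]

theorem den_data_swap (P : Params) (hK : 1 ≤ P.K) (t : ℝ) (j : ℤ) (s : ℝ × ℝ × ℝ) :
    P.data.swap.den (P.b t) (P.a t) s (j - 1) j = P.denY t j s := by
  simp only [PointData.den, PointData.comb, PointData.jW_swap, P.jW_one_id hK, denY, sub_sub]
  norm_num

/-- The Wronskian of two combinations is the combination of the three basic Wronskians with the
minors of the two triples. The common factor J_{j,j-1}, with weights (a, μb), is the one occurring
in the formulas for Q. -/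
theorem Admissible.leftX_sub {P : Params} (hP : P.Admissible) (t : ℝ) (j : ℤ)
    (s s' : ℝ × ℝ × ℝ) (hs : P.denX t j s ≠ 0) (hs' : P.denX t j s' ≠ 0) :
    P.leftX t j s - P.leftX t j s' = P.J t 0 1 j (j - 1)
        * ((s'.1 * s.2.1 - s'.2.1 * s.1) * P.J t 0 0 (j + 1) j
          + (s'.1 * s.2.2 - s'.2.2 * s.1) * P.J t 0 0 j j
          + (s'.2.1 * s.2.2 - s'.2.2 * s.2.1) * P.J t 0 0 j (j - 1))
        / (P.denX t j s * P.denX t j s') := by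
  have key := P.data.numL_wronskian hP.data_valid (P.a t) (P.b t) j j s s'
  simp only [P.den_data hP.K_pos, P.jW_one_one hP.K_pos, P.jW_one_id hP.K_pos] at key
  rw [leftX, leftX, P.den_data hP.K_pos, P.den_data hP.K_pos, div_sub_div _ _ hs hs', ← key]
  congr 1
  ring

theorem Admissible.rightX_sub {P : Params} (hP : P.Admissible) (t : ℝ) (j : ℤ)
    (s s' : ℝ × ℝ × ℝ) (hs : P.denX t j s ≠ 0) (hs' : P.denX t j s' ≠ 0) :
    P.rightX t j s' - P.rightX t j s = P.J t 0 1 j (j - 1)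
        * ((s'.1 * s.2.1 - s'.2.1 * s.1) * P.J t 1 1 j (j - 1)
          + (s'.1 * s.2.2 - s'.2.2 * s.1) * P.J t 1 1 (j - 1) (j - 1)
          + (s'.2.1 * s.2.2 - s'.2.2 * s.2.1) * P.J t 1 1 (j - 1) (j - 2))
        / (P.denX t j s * P.denX t j s') := by
  have key := P.data.numR_wronskian hP.data_valid (P.a t) (P.b t) j j s s'
  simp only [P.den_data hP.K_pos, P.jW_id_id hP.K_pos, P.jW_one_id hP.K_pos] at key
  rw [rightX, rightX, P.den_data hP.K_pos, P.den_data hP.K_pos, div_sub_div _ _ hs' hs, ← key]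
  congr 1 <;> ring

theorem Admissible.leftY_sub {P : Params} (hP : P.Admissible) (t : ℝ) (j : ℤ)
    (s s' : ℝ × ℝ × ℝ) (hs : P.denY t j s ≠ 0) (hs' : P.denY t j s' ≠ 0) :
    P.leftY t j s - P.leftY t j s' = P.J t 1 0 (j - 1) (j - 1)
        * ((s'.1 * s.2.1 - s'.2.1 * s.1) * P.J t 0 0 j j
          + (s'.1 * s.2.2 - s'.2.2 * s.1) * P.J t 0 0 j (j - 1)
          + (s'.2.1 * s.2.2 - s'.2.2 * s.2.1) * P.J t 0 0 (j - 1) (j - 1))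
        / (P.denY t j s * P.denY t j s') := by
  have key := P.data.swap.numL_wronskian hP.data_valid.swap (P.b t) (P.a t) (j - 1) j s s'
  simp only [P.den_data_swap hP.K_pos, PointData.jW_swap, P.jW_one_one hP.K_pos,
    P.jW_id_one hP.K_pos, sub_add_cancel] at key
  rw [leftY, leftY, P.den_data_swap hP.K_pos, P.den_data_swap hP.K_pos, div_sub_div _ _ hs hs',
    ← key]
  congr 1
  ring

theorem Admissible.rightY_sub {P : Params} (hP : P.Admissible) (t : ℝ) (j : ℤ)
    (s s' : ℝ × ℝ × ℝ) (hs : P.denY t j s ≠ 0) (hs' : P.denY t j s' ≠ 0) :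
    P.rightY t j s' - P.rightY t j s = P.J t 1 0 (j - 1) (j - 1)
        * ((s'.1 * s.2.1 - s'.2.1 * s.1) * P.J t 1 1 (j - 1) (j - 1)
          + (s'.1 * s.2.2 - s'.2.2 * s.1) * P.J t 1 1 (j - 1) (j - 2)
          + (s'.2.1 * s.2.2 - s'.2.2 * s.2.1) * P.J t 1 1 (j - 2) (j - 2))
        / (P.denY t j s * P.denY t j s') := by
  have key := P.data.swap.numR_wronskian hP.data_valid.swap (P.b t) (P.a t) (j - 1) j s s'
  simp only [P.den_data_swap hP.K_pos, PointData.jW_swap, P.jW_id_id hP.K_pos,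
    P.jW_id_one hP.K_pos, show j - 1 - 1 = j - 2 by ring] at key
  rw [rightY, rightY, P.den_data_swap hP.K_pos, P.den_data_swap hP.K_pos, div_sub_div _ _ hs' hs,
    ← key]
  congr 1 <;> ring

end Params

end GengXue

end

/-! ### The change of the partial sums over one peakon. -/

noncomputable section

namespace GengXue

open Finset

namespace Params

/-- The numerator of a difference of left sums at an `X`-group. -/
def minorLX (P : Params) (t : ℝ) (j : ℤ) (s' s : ℝ × ℝ × ℝ) : ℝ :=
  (s'.1 * s.2.1 - s'.2.1 * s.1) * P.J t 0 0 (j + 1) j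
    + (s'.1 * s.2.2 - s'.2.2 * s.1) * P.J t 0 0 j j
    + (s'.2.1 * s.2.2 - s'.2.2 * s.2.1) * P.J t 0 0 j (j - 1)

/-- The numerator of a difference of right sums at an `X`-group. -/
def minorRX (P : Params) (t : ℝ) (j : ℤ) (s' s : ℝ × ℝ × ℝ) : ℝ :=
  (s'.1 * s.2.1 - s'.2.1 * s.1) * P.J t 1 1 j (j - 1)
    + (s'.1 * s.2.2 - s'.2.2 * s.1) * P.J t 1 1 (j - 1) (j - 1)
    + (s'.2.1 * s.2.2 - s'.2.2 * s.2.1) * P.J t 1 1 (j - 1) (j - 2)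

/-- The numerator of a difference of left sums at a `Y`-group. -/
def minorLY (P : Params) (t : ℝ) (j : ℤ) (s' s : ℝ × ℝ × ℝ) : ℝ :=
  (s'.1 * s.2.1 - s'.2.1 * s.1) * P.J t 0 0 j j
    + (s'.1 * s.2.2 - s'.2.2 * s.1) * P.J t 0 0 j (j - 1)
    + (s'.2.1 * s.2.2 - s'.2.2 * s.2.1) * P.J t 0 0 (j - 1) (j - 1)

/-- The numerator of a difference of right sums at a `Y`-group. -/
def minorRY (P : Params) (t : ℝ) (j : ℤ) (s' s : ℝ × ℝ × ℝ) : ℝ :=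
  (s'.1 * s.2.1 - s'.2.1 * s.1) * P.J t 1 1 (j - 1) (j - 1)
    + (s'.1 * s.2.2 - s'.2.2 * s.1) * P.J t 1 1 (j - 1) (j - 2)
    + (s'.2.1 * s.2.2 - s'.2.2 * s.2.1) * P.J t 1 1 (j - 2) (j - 2)

theorem Admissible.denX_pos {P : Params} (hP : P.Admissible) (t : ℝ) {l i : ℕ} (h1 : 1 ≤ l)
    (h2 : l ≤ P.K) (hi : i ≤ P.NX l) : 0 < P.denX t (P.grp l) (P.stX l i) := by
  have hI := hP.internalX h1 h2
  have hN := hP.NX_pos l h1 h2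
  rw [denX, stX, grp]
  split_ifs with a1 a2 a3
  · simp only [zero_mul, zero_add, one_mul]
    exact hP.J_pos t _ _ (by omega) (by omega) (by omega) (by omega)
  all_goals
    try
      rw [P.J_eq_zero t 1 0 (i := (P.K : ℤ) + 1 - l) (j := (P.K : ℤ) + 1 - l) (by omega)]
      have := hP.J_pos t 1 0 (i := (P.K : ℤ) + 1 - l) (j := (P.K : ℤ) + 1 - l - 1)
        (by omega) (by omega) (by omega) (by omega)
      simpa using this
  have c1 := hP.J_pos t 1 0 (i := (P.K : ℤ) + 1 - l) (j := (P.K : ℤ) + 1 - l - 1)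
    (by omega) (by omega) (by omega) (by omega)
  have c2 := hP.J_nonneg t 1 0 ((P.K : ℤ) + 1 - l - 1) ((P.K : ℤ) + 1 - l - 1)
  have c3 := hI.sumR_nonneg (show i ≤ P.NX l - 1 by omega)
  -- In the leftmost group J_{KK} = 0, and positivity comes from σ_i J_{K,K-1}, with i ≥ 1 since the
  -- place 0 has been treated. In the other groups J_{jj} is already positive.
  by_cases hl : l = 1
  · have c4 := hI.sigma_pos (show 1 ≤ i by omega) (show i ≤ P.NX l - 1 by omega)
    have c5 := hP.J_nonneg t 1 0 ((P.K : ℤ) + 1 - l) ((P.K : ℤ) + 1 - l)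
    dsimp only
    positivity
  · have c4 := hI.sigma_nonneg (show i ≤ P.NX l - 1 by omega)
    have c5 := hP.J_pos t 1 0 (i := (P.K : ℤ) + 1 - l) (j := (P.K : ℤ) + 1 - l)
      (by omega) (by omega) (by omega) (by omega)
    dsimp only
    positivity

theorem Admissible.denY_pos {P : Params} (hP : P.Admissible) (t : ℝ) {l i : ℕ} (h1 : 1 ≤ l)
    (h2 : l ≤ P.K) (hi : i ≤ P.NY l) : 0 < P.denY t (P.grp l) (P.stY l i) := by
  have hI := hP.internalY h1 h2
  have hN := hP.NY_pos l h1 h2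
  rw [denY, stY, grp]
  split_ifs with a1 a2
  · rw [P.J_eq_zero t 0 1 (i := (P.K : ℤ) + 1 - l - 1) (j := (P.K : ℤ) + 1 - l - 2) (by omega)]
    have := hP.J_pos t 0 1 (i := (P.K : ℤ) + 1 - l - 1) (j := (P.K : ℤ) + 1 - l - 1)
      (by omega) (by omega) (by omega) (by omega)
    simpa using this
  · simp only [zero_mul, zero_add, one_mul]
    exact hP.J_pos t _ _ (by omega) (by omega) (by omega) (by omega)
  · have c1 := hP.J_pos t 0 1 (i := (P.K : ℤ) + 1 - l) (j := (P.K : ℤ) + 1 - l - 1)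
      (by omega) (by omega) (by omega) (by omega)
    have c2 := hP.J_nonneg t 0 1 ((P.K : ℤ) + 1 - l - 1) ((P.K : ℤ) + 1 - l - 1)
    have c5 := hP.J_nonneg t 0 1 ((P.K : ℤ) + 1 - l - 1) ((P.K : ℤ) + 1 - l - 2)
    have c3 := hI.sumR_nonneg (show i ≤ P.NY l - 1 by omega)
    have c4 := hI.sigma_nonneg (show i ≤ P.NY l - 1 by omega)
    dsimp only
    positivity

/-- The right difference is J c U over the two denominators, and the left difference is the same
with the left minor in place of c U. Dividing the two gives X, and the right difference alone gives
Q; positivity of Q then comes from that of all factors. -/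
theorem Admissible.stepX_of {P : Params} (hP : P.Admissible) (t : ℝ) {l i : ℕ} (h1 : 1 ≤ l)
    (h2 : l ≤ P.K) (hi : i ≤ P.NX l) (c U : ℝ)
    (hU : 0 < U) (hR : P.minorRX t (P.grp l) (P.stX l (i - 1)) (P.stX l i) = c * U)
    (hX : P.X t l i * (c * U) = P.minorLX t (P.grp l) (P.stX l (i - 1)) (P.stX l i))
    (hc : 0 < c)
    (hQ : P.Q t l i * (P.denX t (P.grp l) (P.stX l i) * P.denX t (P.grp l) (P.stX l (i - 1)))
      = P.J t 0 1 (P.grp l) (P.grp l - 1) * (c * U)) :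
    (P.leftX t (P.grp l) (P.stX l i) - P.leftX t (P.grp l) (P.stX l (i - 1))
        = P.Q t l i * P.X t l i ∧
      P.rightX t (P.grp l) (P.stX l (i - 1)) - P.rightX t (P.grp l) (P.stX l i) = P.Q t l i) ∧
      0 < P.Q t l i := by
  have d1 := hP.denX_pos t h1 h2 hi
  have d2 := hP.denX_pos t h1 h2 (show i - 1 ≤ P.NX l by omega)
  have dd := mul_pos d1 d2
  have hG : 0 < P.J t 0 1 (P.grp l) (P.grp l - 1) := by
    unfold grp
    exact hP.J_pos t _ _ (by omega) (by omega) (by omega) (by omega)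
  refine ⟨⟨?_, ?_⟩, ?_⟩
  · rw [hP.leftX_sub t _ _ _ d1.ne' d2.ne', div_eq_iff dd.ne']
    change _ * P.minorLX t (P.grp l) (P.stX l (i - 1)) (P.stX l i) = _
    rw [← hX]
    linear_combination -(P.X t l i) * hQ
  · rw [hP.rightX_sub t _ _ _ d1.ne' d2.ne', div_eq_iff dd.ne']
    change _ * P.minorRX t (P.grp l) (P.stX l (i - 1)) (P.stX l i) = _
    rw [hR, hQ]
  · rw [← mul_pos_iff_of_pos_right dd, hQ]
    positivity

theorem Admissible.stepY_of {P : Params} (hP : P.Admissible) (t : ℝ) {l i : ℕ} (h1 : 1 ≤ l)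
    (h2 : l ≤ P.K) (hi : i ≤ P.NY l) (c U : ℝ)
    (hU : 0 < U) (hR : P.minorRY t (P.grp l) (P.stY l (i - 1)) (P.stY l i) = c * U)
    (hY : P.Y t l i * (c * U) = P.minorLY t (P.grp l) (P.stY l (i - 1)) (P.stY l i))
    (hc : 0 < c)
    (hQ : P.PP t l i * (P.denY t (P.grp l) (P.stY l i) * P.denY t (P.grp l) (P.stY l (i - 1)))
      = P.J t 1 0 (P.grp l - 1) (P.grp l - 1) * (c * U)) :
    (P.leftY t (P.grp l) (P.stY l i) - P.leftY t (P.grp l) (P.stY l (i - 1))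
        = P.PP t l i * P.Y t l i ∧
      P.rightY t (P.grp l) (P.stY l (i - 1)) - P.rightY t (P.grp l) (P.stY l i) = P.PP t l i) ∧
      0 < P.PP t l i := by
  have d1 := hP.denY_pos t h1 h2 hi
  have d2 := hP.denY_pos t h1 h2 (show i - 1 ≤ P.NY l by omega)
  have dd := mul_pos d1 d2
  have hG : 0 < P.J t 1 0 (P.grp l - 1) (P.grp l - 1) := by
    unfold grp
    exact hP.J_pos t _ _ (by omega) (by omega) (by omega) (by omega)
  refine ⟨⟨?_, ?_⟩, ?_⟩
  · rw [hP.leftY_sub t _ _ _ d1.ne' d2.ne', div_eq_iff dd.ne']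
    change _ * P.minorLY t (P.grp l) (P.stY l (i - 1)) (P.stY l i) = _
    rw [← hY]
    linear_combination -(P.Y t l i) * hQ
  · rw [hP.rightY_sub t _ _ _ d1.ne' d2.ne', div_eq_iff dd.ne']
    change _ * P.minorRY t (P.grp l) (P.stY l (i - 1)) (P.stY l i) = _
    rw [hR, hQ]
  · rw [← mul_pos_iff_of_pos_right dd, hQ]
    positivity

end Params

end GengXue

end

/-! ### Verification of the formulas for X, Q, Y, P member by member. -/

noncomputable section

namespace GengXue

open Finset

namespace Params

theorem mul_inv_inv_cancel (a b c : ℝ) {f g : ℝ} (hf : f ≠ 0) (hg : g ≠ 0) :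
    a * b * c * f⁻¹ * g⁻¹ * (f * g) = b * (a * c) := by
  field_simp

/-- The common factor σ_i - σ_{i-1} of the minors cancels between the left and right differences and
survives only in Q. -/
theorem minorLX_inner (P : Params) (t : ℝ) (j : ℤ) (tau sig : ℕ → ℝ) {i : ℕ} (hi : 1 ≤ i) :
    P.minorLX t j (1, sigma sig (i - 1), sumR tau sig (i - 1)) (1, sigma sig i, sumR tau sig i)
      = (sigma sig i - sigma sig (i - 1)) * (P.J t 0 0 (j + 1) j + sumT tau i * P.J t 0 0 j j
        + sumS tau sig i * P.J t 0 0 j (j - 1)) := by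
  obtain ⟨k, rfl⟩ : ∃ k, i = k + 1 := ⟨i - 1, by omega⟩
  rw [Nat.add_sub_cancel, minorLX]
  linear_combination P.J t 0 0 j j * sumR_step tau sig k
    + P.J t 0 0 j (j - 1) * sumR_cross tau sig k

theorem minorRX_inner (P : Params) (t : ℝ) (j : ℤ) (tau sig : ℕ → ℝ) {i : ℕ} (hi : 1 ≤ i) :
    P.minorRX t j (1, sigma sig (i - 1), sumR tau sig (i - 1)) (1, sigma sig i, sumR tau sig i)
      = (sigma sig i - sigma sig (i - 1)) * (P.J t 1 1 j (j - 1)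
        + sumT tau i * P.J t 1 1 (j - 1) (j - 1) + sumS tau sig i * P.J t 1 1 (j - 1) (j - 2)) := by
  obtain ⟨k, rfl⟩ : ∃ k, i = k + 1 := ⟨i - 1, by omega⟩
  rw [Nat.add_sub_cancel, minorRX]
  linear_combination P.J t 1 1 (j - 1) (j - 1) * sumR_step tau sig k
    + P.J t 1 1 (j - 1) (j - 2) * sumR_cross tau sig k

theorem minorLY_inner (P : Params) (t : ℝ) (j : ℤ) (tau sig : ℕ → ℝ) {i : ℕ} (hi : 1 ≤ i) :
    P.minorLY t j (1, sigma sig (i - 1), sumR tau sig (i - 1)) (1, sigma sig i, sumR tau sig i)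
      = (sigma sig i - sigma sig (i - 1)) * (P.J t 0 0 j j + sumT tau i * P.J t 0 0 j (j - 1)
        + sumS tau sig i * P.J t 0 0 (j - 1) (j - 1)) := by
  obtain ⟨k, rfl⟩ : ∃ k, i = k + 1 := ⟨i - 1, by omega⟩
  rw [Nat.add_sub_cancel, minorLY]
  linear_combination P.J t 0 0 j (j - 1) * sumR_step tau sig k
    + P.J t 0 0 (j - 1) (j - 1) * sumR_cross tau sig k

theorem minorRY_inner (P : Params) (t : ℝ) (j : ℤ) (tau sig : ℕ → ℝ) {i : ℕ} (hi : 1 ≤ i) :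
    P.minorRY t j (1, sigma sig (i - 1), sumR tau sig (i - 1)) (1, sigma sig i, sumR tau sig i)
      = (sigma sig i - sigma sig (i - 1)) * (P.J t 1 1 (j - 1) (j - 1)
        + sumT tau i * P.J t 1 1 (j - 1) (j - 2)
        + sumS tau sig i * P.J t 1 1 (j - 2) (j - 2)) := by
  obtain ⟨k, rfl⟩ : ∃ k, i = k + 1 := ⟨i - 1, by omega⟩
  rw [Nat.add_sub_cancel, minorRY]
  linear_combination P.J t 1 1 (j - 1) (j - 2) * sumR_step tau sig k
    + P.J t 1 1 (j - 2) (j - 2) * sumR_cross tau sig k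

/-- The change over one member of a group. -/
def StepX (P : Params) (t : ℝ) (l i : ℕ) : Prop :=
  (P.leftX t (P.grp l) (P.stX l i) - P.leftX t (P.grp l) (P.stX l (i - 1))
      = P.Q t l i * P.X t l i ∧
    P.rightX t (P.grp l) (P.stX l (i - 1)) - P.rightX t (P.grp l) (P.stX l i) = P.Q t l i) ∧
    0 < P.Q t l i

/-- The change over one member of a group. -/
def StepY (P : Params) (t : ℝ) (l i : ℕ) : Prop :=
  (P.leftY t (P.grp l) (P.stY l i) - P.leftY t (P.grp l) (P.stY l (i - 1))
      = P.PP t l i * P.Y t l i ∧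
    P.rightY t (P.grp l) (P.stY l (i - 1)) - P.rightY t (P.grp l) (P.stY l i) = P.PP t l i) ∧
    0 < P.PP t l i

theorem Admissible.stepX_singleton {P : Params} (hP : P.Admissible) (t : ℝ) {l : ℕ} (h1 : 1 < l)
    (h2 : l ≤ P.K) (hN : P.NX l = 1) : P.StepX t l 1 := by
  have e0 : P.stX l 0 = (1, 0, 0) := by
    rw [stX, if_neg (by omega), if_neg (by omega), sumR_zero]; simp [sigma]
  have e1 : P.stX l 1 = (0, 0, 1) := by rw [stX, if_pos hN.symm]
  have d0 := hP.denX_pos t h1.le h2 (show 0 ≤ P.NX l by omega)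
  have d1 := hP.denX_pos t h1.le h2 (show 1 ≤ P.NX l by omega)
  have u := hP.J_pos t 1 1 (i := P.grp l - 1) (j := P.grp l - 1) (by unfold grp; omega)
    (by unfold grp; omega) (by unfold grp; omega) (by unfold grp; omega)
  refine hP.stepX_of t h1.le h2 (by omega) 1 (P.J t 1 1 (P.grp l - 1) (P.grp l - 1)) u
    ?_ ?_ one_pos ?_
  · simp [e0, e1, minorRX]
  · simp only [e0, e1, minorLX, X, if_pos hN, if_neg h1.ne']
    rw [← grp]
    field_simp
    ring
  · rw [e0] at d0
    rw [e1] at d1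
    simp only [denX, e0, e1, Q, if_pos hN, if_neg h1.ne', zero_mul, one_mul, zero_add,
      add_zero] at d0 d1 ⊢
    rw [← grp]
    field_simp

theorem Admissible.stepX_inner {P : Params} (hP : P.Admissible) (t : ℝ) {l i : ℕ} (h1 : 1 ≤ l)
    (h2 : l ≤ P.K) (hi : 1 ≤ i) (hiN : i < P.NX l) (hl : l = 1 → i ≠ 1) : P.StepX t l i := by
  have e0 : P.stX l (i - 1)
      = (1, sigma (P.sigX l) (i - 1), sumR (P.tauX l) (P.sigX l) (i - 1)) := by
    rw [stX, if_neg (by omega), if_neg (by omega)]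
  have e1 : P.stX l i = (1, sigma (P.sigX l) i, sumR (P.tauX l) (P.sigX l) i) := by
    rw [stX, if_neg (by omega), if_neg (by omega)]
  have hI := hP.internalX h1 h2
  have d0 := hP.denX_pos t h1 h2 (show i - 1 ≤ P.NX l by omega)
  have d1 := hP.denX_pos t h1 h2 (show i ≤ P.NX l by omega)
  have hs : 0 < sigma (P.sigX l) i - sigma (P.sigX l) (i - 1) := by
    have := hI.sigma_lt (i := i - 1) (by omega)
    rw [Nat.sub_add_cancel hi] at this
    linarith
  have u : 0 < P.J t 1 1 (P.grp l) (P.grp l - 1)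
      + sumT (P.tauX l) i * P.J t 1 1 (P.grp l - 1) (P.grp l - 1)
      + sumS (P.tauX l) (P.sigX l) i * P.J t 1 1 (P.grp l - 1) (P.grp l - 2) := by
    have c1 := hP.J_pos t 1 1 (i := P.grp l) (j := P.grp l - 1) (by unfold grp; omega)
      (by unfold grp; omega) (by unfold grp; omega) (by unfold grp; omega)
    have c2 := hP.J_nonneg t 1 1 (P.grp l - 1) (P.grp l - 1)
    have c3 := hP.J_nonneg t 1 1 (P.grp l - 1) (P.grp l - 2)
    have c4 := hI.sumT_nonneg (show i ≤ P.NX l - 1 by omega)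
    have c5 := hI.sumS_nonneg (show i ≤ P.NX l - 1 by omega)
    positivity
  have hN : P.NX l ≠ 1 := by omega
  refine hP.stepX_of t h1 h2 hiN.le _ _ u (by rw [e0, e1, minorRX_inner _ _ _ _ _ hi]) ?_ hs ?_
  · rw [e0, e1, minorLX_inner _ _ _ _ _ hi, mul_left_comm]
    congr 1
    rw [← eq_div_iff u.ne']
    -- The general formula covers the inner members of the leftmost group as well, since J_{K+1,K}
    -- and J_{KK} vanish.
    by_cases h : l = 1
    · subst h
      have g : P.grp 1 = P.K := by simp [grp]
      simp only [X, if_neg hN, if_neg (hl rfl), if_pos hiN, if_true, g]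
      rw [P.J_eq_zero t 0 0 (i := (P.K : ℤ) + 1) (by omega),
        P.J_eq_zero t 0 0 (i := (P.K : ℤ)) (j := P.K) (by omega)]
      simp
    · simp only [X, if_neg hN, if_pos hiN, if_neg h, grp]
  · rw [e0] at d0
    rw [e1] at d1
    rw [e0, e1]
    by_cases h : l = 1
    · subst h
      have g : P.grp 1 = P.K := by simp [grp]
      have z := P.J_eq_zero t 1 0 (i := (P.K : ℤ)) (j := P.K) (by omega)
      simp only [denX, g, z, one_mul, zero_add] at d0 d1 ⊢
      simp only [Q, if_neg hN, if_neg (hl rfl), if_pos hiN, if_true]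
      exact mul_inv_inv_cancel _ _ _ d1.ne' d0.ne'
    · simp only [denX, one_mul] at d0 d1 ⊢
      simp only [Q, if_neg hN, if_neg h, if_pos hiN]
      exact mul_inv_inv_cancel _ _ _ d1.ne' d0.ne'

theorem Admissible.stepX_last {P : Params} (hP : P.Admissible) (t : ℝ) {l : ℕ} (h1 : 1 ≤ l)
    (h2 : l ≤ P.K) (hN : 2 ≤ P.NX l) : P.StepX t l (P.NX l) := by
  have e0 : P.stX l (P.NX l - 1)
      = (1, sigma (P.sigX l) (P.NX l - 1), sumR (P.tauX l) (P.sigX l) (P.NX l - 1)) := by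
    rw [stX, if_neg (by omega), if_neg (by omega)]
  have e1 : P.stX l (P.NX l) = (0, 0, 1) := by rw [stX, if_pos rfl]
  have hI := hP.internalX h1 h2
  have d0 := hP.denX_pos t h1 h2 (show P.NX l - 1 ≤ P.NX l by omega)
  have d1 := hP.denX_pos t h1 h2 le_rfl
  have hN1 : P.NX l ≠ 1 := by omega
  have hs : sigma (P.sigX l) (P.NX l - 1) = P.sigX l (P.NX l - 1) := by
    rw [sigma, if_neg (by omega)]
  have hs0 := hI.sig_pos (P.NX l - 1) (by omega) le_rfl
  have u : 0 < P.J t 1 1 (P.grp l - 1) (P.grp l - 1)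
      + P.sigX l (P.NX l - 1) * P.J t 1 1 (P.grp l - 1) (P.grp l - 2) := by
    have c1 := hP.J_pos t 1 1 (i := P.grp l - 1) (j := P.grp l - 1) (by unfold grp; omega)
      (by unfold grp; omega) (by unfold grp; omega) (by unfold grp; omega)
    have c3 := hP.J_nonneg t 1 1 (P.grp l - 1) (P.grp l - 2)
    positivity
  refine hP.stepX_of t h1 h2 le_rfl 1 _ u ?_ ?_ one_pos ?_
  · simp [e0, e1, minorRX, hs]
  · rw [e0, e1, one_mul, ← eq_div_iff u.ne']
    by_cases h : l = 1
    · subst h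
      have g : P.grp 1 = P.K := by simp [grp]
      simp only [X, if_neg hN1, lt_irrefl, if_false, if_true, g, minorLX, hs]
      rw [P.J_eq_zero t 0 0 (i := (P.K : ℤ)) (j := P.K) (by omega)]
      simp
    · simp only [X, if_neg hN1, lt_irrefl, if_false, if_neg h, minorLX, hs, grp]
      ring_nf
  · rw [e0] at d0
    rw [e1] at d1
    rw [e0, e1]
    by_cases h : l = 1
    · subst h
      have g : P.grp 1 = P.K := by simp [grp]
      have z := P.J_eq_zero t 1 0 (i := (P.K : ℤ)) (j := P.K) (by omega)
      simp only [denX, g, z, one_mul, zero_add, zero_mul, mul_zero, hs] at d0 d1 ⊢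
      simp only [Q, if_neg hN1, lt_irrefl, if_false, if_true]
      rw [div_mul_cancel₀ _ (mul_ne_zero d1.ne' d0.ne')]
    · simp only [denX, one_mul, zero_mul, zero_add, hs] at d0 d1 ⊢
      simp only [Q, if_neg hN1, if_neg h, lt_irrefl, if_false]
      rw [← grp, div_mul_cancel₀ _ (mul_ne_zero d1.ne' d0.ne')]

/-- The exceptional triple at the far left is combined with the fact that using all μ's (or all λ's)
lets the exponent of the weights be pulled out as a factor M (or L). This turns C/M times
J^{11}_{·,K-1} into C times J^{10}_{·,K-1} and produces the prefactor M/L of Q. -/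
theorem Admissible.stepX_leftmost {P : Params} (hP : P.Admissible) (t : ℝ) : P.StepX t 1 1 := by
  have hK := hP.K_pos
  have hNp := hP.NX_pos 1 le_rfl hK
  have g : P.grp 1 = P.K := by simp [grp]
  have hI := hP.internalX le_rfl hK
  have d0 := hP.denX_pos t le_rfl hK (show 1 - 1 ≤ P.NX 1 by omega)
  have d1 := hP.denX_pos t le_rfl hK (show 1 ≤ P.NX 1 by omega)
  have z1 := P.J_eq_zero t 0 0 (i := (P.K : ℤ) + 1) (j := P.K) (by omega)
  have z2 := P.J_eq_zero t 0 0 (i := (P.K : ℤ)) (j := P.K) (by omega)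
  have z3 := P.J_eq_zero t 1 0 (i := (P.K : ℤ)) (j := P.K) (by omega)
  have s1 := P.J_succ_left t 0 0 (P.K - 1)
  have s2 := P.J_succ_right t 0 0 P.K
  have s3 := P.J_succ_right t 1 0 P.K
  have s4 := P.J_succ_right t 1 0 (P.K - 1)
  have p1 := hP.J_pos t 0 0 (i := P.K) (j := P.K - 1) (by omega) (by omega) (by omega) (by omega)
  have p2 := hP.J_pos t 1 0 (i := P.K - 1) (j := P.K - 1) (by omega) (by omega) (by omega)
    (by omega)
  have p3 := hP.J_nonneg t 1 1 (P.K - 1) (P.K - 2)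
  have hM := hP.M_pos
  have hL := hP.L_pos
  have hC := hP.C_pos
  simp only [zero_add] at s1 s2 s3 s4
  by_cases hN : P.NX 1 = 1
  · have e0 : P.stX 1 (1 - 1) = (P.C / P.M, 1, 0) := by
      rw [stX, if_neg (by omega), if_pos (by omega), if_pos hN, add_zero]
    have e1 : P.stX 1 1 = (0, 0, 1) := by rw [stX, if_pos hN.symm]
    refine hP.stepX_of t le_rfl hK hNp 1
      (P.J t 1 1 (P.K - 1) (P.K - 2) + P.C * P.J t 1 0 (P.K - 1) (P.K - 1)) (by positivity)
      ?_ ?_ one_pos ?_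
    · rw [e0, e1, g, minorRX, s4]
      field_simp
      ring
    · rw [e0, e1, g, minorLX, z1, z2]
      simp only [X, if_pos hN, if_true]
      field_simp
      ring
    · rw [e0, e1, g]
      simp only [Q, if_pos hN, if_true, denX, z3, s1, s2]
      field_simp
      ring
  -- The summand 1/σ₁ is chosen so that the first minor (C/M + 1/σ₁) σ₁ - 1 reduces to C σ₁/M. After
  -- division by σ₁ τ₁ the three minors give the denominator U + C V.
  · have e0 : P.stX 1 (1 - 1) = (P.C / P.M + 1 / P.sigX 1 1, 1, 0) := by
      rw [stX, if_neg (by omega), if_pos (by omega), if_neg hN]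
    have q1 := hI.sig_pos 1 le_rfl (by omega)
    have q2 := hI.tau_pos 1 le_rfl (by omega)
    have e1 : P.stX 1 1 = (1, P.sigX 1 1, P.sigX 1 1 * P.tauX 1 1) := by
      rw [stX, if_neg (by omega), if_neg (by omega)]
      simp [sigma, sumR, sumT, sumS]
    refine hP.stepX_of t le_rfl hK hNp (P.sigX 1 1 * P.tauX 1 1)
      (P.J t 1 1 (P.K - 1) (P.K - 2) + 1 / P.sigX 1 1 * P.J t 1 1 (P.K - 1) (P.K - 1)
          + P.C * (P.J t 1 0 (P.K - 1) (P.K - 1) + 1 / P.tauX 1 1 * P.J t 1 0 P.K (P.K - 1)))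
      ?_ ?_ ?_ (by positivity) ?_
    · rw [s4, s1]; positivity
    · rw [e0, e1, g, minorRX, s4, s3]
      field_simp
      ring
    · rw [e0, e1, g, minorLX, z1, z2]
      have : 0 < P.J t 1 1 (P.K - 1) (P.K - 2) + 1 / P.sigX 1 1 * P.J t 1 1 (P.K - 1) (P.K - 1)
          + P.C * (P.J t 1 0 (P.K - 1) (P.K - 1)
            + 1 / P.tauX 1 1 * P.J t 1 0 P.K (P.K - 1)) := by
        rw [s4, s1]; positivity
      simp only [X, if_neg hN, if_true]
      rw [mul_left_comm, div_mul_cancel₀ _ this.ne']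
      ring
    · rw [e0, e1, g]
      have : 0 < P.J t 1 0 (P.K - 1) (P.K - 1) + 1 / P.tauX 1 1 * P.J t 1 0 P.K (P.K - 1) := by
        rw [s1]; positivity
      have e : P.denX t P.K (1, P.sigX 1 1, P.sigX 1 1 * P.tauX 1 1)
          = P.sigX 1 1 * P.tauX 1 1 * (P.J t 1 0 (P.K - 1) (P.K - 1)
            + 1 / P.tauX 1 1 * P.J t 1 0 P.K (P.K - 1)) := by
        simp only [denX, z3]
        field_simp
        ring
      have e' : P.denX t P.K (P.C / P.M + 1 / P.sigX 1 1, 1, 0) = P.L * P.J t 0 0 P.K (P.K - 1) := by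
        simp only [denX, z3, s1]
        ring
      rw [e, e']
      simp only [Q, if_neg hN, if_true, s2]
      generalize P.J t 1 0 (P.K - 1) (P.K - 1) + 1 / P.tauX 1 1 * P.J t 1 0 P.K (P.K - 1) = V at *
      field_simp

theorem Admissible.stepX {P : Params} (hP : P.Admissible) (t : ℝ) {l i : ℕ} (h1 : 1 ≤ l)
    (h2 : l ≤ P.K) (hi : 1 ≤ i) (hiN : i ≤ P.NX l) : P.StepX t l i := by
  by_cases h : l = 1 ∧ i = 1
  · rw [h.1, h.2]; exact hP.stepX_leftmost t
  rcases hiN.lt_or_eq with hlt | heq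
  · exact hP.stepX_inner t h1 h2 hi hlt (by omega)
  by_cases hN : P.NX l = 1
  · obtain rfl : i = 1 := by omega
    exact hP.stepX_singleton t (by omega) h2 hN
  · rw [heq]; exact hP.stepX_last t h1 h2 (by omega)

theorem J_zero_right (P : Params) (t : ℝ) (r s s' : ℕ) (i : ℤ) :
    P.J t r s i 0 = P.J t r s' i 0 := by
  simp [J]

theorem Admissible.stepY_singleton {P : Params} (hP : P.Admissible) (t : ℝ) {l : ℕ} (h1 : 1 ≤ l)
    (h2 : l < P.K) (hN : P.NY l = 1) : P.StepY t l 1 := by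
  have e0 : P.stY l 0 = (1, 0, 0) := by
    rw [stY, if_neg (by omega), sumR_zero]; simp [sigma]
  have e1 : P.stY l 1 = (0, 0, 1) := by rw [stY, if_pos hN.symm, if_neg (by omega)]
  have d0 := hP.denY_pos t h1 h2.le (show 0 ≤ P.NY l by omega)
  have d1 := hP.denY_pos t h1 h2.le (show 1 ≤ P.NY l by omega)
  have u := hP.J_pos t 1 1 (i := P.grp l - 1) (j := P.grp l - 2) (by unfold grp; omega)
    (by unfold grp; omega) (by unfold grp; omega) (by unfold grp; omega)
  refine hP.stepY_of t h1 h2.le (by omega) 1 (P.J t 1 1 (P.grp l - 1) (P.grp l - 2)) u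
    ?_ ?_ one_pos ?_
  · simp [e0, e1, minorRY]
  · simp only [e0, e1, minorLY, Y, if_pos hN, if_neg h2.ne]
    rw [← grp]
    field_simp
    ring
  · rw [e0] at d0
    rw [e1] at d1
    simp only [denY, e0, e1, PP, if_pos hN, if_neg h2.ne, zero_mul, one_mul, zero_add,
      add_zero] at d0 d1 ⊢
    rw [← grp]
    field_simp

theorem Admissible.stepY_inner {P : Params} (hP : P.Admissible) (t : ℝ) {l i : ℕ} (h1 : 1 ≤ l)
    (h2 : l ≤ P.K) (hi : 1 ≤ i) (hiN : i < P.NY l) : P.StepY t l i := by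
  have e0 : P.stY l (i - 1)
      = (1, sigma (P.sigY l) (i - 1), sumR (P.tauY l) (P.sigY l) (i - 1)) := by
    rw [stY, if_neg (by omega)]
  have e1 : P.stY l i = (1, sigma (P.sigY l) i, sumR (P.tauY l) (P.sigY l) i) := by
    rw [stY, if_neg (by omega)]
  have hI := hP.internalY h1 h2
  have d0 := hP.denY_pos t h1 h2 (show i - 1 ≤ P.NY l by omega)
  have d1 := hP.denY_pos t h1 h2 (show i ≤ P.NY l by omega)
  have hs : 0 < sigma (P.sigY l) i - sigma (P.sigY l) (i - 1) := by
    have := hI.sigma_lt (i := i - 1) (by omega)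
    rw [Nat.sub_add_cancel hi] at this
    linarith
  have u : 0 < P.J t 1 1 (P.grp l - 1) (P.grp l - 1)
      + sumT (P.tauY l) i * P.J t 1 1 (P.grp l - 1) (P.grp l - 2)
      + sumS (P.tauY l) (P.sigY l) i * P.J t 1 1 (P.grp l - 2) (P.grp l - 2) := by
    have c1 := hP.J_pos t 1 1 (i := P.grp l - 1) (j := P.grp l - 1) (by unfold grp; omega)
      (by unfold grp; omega) (by unfold grp; omega) (by unfold grp; omega)
    have c2 := hP.J_nonneg t 1 1 (P.grp l - 1) (P.grp l - 2)
    have c3 := hP.J_nonneg t 1 1 (P.grp l - 2) (P.grp l - 2)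
    have c4 := hI.sumT_nonneg (show i ≤ P.NY l - 1 by omega)
    have c5 := hI.sumS_nonneg (show i ≤ P.NY l - 1 by omega)
    positivity
  have hN : P.NY l ≠ 1 := by omega
  refine hP.stepY_of t h1 h2 hiN.le _ _ u (by rw [e0, e1, minorRY_inner _ _ _ _ _ hi]) ?_ hs ?_
  · rw [e0, e1, minorLY_inner _ _ _ _ _ hi, mul_left_comm]
    congr 1
    rw [← eq_div_iff u.ne']
    by_cases h : l = P.K
    · subst h
      have g : P.grp P.K = 1 := by simp [grp]
      simp only [Y, if_neg hN, if_pos hiN, if_true, g]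
      rw [P.J_eq_zero t 1 1 (i := (1 : ℤ) - 1) (j := (1 : ℤ) - 2) (by omega),
        P.J_eq_zero t 1 1 (i := (1 : ℤ) - 2) (j := (1 : ℤ) - 2) (by omega)]
      simp [P.J_zero_zero hP.K_pos]
    · simp only [Y, if_neg hN, if_pos hiN, if_neg h, grp]
  · rw [e0] at d0
    rw [e1] at d1
    rw [e0, e1]
    by_cases h : l = P.K
    · subst h
      have g : P.grp P.K = 1 := by simp [grp]
      have z := P.J_eq_zero t 0 1 (i := 0) (j := (1 : ℤ) - 2) (by omega)
      have z1 := P.J_eq_zero t 1 1 (i := 0) (j := (1 : ℤ) - 2) (by omega)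
      have z2 := P.J_eq_zero t 1 1 (i := (1 : ℤ) - 2) (j := (1 : ℤ) - 2) (by omega)
      simp only [denY, g, one_mul, sub_self, z, z1, z2, P.J_zero_zero hP.K_pos, mul_one, mul_zero,
        add_zero] at d0 d1 ⊢
      simp only [PP, if_neg hN, if_pos hiN, if_true]
      rw [div_mul_cancel₀ _ (mul_ne_zero d1.ne' d0.ne')]
    · simp only [denY, one_mul] at d0 d1 ⊢
      simp only [PP, if_neg hN, if_neg h, if_pos hiN]
      exact mul_inv_inv_cancel _ _ _ d1.ne' d0.ne'

theorem Admissible.stepY_last {P : Params} (hP : P.Admissible) (t : ℝ) {l : ℕ} (h1 : 1 ≤ l)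
    (h2 : l < P.K) (hN : 2 ≤ P.NY l) : P.StepY t l (P.NY l) := by
  have e0 : P.stY l (P.NY l - 1)
      = (1, sigma (P.sigY l) (P.NY l - 1), sumR (P.tauY l) (P.sigY l) (P.NY l - 1)) := by
    rw [stY, if_neg (by omega)]
  have e1 : P.stY l (P.NY l) = (0, 0, 1) := by rw [stY, if_pos rfl, if_neg h2.ne]
  have hI := hP.internalY h1 h2.le
  have d0 := hP.denY_pos t h1 h2.le (show P.NY l - 1 ≤ P.NY l by omega)
  have d1 := hP.denY_pos t h1 h2.le le_rfl
  have hN1 : P.NY l ≠ 1 := by omega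
  have hs : sigma (P.sigY l) (P.NY l - 1) = P.sigY l (P.NY l - 1) := by
    rw [sigma, if_neg (by omega)]
  have hs0 := hI.sig_pos (P.NY l - 1) (by omega) le_rfl
  have u : 0 < P.J t 1 1 (P.grp l - 1) (P.grp l - 2)
      + P.sigY l (P.NY l - 1) * P.J t 1 1 (P.grp l - 2) (P.grp l - 2) := by
    have c1 := hP.J_pos t 1 1 (i := P.grp l - 1) (j := P.grp l - 2) (by unfold grp; omega)
      (by unfold grp; omega) (by unfold grp; omega) (by unfold grp; omega)
    have c3 := hP.J_nonneg t 1 1 (P.grp l - 2) (P.grp l - 2)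
    positivity
  refine hP.stepY_of t h1 h2.le le_rfl 1 _ u ?_ ?_ one_pos ?_
  · simp [e0, e1, minorRY, hs]
  · rw [e0, e1, one_mul, ← eq_div_iff u.ne']
    simp only [Y, if_neg hN1, lt_irrefl, if_false, if_neg h2.ne, minorLY, hs, grp]
    ring_nf
  · rw [e0] at d0
    rw [e1] at d1
    rw [e0, e1]
    simp only [denY, one_mul, zero_mul, zero_add, hs] at d0 d1 ⊢
    simp only [PP, if_neg hN1, if_neg h2.ne, lt_irrefl, if_false]
    rw [← grp, div_mul_cancel₀ _ (mul_ne_zero d1.ne' d0.ne')]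

/-- Against (0, 1, D + T) with T = T_{N-1}, the triple (1, σ, R) has the minors 1, D + T and σ(D +
T) - R = S + Dσ, which are the coefficients in the formula for the last Y. Singletons are included,
with σ = T = S = 0. -/
theorem Admissible.stepY_rightmost {P : Params} (hP : P.Admissible) (t : ℝ) :
    P.StepY t P.K (P.NY P.K) := by
  have hK := hP.K_pos
  have hNp := hP.NY_pos P.K hK le_rfl
  have g : P.grp P.K = 1 := by simp [grp]
  have hI := hP.internalY hK le_rfl
  have d0 := hP.denY_pos t hK le_rfl (show P.NY P.K - 1 ≤ P.NY P.K by omega)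
  have d1 := hP.denY_pos t hK le_rfl (le_refl (P.NY P.K))
  have e1 : P.stY P.K (P.NY P.K)
      = (0, 1, P.D + sumT (P.tauY P.K) (P.NY P.K - 1)) := by
    rw [stY, if_pos rfl, if_pos rfl]
  have e0 : P.stY P.K (P.NY P.K - 1) = (1, sigma (P.sigY P.K) (P.NY P.K - 1),
      sumR (P.tauY P.K) (P.sigY P.K) (P.NY P.K - 1)) := by
    rw [stY, if_neg (by omega)]
  have z := P.J_eq_zero t 0 1 (i := 0) (j := (1 : ℤ) - 2) (by omega)
  have z1 := P.J_eq_zero t 1 1 (i := 0) (j := (1 : ℤ) - 2) (by omega)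
  have z2 := P.J_eq_zero t 1 1 (i := (1 : ℤ) - 2) (j := (1 : ℤ) - 2) (by omega)
  have j0 := P.J_zero_zero hK t
  rw [e0, g] at d0
  refine hP.stepY_of t hK le_rfl le_rfl 1 1 one_pos ?_ ?_ one_pos ?_
  · rw [e0, e1, g, minorRY]
    simp only [sub_self, z1, z2, j0]
    ring
  · rw [e0, e1, g, minorLY]
    simp only [sub_self, j0]
    by_cases hN : P.NY P.K = 1
    · simp [Y, hN, sumT, sumR, sumS, sigma]
    · have hs : sigma (P.sigY P.K) (P.NY P.K - 1) = P.sigY P.K (P.NY P.K - 1) := by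
        rw [sigma, if_neg (by omega)]
      simp only [Y, if_neg hN, lt_irrefl, if_false, if_true, hs, sumR]
      ring
  · rw [e0, e1, g]
    simp only [denY, one_mul, sub_self, z, j0, mul_one, mul_zero, add_zero, zero_mul,
      zero_add] at d0 ⊢
    by_cases hN : P.NY P.K = 1
    -- Since no μ is used, J^{01}_{10} and J^{00}_{10} coincide.
    · simp only [hN, sigma, PP, if_true, P.J_zero_right t 0 1 0] at d0 ⊢
      simp only [add_zero] at d0 ⊢
      field_simp
    · have hs : sigma (P.sigY P.K) (P.NY P.K - 1) = P.sigY P.K (P.NY P.K - 1) := by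
        rw [sigma, if_neg (by omega)]
      rw [hs] at d0 ⊢
      simp only [PP, if_neg hN, lt_irrefl, if_false, if_true]
      exact div_mul_cancel₀ _ d0.ne'

theorem Admissible.stepY {P : Params} (hP : P.Admissible) (t : ℝ) {l i : ℕ} (h1 : 1 ≤ l)
    (h2 : l ≤ P.K) (hi : 1 ≤ i) (hiN : i ≤ P.NY l) : P.StepY t l i := by
  rcases hiN.lt_or_eq with hlt | rfl
  · exact hP.stepY_inner t h1 h2 hi hlt
  rcases h2.lt_or_eq with h2 | rfl
  · by_cases hN : P.NY l = 1
    · rw [hN]; exact hP.stepY_singleton t h1 h2 hN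
    · exact hP.stepY_last t h1 h2 (by omega)
  · exact hP.stepY_rightmost t

end Params

end GengXue

end

/-! ### Telescoping, and the explicit solution at all times. -/

noncomputable section

namespace GengXue

open Finset

theorem sumLeft_succ_zero (N : ℕ → ℕ) (f : ℕ → ℕ → ℝ) {k : ℕ} (hk : 1 ≤ k) :
    sumLeft N f (k + 1) 0 = sumLeft N f k (N k) := by
  rw [sumLeft, sumLeft, sum_Ico_succ_top hk]
  simp

theorem sumRight_succ_zero (K : ℕ) (N : ℕ → ℕ) (f : ℕ → ℕ → ℝ) {k : ℕ} (hk : k + 1 ≤ K) :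
    sumRight K N f (k + 1) 0 = sumRight K N f k (N k) := by
  have e : Ioc k K = insert (k + 1) (Ioc (k + 1) K) := by
    ext l; simp only [mem_insert, mem_Ioc]; omega
  have e' : Ioc 0 (N (k + 1)) = Icc 1 (N (k + 1)) := by ext; simp [Nat.lt_iff_add_one_le]
  rw [sumRight, sumRight, e, sum_insert (by simp), e']
  simp [add_comm]

/-- A family given by the steps of a function of the places has that function as left sum. -/
theorem sumLeft_eq_of_step (K : ℕ) (N : ℕ → ℕ) (f F : ℕ → ℕ → ℝ) (h0 : F 1 0 = 0)
    (hg : ∀ k, 1 ≤ k → k + 1 ≤ K → F (k + 1) 0 = F k (N k))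
    (hs : ∀ k i, 1 ≤ k → k ≤ K → 1 ≤ i → i ≤ N k → F k i - F k (i - 1) = f k i)
    {k i : ℕ} (hk : 1 ≤ k) (hkK : k ≤ K) (hi : i ≤ N k) : sumLeft N f k i = F k i := by
  have inner : ∀ k, 1 ≤ k → k ≤ K → sumLeft N f k 0 = F k 0 →
      ∀ i ≤ N k, sumLeft N f k i = F k i := by
    intro k hk hkK h i
    induction i with
    | zero => exact fun _ => h
    | succ i ih =>
      intro hi
      have := hs k (i + 1) hk hkK (by omega) hi
      rw [sumLeft_step _ _ _ _ (by omega), Nat.add_sub_cancel, ih (by omega)]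
      rw [Nat.add_sub_cancel] at this
      linarith
  refine inner k hk hkK ?_ i hi
  clear hi
  induction k, hk using Nat.le_induction with
  | base => simp [sumLeft, h0]
  | succ k hk ih =>
    rw [sumLeft_succ_zero _ _ hk, hg k hk hkK]
    exact inner k hk (by omega) (ih (by omega)) _ le_rfl

/-- A family given by the steps of a function of the places has that function as right sum. -/
theorem sumRight_eq_of_step (K : ℕ) (N : ℕ → ℕ) (f F : ℕ → ℕ → ℝ) (h0 : F K (N K) = 0)
    (hg : ∀ k, 1 ≤ k → k + 1 ≤ K → F (k + 1) 0 = F k (N k))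
    (hs : ∀ k i, 1 ≤ k → k ≤ K → 1 ≤ i → i ≤ N k → F k (i - 1) - F k i = f k i)
    {k i : ℕ} (hk : 1 ≤ k) (hkK : k ≤ K) (hi : i ≤ N k) : sumRight K N f k i = F k i := by
  have inner : ∀ k, 1 ≤ k → k ≤ K → sumRight K N f k (N k) = F k (N k) →
      ∀ i ≤ N k, sumRight K N f k i = F k i := by
    intro k hk hkK h i hi
    induction hi using Nat.decreasingInduction with
    | self => exact h
    | of_succ i hi ih =>
      have := hs k (i + 1) hk hkK (by omega) hi
      have e := sumRight_step K N f k (i + 1) (by omega) hi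
      rw [Nat.add_sub_cancel] at this e
      rw [e, ih]
      linarith
  refine inner k hk hkK ?_ i hi
  clear hi
  induction hkK using Nat.decreasingInduction with
  | self => simp [sumRight, h0]
  | of_succ k hkK ih =>
    rw [← sumRight_succ_zero _ _ _ hkK, ← hg k hk hkK]
    exact inner (k + 1) (by omega) (by omega) (ih (by omega)) _ (Nat.zero_le _)

namespace Params

theorem jW_eq_zero_of_lt (P : Params) (w v : ℕ → ℝ) (f g : ℝ → ℝ) (i j : ℤ)
    (h : (P.K : ℤ) - 1 < j) (hK : 1 ≤ P.K) : P.data.jW w v f g i j = 0 := by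
  unfold PointData.jW jSum
  refine sum_eq_zero fun I hI => sum_eq_zero fun J hJ => ?_
  rw [mem_cardSub] at hI hJ
  have := card_le_card hJ.1
  simp [data] at this
  omega

/-- Before a group the triple is (1, 0, 0) at index j, after the preceding group of the same kind it
is (0, 0, 1) at index j + 1. Both select the same sums J, which is how the partial sums of
successive groups fit together. -/
theorem Admissible.stX_zero {P : Params} (hP : P.Admissible) {l : ℕ} (h1 : 2 ≤ l) (h2 : l ≤ P.K) :
    P.stX l 0 = (1, 0, 0) := by
  have := hP.NX_pos l (by omega) h2
  rw [stX, if_neg (by omega), if_neg (by omega), sumR_zero]; simp [sigma]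

theorem Admissible.stY_zero {P : Params} (hP : P.Admissible) {l : ℕ} (h1 : 1 ≤ l) (h2 : l ≤ P.K) :
    P.stY l 0 = (1, 0, 0) := by
  have := hP.NY_pos l (by omega) h2
  rw [stY, if_neg (by omega), sumR_zero]; simp [sigma]

theorem stX_last (P : Params) (l : ℕ) : P.stX l (P.NX l) = (0, 0, 1) := if_pos rfl

theorem stY_last (P : Params) {l : ℕ} (h : l < P.K) : P.stY l (P.NY l) = (0, 0, 1) := by
  rw [stY, if_pos rfl, if_neg h.ne]

theorem grp_succ (P : Params) (l : ℕ) : P.grp (l + 1) = P.grp l - 1 := by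
  unfold grp; push_cast; ring

theorem Admissible.sumLeft_X {P : Params} (hP : P.Admissible) (t : ℝ) {l i : ℕ} (h1 : 1 ≤ l)
    (h2 : l ≤ P.K) (hi : i ≤ P.NX l) :
    sumLeft P.NX (fun k i => P.Q t k i * P.X t k i) l i = P.leftX t (P.grp l) (P.stX l i) := by
  refine sumLeft_eq_of_step P.K P.NX _ (fun l i => P.leftX t (P.grp l) (P.stX l i)) ?_
    (fun k hk hkK => ?_) (fun k i hk hkK hi hiN => (hP.stepX t hk hkK hi hiN).1.1) h1 h2 hi
  -- At the far left the first two numerators would need K + 1 eigenvalues λ and therefore vanish,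
  -- and the third coefficient is 0.
  · have hN := hP.NX_pos 1 le_rfl hP.K_pos
    have e : P.stX 1 0 = (P.C / P.M + if P.NX 1 = 1 then 0 else 1 / P.sigX 1 1, 1, 0) := by
      rw [stX, if_neg (by omega), if_pos (by omega)]
    rw [leftX, e, div_eq_zero_iff]
    left
    simp only [PointData.numL, PointData.comb, grp]
    rw [P.jW_eq_zero _ _ _ _ _ _ (by omega), P.jW_eq_zero _ _ _ _ _ _ (by omega)]
    simp
  · rw [hP.stX_zero (by omega) hkK, stX_last, grp_succ]
    simp only [leftX, PointData.numL, PointData.den, PointData.comb, zero_mul, one_mul, add_zero,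
      zero_add]

theorem Admissible.sumRight_X {P : Params} (hP : P.Admissible) (t : ℝ) {l i : ℕ} (h1 : 1 ≤ l)
    (h2 : l ≤ P.K) (hi : i ≤ P.NX l) :
    sumRight P.K P.NX (fun k i => P.Q t k i) l i = P.rightX t (P.grp l) (P.stX l i) := by
  refine sumRight_eq_of_step P.K P.NX _ (fun l i => P.rightX t (P.grp l) (P.stX l i)) ?_
    (fun k hk hkK => ?_) (fun k i hk hkK hi hiN => (hP.stepX t hk hkK hi hiN).1.2) h1 h2 hi
  -- At the far right the only selected numerator has first index 0 and second index -1.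
  · rw [stX_last, rightX, div_eq_zero_iff]
    left
    simp only [PointData.numR, PointData.comb, grp]
    rw [P.jW_eq_zero _ _ _ _ ((P.K : ℤ) + 1 - P.K - 1) _ (by omega)]
    simp
  · rw [hP.stX_zero (by omega) hkK, stX_last, grp_succ]
    simp only [rightX, PointData.numR, PointData.den, PointData.comb, zero_mul, one_mul, add_zero,
      zero_add]

theorem Admissible.sumLeft_Y {P : Params} (hP : P.Admissible) (t : ℝ) {l i : ℕ} (h1 : 1 ≤ l)
    (h2 : l ≤ P.K) (hi : i ≤ P.NY l) :
    sumLeft P.NY (fun k i => P.PP t k i * P.Y t k i) l i = P.leftY t (P.grp l) (P.stY l i) := by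
  refine sumLeft_eq_of_step P.K P.NY _ (fun l i => P.leftY t (P.grp l) (P.stY l i)) ?_
    (fun k hk hkK => ?_) (fun k i hk hkK hi hiN => (hP.stepY t hk hkK hi hiN).1.1) h1 h2 hi
  · rw [leftY, hP.stY_zero le_rfl hP.K_pos, div_eq_zero_iff]
    left
    simp only [PointData.numL, PointData.comb, PointData.jW_swap, grp]
    rw [P.jW_eq_zero_of_lt _ _ _ _ _ _ (by push_cast; omega) hP.K_pos]
    simp
  · rw [hP.stY_zero (by omega) hkK, stY_last _ hkK, grp_succ]
    simp only [leftY, PointData.numL, PointData.den, PointData.comb, zero_mul, one_mul, add_zero,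
      zero_add]

theorem Admissible.sumRight_Y {P : Params} (hP : P.Admissible) (t : ℝ) {l i : ℕ} (h1 : 1 ≤ l)
    (h2 : l ≤ P.K) (hi : i ≤ P.NY l) :
    sumRight P.K P.NY (fun k i => P.PP t k i) l i = P.rightY t (P.grp l) (P.stY l i) := by
  refine sumRight_eq_of_step P.K P.NY _ (fun l i => P.rightY t (P.grp l) (P.stY l i)) ?_
    (fun k hk hkK => ?_) (fun k i hk hkK hi hiN => (hP.stepY t hk hkK hi hiN).1.2) h1 h2 hi
  · rw [stY, if_pos rfl, if_pos rfl, rightY, div_eq_zero_iff]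
    left
    simp only [PointData.numR, PointData.comb, PointData.jW_swap, grp]
    rw [P.jW_eq_zero _ _ _ _ ((P.K : ℤ) + 1 - P.K - 1 - 1) _ (by omega),
      P.jW_eq_zero _ _ _ _ _ ((P.K : ℤ) + 1 - P.K - 1 - 1) (by omega)]
    simp
  · rw [hP.stY_zero (by omega) hkK, stY_last _ hkK, grp_succ]
    simp only [rightY, PointData.numR, PointData.den, PointData.comb, zero_mul, one_mul, add_zero,
      zero_add]

/-- The explicit formulas solve the equations. -/
theorem Admissible.isPolynomialSolution {P : Params} (hP : P.Admissible) :
    IsPolynomialSolution P.K P.NX P.NY (fun k i t => P.Q t k i)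
      (fun k i t => P.Q t k i * P.X t k i) (fun k i t => P.PP t k i)
      (fun k i t => P.PP t k i * P.Y t k i) := by
  have hK := hP.K_pos
  have hX : ∀ l i t, 1 ≤ l → l ≤ P.K → 1 ≤ i → i ≤ P.NX l →
      HasDerivAt (fun t => P.Q t l i) (massRate P.K P.NX (fun k i => P.Q t k i)
        (fun k i => P.Q t k i * P.X t k i)
        (sumLeft P.NY (fun k i => P.PP t k i * P.Y t k i) l 0)
        (sumRight P.K P.NY (fun k i => P.PP t k i) l 0) l i) t ∧
      HasDerivAt (fun t => P.Q t l i * P.X t l i) (momentRate P.K P.NX (fun k i => P.Q t k i)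
        (fun k i => P.Q t k i * P.X t k i)
        (sumLeft P.NY (fun k i => P.PP t k i * P.Y t k i) l 0)
        (sumRight P.K P.NY (fun k i => P.PP t k i) l 0) l i) t := by
    intro l i t h1 h2 hi hiN
    have hG : P.data.jW (P.a t) (P.b t) 1 id (P.grp l) (P.grp l - 1) ≠ 0 := by
      rw [P.jW_one_id hK]
      exact (hP.J_pos t _ _ (by unfold grp; omega) (by unfold grp; omega) (by unfold grp; omega)
        (by unfold grp; omega)).ne'
    obtain ⟨δ, ε, H⟩ := P.data.hasDerivAt_sums hP.data_valid P.a0 P.b0 (P.grp l) (P.grp l) t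
      P.a P.b rfl rfl hG
    have H1 := H (P.stX l i) (by rw [P.den_data hK]; exact (hP.denX_pos t h1 h2 hiN).ne')
    have H0 := H (P.stX l (i - 1))
      (by rw [P.den_data hK]; exact (hP.denX_pos t h1 h2 (by omega)).ne')
    have eq : (fun t => P.Q t l i) = fun t => P.rightX t (P.grp l) (P.stX l (i - 1))
        - P.rightX t (P.grp l) (P.stX l i) :=
      funext fun t => (hP.stepX t h1 h2 hi hiN).1.2.symm
    have ev : (fun t => P.Q t l i * P.X t l i) = fun t => P.leftX t (P.grp l) (P.stX l i)
        - P.leftX t (P.grp l) (P.stX l (i - 1)) :=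
      funext fun t => (hP.stepX t h1 h2 hi hiN).1.1.symm
    -- The factors in the evolution of the X-sums are themselves partial sums of the Y-family, taken
    -- at the place just before the lth Y-group. That place has the same peakons of the other kind
    -- on either side as every place of the lth X-group.
    have eD : P.rightY t (P.grp l) (P.stY l 0)
        = P.data.jW (P.a t) (P.b t) (fun z => z ^ 2) 1 (P.grp l - 1) (P.grp l - 1)
          / P.data.jW (P.a t) (P.b t) 1 id (P.grp l) (P.grp l - 1) := by
      rw [hP.stY_zero h1 h2]
      simp only [rightY, PointData.numR, PointData.den, PointData.comb, PointData.jW_swap,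
        zero_mul, one_mul, add_zero]
    have eC : P.leftY t (P.grp l) (P.stY l 0)
        = P.data.jW (P.a t) (P.b t) id Inv.inv (P.grp l) (P.grp l)
          / P.data.jW (P.a t) (P.b t) 1 id (P.grp l) (P.grp l - 1) := by
      rw [hP.stY_zero h1 h2]
      simp only [leftY, PointData.numL, PointData.den, PointData.comb, PointData.jW_swap,
        zero_mul, one_mul, add_zero, sub_add_cancel]
    rw [← eD, ← eC] at H0 H1
    rw [eq, ev]
    simp only [massRate, momentRate, placeRate]
    rw [hP.sumLeft_Y t h1 h2 (Nat.zero_le _), hP.sumRight_Y t h1 h2 (Nat.zero_le _),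
      hP.sumLeft_X t h1 h2 hiN, hP.sumLeft_X t h1 h2 (show i - 1 ≤ P.NX l by omega),
      hP.sumRight_X t h1 h2 hiN, hP.sumRight_X t h1 h2 (show i - 1 ≤ P.NX l by omega)]
    constructor
    -- The inhomogeneous terms δ, ε are common to both places and disappear in the difference.
    · refine (H0.2.sub H1.2).congr_deriv ?_
      simp only [leftX, rightX]
      ring
    · refine (H1.1.sub H0.1).congr_deriv ?_
      simp only [leftX, rightX]
      ring
  have hY : ∀ l i t, 1 ≤ l → l ≤ P.K → 1 ≤ i → i ≤ P.NY l →
      HasDerivAt (fun t => P.PP t l i) (massRate P.K P.NY (fun k i => P.PP t k i)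
        (fun k i => P.PP t k i * P.Y t k i)
        (sumLeft P.NX (fun k i => P.Q t k i * P.X t k i) l (P.NX l))
        (sumRight P.K P.NX (fun k i => P.Q t k i) l (P.NX l)) l i) t ∧
      HasDerivAt (fun t => P.PP t l i * P.Y t l i) (momentRate P.K P.NY (fun k i => P.PP t k i)
        (fun k i => P.PP t k i * P.Y t k i)
        (sumLeft P.NX (fun k i => P.Q t k i * P.X t k i) l (P.NX l))
        (sumRight P.K P.NX (fun k i => P.Q t k i) l (P.NX l)) l i) t := by
    intro l i t h1 h2 hi hiN
    have hG : P.data.swap.jW (P.b t) (P.a t) 1 id (P.grp l - 1) (P.grp l - 1) ≠ 0 := by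
      rw [PointData.jW_swap, P.jW_id_one hK]
      exact (hP.J_pos t _ _ (by unfold grp; omega) (by unfold grp; omega) (by unfold grp; omega)
        (by unfold grp; omega)).ne'
    obtain ⟨δ, ε, H⟩ := P.data.swap.hasDerivAt_sums hP.data_valid.swap P.b0 P.a0 (P.grp l - 1)
      (P.grp l) t P.b P.a rfl rfl hG
    have H1 := H (P.stY l i) (by rw [P.den_data_swap hK]; exact (hP.denY_pos t h1 h2 hiN).ne')
    have H0 := H (P.stY l (i - 1))
      (by rw [P.den_data_swap hK]; exact (hP.denY_pos t h1 h2 (by omega)).ne')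
    have eq : (fun t => P.PP t l i) = fun t => P.rightY t (P.grp l) (P.stY l (i - 1))
        - P.rightY t (P.grp l) (P.stY l i) :=
      funext fun t => (hP.stepY t h1 h2 hi hiN).1.2.symm
    have ev : (fun t => P.PP t l i * P.Y t l i) = fun t => P.leftY t (P.grp l) (P.stY l i)
        - P.leftY t (P.grp l) (P.stY l (i - 1)) :=
      funext fun t => (hP.stepY t h1 h2 hi hiN).1.1.symm
    have eD : P.rightX t (P.grp l) (P.stX l (P.NX l))
        = P.data.swap.jW (P.b t) (P.a t) (fun z => z ^ 2) 1 (P.grp l - 1 - 1) (P.grp l - 1)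
          / P.data.swap.jW (P.b t) (P.a t) 1 id (P.grp l - 1) (P.grp l - 1) := by
      rw [stX_last]
      simp only [rightX, PointData.numR, PointData.den, PointData.comb, PointData.jW_swap,
        zero_mul, one_mul, zero_add]
    have eC : P.leftX t (P.grp l) (P.stX l (P.NX l))
        = P.data.swap.jW (P.b t) (P.a t) id Inv.inv (P.grp l - 1) (P.grp l)
          / P.data.swap.jW (P.b t) (P.a t) 1 id (P.grp l - 1) (P.grp l - 1) := by
      rw [stX_last]
      simp only [leftX, PointData.numL, PointData.den, PointData.comb, PointData.jW_swap,
        zero_mul, one_mul, zero_add, sub_add_cancel]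
    rw [← eD, ← eC] at H0 H1
    rw [eq, ev]
    simp only [massRate, momentRate, placeRate]
    rw [hP.sumLeft_X t h1 h2 le_rfl, hP.sumRight_X t h1 h2 le_rfl,
      hP.sumLeft_Y t h1 h2 hiN, hP.sumLeft_Y t h1 h2 (show i - 1 ≤ P.NY l by omega),
      hP.sumRight_Y t h1 h2 hiN, hP.sumRight_Y t h1 h2 (show i - 1 ≤ P.NY l by omega)]
    constructor
    · refine (H0.2.sub H1.2).congr_deriv ?_
      simp only [leftY, rightY]
      ring
    · refine (H1.1.sub H0.1).congr_deriv ?_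
      simp only [leftY, rightY]
      ring
  exact ⟨fun k i t h1 h2 h3 h4 => (hX k i t h1 h2 h3 h4).1,
    fun k i t h1 h2 h3 h4 => (hX k i t h1 h2 h3 h4).2,
    fun k i t h1 h2 h3 h4 => (hY k i t h1 h2 h3 h4).1,
    fun k i t h1 h2 h3 h4 => (hY k i t h1 h2 h3 h4).2⟩

theorem exp_two_mul_half {m x : ℝ} :
    m * Real.exp x = 2 * m * Real.exp (-x) * (1 / 2 * Real.exp (2 * x)) := by
  have : Real.exp (2 * x) = Real.exp x * Real.exp x := by rw [← Real.exp_add]; ring_nf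
  rw [this, Real.exp_neg]
  field_simp

/-- The solution is given by the explicit formulas at all times. -/
theorem Admissible.explicit {P : Params} (hP : P.Admissible) {x m y n : ℕ → ℕ → ℝ → ℝ}
    (hsol : IsPeakonSolution P.K P.NX P.NY x m y n) (hinit : P.HasInitialData x m y n) (t : ℝ) :
    (∀ l i, 1 ≤ l → l ≤ P.K → 1 ≤ i → i ≤ P.NX l →
      1 / 2 * Real.exp (2 * x l i t) = P.X t l i) ∧
    (∀ l i, 1 ≤ l → l ≤ P.K → 1 ≤ i → i ≤ P.NY l →
      1 / 2 * Real.exp (2 * y l i t) = P.Y t l i) := by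
  have h := (hsol.isPolynomialSolution hP.NX_pos hP.NY_pos).unique hP.isPolynomialSolution (t₀ := 0)
    (fun l i h1 h2 h3 h4 => by
      have e1 := hinit.m_init l i h1 h2 h3 h4
      have e2 := hinit.x_init l i h1 h2 h3 h4
      refine ⟨e1, ?_⟩
      rw [← e1, ← e2]
      exact exp_two_mul_half)
    (fun l i h1 h2 h3 h4 => by
      have e1 := hinit.n_init l i h1 h2 h3 h4
      have e2 := hinit.y_init l i h1 h2 h3 h4
      refine ⟨e1, ?_⟩
      rw [← e1, ← e2]
      exact exp_two_mul_half) t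
  refine ⟨fun l i h1 h2 h3 h4 => ?_, fun l i h1 h2 h3 h4 => ?_⟩
  · obtain ⟨e1, e2⟩ := h.1 l i h1 h2 h3 h4
    rw [exp_two_mul_half, e1] at e2
    -- Uniqueness yields Q and the product QX; dividing by Q > 0 gives X.
    exact mul_left_cancel₀ (hP.stepX t h1 h2 h3 h4).2.ne' e2
  · obtain ⟨e1, e2⟩ := h.2 l i h1 h2 h3 h4
    rw [exp_two_mul_half, e1] at e2
    exact mul_left_cancel₀ (hP.stepY t h1 h2 h3 h4).2.ne' e2

end Params

end GengXue

end

/-! ### Leading exponentials of the sums J. -/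

noncomputable section

namespace GengXue

open Finset Filter

/-- `f(t) = (c + o(1)) exp(E t)` along the filter `l`. -/
def HasExp (l : Filter ℝ) (f : ℝ → ℝ) (E c : ℝ) : Prop :=
  Tendsto (fun t => f t * Real.exp (-(E * t))) l (𝓝 c)

theorem HasExp.add {l : Filter ℝ} {f g : ℝ → ℝ} {E c d : ℝ} (hf : HasExp l f E c)
    (hg : HasExp l g E d) : HasExp l (fun t => f t + g t) E (c + d) :=
  (Tendsto.add hf hg).congr fun t => by ring

theorem HasExp.const_mul {l : Filter ℝ} {f : ℝ → ℝ} {E c : ℝ} (hf : HasExp l f E c) (a : ℝ) :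
    HasExp l (fun t => a * f t) E (a * c) :=
  (Tendsto.const_mul a hf).congr fun t => by ring

theorem HasExp.div {l : Filter ℝ} {f g : ℝ → ℝ} {E F c d : ℝ} (hf : HasExp l f E c)
    (hg : HasExp l g F d) (hd : d ≠ 0) : HasExp l (fun t => f t / g t) (E - F) (c / d) := by
  refine (Tendsto.div hf hg hd).congr fun t => ?_
  rw [show -((E - F) * t) = -(E * t) - -(F * t) by ring, Real.exp_sub]
  exact (div_mul_div_comm _ _ _ _).symm

theorem HasExp.sum {ι : Type*} {l : Filter ℝ} (s : Finset ι) {f : ι → ℝ → ℝ} {E : ℝ} {c : ι → ℝ}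
    (hf : ∀ i ∈ s, HasExp l (f i) E (c i)) :
    HasExp l (fun t => ∑ i ∈ s, f i t) E (∑ i ∈ s, c i) := by
  refine (tendsto_finsetSum s hf).congr fun t => ?_
  rw [sum_mul]

theorem hasExp_exp (l : Filter ℝ) (a E : ℝ) : HasExp l (fun t => a * Real.exp (E * t)) E a := by
  refine tendsto_const_nhds.congr fun t => ?_
  rw [mul_assoc, ← Real.exp_add, add_neg_cancel, Real.exp_zero, mul_one]

theorem hasExp_zero (l : Filter ℝ) (E : ℝ) : HasExp l (fun _ => 0) E 0 := by
  simp [HasExp, tendsto_const_nhds]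

theorem HasExp.lt_atTop {f : ℝ → ℝ} {E F c : ℝ} (hf : HasExp atTop f E c) (h : E < F) :
    HasExp atTop f F 0 := by
  have e : Tendsto (fun t : ℝ => Real.exp (-((F - E) * t))) atTop (𝓝 0) :=
    Real.tendsto_exp_neg_atTop_nhds_zero.comp (tendsto_id.const_mul_atTop (sub_pos.2 h))
  have := Tendsto.mul hf e
  rw [mul_zero] at this
  refine this.congr fun t => ?_
  rw [mul_assoc, ← Real.exp_add]
  ring_nf

theorem HasExp.lt_atBot {f : ℝ → ℝ} {E F c : ℝ} (hf : HasExp atBot f E c) (h : F < E) :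
    HasExp atBot f F 0 := by
  have e : Tendsto (fun t : ℝ => Real.exp ((E - F) * t)) atBot (𝓝 0) :=
    Real.tendsto_exp_atBot.comp (tendsto_id.const_mul_atBot (sub_pos.2 h))
  have := Tendsto.mul hf e
  rw [mul_zero] at this
  refine this.congr fun t => ?_
  rw [mul_assoc, ← Real.exp_add]
  ring_nf

/-- From e^{2x}/2 = (c + o(1)) e^{Et} with c > 0, taking logarithms gives 2x = Et + ln(2c) + o(1).
Positivity of c makes the logarithm continuous at the limit. -/
theorem HasExp.approachesLine {l : Filter ℝ} {x X : ℝ → ℝ} {E c d : ℝ}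
    (hx : ∀ t, 1 / 2 * Real.exp (2 * x t) = X t) (hX : HasExp l X E c) (hc : 0 < c)
    (hd : d = 2 * c) : ApproachesLine l x E d := by
  have h2 : Tendsto (fun t => Real.log (2 * (X t * Real.exp (-(E * t))))) l
      (𝓝 (Real.log (2 * c))) :=
    (Tendsto.const_mul 2 hX).log (by positivity)
  have h3 := (h2.sub_const (Real.log (2 * c))).const_mul (1 / 2)
  rw [sub_self, mul_zero] at h3
  refine h3.congr fun t => ?_
  rw [← hx, hd]
  rw [show 2 * (1 / 2 * Real.exp (2 * x t) * Real.exp (-(E * t)))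
    = Real.exp (2 * x t + -(E * t)) by rw [Real.exp_add]; ring, Real.log_exp]
  ring

/-- A set of given size with the largest values has the largest sum. -/
theorem sum_lt_sum_of_threshold {S A I : Finset ℕ} {f : ℕ → ℝ} (c : ℝ) (hA : ∀ p ∈ A, c ≤ f p)
    (hc : ∀ p ∈ S, p ∉ A → f p < c) (hI : I ⊆ S) (hcard : I.card = A.card) (hne : I ≠ A) :
    ∑ p ∈ I, f p < ∑ p ∈ A, f p := by
  rw [← sum_inter_add_sum_sdiff I A f, ← sum_inter_add_sum_sdiff A I f, inter_comm A I]
  -- The common part is removed; the two differences have equal nonzero size, and the threshold c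
  -- separates their values.
  have hcd : (I \ A).card = (A \ I).card := by
    have h1 := card_inter_add_card_sdiff I A
    have h2 := card_inter_add_card_sdiff A I
    rw [inter_comm A I] at h2
    omega
  have hn : (I \ A).Nonempty := by
    rw [sdiff_nonempty]
    exact fun h => hne (eq_of_subset_of_card_le h hcard.ge)
  have h1 : ∑ p ∈ I \ A, f p < ∑ _p ∈ I \ A, c :=
    sum_lt_sum_of_nonempty hn fun p hp => by
      rw [Finset.mem_sdiff] at hp
      exact hc p (hI hp.1) hp.2
  have h2 : ∑ _p ∈ A \ I, c ≤ ∑ p ∈ A \ I, f p :=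
    sum_le_sum fun p hp => hA p (Finset.mem_sdiff.1 hp).1
  rw [sum_const, hcd, ← sum_const] at h1
  linarith

theorem sum_lt_sum_initial {f : ℕ → ℝ} {n i : ℕ}
    (hf : ∀ p q, 1 ≤ p → p < q → q ≤ n → f q < f p) {I : Finset ℕ}
    (hI : I ⊆ Icc 1 n) (hcard : I.card = i) (hne : I ≠ Icc 1 i) :
    ∑ p ∈ I, f p < ∑ p ∈ Icc 1 i, f p := by
  have hin : i ≤ n := by
    have := card_le_card hI
    rw [Nat.card_Icc] at this
    omega
  have h0 : 1 ≤ i := by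
    by_contra h
    obtain rfl : i = 0 := by omega
    exact hne (by simpa using hcard)
  refine sum_lt_sum_of_threshold (f i) (fun p hp => ?_) (fun p hp hpA => ?_) hI
    (by simpa using hcard) hne
  · rw [mem_Icc] at hp
    rcases hp.2.lt_or_eq with h | rfl
    · exact (hf p i hp.1 h hin).le
    · exact le_rfl
  · rw [mem_Icc] at hp hpA
    exact hf i p h0 (by omega) hp.2

theorem sum_lt_sum_final {f : ℕ → ℝ} {n k : ℕ} (hk : 1 ≤ k)
    (hf : ∀ p q, 1 ≤ p → p < q → q ≤ n → f q < f p) {I : Finset ℕ}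
    (hI : I ⊆ Icc 1 n) (hcard : I.card = n + 1 - k) (hne : I ≠ Icc k n) :
    ∑ p ∈ Icc k n, f p < ∑ p ∈ I, f p := by
  have hkn : k ≤ n := by
    by_contra h
    rw [show n + 1 - k = 0 by omega, card_eq_zero] at hcard
    exact hne (by rw [hcard, Icc_eq_empty (by omega)])
  -- The smallest values of f are the largest values of -f.
  have := sum_lt_sum_of_threshold (f := fun p => -f p) (S := Icc 1 n) (A := Icc k n) (I := I)
    (-f k) (fun p hp => ?_) (fun p hp hpA => ?_) hI (by simpa using hcard) hne
  · simpa using this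
  · rw [mem_Icc] at hp
    rcases hp.1.lt_or_eq with h | rfl
    · exact neg_le_neg (hf k p hk h hp.2).le
    · exact le_rfl
  · rw [mem_Icc] at hp hpA
    exact neg_lt_neg (hf p k hp.1 (by omega) hkn)

namespace Params

/-- The exponent of a summand of `J`. -/
def expo (P : Params) (I J : Finset ℕ) : ℝ := ∑ p ∈ I, 1 / P.lam p + ∑ q ∈ J, 1 / P.mu q

/-- The coefficient of a summand of `J`. -/
def coef (P : Params) (r s : ℕ) (I J : Finset ℕ) : ℝ :=
  P.Psi I J * (∏ p ∈ I, P.lam p ^ r * P.a0 p) * (∏ q ∈ J, P.mu q ^ s * P.b0 q)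

theorem term_eq (P : Params) (t : ℝ) (r s : ℕ) (I J : Finset ℕ) :
    P.term t r s I J = P.coef r s I J * Real.exp (P.expo I J * t) := by
  have e : Real.exp (P.expo I J * t)
      = (∏ p ∈ I, Real.exp (t / P.lam p)) * ∏ q ∈ J, Real.exp (t / P.mu q) := by
    rw [← Real.exp_sum, ← Real.exp_sum, ← Real.exp_add, expo, add_mul, sum_mul, sum_mul]
    simp only [div_eq_mul_inv, one_mul, mul_comm]
  simp only [term, coef, a, b, e, ← mul_assoc, prod_mul_distrib]
  ring

theorem J_eq_sum (P : Params) (t : ℝ) (r s : ℕ) {i j : ℕ} (hi : i ≤ P.K) (hj : j + 1 ≤ P.K) :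
    P.J t r s i j = ∑ z ∈ (Icc 1 P.K).powersetCard i ×ˢ (Icc 1 (P.K - 1)).powersetCard j,
      P.coef r s z.1 z.2 * Real.exp (P.expo z.1 z.2 * t) := by
  rw [J, if_pos (by omega), sum_product]
  simp only [Int.toNat_natCast, ← term_eq]
  rfl

/-- Only the dominant pair of index sets contributes to the limit; each of the finitely many other
terms is negligible against its exponential. -/
theorem hasExp_J_of_dominant (P : Params) {l : Filter ℝ} (r s : ℕ) {i j : ℕ} (hi : i ≤ P.K)
    (hj : j + 1 ≤ P.K) {A B : Finset ℕ} (hA : A ⊆ Icc 1 P.K) (hAc : A.card = i)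
    (hB : B ⊆ Icc 1 (P.K - 1)) (hBc : B.card = j)
    (hdom : ∀ I J, I ⊆ Icc 1 P.K → I.card = i → J ⊆ Icc 1 (P.K - 1) → J.card = j →
      (I ≠ A ∨ J ≠ B) → ∀ c : ℝ,
        HasExp l (fun t => c * Real.exp (P.expo I J * t)) (P.expo A B) 0) :
    HasExp l (fun t => P.J t r s i j) (P.expo A B) (P.coef r s A B) := by
  have key := HasExp.sum (l := l) (E := P.expo A B)
    ((Icc 1 P.K).powersetCard i ×ˢ (Icc 1 (P.K - 1)).powersetCard j)
    (f := fun z t => P.coef r s z.1 z.2 * Real.exp (P.expo z.1 z.2 * t))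
    (c := fun z => if z = (A, B) then P.coef r s A B else 0) (fun z hz => by
      split_ifs with h
      · rw [h]; exact hasExp_exp l _ _
      · rw [mem_product, mem_powersetCard, mem_powersetCard] at hz
        refine hdom z.1 z.2 hz.1.1 hz.1.2 hz.2.1 hz.2.2 ?_ _
        by_contra hcon
        push Not at hcon
        exact h (Prod.ext hcon.1 hcon.2))
  rw [sum_ite_eq' , if_pos (by
    rw [mem_product, mem_powersetCard, mem_powersetCard]; exact ⟨⟨hA, hAc⟩, hB, hBc⟩)] at key
  simpa only [P.J_eq_sum _ r s hi hj] using key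

theorem Admissible.inv_lam_lt {P : Params} (hP : P.Admissible) (p q : ℕ) (hp : 1 ≤ p) (hpq : p < q)
    (hq : q ≤ P.K) : 1 / P.lam q < 1 / P.lam p :=
  one_div_lt_one_div_of_lt (hP.lam_pos p hp (by omega)) (lt_of_step_lt hP.lam_lt hp hpq hq)

theorem Admissible.inv_mu_lt {P : Params} (hP : P.Admissible) (p q : ℕ) (hp : 1 ≤ p) (hpq : p < q)
    (hq : q ≤ P.K - 1) : 1 / P.mu q < 1 / P.mu p :=
  one_div_lt_one_div_of_lt (hP.mu_pos p hp (by omega)) (lt_of_step_lt hP.mu_lt hp hpq hq)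

/-- The exponents 1/λ_i and 1/μ_j decrease with the index, so the growth is largest for the initial
segments, in each of the two sets independently. -/
theorem Admissible.hasExp_J_atTop {P : Params} (hP : P.Admissible) (r s : ℕ) {i j : ℕ} {i' j' : ℤ}
    (hi : i ≤ P.K) (hj : j + 1 ≤ P.K) (hi' : i' = i) (hj' : j' = j) :
    HasExp atTop (fun t => P.J t r s i' j')
      (P.expo (Icc 1 i) (Icc 1 j)) (P.coef r s (Icc 1 i) (Icc 1 j)) := by
  subst hi' hj'
  refine P.hasExp_J_of_dominant r s hi hj (Icc_subset_Icc le_rfl hi) (by simp)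
    (Icc_subset_Icc le_rfl (by omega)) (by simp) fun I J hI hIc hJ hJc hne c =>
    (hasExp_exp atTop c _).lt_atTop ?_
  unfold expo
  by_cases h1 : I = Icc 1 i
  · have := sum_lt_sum_initial hP.inv_mu_lt hJ hJc (hne.resolve_left (not_not.2 h1))
    rw [h1]
    linarith
  · have h2 := sum_lt_sum_initial hP.inv_lam_lt hI hIc h1
    by_cases h3 : J = Icc 1 j
    · rw [h3]; linarith
    · have := sum_lt_sum_initial hP.inv_mu_lt hJ hJc h3
      linarith

theorem Admissible.hasExp_J_atBot {P : Params} (hP : P.Admissible) (r s : ℕ) {p q : ℕ} {i j : ℤ}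
    (hp : 1 ≤ p) (hpK : p ≤ P.K + 1) (hq : 1 ≤ q) (hqK : q ≤ P.K)
    (hi : i = (P.K : ℤ) + 1 - p) (hj : j = (P.K : ℤ) - q) :
    HasExp atBot (fun t => P.J t r s i j)
      (P.expo (Icc p P.K) (Icc q (P.K - 1))) (P.coef r s (Icc p P.K) (Icc q (P.K - 1))) := by
  obtain ⟨i, rfl⟩ : ∃ i' : ℕ, i = i' := ⟨i.toNat, by omega⟩
  obtain ⟨j, rfl⟩ : ∃ j' : ℕ, j = j' := ⟨j.toNat, by omega⟩
  refine P.hasExp_J_of_dominant r s (by omega) (by omega) (Icc_subset_Icc hp le_rfl)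
    (by rw [Nat.card_Icc]; omega) (Icc_subset_Icc hq le_rfl) (by rw [Nat.card_Icc]; omega)
    fun I J hI hIc hJ hJc hne c => (hasExp_exp atBot c _).lt_atBot ?_
  unfold expo
  by_cases h1 : I = Icc p P.K
  · have := sum_lt_sum_final hq hP.inv_mu_lt hJ (by omega) (hne.resolve_left (not_not.2 h1))
    rw [h1]
    linarith
  · have h2 := sum_lt_sum_final hp hP.inv_lam_lt hI (by omega) h1
    by_cases h3 : J = Icc q (P.K - 1)
    · rw [h3]; linarith
    · have := sum_lt_sum_final hq hP.inv_mu_lt hJ (by omega) h3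
      linarith

theorem sum_ssubset_lt {f : ℕ → ℝ} {A B : Finset ℕ} (h : A ⊂ B) (hf : ∀ p ∈ B, 0 < f p) :
    ∑ p ∈ A, f p < ∑ p ∈ B, f p := by
  obtain ⟨p, hpB, hpA⟩ := exists_of_ssubset h
  exact sum_lt_sum_of_subset h.1 hpB hpA (hf p hpB) fun q hq _ => (hf q hq).le

theorem Admissible.expo_lt {P : Params} (hP : P.Admissible) {I I' J J' : Finset ℕ} (hI : I ⊆ I')
    (hJ : J ⊆ J') (hI' : I' ⊆ Icc 1 P.K) (hJ' : J' ⊆ Icc 1 (P.K - 1)) (hne : I ≠ I' ∨ J ≠ J') :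
    P.expo I J < P.expo I' J' := by
  have h1 : ∀ p ∈ I', 0 < 1 / P.lam p := fun p hp =>
    one_div_pos.2 (hP.lam_pos p (mem_Icc.1 (hI' hp)).1 (mem_Icc.1 (hI' hp)).2)
  have h2 : ∀ p ∈ J', 0 < 1 / P.mu p := fun p hp =>
    one_div_pos.2 (hP.mu_pos p (mem_Icc.1 (hJ' hp)).1 (mem_Icc.1 (hJ' hp)).2)
  have h3 := sum_le_sum_of_subset_of_nonneg hI fun p hp _ => (h1 p hp).le
  have h4 := sum_le_sum_of_subset_of_nonneg hJ fun p hp _ => (h2 p hp).le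
  unfold expo
  rcases hne with hne | hne
  · have := sum_ssubset_lt (Finset.ssubset_iff_subset_ne.2 ⟨hI, hne⟩) h1
    linarith
  · have := sum_ssubset_lt (Finset.ssubset_iff_subset_ne.2 ⟨hJ, hne⟩) h2
    linarith

/-- Sums with fewer factors are negligible as `t → ∞`. -/
theorem Admissible.hasExp_J_atTop_zero {P : Params} (hP : P.Admissible) (r s : ℕ) {i j : ℕ}
    {i' j' : ℤ} (hi : i ≤ P.K) (hj : j + 1 ≤ P.K) (hi' : i' ≤ i) (hj' : j' ≤ j)
    (hne : i' ≠ i ∨ j' ≠ j) :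
    HasExp atTop (fun t => P.J t r s i' j') (P.expo (Icc 1 i) (Icc 1 j)) 0 := by
  by_cases h : 0 ≤ i' ∧ 0 ≤ j'
  · obtain ⟨k, rfl⟩ : ∃ k : ℕ, i' = k := ⟨i'.toNat, by omega⟩
    obtain ⟨l, rfl⟩ : ∃ k : ℕ, j' = k := ⟨j'.toNat, by omega⟩
    refine (hP.hasExp_J_atTop r s (by omega) (by omega) rfl rfl).lt_atTop ?_
    refine hP.expo_lt (Icc_subset_Icc le_rfl (by omega)) (Icc_subset_Icc le_rfl (by omega))
      (Icc_subset_Icc le_rfl hi) (Icc_subset_Icc le_rfl (by omega)) ?_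
    refine hne.imp (fun h he => h ?_) fun h he => h ?_
    all_goals
      have := congrArg card he
      simpa using this
  · simp only [P.J_eq_zero _ r s (i := i') (j := j') (by omega)]
    exact hasExp_zero _ _

/-- Sums with more factors are negligible as `t → -∞`. -/
theorem Admissible.hasExp_J_atBot_zero {P : Params} (hP : P.Admissible) (r s : ℕ) {p q : ℕ}
    {i' j' : ℤ} (hpK : p ≤ P.K + 1) (hq : 1 ≤ q) (hqK : q ≤ P.K)
    (hi' : (P.K : ℤ) + 1 - p ≤ i') (hj' : (P.K : ℤ) - q ≤ j')
    (hne : (P.K : ℤ) + 1 - p ≠ i' ∨ (P.K : ℤ) - q ≠ j') :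
    HasExp atBot (fun t => P.J t r s i' j') (P.expo (Icc p P.K) (Icc q (P.K - 1))) 0 := by
  by_cases h : i' ≤ P.K ∧ j' ≤ (P.K : ℤ) - 1
  · obtain ⟨k, hk⟩ : ∃ k : ℕ, (k : ℤ) = P.K + 1 - i' := ⟨(P.K + 1 - i').toNat, by omega⟩
    obtain ⟨l, hl⟩ : ∃ l : ℕ, (l : ℤ) = P.K - j' := ⟨(P.K - j').toNat, by omega⟩
    refine (hP.hasExp_J_atBot r s (p := k) (q := l) (by omega) (by omega) (by omega) (by omega)
      (by omega) (by omega)).lt_atBot ?_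
    refine hP.expo_lt (Icc_subset_Icc (by omega) le_rfl) (Icc_subset_Icc (by omega) le_rfl)
      (Icc_subset_Icc (by omega) le_rfl) (Icc_subset_Icc (by omega) le_rfl) ?_
    refine hne.imp (fun h he => h ?_) fun h he => h ?_
    all_goals
      have := congrArg card he
      simp only [Nat.card_Icc] at this
      omega
  · simp only [P.J_eq_zero _ r s (i := i') (j := j') (by omega)]
    exact hasExp_zero _ _

theorem Admissible.coef_pos {P : Params} (hP : P.Admissible) (r s : ℕ) {I J : Finset ℕ}
    (hI : I ⊆ Icc 1 P.K) (hJ : J ⊆ Icc 1 (P.K - 1)) : 0 < P.coef r s I J := by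
  have := hP.term_pos 0 r s hI hJ
  rwa [term_eq, mul_zero, Real.exp_zero, mul_one] at this

/-- The leading coefficient of a quotient when both sets grow by one element. -/
theorem Admissible.hasExp_ratio {P : Params} (hP : P.Admissible) {l : Filter ℝ} {f g : ℝ → ℝ}
    {p q : ℕ} {I J I' J' : Finset ℕ} (hp : p ∉ I) (hq : q ∉ J) (eI : I' = insert p I)
    (eJ : J' = insert q J)
    (hI : I ⊆ Icc 1 P.K) (hJ : J ⊆ Icc 1 (P.K - 1)) {c : ℝ} (hc : c ≠ 0)
    (hf : HasExp l f (P.expo I' J') (c * P.coef 0 0 I' J'))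
    (hg : HasExp l g (P.expo I J) (c * P.coef 1 1 I J)) :
    HasExp l (fun t => f t / g t) (1 / P.lam p + 1 / P.mu q)
      (P.a0 p * P.b0 q * P.Psi I' J'
        / ((∏ i ∈ I, P.lam i) * (∏ j ∈ J, P.mu j) * P.Psi I J)) := by
  have h1 := (hP.coef_pos 1 1 hI hJ).ne'
  convert hf.div hg (mul_ne_zero hc h1) using 1
  · rw [eI, eJ, expo, expo, sum_insert hp, sum_insert hq]
    ring
  · rw [mul_div_mul_left _ _ hc]
    simp only [coef, eI, eJ, prod_insert hp, prod_insert hq, pow_zero, pow_one, one_mul,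
      prod_mul_distrib] at h1 ⊢
    have h2 : ∏ i ∈ I, P.a0 i ≠ 0 := fun h => h1 (by rw [h]; ring)
    have h3 : ∏ i ∈ J, P.b0 i ≠ 0 := fun h => h1 (by rw [h]; ring)
    have h4 : ∏ i ∈ I, P.lam i ≠ 0 := fun h => h1 (by rw [h]; ring)
    have h5 : ∏ i ∈ J, P.mu i ≠ 0 := fun h => h1 (by rw [h]; ring)
    have h6 : P.Psi I J ≠ 0 := fun h => h1 (by rw [h]; ring)
    field_simp

/-- The leading coefficient of a quotient when only the first set grows by one element. -/
theorem Admissible.hasExp_ratio_left {P : Params} (hP : P.Admissible) {l : Filter ℝ} {f g : ℝ → ℝ}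
    {p : ℕ} {I J I' : Finset ℕ} (hp : p ∉ I) (eI : I' = insert p I)
    (hI : I ⊆ Icc 1 P.K) (hJ : J ⊆ Icc 1 (P.K - 1)) {c d : ℝ} (hd : d ≠ 0)
    (hf : HasExp l f (P.expo I' J) (c * P.coef 0 0 I' J))
    (hg : HasExp l g (P.expo I J) (d * P.coef 1 1 I J)) :
    HasExp l (fun t => f t / g t) (1 / P.lam p)
      (c / d * P.a0 p * P.Psi I' J
        / ((∏ i ∈ I, P.lam i) * (∏ j ∈ J, P.mu j) * P.Psi I J)) := by
  have h1 := (hP.coef_pos 1 1 hI hJ).ne'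
  convert hf.div hg (mul_ne_zero hd h1) using 1
  · rw [eI, expo, expo, sum_insert hp]
    ring
  · simp only [coef, eI, prod_insert hp, pow_zero, pow_one, one_mul,
      prod_mul_distrib] at h1 ⊢
    have h2 : ∏ i ∈ I, P.a0 i ≠ 0 := fun h => h1 (by rw [h]; ring)
    have h3 : ∏ i ∈ J, P.b0 i ≠ 0 := fun h => h1 (by rw [h]; ring)
    have h4 : ∏ i ∈ I, P.lam i ≠ 0 := fun h => h1 (by rw [h]; ring)
    have h5 : ∏ i ∈ J, P.mu i ≠ 0 := fun h => h1 (by rw [h]; ring)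
    have h6 : P.Psi I J ≠ 0 := fun h => h1 (by rw [h]; ring)
    field_simp

end Params

end GengXue

end

/-! ### From quotients of sums J to asymptotic lines. -/

noncomputable section

namespace GengXue

open Finset Filter

theorem sumS_one (tau sig : ℕ → ℝ) : sumS tau sig 1 = 0 := by simp [sumS]

theorem sumT_one (tau : ℕ → ℝ) : sumT tau 1 = tau 1 := by simp [sumT]

namespace Params

/-- The separate formula for the leftmost group is the general one with the vanishing sums J_{K+1,K}
and J_{KK} left out; only its first member is an exception. -/
theorem X_inner (P : Params) (t : ℝ) {l i : ℕ} {g : ℤ} (hg : P.grp l = g) (hi : 1 ≤ i)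
    (hiN : i < P.NX l) (h : l ≠ 1 ∨ i ≠ 1) :
    P.X t l i = (P.J t 0 0 (g + 1) g + sumT (P.tauX l) i * P.J t 0 0 g g
        + sumS (P.tauX l) (P.sigX l) i * P.J t 0 0 g (g - 1))
      / (P.J t 1 1 g (g - 1) + sumT (P.tauX l) i * P.J t 1 1 (g - 1) (g - 1)
        + sumS (P.tauX l) (P.sigX l) i * P.J t 1 1 (g - 1) (g - 2)) := by
  have hN : P.NX l ≠ 1 := by omega
  subst hg
  by_cases hl : l = 1
  · subst hl
    have hg : P.grp 1 = P.K := by simp [grp]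
    simp only [X, if_neg hN, if_neg (h.resolve_left (not_not.2 rfl)), if_pos hiN, if_true, hg]
    rw [P.J_eq_zero t 0 0 (i := (P.K : ℤ) + 1) (by omega),
      P.J_eq_zero t 0 0 (i := (P.K : ℤ)) (j := P.K) (by omega)]
    simp
  · simp only [X, if_neg hN, if_pos hiN, if_neg hl, grp]

theorem X_last (P : Params) (t : ℝ) {l : ℕ} {g : ℤ} (hg : P.grp l = g) (hN : 2 ≤ P.NX l) :
    P.X t l (P.NX l) = (P.J t 0 0 g g + P.sigX l (P.NX l - 1) * P.J t 0 0 g (g - 1))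
      / (P.J t 1 1 (g - 1) (g - 1) + P.sigX l (P.NX l - 1) * P.J t 1 1 (g - 1) (g - 2)) := by
  have hN1 : P.NX l ≠ 1 := by omega
  subst hg
  by_cases hl : l = 1
  · subst hl
    have hg : P.grp 1 = P.K := by simp [grp]
    simp only [X, if_neg hN1, lt_irrefl, if_false, if_true, hg]
    rw [P.J_eq_zero t 0 0 (i := (P.K : ℤ)) (j := P.K) (by omega)]
    simp
  · simp only [X, if_neg hN1, lt_irrefl, if_false, if_neg hl, grp]

/-- In the rightmost group the denominator of the general formula reduces to J_{00} = 1. -/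
theorem Y_inner (P : Params) (hK : 1 ≤ P.K) (t : ℝ) {l i : ℕ} {g : ℤ} (hg : P.grp l = g)
    (hi : 1 ≤ i) (hiN : i < P.NY l) :
    P.Y t l i = (P.J t 0 0 g g + sumT (P.tauY l) i * P.J t 0 0 g (g - 1)
        + sumS (P.tauY l) (P.sigY l) i * P.J t 0 0 (g - 1) (g - 1))
      / (P.J t 1 1 (g - 1) (g - 1) + sumT (P.tauY l) i * P.J t 1 1 (g - 1) (g - 2)
        + sumS (P.tauY l) (P.sigY l) i * P.J t 1 1 (g - 2) (g - 2)) := by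
  have hN : P.NY l ≠ 1 := by omega
  subst hg
  by_cases hl : l = P.K
  · subst hl
    have hg : P.grp P.K = 1 := by simp [grp]
    simp only [Y, if_neg hN, if_pos hiN, if_true, hg]
    rw [P.J_eq_zero t 1 1 (i := (1 : ℤ) - 1) (j := (1 : ℤ) - 2) (by omega),
      P.J_eq_zero t 1 1 (i := (1 : ℤ) - 2) (j := (1 : ℤ) - 2) (by omega)]
    simp [P.J_zero_zero hK]
  · simp only [Y, if_neg hN, if_pos hiN, if_neg hl, grp]

theorem Y_last (P : Params) (t : ℝ) {l : ℕ} {g : ℤ} (hg : P.grp l = g) (hl : l ≠ P.K)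
    (hN : 2 ≤ P.NY l) :
    P.Y t l (P.NY l)
      = (P.J t 0 0 g (g - 1) + P.sigY l (P.NY l - 1) * P.J t 0 0 (g - 1) (g - 1))
      / (P.J t 1 1 (g - 1) (g - 2) + P.sigY l (P.NY l - 1) * P.J t 1 1 (g - 2) (g - 2)) := by
  have hN1 : P.NY l ≠ 1 := by omega
  subst hg
  simp only [Y, if_neg hN1, lt_irrefl, if_false, if_neg hl, grp]

/-- The factors J_{00} = 1 are inserted to bring this case into the form of a quotient of sums J, so
that the common asymptotic lemmas apply. -/
theorem Y_rightmost_last (P : Params) (hK : 1 ≤ P.K) (t : ℝ) (hN : 2 ≤ P.NY P.K) :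
    P.Y t P.K (P.NY P.K)
      = (P.J t 0 0 1 1 + (sumT (P.tauY P.K) (P.NY P.K - 1) + P.D) * P.J t 0 0 1 0
        + (sumS (P.tauY P.K) (P.sigY P.K) (P.NY P.K - 1) + P.D * P.sigY P.K (P.NY P.K - 1))
          * P.J t 0 0 0 0) / P.J t 1 1 0 0 := by
  have hN1 : P.NY P.K ≠ 1 := by omega
  simp only [Y, if_neg hN1, lt_irrefl, if_false, if_true, P.J_zero_zero hK, mul_one, div_one]

/-- The factor `c` is the internal coefficient multiplying the dominant terms above and below. It is
the same in both and cancels, so neither slope nor constant depends on the internal parameters. -/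
theorem Admissible.approachesLine_ratio {P : Params} (hP : P.Admissible) {l : Filter ℝ}
    {x X f g : ℝ → ℝ} {p q : ℕ} {I J I' J' : Finset ℕ} {c cf cg d : ℝ}
    (hx : ∀ t, 1 / 2 * Real.exp (2 * x t) = X t) (hX : ∀ t, X t = f t / g t)
    (hf : HasExp l f (P.expo I' J') cf) (hg : HasExp l g (P.expo I J) cg)
    (hp : p ∉ I) (hq : q ∉ J) (eI : I' = insert p I)
    (eJ : J' = insert q J) (hI : I' ⊆ Icc 1 P.K) (hJ : J' ⊆ Icc 1 (P.K - 1)) (hc : 0 < c)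
    (hcf : cf = c * P.coef 0 0 I' J') (hcg : cg = c * P.coef 1 1 I J)
    (hd : d = 2 * (P.a0 p * P.b0 q * P.Psi I' J'
        / ((∏ i ∈ I, P.lam i) * (∏ j ∈ J, P.mu j) * P.Psi I J))) :
    ApproachesLine l x (1 / P.lam p + 1 / P.mu q) d := by
  have hI1 : I ⊆ Icc 1 P.K := ((subset_insert p I).trans eI.symm.subset).trans hI
  have hJ1 : J ⊆ Icc 1 (P.K - 1) := ((subset_insert q J).trans eJ.symm.subset).trans hJ
  rw [hcf] at hf
  rw [hcg] at hg
  refine HasExp.approachesLine (fun t => (hx t).trans (hX t))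
    (hP.hasExp_ratio hp hq eI eJ hI1 hJ1 hc.ne' hf hg) ?_ hd
  have hp' := mem_Icc.1 (hI (eI ▸ mem_insert_self p I))
  have hq' := mem_Icc.1 (hJ (eJ ▸ mem_insert_self q J))
  have h1 := hP.a0_pos p hp'.1 hp'.2
  have h2 := hP.b0_pos q hq'.1 hq'.2
  have h3 := hP.Psi_pos hI hJ
  have h4 := hP.Psi_pos hI1 hJ1
  have h5 : 0 < ∏ i ∈ I, P.lam i :=
    prod_pos fun i hi => hP.lam_pos i (mem_Icc.1 (hI1 hi)).1 (mem_Icc.1 (hI1 hi)).2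
  have h6 : 0 < ∏ i ∈ J, P.mu i :=
    prod_pos fun i hi => hP.mu_pos i (mem_Icc.1 (hJ1 hi)).1 (mem_Icc.1 (hJ1 hi)).2
  positivity

/-- Here the dominant terms above and below carry possibly different internal coefficients `c` and
`e`, whose quotient remains in the constant; the index sets differ by a single λ. -/
theorem Admissible.approachesLine_ratio_left {P : Params} (hP : P.Admissible) {l : Filter ℝ}
    {x X f g : ℝ → ℝ} {p : ℕ} {I J I' : Finset ℕ} {c e cf cg d : ℝ}
    (hx : ∀ t, 1 / 2 * Real.exp (2 * x t) = X t) (hX : ∀ t, X t = f t / g t)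
    (hf : HasExp l f (P.expo I' J) cf) (hg : HasExp l g (P.expo I J) cg)
    (hp : p ∉ I) (eI : I' = insert p I) (hI : I' ⊆ Icc 1 P.K) (hJ : J ⊆ Icc 1 (P.K - 1))
    (hc : 0 < c) (he : 0 < e)
    (hcf : cf = c * P.coef 0 0 I' J) (hcg : cg = e * P.coef 1 1 I J)
    (hd : d = 2 * (c / e * P.a0 p * P.Psi I' J
        / ((∏ i ∈ I, P.lam i) * (∏ j ∈ J, P.mu j) * P.Psi I J))) :
    ApproachesLine l x (1 / P.lam p) d := by
  have hI1 : I ⊆ Icc 1 P.K := ((subset_insert p I).trans eI.symm.subset).trans hI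
  rw [hcf] at hf
  rw [hcg] at hg
  refine HasExp.approachesLine (fun t => (hx t).trans (hX t))
    (hP.hasExp_ratio_left hp eI hI1 hJ he.ne' hf hg) ?_ hd
  have hp' := mem_Icc.1 (hI (eI ▸ mem_insert_self p I))
  have h1 := hP.a0_pos p hp'.1 hp'.2
  have h3 := hP.Psi_pos hI hJ
  have h4 := hP.Psi_pos hI1 hJ
  have h5 : 0 < ∏ i ∈ I, P.lam i :=
    prod_pos fun i hi => hP.lam_pos i (mem_Icc.1 (hI1 hi)).1 (mem_Icc.1 (hI1 hi)).2
  have h6 : 0 < ∏ i ∈ J, P.mu i :=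
    prod_pos fun i hi => hP.mu_pos i (mem_Icc.1 (hJ hi)).1 (mem_Icc.1 (hJ hi)).2
  positivity

theorem Icc_one_eq_insert {i : ℕ} (h : 1 ≤ i) : Icc 1 i = insert i (Icc 1 (i - 1)) := by
  ext p; simp only [mem_insert, mem_Icc]; omega

theorem Icc_eq_insert {p n : ℕ} (h : p ≤ n) : Icc p n = insert p (Icc (p + 1) n) := by
  ext p; simp only [mem_insert, mem_Icc]; omega

/-- All quotients which are dominated by `J_{ij} / J_{i-1,j-1}` as `t → ∞`. -/
theorem Admissible.approachesLine_atTop {P : Params} (hP : P.Admissible) {x X f g : ℝ → ℝ}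
    {i j : ℕ} {c cf cg d : ℝ} (hi : 1 ≤ i) (hiK : i ≤ P.K) (hj : 1 ≤ j) (hjK : j + 1 ≤ P.K)
    (hx : ∀ t, 1 / 2 * Real.exp (2 * x t) = X t) (hX : ∀ t, X t = f t / g t)
    (hf : HasExp atTop f (P.expo (Icc 1 i) (Icc 1 j)) cf)
    (hg : HasExp atTop g (P.expo (Icc 1 (i - 1)) (Icc 1 (j - 1))) cg) (hc : 0 < c)
    (hcf : cf = c * P.coef 0 0 (Icc 1 i) (Icc 1 j))
    (hcg : cg = c * P.coef 1 1 (Icc 1 (i - 1)) (Icc 1 (j - 1)))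
    (hd : d = 2 * P.a0 i * P.b0 j * P.psi 1 i 1 j
      / (P.prodLam 1 (i - 1) * P.prodMu 1 (j - 1) * P.psi 1 (i - 1) 1 (j - 1))) :
    ApproachesLine atTop x (1 / P.lam i + 1 / P.mu j) d :=
  hP.approachesLine_ratio hx hX hf hg (by simp; omega) (by simp; omega) (Icc_one_eq_insert hi)
    (Icc_one_eq_insert hj) (Icc_subset_Icc le_rfl hiK) (Icc_subset_Icc le_rfl (by omega)) hc hcf
    hcg (by rw [hd]; simp only [psi, prodLam, prodMu]; ring)

/-- All quotients which are dominated by `J_{K,K-1} / J_{K-1,K-1}` as `t → ∞`. -/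
theorem Admissible.approachesLine_atTop_left {P : Params} (hP : P.Admissible) {x X f g : ℝ → ℝ}
    {c cf cg d : ℝ}
    (hx : ∀ t, 1 / 2 * Real.exp (2 * x t) = X t) (hX : ∀ t, X t = f t / g t)
    (hf : HasExp atTop f (P.expo (Icc 1 P.K) (Icc 1 (P.K - 1))) cf)
    (hg : HasExp atTop g (P.expo (Icc 1 (P.K - 1)) (Icc 1 (P.K - 1))) cg) (hc : 0 < c)
    (hcf : cf = c * P.coef 0 0 (Icc 1 P.K) (Icc 1 (P.K - 1)))
    (hcg : cg = P.coef 1 1 (Icc 1 (P.K - 1)) (Icc 1 (P.K - 1)))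
    (hd : d = 2 * c * P.a0 P.K * P.psi 1 P.K 1 (P.K - 1)
      / (P.prodLam 1 (P.K - 1) * P.M * P.psi 1 (P.K - 1) 1 (P.K - 1))) :
    ApproachesLine atTop x (1 / P.lam P.K) d :=
  have hK := hP.K_pos
  hP.approachesLine_ratio_left hx hX hf hg (by simp; omega) (Icc_one_eq_insert hP.K_pos)
    subset_rfl subset_rfl hc one_pos hcf (by rw [hcg, one_mul])
    (by rw [hd]; simp only [psi, prodLam, prodMu, M]; ring)

/-- All quotients which are dominated by a quotient of sums over final segments as
`t → -∞`. -/
theorem Admissible.approachesLine_atBot {P : Params} (hP : P.Admissible) {x X f g : ℝ → ℝ}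
    {p q : ℕ} {c cf cg d : ℝ} (hp : 1 ≤ p) (hpK : p ≤ P.K) (hq : 1 ≤ q) (hqK : q + 1 ≤ P.K)
    (hx : ∀ t, 1 / 2 * Real.exp (2 * x t) = X t) (hX : ∀ t, X t = f t / g t)
    (hf : HasExp atBot f (P.expo (Icc p P.K) (Icc q (P.K - 1))) cf)
    (hg : HasExp atBot g (P.expo (Icc (p + 1) P.K) (Icc (q + 1) (P.K - 1))) cg) (hc : 0 < c)
    (hcf : cf = c * P.coef 0 0 (Icc p P.K) (Icc q (P.K - 1)))
    (hcg : cg = c * P.coef 1 1 (Icc (p + 1) P.K) (Icc (q + 1) (P.K - 1)))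
    (hd : d = 2 * P.a0 p * P.b0 q * P.psi p P.K q (P.K - 1)
      / (P.prodLam (p + 1) P.K * P.prodMu (q + 1) (P.K - 1)
        * P.psi (p + 1) P.K (q + 1) (P.K - 1))) :
    ApproachesLine atBot x (1 / P.lam p + 1 / P.mu q) d :=
  hP.approachesLine_ratio hx hX hf hg (by simp) (by simp) (Icc_eq_insert hpK)
    (Icc_eq_insert (by omega)) (Icc_subset_Icc hp le_rfl) (Icc_subset_Icc hq le_rfl) hc hcf
    hcg (by rw [hd]; simp only [psi, prodLam, prodMu]; ring)

theorem Psi_empty_empty (P : Params) : P.Psi ∅ ∅ = 1 := by simp [Psi]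

theorem Psi_singleton_empty (P : Params) (p : ℕ) : P.Psi {p} ∅ = 1 := by
  simp [Psi, filter_singleton]

theorem coef_empty_empty (P : Params) (r s : ℕ) : P.coef r s ∅ ∅ = 1 := by
  simp [coef, Psi_empty_empty]

/-- All quotients which are dominated by `J_{10} / J_{00}` as `t → -∞`. -/
theorem Admissible.approachesLine_atBot_left {P : Params} (hP : P.Admissible) {x X f g : ℝ → ℝ}
    {c e cf cg d : ℝ}
    (hx : ∀ t, 1 / 2 * Real.exp (2 * x t) = X t) (hX : ∀ t, X t = f t / g t)
    (hf : HasExp atBot f (P.expo (Icc P.K P.K) (Icc P.K (P.K - 1))) cf)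
    (hg : HasExp atBot g (P.expo (Icc (P.K + 1) P.K) (Icc P.K (P.K - 1))) cg) (hc : 0 < c)
    (he : 0 < e) (hcf : cf = c * P.coef 0 0 (Icc P.K P.K) (Icc P.K (P.K - 1)))
    (hcg : cg = e * P.coef 1 1 (Icc (P.K + 1) P.K) (Icc P.K (P.K - 1)))
    (hd : d = 2 * c * P.a0 P.K / e) :
    ApproachesLine atBot x (1 / P.lam P.K) d :=
  have hK := hP.K_pos
  hP.approachesLine_ratio_left hx hX hf hg (by simp) (Icc_eq_insert le_rfl)
    (Icc_subset_Icc hK le_rfl) (Icc_subset_Icc hK le_rfl) hc he hcf hcg (by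
      rw [hd, Icc_eq_empty (a := P.K) (b := P.K - 1) (by omega), Icc_self,
        Icc_eq_empty (a := P.K + 1) (by omega), Psi_empty_empty, Psi_singleton_empty]
      simp
      ring)

end Params

end GengXue

end

/-! ### The individual groups as t → +∞ and t → -∞. -/

noncomputable section

namespace GengXue

open Finset Filter

namespace Params

theorem hasExp_J_outside (P : Params) {l : Filter ℝ} {E : ℝ} (r s : ℕ) {i j : ℤ}
    (h : ¬(0 ≤ i ∧ i ≤ (P.K : ℤ) ∧ 0 ≤ j ∧ j ≤ (P.K : ℤ) - 1)) :
    HasExp l (fun t => P.J t r s i j) E 0 := by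
  simp only [fun t => P.J_eq_zero t r s h]
  exact hasExp_zero _ _

theorem grp_sub (P : Params) {j : ℕ} (h2 : j ≤ P.K) : P.grp (P.K + 1 - j) = j := by
  unfold grp; omega

/-- Among the three terms above and below the bar, the ones with the most factors dominate as t →
+∞. They have coefficient 1, so T_i and S_i do not matter and all these members share one asymptote.
-/
theorem Admissible.X_inner_atTop {P : Params} (hP : P.Admissible) {x : ℝ → ℝ} {d : ℝ} {j i : ℕ}
    (h1 : 1 ≤ j) (h2 : j ≤ P.K - 1) (hi : 1 ≤ i) (hiN : i < P.NX (P.K + 1 - j))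
    (hx : ∀ t, 1 / 2 * Real.exp (2 * x t) = P.X t (P.K + 1 - j) i)
    (hd : d = 2 * P.a0 (j + 1) * P.b0 j * P.psi 1 (j + 1) 1 j
            / (P.prodLam 1 j * P.prodMu 1 (j - 1) * P.psi 1 j 1 (j - 1))) :
    ApproachesLine atTop x (1 / P.lam (j + 1) + 1 / P.mu j) d :=
  hP.approachesLine_atTop (i := j + 1) (j := j) (c := 1) (by omega) (by omega) h1 (by omega) hx
    (fun t => P.X_inner t (P.grp_sub (by omega)) hi hiN (by omega))
    (((hP.hasExp_J_atTop _ _ (by omega) (by omega) (by omega) (by omega)).add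
      ((hP.hasExp_J_atTop_zero _ _ (by omega) (by omega) (by omega) (by omega)
        (by omega)).const_mul _)).add
      ((hP.hasExp_J_atTop_zero _ _ (by omega) (by omega) (by omega) (by omega)
        (by omega)).const_mul _))
    (((hP.hasExp_J_atTop _ _ (by omega) (by omega) (by omega) (by omega)).add
      ((hP.hasExp_J_atTop_zero _ _ (by omega) (by omega) (by omega) (by omega)
        (by omega)).const_mul _)).add
      ((hP.hasExp_J_atTop_zero _ _ (by omega) (by omega) (by omega) (by omega)
        (by omega)).const_mul _))
    one_pos (by simp) (by simp) (by rw [hd]; simp)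

theorem Admissible.X_last_atTop {P : Params} (hP : P.Admissible) {x : ℝ → ℝ} {d : ℝ} {j : ℕ}
    (h1 : 1 ≤ j) (h2 : j ≤ P.K - 1) (hN : 2 ≤ P.NX (P.K + 1 - j))
    (hx : ∀ t, 1 / 2 * Real.exp (2 * x t) = P.X t (P.K + 1 - j) (P.NX (P.K + 1 - j)))
    (hd : d = 2 * P.a0 j * P.b0 j * P.psi 1 j 1 j
          / (P.psi 1 (j - 1) 1 (j - 1) * P.prodLam 1 (j - 1) * P.prodMu 1 (j - 1))) :
    ApproachesLine atTop x (1 / P.lam j + 1 / P.mu j) d :=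
  hP.approachesLine_atTop (i := j) (j := j) (c := 1) (by omega) (by omega) h1 (by omega) hx
    (fun t => P.X_last t (P.grp_sub (by omega)) hN)
    ((hP.hasExp_J_atTop _ _ (by omega) (by omega) (by omega) (by omega)).add
      ((hP.hasExp_J_atTop_zero _ _ (by omega) (by omega) (by omega) (by omega)
        (by omega)).const_mul _))
    ((hP.hasExp_J_atTop _ _ (by omega) (by omega) (by omega) (by omega)).add
      ((hP.hasExp_J_atTop_zero _ _ (by omega) (by omega) (by omega) (by omega)
        (by omega)).const_mul _))
    one_pos (by simp) (by simp) (by rw [hd]; ring)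

theorem coef_eq_L (P : Params) (s : ℕ) (J : Finset ℕ) :
    P.coef 1 s (Icc 1 P.K) J = P.L * P.coef 0 s (Icc 1 P.K) J := by
  simp only [coef, pow_one, pow_zero, one_mul, prod_mul_distrib, L, prodLam]
  ring

theorem coef_eq_M (P : Params) (r : ℕ) (I : Finset ℕ) :
    P.coef r 1 I (Icc 1 (P.K - 1)) = P.M * P.coef r 0 I (Icc 1 (P.K - 1)) := by
  simp only [coef, pow_one, pow_zero, one_mul, prod_mul_distrib, M, prodMu]
  ring

theorem X_one_one (P : Params) (t : ℝ) (hN : 2 ≤ P.NX 1) :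
    P.X t 1 1 = P.J t 0 0 P.K (P.K - 1)
        / (P.J t 1 1 (P.K - 1) (P.K - 2)
            + 1 / P.sigX 1 1 * P.J t 1 1 (P.K - 1) (P.K - 1)
          + P.C * (P.J t 1 0 (P.K - 1) (P.K - 1)
            + 1 / P.tauX 1 1 * P.J t 1 0 P.K (P.K - 1))) := by
  simp only [X, if_neg (show P.NX 1 ≠ 1 by omega), if_true]

/-- Numerator and denominator are both led by J_{K,K-1}, in the denominator through the term (C/τ₁)
J^{10}_{K,K-1}, so the position converges. Since all λ's are used, J^{10} and J^{00} differ by the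
factor L. -/
theorem Admissible.X_one_one_atTop {P : Params} (hP : P.Admissible) {x : ℝ → ℝ}
    (hN : 2 ≤ P.NX 1) (hx : ∀ t, 1 / 2 * Real.exp (2 * x t) = P.X t 1 1) :
    ApproachesLine atTop x 0 (2 * P.tauX 1 1 / (P.C * P.L)) := by
  have hK := hP.K_pos
  have hc := hP.coef_pos 0 0 (I := Icc 1 P.K) (J := Icc 1 (P.K - 1)) subset_rfl subset_rfl
  have ht := hP.tauX_pos 1 1 le_rfl hK le_rfl (by omega)
  have hL := hP.L_pos
  have hC := hP.C_pos
  have f := hP.hasExp_J_atTop 0 0 (i := P.K) (j := P.K - 1) (i' := P.K) (j' := P.K - 1) le_rfl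
    (by omega) rfl (by omega)
  have g := hP.hasExp_J_atTop 1 0 (i := P.K) (j := P.K - 1) (i' := P.K) (j' := P.K - 1) le_rfl
    (by omega) rfl (by omega)
  have z := fun r s => hP.hasExp_J_atTop_zero r s (i := P.K) (j := P.K - 1) (i' := P.K - 1)
    (j' := P.K - 1) le_rfl (by omega) (by omega) (by omega) (by omega)
  have z' := hP.hasExp_J_atTop_zero 1 1 (i := P.K) (j := P.K - 1) (i' := P.K - 1)
    (j' := P.K - 2) le_rfl (by omega) (by omega) (by omega) (by omega)
  have G := (z'.add ((z 1 1).const_mul (1 / P.sigX 1 1))).add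
    (((z 1 0).add (g.const_mul (1 / P.tauX 1 1))).const_mul P.C)
  rw [coef_eq_L] at G
  have H := f.div G (by simp only [mul_zero, zero_add, add_zero]; positivity)
  rw [sub_self] at H
  refine HasExp.approachesLine (fun t => (hx t).trans (P.X_one_one t hN)) H
    (by simp only [mul_zero, zero_add, add_zero]; positivity) ?_
  simp only [mul_zero, zero_add, add_zero]
  field_simp

theorem Admissible.X_one_inner_atTop {P : Params} (hP : P.Admissible) {x : ℝ → ℝ} {i : ℕ}
    (hi : 2 ≤ i) (hiN : i ≤ P.NX 1 - 1) (hx : ∀ t, 1 / 2 * Real.exp (2 * x t) = P.X t 1 i) :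
    ApproachesLine atTop x 0 (2 * P.SX 1 i / (P.L * P.M)) := by
  have hK := hP.K_pos
  have hc := hP.coef_pos 0 0 (I := Icc 1 P.K) (J := Icc 1 (P.K - 1)) subset_rfl subset_rfl
  have hS := (hP.internalX le_rfl hK).sumS_pos hi hiN
  have hL := hP.L_pos
  have hM := hP.M_pos
  have hz : ∀ t, P.J t 0 0 P.K P.K = 0 := fun t => P.J_eq_zero t 0 0 (by omega)
  have hz' : ∀ t, P.J t 0 0 (P.K + 1) P.K = 0 := fun t => P.J_eq_zero t 0 0 (by omega)
  have f := (hP.hasExp_J_atTop 0 0 (i := P.K) (j := P.K - 1) (i' := P.K) (j' := P.K - 1) le_rfl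
    (by omega) rfl (by omega)).const_mul (sumS (P.tauX 1) (P.sigX 1) i)
  have g := hP.hasExp_J_atTop 1 1 (i := P.K) (j := P.K - 1) (i' := P.K) (j' := P.K - 1) le_rfl
    (by omega) rfl (by omega)
  have z := hP.hasExp_J_atTop_zero 1 1 (i := P.K) (j := P.K - 1) (i' := P.K - 1)
    (j' := P.K - 1) le_rfl (by omega) (by omega) (by omega) (by omega)
  have z' := hP.hasExp_J_atTop_zero 1 1 (i := P.K) (j := P.K - 1) (i' := P.K - 1)
    (j' := P.K - 2) le_rfl (by omega) (by omega) (by omega) (by omega)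
  have G := (g.add (z.const_mul (sumT (P.tauX 1) i))).add
    (z'.const_mul (sumS (P.tauX 1) (P.sigX 1) i))
  rw [coef_eq_L, coef_eq_M] at G
  have H := f.div G (by simp only [mul_zero, add_zero]; positivity)
  rw [sub_self] at H
  refine HasExp.approachesLine (fun t => (hx t).trans ?_) H
    (by simp only [mul_zero, add_zero]; positivity) ?_
  · rw [P.X_inner t (g := P.K) (by simp [grp]) (by omega) (by omega) (by omega), hz, hz']
    simp
  · simp only [mul_zero, add_zero, SX]
    field_simp

theorem Admissible.X_one_last_atTop {P : Params} (hP : P.Admissible) {x : ℝ → ℝ}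
    (hN : 2 ≤ P.NX 1) (hx : ∀ t, 1 / 2 * Real.exp (2 * x t) = P.X t 1 (P.NX 1)) :
    ApproachesLine atTop x (1 / P.lam P.K)
        (2 * P.sigX 1 (P.NX 1 - 1) * P.a0 P.K * P.psi 1 P.K 1 (P.K - 1)
          / (P.prodLam 1 (P.K - 1) * P.M * P.psi 1 (P.K - 1) 1 (P.K - 1))) :=
  have hK := hP.K_pos
  hP.approachesLine_atTop_left (c := P.sigX 1 (P.NX 1 - 1)) hx
    (fun t => P.X_last t (g := P.K) (by simp [grp]) hN)
    ((P.hasExp_J_outside _ _ (by omega)).add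
      ((hP.hasExp_J_atTop _ _ (by omega) (by omega) (by omega) (by omega)).const_mul _))
    ((hP.hasExp_J_atTop _ _ (by omega) (by omega) (by omega) (by omega)).add
      ((hP.hasExp_J_atTop_zero _ _ (by omega) (by omega) (by omega) (by omega)
        (by omega)).const_mul _))
    (hP.sigX_pos _ _ le_rfl hK (by omega) le_rfl) (by simp) (by simp) rfl

theorem Admissible.Y_inner_atTop {P : Params} (hP : P.Admissible) {y : ℝ → ℝ} {d : ℝ} {j i : ℕ}
    (h1 : 1 ≤ j) (h2 : j ≤ P.K - 1) (hi : 1 ≤ i) (hiN : i < P.NY (P.K + 1 - j))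
    (hy : ∀ t, 1 / 2 * Real.exp (2 * y t) = P.Y t (P.K + 1 - j) i)
    (hd : d = 2 * P.a0 j * P.b0 j * P.psi 1 j 1 j
            / (P.prodLam 1 (j - 1) * P.prodMu 1 (j - 1) * P.psi 1 (j - 1) 1 (j - 1))) :
    ApproachesLine atTop y (1 / P.lam j + 1 / P.mu j) d :=
  hP.approachesLine_atTop (i := j) (j := j) (c := 1) (by omega) (by omega) h1 (by omega) hy
    (fun t => P.Y_inner hP.K_pos t (P.grp_sub (by omega)) hi hiN)
    (((hP.hasExp_J_atTop _ _ (by omega) (by omega) (by omega) (by omega)).add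
      ((hP.hasExp_J_atTop_zero _ _ (by omega) (by omega) (by omega) (by omega)
        (by omega)).const_mul _)).add
      ((hP.hasExp_J_atTop_zero _ _ (by omega) (by omega) (by omega) (by omega)
        (by omega)).const_mul _))
    (((hP.hasExp_J_atTop _ _ (by omega) (by omega) (by omega) (by omega)).add
      ((hP.hasExp_J_atTop_zero _ _ (by omega) (by omega) (by omega) (by omega)
        (by omega)).const_mul _)).add
      ((hP.hasExp_J_atTop_zero _ _ (by omega) (by omega) (by omega) (by omega)
        (by omega)).const_mul _))
    one_pos (by simp) (by simp) hd

theorem Admissible.Y_last_atTop {P : Params} (hP : P.Admissible) {y : ℝ → ℝ} {d : ℝ} {j : ℕ}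
    (h1 : 2 ≤ j) (h2 : j ≤ P.K) (hN : 2 ≤ P.NY (P.K + 1 - j))
    (hy : ∀ t, 1 / 2 * Real.exp (2 * y t) = P.Y t (P.K + 1 - j) (P.NY (P.K + 1 - j)))
    (hd : d = 2 * P.a0 j * P.b0 (j - 1) * P.psi 1 j 1 (j - 1)
          / (P.prodLam 1 (j - 1) * P.prodMu 1 (j - 2) * P.psi 1 (j - 1) 1 (j - 2))) :
    ApproachesLine atTop y (1 / P.lam j + 1 / P.mu (j - 1)) d :=
  hP.approachesLine_atTop (i := j) (j := j - 1) (c := 1) (by omega) (by omega) (by omega)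
    (by omega) hy
    (fun t => P.Y_last t (P.grp_sub (by omega)) (by omega) hN)
    ((hP.hasExp_J_atTop _ _ (by omega) (by omega) (by omega) (by omega)).add
      ((hP.hasExp_J_atTop_zero _ _ (by omega) (by omega) (by omega) (by omega)
        (by omega)).const_mul _))
    ((hP.hasExp_J_atTop _ _ (by omega) (by omega) (by omega) (by omega)).add
      ((hP.hasExp_J_atTop_zero _ _ (by omega) (by omega) (by omega) (by omega)
        (by omega)).const_mul _))
    one_pos (by simp) (by simp) hd

/-- The term J_{KK} that would dominate vanishes, so T_i J_{K,K-1} leads the numerator. The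
denominator is led by J_{K-1,K-1} with coefficient 1, and T_i remains. -/
theorem Admissible.Y_one_inner_atTop {P : Params} (hP : P.Admissible) {y : ℝ → ℝ} {i : ℕ}
    (hi : 1 ≤ i) (hiN : i ≤ P.NY 1 - 1) (hy : ∀ t, 1 / 2 * Real.exp (2 * y t) = P.Y t 1 i) :
    ApproachesLine atTop y (1 / P.lam P.K)
        (2 * P.TY 1 i * P.a0 P.K * P.psi 1 P.K 1 (P.K - 1)
          / (P.prodLam 1 (P.K - 1) * P.M * P.psi 1 (P.K - 1) 1 (P.K - 1))) :=
  have hK := hP.K_pos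
  hP.approachesLine_atTop_left (c := P.TY 1 i) hy
    (fun t => P.Y_inner hK t (g := P.K) (by simp [grp]) hi (by omega))
    (((P.hasExp_J_outside _ _ (by omega)).add
      ((hP.hasExp_J_atTop _ _ (by omega) (by omega) (by omega) (by omega)).const_mul _)).add
      ((hP.hasExp_J_atTop_zero _ _ (by omega) (by omega) (by omega) (by omega)
        (by omega)).const_mul _))
    (((hP.hasExp_J_atTop _ _ (by omega) (by omega) (by omega) (by omega)).add
      ((hP.hasExp_J_atTop_zero _ _ (by omega) (by omega) (by omega) (by omega)
        (by omega)).const_mul _)).add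
      ((hP.hasExp_J_atTop_zero _ _ (by omega) (by omega) (by omega) (by omega)
        (by omega)).const_mul _))
    ((hP.internalY le_rfl hK).sumT_pos hi hiN) (by simp [TY]) (by simp) rfl

theorem Admissible.Y_rightmost_last_atTop {P : Params} (hP : P.Admissible) {y : ℝ → ℝ}
    (hK : 2 ≤ P.K) (hN : 2 ≤ P.NY P.K)
    (hy : ∀ t, 1 / 2 * Real.exp (2 * y t) = P.Y t P.K (P.NY P.K)) :
    ApproachesLine atTop y (1 / P.lam 1 + 1 / P.mu 1) (2 * P.a0 1 * P.b0 1 * P.psi 1 1 1 1) :=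
  hP.approachesLine_atTop (i := 1) (j := 1) (c := 1) le_rfl (by omega) le_rfl (by omega) hy
    (fun t => P.Y_rightmost_last hP.K_pos t hN)
    (((hP.hasExp_J_atTop _ _ (by omega) (by omega) (by omega) (by omega)).add
      ((hP.hasExp_J_atTop_zero _ _ (by omega) (by omega) (by omega) (by omega)
        (by omega)).const_mul _)).add
      ((hP.hasExp_J_atTop_zero _ _ (by omega) (by omega) (by omega) (by omega)
        (by omega)).const_mul _))
    (hP.hasExp_J_atTop _ _ (by omega) (by omega) (by omega) (by omega))
    one_pos (by simp) (by simp) (by simp [psi, prodLam, prodMu, Psi_empty_empty])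

theorem psi_one_group (P : Params) (hK : P.K = 1) (c : ℝ) :
    c * P.a0 P.K * P.psi 1 P.K 1 (P.K - 1)
      / (P.prodLam 1 (P.K - 1) * P.M * P.psi 1 (P.K - 1) 1 (P.K - 1)) = c * P.a0 1 := by
  simp [hK, psi, prodLam, prodMu, M, Psi_empty_empty, Psi_singleton_empty]

theorem Admissible.Y_only_last_atTop {P : Params} (hP : P.Admissible) {y : ℝ → ℝ}
    (hK : P.K = 1) (hN : 2 ≤ P.NY 1)
    (hy : ∀ t, 1 / 2 * Real.exp (2 * y t) = P.Y t 1 (P.NY 1)) :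
    ApproachesLine atTop y (1 / P.lam 1) (2 * (P.TY 1 (P.NY 1 - 1) + P.D) * P.a0 1) := by
  have hT := (hP.internalY le_rfl hP.K_pos).sumT_nonneg (le_refl (P.NY 1 - 1))
  have hD := hP.D_pos
  have hY : ∀ t, P.Y t 1 (P.NY 1) = _ := fun t => by
    have := P.Y_rightmost_last hP.K_pos t (by rwa [hK])
    simpa only [hK] using this
  have := hP.approachesLine_atTop_left (c := P.TY 1 (P.NY 1 - 1) + P.D) hy hY
    (((P.hasExp_J_outside _ _ (by omega)).add
      ((hP.hasExp_J_atTop _ _ (by omega) (by omega) (by omega) (by omega)).const_mul _)).add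
      ((hP.hasExp_J_atTop_zero _ _ (by omega) (by omega) (by omega) (by omega)
        (by omega)).const_mul _))
    (hP.hasExp_J_atTop _ _ (by omega) (by omega) (by omega) (by omega))
    (by unfold TY; positivity) (by simp [TY]) rfl rfl
  rwa [psi_one_group _ hK, hK] at this

/-- As t → -∞ the terms with the fewest factors dominate. Because S₁ = 0, for the first member these
are the ones with coefficient T₁ = τ₁, which cancels; from the second member on the terms with S_i
take over. -/
theorem Admissible.X_first_atBot {P : Params} (hP : P.Admissible) {x : ℝ → ℝ} {j : ℕ}
    (h1 : 2 ≤ j) (h2 : j ≤ P.K) (hN : 2 ≤ P.NX j)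
    (hx : ∀ t, 1 / 2 * Real.exp (2 * x t) = P.X t j 1) :
    ApproachesLine atBot x (1 / P.lam j + 1 / P.mu (j - 1))
        (2 * P.a0 j * P.b0 (j - 1) * P.psi j P.K (j - 1) (P.K - 1)
          / (P.prodLam (j + 1) P.K * P.prodMu j (P.K - 1)
            * P.psi (j + 1) P.K j (P.K - 1))) :=
  have e : j - 1 + 1 = j := by omega
  hP.approachesLine_atBot (p := j) (q := j - 1) (c := P.tauX j 1) (by omega) (by omega) (by omega)
    (by omega) hx
    (fun t => P.X_inner t rfl le_rfl (by omega) (by omega))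
    (((hP.hasExp_J_atBot_zero _ _ (by omega) (by omega) (by omega) (by unfold grp; omega)
        (by unfold grp; omega) (by unfold grp; omega)).add
      ((hP.hasExp_J_atBot _ _ (by omega) (by omega) (by omega) (by omega) (by unfold grp; omega)
        (by unfold grp; omega)).const_mul _)).add
      (by rw [sumS_one]; simpa using hasExp_zero _ _))
    (((hP.hasExp_J_atBot_zero _ _ (by omega) (by omega) (by omega) (by unfold grp; omega)
        (by unfold grp; omega) (by unfold grp; omega)).add
      ((hP.hasExp_J_atBot _ _ (by omega) (by omega) (by omega) (by omega) (by unfold grp; omega)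
        (by unfold grp; omega)).const_mul _)).add
      (by rw [sumS_one]; simpa using hasExp_zero _ _))
    (hP.tauX_pos j 1 (by omega) h2 le_rfl (by omega)) (by simp [sumT_one]) (by simp [sumT_one])
    (by rw [e])

theorem Admissible.X_inner_atBot {P : Params} (hP : P.Admissible) {x : ℝ → ℝ} {j i : ℕ}
    (h1 : 1 ≤ j) (h2 : j ≤ P.K - 1) (hi : 2 ≤ i) (hiN : i < P.NX j)
    (hx : ∀ t, 1 / 2 * Real.exp (2 * x t) = P.X t j i) :
    ApproachesLine atBot x (1 / P.lam j + 1 / P.mu j)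
          (2 * P.a0 j * P.b0 j * P.psi j P.K j (P.K - 1)
            / (P.prodLam (j + 1) P.K * P.prodMu (j + 1) (P.K - 1)
              * P.psi (j + 1) P.K (j + 1) (P.K - 1))) :=
  hP.approachesLine_atBot (p := j) (q := j) (c := sumS (P.tauX j) (P.sigX j) i) (by omega)
    (by omega) (by omega) (by omega) hx
    (fun t => P.X_inner t rfl (by omega) hiN (by omega))
    (((hP.hasExp_J_atBot_zero _ _ (by omega) (by omega) (by omega) (by unfold grp; omega)
        (by unfold grp; omega) (by unfold grp; omega)).add
      ((hP.hasExp_J_atBot_zero _ _ (by omega) (by omega) (by omega) (by unfold grp; omega)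
        (by unfold grp; omega) (by unfold grp; omega)).const_mul _)).add
      ((hP.hasExp_J_atBot _ _ (by omega) (by omega) (by omega) (by omega) (by unfold grp; omega)
        (by unfold grp; omega)).const_mul _))
    (((hP.hasExp_J_atBot_zero _ _ (by omega) (by omega) (by omega) (by unfold grp; omega)
        (by unfold grp; omega) (by unfold grp; omega)).add
      ((hP.hasExp_J_atBot_zero _ _ (by omega) (by omega) (by omega) (by unfold grp; omega)
        (by unfold grp; omega) (by unfold grp; omega)).const_mul _)).add
      ((hP.hasExp_J_atBot _ _ (by omega) (by omega) (by omega) (by omega) (by unfold grp; omega)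
        (by unfold grp; omega)).const_mul _))
    ((hP.internalX h1 (by omega)).sumS_pos hi (by omega)) (by simp) (by simp) rfl

theorem Admissible.X_last_atBot {P : Params} (hP : P.Admissible) {x : ℝ → ℝ} {j : ℕ}
    (h1 : 1 ≤ j) (h2 : j ≤ P.K - 1) (hN : 2 ≤ P.NX j)
    (hx : ∀ t, 1 / 2 * Real.exp (2 * x t) = P.X t j (P.NX j)) :
    ApproachesLine atBot x (1 / P.lam j + 1 / P.mu j)
          (2 * P.a0 j * P.b0 j * P.psi j P.K j (P.K - 1)
            / (P.prodLam (j + 1) P.K * P.prodMu (j + 1) (P.K - 1)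
              * P.psi (j + 1) P.K (j + 1) (P.K - 1))) :=
  hP.approachesLine_atBot (p := j) (q := j) (c := P.sigX j (P.NX j - 1)) (by omega)
    (by omega) (by omega) (by omega) hx
    (fun t => P.X_last t rfl hN)
    ((hP.hasExp_J_atBot_zero _ _ (by omega) (by omega) (by omega) (by unfold grp; omega)
        (by unfold grp; omega) (by unfold grp; omega)).add
      ((hP.hasExp_J_atBot _ _ (by omega) (by omega) (by omega) (by omega) (by unfold grp; omega)
        (by unfold grp; omega)).const_mul _))
    ((hP.hasExp_J_atBot_zero _ _ (by omega) (by omega) (by omega) (by unfold grp; omega)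
        (by unfold grp; omega) (by unfold grp; omega)).add
      ((hP.hasExp_J_atBot _ _ (by omega) (by omega) (by omega) (by omega) (by unfold grp; omega)
        (by unfold grp; omega)).const_mul _))
    (hP.sigX_pos j _ h1 (by omega) (by omega) le_rfl) (by simp) (by simp) rfl

theorem Admissible.X_one_one_atBot {P : Params} (hP : P.Admissible) {x : ℝ → ℝ}
    (hK : 2 ≤ P.K) (hN : 2 ≤ P.NX 1)
    (hx : ∀ t, 1 / 2 * Real.exp (2 * x t) = P.X t 1 1) :
    ApproachesLine atBot x (1 / P.lam 1 + 1 / P.mu 1)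
          (2 * P.a0 1 * P.b0 1 * P.psi 1 P.K 1 (P.K - 1)
            / (P.prodLam 2 P.K * P.prodMu 2 (P.K - 1) * P.psi 2 P.K 2 (P.K - 1))) :=
  hP.approachesLine_atBot (p := 1) (q := 1) (c := 1) le_rfl
    (by omega) le_rfl (by omega) hx
    (fun t => P.X_one_one t hN)
    (hP.hasExp_J_atBot _ _ (by omega) (by omega) (by omega) (by omega) (by omega) (by omega))
    (((hP.hasExp_J_atBot _ _ (by omega) (by omega) (by omega) (by omega) (by omega)
        (by omega)).add
      ((hP.hasExp_J_atBot_zero _ _ (by omega) (by omega) (by omega) (by omega)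
        (by omega) (by omega)).const_mul _)).add
      (((hP.hasExp_J_atBot_zero _ _ (by omega) (by omega) (by omega) (by omega)
        (by omega) (by omega)).add
        ((hP.hasExp_J_atBot_zero _ _ (by omega) (by omega) (by omega) (by omega)
        (by omega) (by omega)).const_mul _)).const_mul _))
    one_pos (by simp) (by simp) rfl

/-- In the last group the term of the denominator with coefficient S_i would be J_{0,-1} = 0. Thus
S_i leads the numerator and T_i the denominator. -/
theorem Admissible.X_rightmost_inner_atBot {P : Params} (hP : P.Admissible) {x : ℝ → ℝ} {i : ℕ}
    (hi : 2 ≤ i) (hiN : i ≤ P.NX P.K - 1)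
    (hx : ∀ t, 1 / 2 * Real.exp (2 * x t) = P.X t P.K i) :
    ApproachesLine atBot x (1 / P.lam P.K) (2 * P.SX P.K i * P.a0 P.K / P.TX P.K i) :=
  have hK := hP.K_pos
  have hI := hP.internalX hK le_rfl
  hP.approachesLine_atBot_left (c := P.SX P.K i) (e := P.TX P.K i) hx
    (fun t => P.X_inner t rfl (by omega) (by omega) (by omega))
    (((hP.hasExp_J_atBot_zero _ _ (by omega) (by omega) (by omega) (by unfold grp; omega)
        (by unfold grp; omega) (by unfold grp; omega)).add
      ((hP.hasExp_J_atBot_zero _ _ (by omega) (by omega) (by omega) (by unfold grp; omega)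
        (by unfold grp; omega) (by unfold grp; omega)).const_mul _)).add
      ((hP.hasExp_J_atBot _ _ (by omega) (by omega) (by omega) (by omega) (by unfold grp; omega)
        (by unfold grp; omega)).const_mul _))
    (((hP.hasExp_J_atBot_zero _ _ (by omega) (by omega) (by omega) (by unfold grp; omega)
        (by unfold grp; omega) (by unfold grp; omega)).add
      ((hP.hasExp_J_atBot _ _ (by omega) (by omega) (by omega) (by omega) (by unfold grp; omega)
        (by unfold grp; omega)).const_mul _)).add
      ((P.hasExp_J_outside _ _ (by unfold grp; omega)).const_mul _))
    (hI.sumS_pos hi hiN) (hI.sumT_pos (by omega) hiN) (by simp [SX]) (by simp [TX]) rfl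

theorem Admissible.X_rightmost_last_atBot {P : Params} (hP : P.Admissible) {x : ℝ → ℝ}
    (hN : 2 ≤ P.NX P.K) (hx : ∀ t, 1 / 2 * Real.exp (2 * x t) = P.X t P.K (P.NX P.K)) :
    ApproachesLine atBot x (1 / P.lam P.K) (2 * P.sigX P.K (P.NX P.K - 1) * P.a0 P.K) :=
  have hK := hP.K_pos
  hP.approachesLine_atBot_left (c := P.sigX P.K (P.NX P.K - 1)) (e := 1) hx
    (fun t => P.X_last t rfl hN)
    ((hP.hasExp_J_atBot_zero _ _ (by omega) (by omega) (by omega) (by unfold grp; omega)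
        (by unfold grp; omega) (by unfold grp; omega)).add
      ((hP.hasExp_J_atBot _ _ (by omega) (by omega) (by omega) (by omega) (by unfold grp; omega)
        (by unfold grp; omega)).const_mul _))
    ((hP.hasExp_J_atBot _ _ (by omega) (by omega) (by omega) (by omega) (by unfold grp; omega)
        (by unfold grp; omega)).add
      ((P.hasExp_J_outside _ _ (by unfold grp; omega)).const_mul _))
    (hP.sigX_pos _ _ hK le_rfl (by omega) le_rfl) one_pos (by simp) (by simp) (by simp)

/-- For K = 1 the denominator is 1/σ₁ + C(1 + J^{10}_{10}/τ₁), whose limit as t → -∞ is 1/σ₁ + C. -/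
theorem Admissible.X_only_first_atBot {P : Params} (hP : P.Admissible) {x : ℝ → ℝ}
    (hK : P.K = 1) (hN : 2 ≤ P.NX 1)
    (hx : ∀ t, 1 / 2 * Real.exp (2 * x t) = P.X t 1 1) :
    ApproachesLine atBot x (1 / P.lam 1) (2 * P.sigX 1 1 * P.a0 1 / (1 + P.C * P.sigX 1 1)) := by
  have hC := hP.C_pos
  have hs := hP.sigX_pos 1 1 le_rfl hP.K_pos le_rfl (by omega)
  have ht := hP.tauX_pos 1 1 le_rfl hP.K_pos le_rfl (by omega)
  have hD := hP.D_pos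
  have e1 : P.coef 1 1 (Icc (P.K + 1) P.K) (Icc P.K (P.K - 1)) = 1 := by
    rw [Icc_eq_empty (by omega), Icc_eq_empty (by omega), coef_empty_empty]
  have e2 : P.coef 1 0 (Icc (P.K + 1) P.K) (Icc P.K (P.K - 1)) = 1 := by
    rw [Icc_eq_empty (by omega), Icc_eq_empty (by omega), coef_empty_empty]
  have := hP.approachesLine_atBot_left (c := 1) (e := 1 / P.sigX 1 1 + P.C)
    (d := 2 * P.sigX 1 1 * P.a0 1 / (1 + P.C * P.sigX 1 1)) hx
    (fun t => P.X_one_one t hN)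
    (hP.hasExp_J_atBot _ _ (by omega) (by omega) (by omega) (by omega) (by omega) (by omega))
    (((P.hasExp_J_outside _ _ (by omega)).add
      ((hP.hasExp_J_atBot _ _ (by omega) (by omega) (by omega) (by omega)
        (by omega) (by omega)).const_mul _)).add
      (((hP.hasExp_J_atBot _ _ (by omega) (by omega) (by omega) (by omega)
        (by omega) (by omega)).add
        ((hP.hasExp_J_atBot_zero _ _ (by omega) (by omega) (by omega) (by omega)
        (by omega) (by omega)).const_mul _)).const_mul _))
    one_pos (by positivity) (by simp) (by rw [e1, e2]; simp) (by rw [hK]; field_simp)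
  rwa [hK] at this

theorem Admissible.Y_first_atBot {P : Params} (hP : P.Admissible) {y : ℝ → ℝ} {j : ℕ}
    (h1 : 1 ≤ j) (h2 : j ≤ P.K - 1) (hN : 2 ≤ P.NY j)
    (hy : ∀ t, 1 / 2 * Real.exp (2 * y t) = P.Y t j 1) :
    ApproachesLine atBot y (1 / P.lam j + 1 / P.mu j)
        (2 * P.a0 j * P.b0 j * P.psi j P.K j (P.K - 1)
          / (P.prodLam (j + 1) P.K * P.prodMu (j + 1) (P.K - 1)
            * P.psi (j + 1) P.K (j + 1) (P.K - 1))) :=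
  hP.approachesLine_atBot (p := j) (q := j) (c := P.tauY j 1) (by omega) (by omega) (by omega)
    (by omega) hy
    (fun t => P.Y_inner hP.K_pos t rfl le_rfl (by omega))
    (((hP.hasExp_J_atBot_zero _ _ (by omega) (by omega) (by omega) (by unfold grp; omega)
        (by unfold grp; omega) (by unfold grp; omega)).add
      ((hP.hasExp_J_atBot _ _ (by omega) (by omega) (by omega) (by omega) (by unfold grp; omega)
        (by unfold grp; omega)).const_mul _)).add
      (by rw [sumS_one]; simpa using hasExp_zero _ _))
    (((hP.hasExp_J_atBot_zero _ _ (by omega) (by omega) (by omega) (by unfold grp; omega)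
        (by unfold grp; omega) (by unfold grp; omega)).add
      ((hP.hasExp_J_atBot _ _ (by omega) (by omega) (by omega) (by omega) (by unfold grp; omega)
        (by unfold grp; omega)).const_mul _)).add
      (by rw [sumS_one]; simpa using hasExp_zero _ _))
    (hP.tauY_pos j 1 (by omega) (by omega) le_rfl (by omega)) (by simp [sumT_one])
    (by simp [sumT_one]) rfl

theorem Admissible.Y_inner_atBot {P : Params} (hP : P.Admissible) {y : ℝ → ℝ} {j i : ℕ}
    (h1 : 1 ≤ j) (h2 : j ≤ P.K - 1) (hi : 2 ≤ i) (hiN : i < P.NY j)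
    (hy : ∀ t, 1 / 2 * Real.exp (2 * y t) = P.Y t j i) :
    ApproachesLine atBot y (1 / P.lam (j + 1) + 1 / P.mu j)
          (2 * P.a0 (j + 1) * P.b0 j * P.psi (j + 1) P.K j (P.K - 1)
            / (P.prodLam (j + 2) P.K * P.prodMu (j + 1) (P.K - 1)
              * P.psi (j + 2) P.K (j + 1) (P.K - 1))) :=
  hP.approachesLine_atBot (p := j + 1) (q := j) (c := sumS (P.tauY j) (P.sigY j) i) (by omega)
    (by omega) (by omega) (by omega) hy
    (fun t => P.Y_inner hP.K_pos t rfl (by omega) hiN)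
    (((hP.hasExp_J_atBot_zero _ _ (by omega) (by omega) (by omega) (by unfold grp; omega)
        (by unfold grp; omega) (by unfold grp; omega)).add
      ((hP.hasExp_J_atBot_zero _ _ (by omega) (by omega) (by omega) (by unfold grp; omega)
        (by unfold grp; omega) (by unfold grp; omega)).const_mul _)).add
      ((hP.hasExp_J_atBot _ _ (by omega) (by omega) (by omega) (by omega) (by unfold grp; omega)
        (by unfold grp; omega)).const_mul _))
    (((hP.hasExp_J_atBot_zero _ _ (by omega) (by omega) (by omega) (by unfold grp; omega)
        (by unfold grp; omega) (by unfold grp; omega)).add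
      ((hP.hasExp_J_atBot_zero _ _ (by omega) (by omega) (by omega) (by unfold grp; omega)
        (by unfold grp; omega) (by unfold grp; omega)).const_mul _)).add
      ((hP.hasExp_J_atBot _ _ (by omega) (by omega) (by omega) (by omega) (by unfold grp; omega)
        (by unfold grp; omega)).const_mul _))
    ((hP.internalY h1 (by omega)).sumS_pos hi (by omega)) (by simp) (by simp) rfl

theorem Admissible.Y_last_atBot {P : Params} (hP : P.Admissible) {y : ℝ → ℝ} {j : ℕ}
    (h1 : 1 ≤ j) (h2 : j ≤ P.K - 1) (hN : 2 ≤ P.NY j)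
    (hy : ∀ t, 1 / 2 * Real.exp (2 * y t) = P.Y t j (P.NY j)) :
    ApproachesLine atBot y (1 / P.lam (j + 1) + 1 / P.mu j)
          (2 * P.a0 (j + 1) * P.b0 j * P.psi (j + 1) P.K j (P.K - 1)
            / (P.prodLam (j + 2) P.K * P.prodMu (j + 1) (P.K - 1)
              * P.psi (j + 2) P.K (j + 1) (P.K - 1))) :=
  hP.approachesLine_atBot (p := j + 1) (q := j) (c := P.sigY j (P.NY j - 1)) (by omega)
    (by omega) (by omega) (by omega) hy
    (fun t => P.Y_last t rfl (by omega) hN)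
    ((hP.hasExp_J_atBot_zero _ _ (by omega) (by omega) (by omega) (by unfold grp; omega)
        (by unfold grp; omega) (by unfold grp; omega)).add
      ((hP.hasExp_J_atBot _ _ (by omega) (by omega) (by omega) (by omega) (by unfold grp; omega)
        (by unfold grp; omega)).const_mul _))
    ((hP.hasExp_J_atBot_zero _ _ (by omega) (by omega) (by omega) (by unfold grp; omega)
        (by unfold grp; omega) (by unfold grp; omega)).add
      ((hP.hasExp_J_atBot _ _ (by omega) (by omega) (by omega) (by omega) (by unfold grp; omega)
        (by unfold grp; omega)).const_mul _))
    (hP.sigY_pos j _ h1 (by omega) (by omega) le_rfl) (by simp) (by simp) rfl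

theorem Admissible.Y_rightmost_first_atBot {P : Params} (hP : P.Admissible) {y : ℝ → ℝ}
    (hN : 2 ≤ P.NY P.K) (hy : ∀ t, 1 / 2 * Real.exp (2 * y t) = P.Y t P.K 1) :
    ApproachesLine atBot y (1 / P.lam P.K) (2 * P.tauY P.K 1 * P.a0 P.K) :=
  have hK := hP.K_pos
  have hz : ∀ t, P.Y t P.K 1 = (P.J t 0 0 1 1 + P.tauY P.K 1 * P.J t 0 0 1 0)
      / P.J t 1 1 0 0 := fun t => by
    simp [Y, show P.NY P.K ≠ 1 by omega, show 1 < P.NY P.K by omega, sumT_one, sumS_one,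
      P.J_zero_zero hK]
  hP.approachesLine_atBot_left (c := P.tauY P.K 1) (e := 1) hy hz
    ((hP.hasExp_J_atBot_zero _ _ (by omega) (by omega) (by omega) (by omega)
        (by omega) (by omega)).add
      ((hP.hasExp_J_atBot _ _ (by omega) (by omega) (by omega) (by omega) (by omega)
        (by omega)).const_mul _))
    (hP.hasExp_J_atBot _ _ (by omega) (by omega) (by omega) (by omega) (by omega) (by omega))
    (hP.tauY_pos _ _ hK le_rfl (by omega) (by omega)) one_pos (by simp) (by simp) (by simp)

/-- The numerators in the rightmost group tend to constants as `t → -∞`. -/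
theorem Admissible.approachesLine_const_atBot {P : Params} (hP : P.Admissible) {y : ℝ → ℝ}
    (T : ℝ) {S : ℝ} (hS : 0 < S)
    (hy : ∀ t, 1 / 2 * Real.exp (2 * y t) = P.J t 0 0 1 1 + T * P.J t 0 0 1 0 + S) :
    ApproachesLine atBot y 0 (2 * S) := by
  have hK := hP.K_pos
  have e : P.expo (Icc (P.K + 1) P.K) (Icc P.K (P.K - 1)) = 0 := by
    rw [Icc_eq_empty (by omega), Icc_eq_empty (by omega)]
    simp [expo]
  have z1 := hP.hasExp_J_atBot_zero 0 0 (p := P.K + 1) (q := P.K) (i' := 1) (j' := 1) (by omega)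
    (by omega) (by omega) (by omega) (by omega) (by omega)
  have z2 := hP.hasExp_J_atBot_zero 0 0 (p := P.K + 1) (q := P.K) (i' := 1) (j' := 0) (by omega)
    (by omega) (by omega) (by omega) (by omega) (by omega)
  rw [e] at z1 z2
  have h : HasExp atBot (fun _ => S) 0 S := by simpa using hasExp_exp atBot S 0
  exact HasExp.approachesLine hy ((z1.add (z2.const_mul T)).add h) (by simpa using hS) (by simp)

theorem Admissible.Y_rightmost_inner_atBot {P : Params} (hP : P.Admissible) {y : ℝ → ℝ} {i : ℕ}
    (hi : 2 ≤ i) (hiN : i ≤ P.NY P.K - 1)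
    (hy : ∀ t, 1 / 2 * Real.exp (2 * y t) = P.Y t P.K i) :
    ApproachesLine atBot y 0 (2 * P.SY P.K i) :=
  hP.approachesLine_const_atBot (P.TY P.K i)
    ((hP.internalY hP.K_pos le_rfl).sumS_pos hi hiN) fun t => by
      rw [hy]
      simp only [Y, if_neg (show P.NY P.K ≠ 1 by omega), if_pos (show i < P.NY P.K by omega),
        if_true]
      rfl

theorem Admissible.Y_rightmost_last_atBot {P : Params} (hP : P.Admissible) {y : ℝ → ℝ}
    (hN : 2 ≤ P.NY P.K) (hy : ∀ t, 1 / 2 * Real.exp (2 * y t) = P.Y t P.K (P.NY P.K)) :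
    ApproachesLine atBot y 0
      (2 * (P.SY P.K (P.NY P.K - 1) + P.D * P.sigY P.K (P.NY P.K - 1))) := by
  have hI := hP.internalY hP.K_pos le_rfl
  have h1 := hI.sumS_nonneg (le_refl (P.NY P.K - 1))
  have h2 := mul_pos hP.D_pos (hI.sig_pos (P.NY P.K - 1) (by omega) le_rfl)
  refine hP.approachesLine_const_atBot (P.TY P.K (P.NY P.K - 1) + P.D)
    (by unfold SY; linarith) fun t => ?_
  rw [hy]
  simp only [Y, if_neg (show P.NY P.K ≠ 1 by omega), lt_irrefl, if_false, if_true]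
  rfl

theorem eq_of_exp_eq {z t c a lam : ℝ} (hc : 0 < c) (ha : 0 < a)
    (h : 1 / 2 * Real.exp (2 * z) = c * (a * Real.exp (t / lam))) :
    z = t / 2 * (1 / lam) + 1 / 2 * Real.log (2 * c * a) := by
  have h1 : Real.exp (2 * z) = 2 * c * a * Real.exp (t / lam) := by linarith
  have h2 := congrArg Real.log h1
  rw [Real.log_exp, Real.log_mul (by positivity) (Real.exp_pos _).ne', Real.log_exp] at h2
  rw [show t / 2 * (1 / lam) = 1 / 2 * (t / lam) by ring]
  linarith

theorem J_one_zero_of_one_group (P : Params) (hK : P.K = 1) (t : ℝ) : P.J t 0 0 1 0 = P.a t 1 := by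
  rw [J, if_pos (by omega)]
  simp [hK, Psi, powersetCard_one, filter_singleton]

theorem Admissible.Y_only_first {P : Params} (hP : P.Admissible) {y : ℝ → ℝ}
    (hK : P.K = 1) (hN : 2 ≤ P.NY 1) (hy : ∀ t, 1 / 2 * Real.exp (2 * y t) = P.Y t 1 1) (t : ℝ) :
    y t = t / (2 * P.lam 1) + 1 / 2 * Real.log (2 * P.tauY 1 1 * P.a0 1) := by
  rw [eq_of_exp_eq (z := y t) (t := t) (c := P.tauY 1 1) (a := P.a0 1) (lam := P.lam 1)
    (hP.tauY_pos 1 1 le_rfl hP.K_pos le_rfl (by omega)) (hP.a0_pos 1 le_rfl hP.K_pos)]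
  · ring
  · rw [hy]
    simp only [Y, if_neg (show P.NY 1 ≠ 1 by omega), if_pos (show 1 < P.NY 1 by omega),
      if_pos hK.symm, sumT_one, sumS_one]
    rw [P.J_eq_zero t 0 0 (j := 1) (by omega), P.J_one_zero_of_one_group hK, a]
    ring

/-- For K = 1 the vanishing sums leave X = σ_{N-1} a₁(t), a single exponential; hence there is no
error term. -/
theorem Admissible.X_only_last {P : Params} (hP : P.Admissible) {x : ℝ → ℝ}
    (hK : P.K = 1) (hN : 2 ≤ P.NX 1) (hx : ∀ t, 1 / 2 * Real.exp (2 * x t) = P.X t 1 (P.NX 1))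
    (t : ℝ) :
    x t = t / 2 * (1 / P.lam 1) + 1 / 2 * Real.log (2 * P.sigX 1 (P.NX 1 - 1) * P.a0 1) := by
  refine eq_of_exp_eq (hP.sigX_pos 1 _ le_rfl hP.K_pos (by omega) le_rfl)
    (hP.a0_pos 1 le_rfl hP.K_pos) ?_
  rw [hx, P.X_last t (g := 1) (by simp [grp, hK]) hN, P.J_eq_zero t 0 0 (j := 1) (by omega),
    P.J_eq_zero t 1 1 (j := 1 - 2) (by omega), sub_self, P.J_zero_zero hP.K_pos,
    P.J_one_zero_of_one_group hK, a]
  simp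

end Params

end GengXue

end

/-! ### Assembly of the cases. -/

theorem mainTheorem4
    (P : GengXue.Params) (hP : P.Admissible)
    (x m y n : ℕ → ℕ → ℝ → ℝ)
    (hsol : GengXue.IsPeakonSolution P.K P.NX P.NY x m y n)
    (hinit : P.HasInitialData x m y n) :
    -- As `t → +∞`.
    -- All `X`-groups except the leftmost one; `K + 1 - j` is the number of the group.
    (∀ j, 1 ≤ j → j ≤ P.K - 1 → 2 ≤ P.NX (P.K + 1 - j) →
      (∀ i, 1 ≤ i → i ≤ P.NX (P.K + 1 - j) - 1 →
        GengXue.ApproachesLine Filter.atTop (x (P.K + 1 - j) i)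
          (1 / P.lam (j + 1) + 1 / P.mu j)
          (2 * P.a0 (j + 1) * P.b0 j * P.psi 1 (j + 1) 1 j
            / (P.prodLam 1 j * P.prodMu 1 (j - 1) * P.psi 1 j 1 (j - 1)))) ∧
      GengXue.ApproachesLine Filter.atTop (x (P.K + 1 - j) (P.NX (P.K + 1 - j)))
        (1 / P.lam j + 1 / P.mu j)
        (2 * P.a0 j * P.b0 j * P.psi 1 j 1 j
          / (P.psi 1 (j - 1) 1 (j - 1) * P.prodLam 1 (j - 1) * P.prodMu 1 (j - 1)))) ∧
    -- The leftmost `X`-group.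
    (2 ≤ P.NX 1 →
      GengXue.ApproachesLine Filter.atTop (x 1 1) 0 (2 * P.tauX 1 1 / (P.C * P.L)) ∧
      (∀ i, 2 ≤ i → i ≤ P.NX 1 - 1 →
        GengXue.ApproachesLine Filter.atTop (x 1 i) 0 (2 * P.SX 1 i / (P.L * P.M))) ∧
      GengXue.ApproachesLine Filter.atTop (x 1 (P.NX 1))
        (1 / P.lam P.K)
        (2 * P.sigX 1 (P.NX 1 - 1) * P.a0 P.K * P.psi 1 P.K 1 (P.K - 1)
          / (P.prodLam 1 (P.K - 1) * P.M * P.psi 1 (P.K - 1) 1 (P.K - 1)))) ∧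
    -- All `Y`-groups except the leftmost and rightmost ones.
    (∀ j, 2 ≤ j → j ≤ P.K - 1 → 2 ≤ P.NY (P.K + 1 - j) →
      (∀ i, 1 ≤ i → i ≤ P.NY (P.K + 1 - j) - 1 →
        GengXue.ApproachesLine Filter.atTop (y (P.K + 1 - j) i)
          (1 / P.lam j + 1 / P.mu j)
          (2 * P.a0 j * P.b0 j * P.psi 1 j 1 j
            / (P.prodLam 1 (j - 1) * P.prodMu 1 (j - 1) * P.psi 1 (j - 1) 1 (j - 1)))) ∧
      GengXue.ApproachesLine Filter.atTop (y (P.K + 1 - j) (P.NY (P.K + 1 - j)))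
        (1 / P.lam j + 1 / P.mu (j - 1))
        (2 * P.a0 j * P.b0 (j - 1) * P.psi 1 j 1 (j - 1)
          / (P.prodLam 1 (j - 1) * P.prodMu 1 (j - 2) * P.psi 1 (j - 1) 1 (j - 2)))) ∧
    -- The leftmost `Y`-group, if `K ≥ 2`.
    (2 ≤ P.K → 2 ≤ P.NY 1 →
      (∀ i, 1 ≤ i → i ≤ P.NY 1 - 1 →
        GengXue.ApproachesLine Filter.atTop (y 1 i)
          (1 / P.lam P.K)
          (2 * P.TY 1 i * P.a0 P.K * P.psi 1 P.K 1 (P.K - 1)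
            / (P.prodLam 1 (P.K - 1) * P.M * P.psi 1 (P.K - 1) 1 (P.K - 1)))) ∧
      GengXue.ApproachesLine Filter.atTop (y 1 (P.NY 1))
        (1 / P.lam P.K + 1 / P.mu (P.K - 1))
        (2 * P.a0 P.K * P.b0 (P.K - 1) * P.psi 1 P.K 1 (P.K - 1)
          / (P.prodLam 1 (P.K - 1) * P.prodMu 1 (P.K - 2) * P.psi 1 (P.K - 1) 1 (P.K - 2)))) ∧
    -- The rightmost `Y`-group, if `K ≥ 2`.
    (2 ≤ P.K → 2 ≤ P.NY P.K →
      ∀ i, 1 ≤ i → i ≤ P.NY P.K →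
        GengXue.ApproachesLine Filter.atTop (y P.K i)
          (1 / P.lam 1 + 1 / P.mu 1)
          (2 * P.a0 1 * P.b0 1 * P.psi 1 1 1 1)) ∧
    -- The only `Y`-group, if `K = 1`; the formula for its leftmost peakon is exact.
    (P.K = 1 → 2 ≤ P.NY 1 →
      (∀ i, 1 ≤ i → i ≤ P.NY 1 - 1 →
        GengXue.ApproachesLine Filter.atTop (y 1 i)
          (1 / P.lam 1) (2 * P.TY 1 i * P.a0 1)) ∧
      GengXue.ApproachesLine Filter.atTop (y 1 (P.NY 1))
        (1 / P.lam 1) (2 * (P.TY 1 (P.NY 1 - 1) + P.D) * P.a0 1) ∧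
      (∀ t : ℝ, y 1 1 t
        = t / (2 * P.lam 1) + 1 / 2 * Real.log (2 * P.tauY 1 1 * P.a0 1))) ∧
    -- As `t → -∞`.
    -- All `X`-groups except the leftmost and rightmost ones.
    (∀ j, 2 ≤ j → j ≤ P.K - 1 → 2 ≤ P.NX j →
      GengXue.ApproachesLine Filter.atBot (x j 1)
        (1 / P.lam j + 1 / P.mu (j - 1))
        (2 * P.a0 j * P.b0 (j - 1) * P.psi j P.K (j - 1) (P.K - 1)
          / (P.prodLam (j + 1) P.K * P.prodMu j (P.K - 1)
            * P.psi (j + 1) P.K j (P.K - 1))) ∧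
      (∀ i, 2 ≤ i → i ≤ P.NX j →
        GengXue.ApproachesLine Filter.atBot (x j i)
          (1 / P.lam j + 1 / P.mu j)
          (2 * P.a0 j * P.b0 j * P.psi j P.K j (P.K - 1)
            / (P.prodLam (j + 1) P.K * P.prodMu (j + 1) (P.K - 1)
              * P.psi (j + 1) P.K (j + 1) (P.K - 1))))) ∧
    -- The leftmost `X`-group, if `K ≥ 2`.
    (2 ≤ P.K → 2 ≤ P.NX 1 →
      ∀ i, 1 ≤ i → i ≤ P.NX 1 →
        GengXue.ApproachesLine Filter.atBot (x 1 i)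
          (1 / P.lam 1 + 1 / P.mu 1)
          (2 * P.a0 1 * P.b0 1 * P.psi 1 P.K 1 (P.K - 1)
            / (P.prodLam 2 P.K * P.prodMu 2 (P.K - 1) * P.psi 2 P.K 2 (P.K - 1)))) ∧
    -- The rightmost `X`-group, if `K ≥ 2`.
    (2 ≤ P.K → 2 ≤ P.NX P.K →
      GengXue.ApproachesLine Filter.atBot (x P.K 1)
        (1 / P.lam P.K + 1 / P.mu (P.K - 1))
        (2 * P.a0 P.K * P.b0 (P.K - 1) * P.psi P.K P.K (P.K - 1) (P.K - 1)) ∧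
      (∀ i, 2 ≤ i → i ≤ P.NX P.K - 1 →
        GengXue.ApproachesLine Filter.atBot (x P.K i)
          (1 / P.lam P.K) (2 * P.SX P.K i * P.a0 P.K / P.TX P.K i)) ∧
      GengXue.ApproachesLine Filter.atBot (x P.K (P.NX P.K))
        (1 / P.lam P.K) (2 * P.sigX P.K (P.NX P.K - 1) * P.a0 P.K)) ∧
    -- The only `X`-group, if `K = 1`; the formula for its rightmost peakon is exact.
    (P.K = 1 → 2 ≤ P.NX 1 →
      GengXue.ApproachesLine Filter.atBot (x 1 1)
        (1 / P.lam 1) (2 * P.sigX 1 1 * P.a0 1 / (1 + P.C * P.sigX 1 1)) ∧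
      (∀ i, 2 ≤ i → i ≤ P.NX 1 - 1 →
        GengXue.ApproachesLine Filter.atBot (x 1 i)
          (1 / P.lam 1) (2 * P.SX 1 i * P.a0 1 / P.TX 1 i)) ∧
      (∀ t : ℝ, x 1 (P.NX 1) t
        = t / 2 * (1 / P.lam 1)
          + 1 / 2 * Real.log (2 * P.sigX 1 (P.NX 1 - 1) * P.a0 1))) ∧
    -- All `Y`-groups except the rightmost one.
    (∀ j, 1 ≤ j → j ≤ P.K - 1 → 2 ≤ P.NY j →
      GengXue.ApproachesLine Filter.atBot (y j 1)
        (1 / P.lam j + 1 / P.mu j)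
        (2 * P.a0 j * P.b0 j * P.psi j P.K j (P.K - 1)
          / (P.prodLam (j + 1) P.K * P.prodMu (j + 1) (P.K - 1)
            * P.psi (j + 1) P.K (j + 1) (P.K - 1))) ∧
      (∀ i, 2 ≤ i → i ≤ P.NY j →
        GengXue.ApproachesLine Filter.atBot (y j i)
          (1 / P.lam (j + 1) + 1 / P.mu j)
          (2 * P.a0 (j + 1) * P.b0 j * P.psi (j + 1) P.K j (P.K - 1)
            / (P.prodLam (j + 2) P.K * P.prodMu (j + 1) (P.K - 1)
              * P.psi (j + 2) P.K (j + 1) (P.K - 1))))) ∧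
    -- The rightmost `Y`-group.
    (2 ≤ P.NY P.K →
      GengXue.ApproachesLine Filter.atBot (y P.K 1)
        (1 / P.lam P.K) (2 * P.tauY P.K 1 * P.a0 P.K) ∧
      (∀ i, 2 ≤ i → i ≤ P.NY P.K - 1 →
        GengXue.ApproachesLine Filter.atBot (y P.K i) 0 (2 * P.SY P.K i)) ∧
      GengXue.ApproachesLine Filter.atBot (y P.K (P.NY P.K)) 0
        (2 * (P.SY P.K (P.NY P.K - 1) + P.D * P.sigY P.K (P.NY P.K - 1)))) := by
  have hK := hP.K_pos
  have hx : ∀ l i, 1 ≤ l → l ≤ P.K → 1 ≤ i → i ≤ P.NX l →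
      ∀ t, 1 / 2 * Real.exp (2 * x l i t) = P.X t l i :=
    fun l i h1 h2 h3 h4 t => (hP.explicit hsol hinit t).1 l i h1 h2 h3 h4
  have hy : ∀ l i, 1 ≤ l → l ≤ P.K → 1 ≤ i → i ≤ P.NY l →
      ∀ t, 1 / 2 * Real.exp (2 * y l i t) = P.Y t l i :=
    fun l i h1 h2 h3 h4 t => (hP.explicit hsol hinit t).2 l i h1 h2 h3 h4
  refine ⟨fun j h1 h2 hN => ⟨fun i hi hiN => ?_, ?_⟩, fun hN => ⟨?_, fun i hi hiN => ?_, ?_⟩,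
    fun j h1 h2 hN => ⟨fun i hi hiN => ?_, ?_⟩, fun hK2 hN => ⟨fun i hi hiN => ?_, ?_⟩,
    fun hK2 hN i hi hiN => ?_, fun hK1 hN => ⟨fun i hi hiN => ?_, ?_, ?_⟩,
    fun j h1 h2 hN => ⟨?_, fun i hi hiN => ?_⟩, fun hK2 hN i hi hiN => ?_,
    fun hK2 hN => ⟨?_, fun i hi hiN => ?_, ?_⟩, fun hK1 hN => ⟨?_, fun i hi hiN => ?_, ?_⟩,
    fun j h1 h2 hN => ⟨?_, fun i hi hiN => ?_⟩, fun hN => ⟨?_, fun i hi hiN => ?_, ?_⟩⟩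
  · exact hP.X_inner_atTop h1 h2 hi (by omega)
      (hx _ _ (by omega) (by omega) hi (by omega)) rfl
  · exact hP.X_last_atTop h1 h2 hN (hx _ _ (by omega) (by omega) (by omega) le_rfl) rfl
  · exact hP.X_one_one_atTop hN (hx _ _ le_rfl hK le_rfl (by omega))
  · exact hP.X_one_inner_atTop hi hiN (hx _ _ le_rfl hK (by omega) (by omega))
  · exact hP.X_one_last_atTop hN (hx _ _ le_rfl hK (by omega) le_rfl)
  · exact hP.Y_inner_atTop (by omega) h2 hi (by omega)
      (hy _ _ (by omega) (by omega) hi (by omega)) rfl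
  · exact hP.Y_last_atTop h1 (by omega) hN (hy _ _ (by omega) (by omega) (by omega) le_rfl) rfl
  · exact hP.Y_one_inner_atTop hi hiN (hy _ _ le_rfl hK hi (by omega))
  -- The last member of the leftmost group is the case j = K of the general formula.
  · have e : P.K + 1 - P.K = 1 := by omega
    exact hP.Y_last_atTop (j := P.K) hK2 le_rfl (by rwa [e])
      (by rw [e]; exact hy _ _ le_rfl hK (by omega) le_rfl) rfl
  · rcases hiN.lt_or_eq with hlt | rfl
    -- The rightmost group is the case j = 1, where the products and Ψ of the denominator are empty.
    -- Its last member needs the formula with D, but has the same leading term.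
    · have e : P.K + 1 - 1 = P.K := by omega
      exact hP.Y_inner_atTop (j := 1) (i := i) le_rfl (by omega) hi (by rwa [e])
        (by rw [e]; exact hy _ _ hK le_rfl hi (by omega))
        (by simp [GengXue.Params.psi, GengXue.Params.prodLam, GengXue.Params.prodMu,
          GengXue.Params.Psi_empty_empty])
    · exact hP.Y_rightmost_last_atTop hK2 hN (hy _ _ hK le_rfl hi le_rfl)
  -- For K = 1 the only group is still a leftmost one, and the Ψ and the products in the constant
  -- are 1.
  · have := hP.Y_one_inner_atTop hi hiN (hy _ _ le_rfl hK hi (by omega))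
    rwa [P.psi_one_group hK1, hK1] at this
  · exact hP.Y_only_last_atTop hK1 hN (hy _ _ le_rfl hK (by omega) le_rfl)
  · exact hP.Y_only_first hK1 hN (hy _ _ le_rfl hK le_rfl (by omega))
  · exact hP.X_first_atBot h1 (by omega) hN (hx _ _ (by omega) (by omega) le_rfl (by omega))
  · rcases hiN.lt_or_eq with hlt | rfl
    · exact hP.X_inner_atBot (by omega) h2 hi hlt (hx _ _ (by omega) (by omega) (by omega) hiN)
    · exact hP.X_last_atBot (by omega) h2 hN (hx _ _ (by omega) (by omega) (by omega) le_rfl)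
  · rcases hi.eq_or_lt with rfl | hi
    · exact hP.X_one_one_atBot hK2 hN (hx _ _ le_rfl hK le_rfl (by omega))
    rcases hiN.lt_or_eq with hlt | rfl
    · exact hP.X_inner_atBot le_rfl (by omega) hi hlt (hx _ _ le_rfl hK (by omega) hiN)
    · exact hP.X_last_atBot le_rfl (by omega) hN (hx _ _ le_rfl hK (by omega) le_rfl)
  -- This is the case j = K of the formula for the first member, with empty index sets in the
  -- denominator.
  · have := hP.X_first_atBot hK2 le_rfl hN (hx _ _ hK le_rfl le_rfl (by omega))
    have e1 : Finset.Icc (P.K + 1) P.K = ∅ := Finset.Icc_eq_empty (by omega)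
    have e2 : Finset.Icc P.K (P.K - 1) = ∅ := Finset.Icc_eq_empty (by omega)
    simpa [GengXue.Params.prodLam, GengXue.Params.prodMu, GengXue.Params.psi, e1, e2,
      GengXue.Params.Psi_empty_empty] using this
  · exact hP.X_rightmost_inner_atBot hi hiN (hx _ _ hK le_rfl (by omega) (by omega))
  · exact hP.X_rightmost_last_atBot hN (hx _ _ hK le_rfl (by omega) le_rfl)
  · exact hP.X_only_first_atBot hK1 hN (hx _ _ le_rfl hK le_rfl (by omega))
  · have := hP.X_rightmost_inner_atBot (i := i) hi (by rwa [hK1])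
      (hx _ _ hK le_rfl (by omega) (by rw [hK1]; omega))
    rwa [hK1] at this
  · exact hP.X_only_last hK1 hN (hx _ _ le_rfl hK (by omega) le_rfl)
  · exact hP.Y_first_atBot h1 h2 hN (hy _ _ h1 (by omega) le_rfl (by omega))
  · rcases hiN.lt_or_eq with hlt | rfl
    · exact hP.Y_inner_atBot h1 h2 hi hlt (hy _ _ h1 (by omega) (by omega) hiN)
    · exact hP.Y_last_atBot h1 h2 hN (hy _ _ h1 (by omega) (by omega) le_rfl)
  · exact hP.Y_rightmost_first_atBot hN (hy _ _ hK le_rfl le_rfl (by omega))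
  · exact hP.Y_rightmost_inner_atBot hi hiN (hy _ _ hK le_rfl (by omega) (by omega))
  · exact hP.Y_rightmost_last_atBot hN (hy _ _ hK le_rfl (by omega) le_rfl)
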